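/- **Conventions.** All categories are over $\mathbb C$. A *fusion category* is a finite semisimple $\mathbb C$-linear abelian rigid monoidal category with bilinear tensor product and $\mathrm{End}(\mathbf 1)\cong\mathbb C$; it is *spherical* if it carries a pivotal structure (a monoidal natural isomorphism $\omega:{**}\Rightarrow\mathrm{id}$) whose left and right traces agree. $\mathrm{Vect}_{\mathbb C}$ is the category of finite-dimensional complex vector spaces. A *skew pairing* of Hopf algebras $H,K$ is a bilinear map $\tau:H\times K\to\mathbb C$ with $$\tau(hh',k)=\tau(h,k_{(1)})\tau(h',k_{(2)}),\quad \tau(h,kk')=\tau(h_{(2)},k)\tau(h_{(1)},k'),\quad \tau(h,1)=\epsilon(h),\quad \tau(1,k)=\epsilon(k);$$ its convolution inverse is $\tau^{-1}$, and its *generalised double* $D(H,K)$ is the Hopf algebra with coalgebra $H\otimes K$, unit $1\otimes 1$ and product $$(h\otimes k)(h'\otimes k')=\tau(h'_{(1)},k_{(1)})\,\tau^{-1}(h'_{(3)},k_{(3)})\;hh'_{(2)}\otimes k_{(2)}k'.$$ A *Hopf triplet* $(A,B,C)$ consists of finite-dimensional semisimple complex Hopf algebras $A,B,C$ and skew pairings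 $\tau_{AB}:A\times B\to\mathbb C$, $\tau_{BC}:B\times C\to\mathbb C$, $\tau_{CA}:C\times A\to\mathbb C$ such that $$\phi_{ABC}:D(A^{op},B^{cop})\to C^*,\qquad \phi_{ABC}(a\otimes b)(c)=\tau_{CA}(c_{(1)},a)\,\tau_{BC}(b,c_{(2)}),$$ and its two cyclic permutations $\phi_{BCA}:D(B^{op},C^{cop})\to A^*$, $\phi_{CAB}:D(C^{op},A^{cop})\to B^*$ are homomorphisms of Hopf algebras (the doubles being formed with $\tau_{AB}$, $\tau_{BC}$, $\tau_{CA}$, respectively). We regard $\tau_{AB}$ as an element $\tau_{AB(1)}\otimes\tau_{AB(2)}$ of $A^*\otimes B^*$, and similarly for the other pairings and for $\tau_{CA}^{-1}\in C^*\otimes A^*$. **Proposition.** Let $\mathcal A,\mathcal B,\mathcal C$ be spherical fusion categories over $\mathbb C$. Let $\mathrm{Vect}_{\mathbb C}$ be equipped with the structure of a $(\mathcal C,\mathcal B)$-bimodule category, given by a left action $\rhd$ of $\mathcal C$ and a right action $\lhd$ of $\mathcal B$ (bilinear on morphisms, exact in the acting variable, with coherence isomorphisms $(x\otimes y)\rhd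 V\cong x\rhd(y\rhd V)$, $\mathbf 1\rhd V\cong V$, $(V\lhd u)\lhd v\cong V\lhd(u\otimes v)$, $V\lhd\mathbf 1\cong V$ satisfying the usual axioms) and a natural isomorphism $q_{x,V,u}:(x\rhd V)\lhd u\to x\rhd(V\lhd u)$ satisfying the two pentagon axioms. Let $\mathrm{tr}$ be a $(\mathcal C,\mathcal B)$-bimodule trace on it, i.e. a family of linear maps $\mathrm{tr}_V:\mathrm{End}(V)\to\mathbb C$ that is cyclic, non-degenerate and compatible with the partial traces of $\mathcal C$ and $\mathcal B$. Let $\mathrm{End}_{(\mathcal C,\mathcal B)}(\mathrm{Vect}_{\mathbb C})$ be the monoidal category (under composition) of right exact $\mathbb C$-linear endofunctors $F$ with coherence isomorphisms $s_{x,V}:F(x\rhd V)\to x\rhd F(V)$ and $t_{V,u}:F(V)\lhd u\to F(V\lhd u)$ that make $F$ a bimodule functor, and bimodule natural transformations. Its pivotal structure $\omega^F:F^{ll}\Rightarrow F$, where $F^l$ is the left adjoint of $F$ with counit $\epsilon^F:F^lF\Rightarrow\mathrm{id}$, is the one determined by $$\mathrm{tr}_{F^l(W)}(\beta\circ\epsilon^F_V\circ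 F^l(\alpha))=\mathrm{tr}_W(\epsilon^{F^l}_W\circ F^{ll}(\beta)\circ(\omega^F_V)^{-1}\circ\alpha)$$ for all $\alpha:W\to F(V)$, $\beta:V\to F^l(W)$. Let $\Phi:\mathcal A\to\mathrm{End}_{(\mathcal C,\mathcal B)}(\mathrm{Vect}_{\mathbb C})$ be a pivotal functor, i.e. an exact $\mathbb C$-linear monoidal functor with $\Phi(\omega_a)=\omega^{\Phi(a)}$ for all $a$ (where the duals of $\Phi(a)$ are identified with the images of the duals of $a$). Then this datum arises from a Hopf triplet: there are a Hopf triplet $(A,B,C)$, pivotal tensor equivalences $$\mathcal A\simeq A^{*cop}\text{-}\mathrm{Mod},\qquad \mathcal B\simeq B^{*}\text{-}\mathrm{Mod},\qquad \mathcal C\simeq C^{*op}\text{-}\mathrm{Mod}$$ onto the categories of finite-dimensional modules with their standard pivotal structures, sending $a$, $u$, $x$ to modules $M_a$, $N_u$, $P_x$, and isomorphisms $$x\rhd V\cong P_x\otimes V,\qquad V\lhd u\cong N_u\otimes V,\qquad \Phi(a)(V)\cong M_a\otimes V,$$ natural in all arguments, which identify the associativity and unit isomorphisms of the two actions and the monoidal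 structure of $\Phi$ with those induced by the associators and unitors of $\mathrm{Vect}_{\mathbb C}$ and the monoidal structures of the equivalences (for the right action together with the flip $N_v\otimes N_u\cong N_u\otimes N_v$), and which identify $q$ and the coherence isomorphisms $s$, $t$ of $\Phi(a)$ with $$\begin{aligned} q:\ N\otimes P\otimes V\to P\otimes N\otimes V,&\quad n\otimes p\otimes v\mapsto(\tau_{BC(2)}\rhd p)\otimes(\tau_{BC(1)}\rhd n)\otimes v,\\ s:\ M\otimes P\otimes V\to P\otimes M\otimes V,&\quad m\otimes p\otimes v\mapsto(\tau^{-1}_{CA(1)}\rhd p)\otimes(\tau^{-1}_{CA(2)}\rhd m)\otimes v,\\ t:\ N\otimes M\otimes V\to M\otimes N\otimes V,&\quad n\otimes m\otimes v\mapsto(\tau_{AB(1)}\rhd m)\otimes(\tau_{AB(2)}\rhd n)\otimes v, \end{aligned}$$ where $M=M_a$, $N=N_u$, $P=P_x$. -/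

import Mathlib

open CategoryTheory MonoidalCategory MonoidalLeftAction MonoidalRightAction Limits
open scoped TensorProduct

noncomputable section

namespace HopfTrip

section HopfAlgebra

/-- `H^{cop}`: the same algebra with the opposite comultiplication. -/
def Cop (H : Type) : Type := H

namespace Cop

variable (H : Type) [Ring H] [Bialgebra ℂ H]

instance : Ring (Cop H) := inferInstanceAs (Ring H)
instance : Algebra ℂ (Cop H) := inferInstanceAs (Algebra ℂ H)
instance [Module.Finite ℂ H] : Module.Finite ℂ (Cop H) := inferInstanceAs (Module.Finite ℂ H)

/-- The identity map `H^{cop} → H`. -/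
def algEquiv : Cop H ≃ₐ[ℂ] H := AlgEquiv.refl

instance : CoalgebraStruct ℂ (Cop H) where
  comul := TensorProduct.map (algEquiv H).symm.toLinearMap (algEquiv H).symm.toLinearMap ∘ₗ
    (TensorProduct.comm ℂ H H).toLinearMap ∘ₗ Coalgebra.comul ∘ₗ (algEquiv H).toLinearMap
  counit := Coalgebra.counit ∘ₗ (algEquiv H).toLinearMap

variable {H}

theorem comul_apply (a : Cop H) : Coalgebra.comul (R := ℂ) a =
    TensorProduct.map (algEquiv H).symm.toLinearMap (algEquiv H).symm.toLinearMap
      (TensorProduct.comm ℂ H H (Coalgebra.comul (R := ℂ) (algEquiv H a))) := rfl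

theorem counit_apply (a : Cop H) : Coalgebra.counit (R := ℂ) a =
    Coalgebra.counit (R := ℂ) (algEquiv H a) := rfl

theorem comul_eq_sum (a : Cop H) {ι : Type*} (r : Coalgebra.Repr ℂ (algEquiv H a) ι) :
    Coalgebra.comul (R := ℂ) a =
      ∑ i ∈ r.index, (algEquiv H).symm (r.right i) ⊗ₜ[ℂ] (algEquiv H).symm (r.left i) := by
  rw [comul_apply, ← r.eq]
  simp [map_sum]

instance : Coalgebra ℂ (Cop H) where
  coassoc := by
    ext a
    let r := Coalgebra.Repr.arbitrary ℂ (algEquiv H a)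
    have h := Coalgebra.sum_tmul_tmul_eq r
      (fun i => Coalgebra.Repr.arbitrary ℂ _) (fun i => Coalgebra.Repr.arbitrary ℂ _)
    apply_fun fun t => TensorProduct.map (algEquiv H).symm.toLinearMap
      (TensorProduct.map (algEquiv H).symm.toLinearMap (algEquiv H).symm.toLinearMap)
      (TensorProduct.assoc ℂ H H H (TensorProduct.comm ℂ _ _
        ((TensorProduct.comm ℂ H H).toLinearMap.lTensor H t))) at h
    simp only [map_sum, LinearMap.lTensor_tmul, LinearEquiv.coe_coe, TensorProduct.comm_tmul,
      TensorProduct.assoc_tmul, TensorProduct.map_tmul] at h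
    simp only [LinearMap.comp_apply, LinearEquiv.coe_coe]
    rw [comul_eq_sum a r]
    simp only [map_sum, LinearMap.lTensor_tmul, LinearMap.rTensor_tmul]
    have e1 : ∀ i, Coalgebra.comul (R := ℂ) ((algEquiv H).symm (r.right i)) = _ := fun i =>
      comul_eq_sum _ (Coalgebra.Repr.arbitrary ℂ (r.right i))
    have e2 : ∀ i, Coalgebra.comul (R := ℂ) ((algEquiv H).symm (r.left i)) = _ := fun i =>
      comul_eq_sum _ (Coalgebra.Repr.arbitrary ℂ (r.left i))
    simp only [e1, e2, TensorProduct.tmul_sum, TensorProduct.sum_tmul, map_sum,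
      TensorProduct.assoc_tmul]
    exact h.symm
  rTensor_counit_comp_comul := by
    ext a
    let r := Coalgebra.Repr.arbitrary ℂ (algEquiv H a)
    have h := Coalgebra.sum_tmul_counit_eq r
    apply_fun fun t => (algEquiv H).symm.toLinearMap.lTensor ℂ (TensorProduct.comm ℂ _ _ t) at h
    simp only [LinearMap.comp_apply]
    rw [comul_eq_sum a r]
    simp only [map_sum, TensorProduct.comm_tmul, LinearMap.lTensor_tmul] at h
    simp only [map_sum, LinearMap.rTensor_tmul]
    exact h
  lTensor_counit_comp_comul := by
    ext a
    let r := Coalgebra.Repr.arbitrary ℂ (algEquiv H a)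
    have h := Coalgebra.sum_counit_tmul_eq r
    apply_fun fun t => (algEquiv H).symm.toLinearMap.rTensor ℂ (TensorProduct.comm ℂ _ _ t) at h
    simp only [LinearMap.comp_apply]
    rw [comul_eq_sum a r]
    simp only [map_sum, TensorProduct.comm_tmul, LinearMap.rTensor_tmul] at h
    simp only [map_sum, LinearMap.lTensor_tmul]
    exact h

instance : Bialgebra ℂ (Cop H) := Bialgebra.mk' ℂ (Cop H)
  (by rw [counit_apply, map_one, Bialgebra.counit_one])
  (by intro a b; simp only [counit_apply, map_mul, Bialgebra.counit_mul])
  (by rw [comul_apply, map_one, Bialgebra.comul_one, Algebra.TensorProduct.one_def]; simp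
      rfl)
  (by
    intro a b
    have key : ∀ t : Cop H, Coalgebra.comul (R := ℂ) t =
      Algebra.TensorProduct.map (algEquiv H).symm.toAlgHom (algEquiv H).symm.toAlgHom
        (Algebra.TensorProduct.comm ℂ H H (Coalgebra.comul (R := ℂ) (algEquiv H t))) :=
      fun _ => rfl
    simp only [key, map_mul, Bialgebra.comul_mul])

end Cop

instance (H : Type) [Ring H] [Bialgebra ℂ H] : Bialgebra ℂ Hᵐᵒᵖ := Bialgebra.mk' ℂ Hᵐᵒᵖ
  (by simp [MulOpposite.counit_def])
  (by intro a b; simp [MulOpposite.counit_def, mul_comm])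
  (by simp [MulOpposite.comul_def, Algebra.TensorProduct.one_def])
  (by
    intro a b
    let ra := Coalgebra.Repr.arbitrary ℂ a.unop
    let rb := Coalgebra.Repr.arbitrary ℂ b.unop
    simp only [MulOpposite.comul_def, LinearMap.comp_apply, LinearEquiv.coe_coe,
      MulOpposite.coe_opLinearEquiv_symm, MulOpposite.unop_mul, Bialgebra.comul_mul]
    rw [← ra.eq, ← rb.eq]
    simp only [Finset.sum_mul_sum, map_sum, Algebra.TensorProduct.tmul_mul_tmul,
      TensorProduct.map_tmul, LinearEquiv.coe_coe, MulOpposite.coe_opLinearEquiv,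
      MulOpposite.op_mul]
    rw [Finset.sum_comm])

/-- `H^*`: linear functionals with the convolution product. -/
abbrev HDual (H : Type) [Ring H] [Bialgebra ℂ H] : Type := WithConv (H →ₗ[ℂ] ℂ)

namespace HDual

variable (H : Type) [Ring H] [Bialgebra ℂ H] 

variable [Module.Finite ℂ H]

/-- The canonical isomorphism `H^* ⊗ K^* ≅ (H ⊗ K)^*`. -/
def pairEquiv (K : Type) [Ring K] [Bialgebra ℂ K] [Module.Finite ℂ K] :
    HDual H ⊗[ℂ] HDual K ≃ₗ[ℂ] (H ⊗[ℂ] K →ₗ[ℂ] ℂ) :=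
  TensorProduct.congr (WithConv.linearEquiv ℂ (H →ₗ[ℂ] ℂ)) (WithConv.linearEquiv ℂ (K →ₗ[ℂ] ℂ)) ≪≫ₗ
    TensorProduct.dualDistribEquiv ℂ H K

variable {H}
@[simp] theorem pairEquiv_tmul (K : Type) [Ring K] [Bialgebra ℂ K] [Module.Finite ℂ K]
    (f : HDual H) (g : HDual K) (x : H) (y : K) :
    pairEquiv H K (f ⊗ₜ g) (x ⊗ₜ y) = f x * g y := by
  simp [pairEquiv]

instance : CoalgebraStruct ℂ (HDual H) where
  comul := (pairEquiv H H).symm.toLinearMap ∘ₗ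
    (LinearMap.mul' ℂ H).dualMap ∘ₗ (WithConv.linearEquiv ℂ (H →ₗ[ℂ] ℂ)).toLinearMap
  counit := (LinearMap.applyₗ (1 : H)) ∘ₗ (WithConv.linearEquiv ℂ (H →ₗ[ℂ] ℂ)).toLinearMap

theorem counit_apply (f : HDual H) : Coalgebra.counit (R := ℂ) f = f 1 := rfl

theorem pairEquiv_comul (f : HDual H) (x y : H) :
    pairEquiv H H (Coalgebra.comul (R := ℂ) f) (x ⊗ₜ y) = f (x * y) := by
  change pairEquiv H H ((pairEquiv H H).symm _) _ = _
  rw [LinearEquiv.apply_symm_apply]; rfl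

theorem repr_apply {f : HDual H} {ι : Type*} (r : Coalgebra.Repr ℂ f ι) (x y : H) :
    ∑ i ∈ r.index, r.left i x * r.right i y = f (x * y) := by
  rw [← pairEquiv_comul, ← r.eq]; simp [map_sum]

theorem tensor_ext {s t : HDual H ⊗[ℂ] HDual H}
    (h : ∀ x y, pairEquiv H H s (x ⊗ₜ y) = pairEquiv H H t (x ⊗ₜ y)) : s = t := by
  apply (pairEquiv H H).injective
  ext x y; exact h x y

instance : Coalgebra ℂ (HDual H) where
  coassoc := by
    ext1 f
    let r := Coalgebra.Repr.arbitrary ℂ f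
    let e : HDual H ⊗[ℂ] (HDual H ⊗[ℂ] HDual H) ≃ₗ[ℂ] (H ⊗[ℂ] (H ⊗[ℂ] H) →ₗ[ℂ] ℂ) :=
      TensorProduct.congr (WithConv.linearEquiv ℂ (H →ₗ[ℂ] ℂ)) (pairEquiv H H) ≪≫ₗ
        TensorProduct.dualDistribEquiv ℂ H (H ⊗[ℂ] H)
    have he : ∀ a s x y, e (a ⊗ₜ s) (x ⊗ₜ y) = a x * pairEquiv H H s y := by
      intro a s x y; simp [e]
    apply e.injective
    ext x y z
    simp only [LinearMap.comp_apply, LinearEquiv.coe_coe,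
      TensorProduct.AlgebraTensorModule.curry_apply, LinearMap.restrictScalars_self, TensorProduct.curry_apply]
    rw [← r.eq]
    simp only [map_sum, LinearMap.rTensor_tmul, LinearMap.lTensor_tmul, LinearMap.sum_apply, he,
      pairEquiv_comul, repr_apply]
    rw [← mul_assoc, ← repr_apply r]
    refine Finset.sum_congr rfl fun i _ => ?_
    let s := Coalgebra.Repr.arbitrary ℂ (r.left i)
    rw [← s.eq, ← repr_apply s]
    simp [TensorProduct.sum_tmul, he, Finset.sum_mul, mul_assoc, LinearMap.sum_apply]
  rTensor_counit_comp_comul := by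
    ext1 f
    let r := Coalgebra.Repr.arbitrary ℂ f
    simp only [LinearMap.comp_apply]
    rw [← r.eq]
    apply (TensorProduct.lid ℂ (HDual H)).injective
    ext x
    simpa [map_sum, counit_apply] using repr_apply r 1 x
  lTensor_counit_comp_comul := by
    ext1 f
    let r := Coalgebra.Repr.arbitrary ℂ f
    simp only [LinearMap.comp_apply]
    rw [← r.eq]
    apply (TensorProduct.rid ℂ (HDual H)).injective
    ext x
    simpa [map_sum, counit_apply, mul_comm] using repr_apply r x 1

instance : Bialgebra ℂ (HDual H) := Bialgebra.mk' ℂ (HDual H)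
  (by rw [counit_apply, LinearMap.convOne_def]; simp)
  (by intro a b; simp [counit_apply, Algebra.TensorProduct.one_def])
  (by
    apply tensor_ext
    intro x y
    rw [pairEquiv_comul, Algebra.TensorProduct.one_def, pairEquiv_tmul, LinearMap.convOne_def]
    simp)
  (by
    intro f g
    apply tensor_ext
    intro x y
    let rf := Coalgebra.Repr.arbitrary ℂ f
    let rg := Coalgebra.Repr.arbitrary ℂ g
    let rx := Coalgebra.Repr.arbitrary ℂ x
    let ry := Coalgebra.Repr.arbitrary ℂ y
    rw [pairEquiv_comul, ← rf.eq, ← rg.eq]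
    simp only [LinearMap.convMul_apply, Bialgebra.comul_mul, Finset.sum_mul_sum,
      Algebra.TensorProduct.tmul_mul_tmul, map_sum, LinearMap.sum_apply, pairEquiv_tmul]
    rw [← rx.eq, ← ry.eq]
    simp only [map_sum, Finset.sum_mul_sum, Algebra.TensorProduct.tmul_mul_tmul, 
      TensorProduct.map_tmul, LinearMap.mul'_apply]
    simp only [← repr_apply rf, ← repr_apply rg]
    simp only [Finset.sum_mul_sum]
    conv_rhs =>
      enter [2, a]
      rw [Finset.sum_comm]
    rw [Finset.sum_comm (s := rf.index)]
    refine Finset.sum_congr rfl fun i _ => ?_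
    conv_rhs =>
      enter [2, a]
      rw [Finset.sum_comm]
    rw [Finset.sum_comm (s := rf.index)]
    refine Finset.sum_congr rfl fun j _ => Finset.sum_congr rfl fun k _ =>
      Finset.sum_congr rfl fun l _ => ?_
    ring)

end HDual

section Pairings

variable {H K L : Type} [Ring H] [Bialgebra ℂ H] [Ring K] [Bialgebra ℂ K] [Ring L] [Bialgebra ℂ L]

/-- A skew pairing `τ : H × K → ℂ`:
`τ(hh', k) = τ(h, k₁) τ(h', k₂)`, `τ(h, kk') = τ(h₂, k) τ(h₁, k')`,
`τ(h, 1) = ε(h)` and `τ(1, k) = ε(k)`. -/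
structure IsSkewPairing (τ : H →ₗ[ℂ] K →ₗ[ℂ] ℂ) : Prop where
  mul_left (h h' : H) (k : K) : τ (h * h') k =
    LinearMap.mul' ℂ ℂ (TensorProduct.map (τ h) (τ h') (Coalgebra.comul (R := ℂ) k))
  mul_right (h : H) (k k' : K) : τ h (k * k') =
    LinearMap.mul' ℂ ℂ (TensorProduct.map (τ.flip k') (τ.flip k) (Coalgebra.comul (R := ℂ) h))
  one_right (h : H) : τ h 1 = Coalgebra.counit (R := ℂ) h
  one_left (k : K) : τ 1 k = Coalgebra.counit (R := ℂ) k

/-- The inverse of a bilinear form `τ : H × K → ℂ` with respect to the convolution product of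
linear functionals on the tensor product coalgebra `H ⊗ K`. (For a skew pairing of Hopf algebras it
exists and is given by `(h, k) ↦ τ(S h, k)`.) -/
def convInv (τ : H →ₗ[ℂ] K →ₗ[ℂ] ℂ) : H →ₗ[ℂ] K →ₗ[ℂ] ℂ :=
  TensorProduct.curry (Ring.inverse (WithConv.toConv (TensorProduct.lift τ))).ofConv

/-- For functionals `s`, `t` on a coalgebra `P`, the map `p ↦ s(p₁) t(p₃) p₂`. -/
def twist {P : Type} [AddCommGroup P] [Module ℂ P] [Coalgebra ℂ P] (s t : P →ₗ[ℂ] ℂ) : P →ₗ[ℂ] P :=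
  (TensorProduct.lid ℂ P).toLinearMap ∘ₗ
    TensorProduct.map s ((TensorProduct.rid ℂ P).toLinearMap ∘ₗ t.lTensor P ∘ₗ Coalgebra.comul) ∘ₗ
      Coalgebra.comul

/-- The multiplication of the generalised double `D(H, K)` of a skew pairing `τ`, which is a Hopf
algebra with underlying coalgebra `H ⊗ K` and unit `1 ⊗ 1`:
`(h ⊗ k)(h' ⊗ k') = τ(h'₁, k₁) τ⁻¹(h'₃, k₃) h h'₂ ⊗ k₂ k'`. -/
def doubleMul (τ : H →ₗ[ℂ] K →ₗ[ℂ] ℂ) : (H ⊗[ℂ] K) ⊗[ℂ] (H ⊗[ℂ] K) →ₗ[ℂ] H ⊗[ℂ] K :=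
  TensorProduct.map (LinearMap.mul' ℂ H) (LinearMap.mul' ℂ K) ∘ₗ
    (TensorProduct.assoc ℂ H H (K ⊗[ℂ] K)).symm.toLinearMap ∘ₗ
    ((TensorProduct.assoc ℂ H K K).toLinearMap ∘ₗ
      ((twist (TensorProduct.lift τ) (TensorProduct.lift (convInv τ)) ∘ₗ
        (TensorProduct.comm ℂ K H).toLinearMap).rTensor K) ∘ₗ
      (TensorProduct.assoc ℂ K H K).symm.toLinearMap).lTensor H ∘ₗ
    (TensorProduct.assoc ℂ H K (H ⊗[ℂ] K)).toLinearMap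

theorem doubleMul_tmul (τ : H →ₗ[ℂ] K →ₗ[ℂ] ℂ) (h h' : H) (k k' : K) :
    doubleMul τ ((h ⊗ₜ k) ⊗ₜ (h' ⊗ₜ k')) =
      TensorProduct.map (LinearMap.mulLeft ℂ h) (LinearMap.mulRight ℂ k')
        (twist (TensorProduct.lift τ) (TensorProduct.lift (convInv τ)) (h' ⊗ₜ k)) := by
  simp only [doubleMul, LinearMap.comp_apply, LinearEquiv.coe_coe, TensorProduct.assoc_tmul,
    LinearMap.lTensor_tmul, TensorProduct.assoc_symm_tmul, LinearMap.rTensor_tmul,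
    TensorProduct.comm_tmul]
  induction twist (TensorProduct.lift τ) (TensorProduct.lift (convInv τ)) (h' ⊗ₜ k) with
  | zero => simp
  | tmul x y => simp
  | add x y hx hy => simp only [TensorProduct.add_tmul, TensorProduct.tmul_add, map_add, hx, hy]

/-- The form `τ : H × K → ℂ`, regarded as a form `H^{op} × K^{cop} → ℂ`. -/
def opCop (τ : H →ₗ[ℂ] K →ₗ[ℂ] ℂ) : Hᵐᵒᵖ →ₗ[ℂ] Cop K →ₗ[ℂ] ℂ :=
  τ.compl₁₂ (MulOpposite.opLinearEquiv ℂ).symm.toLinearMap (Cop.algEquiv K).toLinearMap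

/-- `φ` is a homomorphism of Hopf algebras from the generalised double `D(H, K)` of `τ` to `L`. -/
structure IsDoubleHom (τ : H →ₗ[ℂ] K →ₗ[ℂ] ℂ) (φ : H ⊗[ℂ] K →ₗ[ℂ] L) : Prop where
  map_mul (x y : H ⊗[ℂ] K) : φ (doubleMul τ (x ⊗ₜ y)) = φ x * φ y
  map_one : φ (1 ⊗ₜ 1) = 1
  map_comul : Coalgebra.comul ∘ₗ φ = TensorProduct.map φ φ ∘ₗ Coalgebra.comul
  map_counit : Coalgebra.counit ∘ₗ φ = Coalgebra.counit

variable {A B C : Type} [Ring A] [Bialgebra ℂ A] [Ring B] [Bialgebra ℂ B] [Ring C] [Bialgebra ℂ C]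

/-- The map `φ_{ABC} : A^{op} ⊗ B^{cop} → C^*`, `φ(a ⊗ b)(c) = τ_{CA}(c₁, a) τ_{BC}(b, c₂)`. -/
def tripletMap (τBC : B →ₗ[ℂ] C →ₗ[ℂ] ℂ) (τCA : C →ₗ[ℂ] A →ₗ[ℂ] ℂ) :
    Aᵐᵒᵖ ⊗[ℂ] Cop B →ₗ[ℂ] HDual C :=
  LinearMap.mul' ℂ (HDual C) ∘ₗ TensorProduct.map
    ((WithConv.linearEquiv ℂ (C →ₗ[ℂ] ℂ)).symm.toLinearMap ∘ₗ τCA.flip ∘ₗ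
      (MulOpposite.opLinearEquiv ℂ).symm.toLinearMap)
    ((WithConv.linearEquiv ℂ (C →ₗ[ℂ] ℂ)).symm.toLinearMap ∘ₗ τBC ∘ₗ (Cop.algEquiv B).toLinearMap)

theorem tripletMap_tmul (τBC : B →ₗ[ℂ] C →ₗ[ℂ] ℂ) (τCA : C →ₗ[ℂ] A →ₗ[ℂ] ℂ) (a : A) (b : B)
    (c : C) : tripletMap τBC τCA (MulOpposite.op a ⊗ₜ (Cop.algEquiv B).symm b) c =
      LinearMap.mul' ℂ ℂ (TensorProduct.map (τCA.flip a) (τBC b) (Coalgebra.comul (R := ℂ) c)) := by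
  simp [tripletMap]

/-- The element of `H^* ⊗ K^*` corresponding to a bilinear form `H × K → ℂ`. -/
def pairingElt [Module.Finite ℂ H] [Module.Finite ℂ K] (τ : H →ₗ[ℂ] K →ₗ[ℂ] ℂ) :
    HDual H ⊗[ℂ] HDual K :=
  (HDual.pairEquiv H K).symm (TensorProduct.lift τ)

end Pairings

/-- A Hopf triplet: finite-dimensional semisimple complex Hopf algebras `A`, `B`, `C` with skew
pairings `τ_{AB}`, `τ_{BC}`, `τ_{CA}` that induce Hopf algebra homomorphisms
`D(A^{op}, B^{cop}) → C^*`, `D(B^{op}, C^{cop}) → A^*` and `D(C^{op}, A^{cop}) → B^*`. -/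
structure HopfTriplet where
  (A B C : Type)
  [ringA : Ring A] [hopfA : HopfAlgebra ℂ A] [finA : Module.Finite ℂ A] [ssA : IsSemisimpleRing A]
  [ringB : Ring B] [hopfB : HopfAlgebra ℂ B] [finB : Module.Finite ℂ B] [ssB : IsSemisimpleRing B]
  [ringC : Ring C] [hopfC : HopfAlgebra ℂ C] [finC : Module.Finite ℂ C] [ssC : IsSemisimpleRing C]
  τAB : A →ₗ[ℂ] B →ₗ[ℂ] ℂ
  τBC : B →ₗ[ℂ] C →ₗ[ℂ] ℂ
  τCA : C →ₗ[ℂ] A →ₗ[ℂ] ℂ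
  skewAB : IsSkewPairing τAB
  skewBC : IsSkewPairing τBC
  skewCA : IsSkewPairing τCA
  homABC : IsDoubleHom (opCop τAB) (tripletMap τBC τCA)
  homBCA : IsDoubleHom (opCop τBC) (tripletMap τCA τAB)
  homCAB : IsDoubleHom (opCop τCA) (tripletMap τAB τBC)

attribute [instance] HopfTriplet.ringA HopfTriplet.hopfA HopfTriplet.finA HopfTriplet.ssA
  HopfTriplet.ringB HopfTriplet.hopfB HopfTriplet.finB HopfTriplet.ssB
  HopfTriplet.ringC HopfTriplet.hopfC HopfTriplet.finC HopfTriplet.ssC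

end HopfAlgebra

section HMod

/-- A finite-dimensional (left) module over a complex Hopf algebra (or bialgebra) `H`. -/
structure HMod (H : Type) [Ring H] [Bialgebra ℂ H] where
  V : FGModuleCat.{0} ℂ
  ρ : H →ₐ[ℂ] Module.End ℂ V

namespace HMod

variable {H : Type} [Ring H] [Bialgebra ℂ H]

/-- `H`-linear maps. -/
@[ext]
structure Hom (X Y : HMod H) where
  hom : X.V ⟶ Y.V
  comm (h : H) : hom.hom.hom ∘ₗ X.ρ h = Y.ρ h ∘ₗ hom.hom.hom

instance : Category (HMod H) where
  Hom := Hom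
  id X := ⟨𝟙 _, fun h => by ext; rfl⟩
  comp f g := ⟨f.hom ≫ g.hom, fun h => by
    simp only [FGModuleCat.hom_hom_comp]
    rw [LinearMap.comp_assoc, f.comm, ← LinearMap.comp_assoc, g.comm, LinearMap.comp_assoc]⟩

@[ext] theorem hom_ext {X Y : HMod H} {f g : X ⟶ Y} (h : f.hom = g.hom) : f = g := Hom.ext h
@[simp] theorem id_hom (X : HMod H) : (𝟙 X : X ⟶ X).hom = 𝟙 X.V := rfl
@[simp] theorem comp_hom {X Y Z : HMod H} (f : X ⟶ Y) (g : Y ⟶ Z) :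
    (f ≫ g).hom = f.hom ≫ g.hom := rfl

variable (H) in
/-- The forgetful functor to finite-dimensional vector spaces. -/
@[simps] def forget : HMod H ⥤ FGModuleCat.{0} ℂ where
  obj X := X.V
  map f := f.hom

instance : (forget H).Faithful where
  map_injective h := hom_ext h

/-- An isomorphism of vector spaces that is `H`-linear. -/
@[simps] def isoMk {X Y : HMod H} (e : X.V ≅ Y.V)
    (h : ∀ h, e.hom.hom.hom ∘ₗ X.ρ h = Y.ρ h ∘ₗ e.hom.hom.hom) : X ≅ Y where
  hom := ⟨e.hom, h⟩
  inv := ⟨e.inv, fun a => by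
    have h1 : e.hom.hom.hom ∘ₗ e.inv.hom.hom = LinearMap.id := by
      rw [← FGModuleCat.hom_hom_comp, e.inv_hom_id]; rfl
    have h2 : e.inv.hom.hom ∘ₗ e.hom.hom.hom = LinearMap.id := by
      rw [← FGModuleCat.hom_hom_comp, e.hom_inv_id]; rfl
    calc e.inv.hom.hom ∘ₗ Y.ρ a
        = e.inv.hom.hom ∘ₗ (Y.ρ a ∘ₗ e.hom.hom.hom) ∘ₗ e.inv.hom.hom := by
          rw [LinearMap.comp_assoc, h1, LinearMap.comp_id]
      _ = X.ρ a ∘ₗ e.inv.hom.hom := by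
          rw [← h, LinearMap.comp_assoc, ← LinearMap.comp_assoc, h2, LinearMap.id_comp]⟩

/-- The action of `H` on a tensor product of modules, via the comultiplication. -/
def tensorρ (X Y : HMod H) : H →ₐ[ℂ] Module.End ℂ (X.V ⊗[ℂ] Y.V) :=
  (Module.endTensorEndAlgHom (R := ℂ) (S := ℂ) (A := ℂ)).comp
    ((Algebra.TensorProduct.map X.ρ Y.ρ).comp (Bialgebra.comulAlgHom ℂ H))

/-- The trivial module `ℂ`, via the counit. -/
def unitρ : H →ₐ[ℂ] Module.End ℂ ℂ := (Algebra.lmul ℂ ℂ).comp (Bialgebra.counitAlgHom ℂ H)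

theorem tensorρ_eq (X Y : HMod H) (h : H) : tensorρ X Y h =
    TensorProduct.homTensorHomMap (RingHom.id ℂ) X.V Y.V X.V Y.V
      (TensorProduct.map X.ρ.toLinearMap Y.ρ.toLinearMap (Coalgebra.comul (R := ℂ) h)) := rfl

theorem tensorρ_sum (X Y : HMod H) (h : H) {ι : Type*} (r : Coalgebra.Repr ℂ h ι) :
    tensorρ X Y h = ∑ i ∈ r.index, TensorProduct.map (X.ρ (r.left i)) (Y.ρ (r.right i)) := by
  rw [tensorρ_eq, ← r.eq]
  simp [map_sum]

theorem map_tensorρ {X X' Y Y' : HMod H} (f : X ⟶ X') (g : Y ⟶ Y') (h : H) :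
    TensorProduct.map f.hom.hom.hom g.hom.hom.hom ∘ₗ tensorρ X Y h =
      tensorρ X' Y' h ∘ₗ TensorProduct.map f.hom.hom.hom g.hom.hom.hom := by
  let r := Coalgebra.Repr.arbitrary ℂ h
  have hf : ∀ a x, f.hom.hom.hom (X.ρ a x) = X'.ρ a (f.hom.hom.hom x) := fun a x =>
    LinearMap.congr_fun (f.comm a) x
  have hg : ∀ a x, g.hom.hom.hom (Y.ρ a x) = Y'.ρ a (g.hom.hom.hom x) := fun a x =>
    LinearMap.congr_fun (g.comm a) x
  rw [tensorρ_sum _ _ _ r, tensorρ_sum _ _ _ r]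
  refine TensorProduct.ext' fun x y => ?_
  simp [map_sum, hf, hg]

theorem assoc_tensorρ (X Y Z : HMod H) (h : H) :
    (TensorProduct.assoc ℂ X.V Y.V Z.V).toLinearMap ∘ₗ tensorρ ⟨X.V ⊗ Y.V, tensorρ X Y⟩ Z h =
      tensorρ X ⟨Y.V ⊗ Z.V, tensorρ Y Z⟩ h ∘ₗ
        (TensorProduct.assoc ℂ X.V Y.V Z.V).toLinearMap := by
  let r := Coalgebra.Repr.arbitrary ℂ h
  rw [tensorρ_sum _ _ _ r, tensorρ_sum _ _ _ r]
  refine TensorProduct.ext_threefold fun x y z => ?_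
  have key := Coalgebra.sum_tmul_tmul_eq r
      (fun i => Coalgebra.Repr.arbitrary ℂ _) (fun i => Coalgebra.Repr.arbitrary ℂ _)
  apply_fun fun t => TensorProduct.map (X.ρ.toLinearMap.flip x)
    (TensorProduct.map (Y.ρ.toLinearMap.flip y) (Z.ρ.toLinearMap.flip z)) t at key
  simp only [map_sum, TensorProduct.map_tmul, LinearMap.flip_apply, AlgHom.toLinearMap_apply] at key
  have e1 : ∀ i, tensorρ X Y (r.left i) = _ := fun i =>
    tensorρ_sum X Y _ (Coalgebra.Repr.arbitrary ℂ (r.left i))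
  have e2 : ∀ i, tensorρ Y Z (r.right i) = _ := fun i =>
    tensorρ_sum Y Z _ (Coalgebra.Repr.arbitrary ℂ (r.right i))
  simp only [LinearMap.comp_apply, LinearMap.sum_apply, LinearEquiv.coe_coe, map_sum,
    TensorProduct.assoc_tmul]
  calc _ = _ := Finset.sum_congr rfl fun i _ => ?_
    _ = _ := key
    _ = _ := Finset.sum_congr rfl fun i _ => ?_
  · change TensorProduct.assoc ℂ X.V Y.V Z.V
      (TensorProduct.map (tensorρ X Y (r.left i)) (Z.ρ (r.right i)) ((x ⊗ₜ y) ⊗ₜ z)) = _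
    rw [e1, TensorProduct.map_tmul, LinearMap.sum_apply, TensorProduct.sum_tmul, map_sum]
    rfl
  · change _ = TensorProduct.map (X.ρ (r.left i)) (tensorρ Y Z (r.right i)) (x ⊗ₜ (y ⊗ₜ z))
    rw [e2, TensorProduct.map_tmul, LinearMap.sum_apply, TensorProduct.tmul_sum]
    rfl

theorem lid_tensorρ (X : HMod H) (h : H) :
    (TensorProduct.lid ℂ X.V).toLinearMap ∘ₗ tensorρ ⟨𝟙_ _, unitρ⟩ X h =
      X.ρ h ∘ₗ (TensorProduct.lid ℂ X.V).toLinearMap := by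
  let r := Coalgebra.Repr.arbitrary ℂ h
  rw [tensorρ_sum _ _ _ r]
  refine TensorProduct.ext' fun c x => ?_
  have key := Coalgebra.sum_counit_tmul_eq r
  apply_fun fun t => TensorProduct.lid ℂ X.V
    (TensorProduct.map LinearMap.id (X.ρ.toLinearMap.flip x) t) at key
  simp only [map_sum, TensorProduct.map_tmul, LinearMap.flip_apply, AlgHom.toLinearMap_apply,
    TensorProduct.lid_tmul, LinearMap.id_apply, one_smul] at key
  simp only [LinearMap.comp_apply, LinearMap.sum_apply, LinearEquiv.coe_coe, map_sum]
  calc _ = ∑ i ∈ r.index, c • (Coalgebra.counit (R := ℂ) (r.left i) • X.ρ (r.right i) x) :=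
        Finset.sum_congr rfl fun i _ => by
          change (Coalgebra.counit (R := ℂ) (r.left i) * c) • X.ρ (r.right i) x = _
          rw [mul_comm, mul_smul]
    _ = c • X.ρ h x := (Finset.smul_sum (M := ℂ) (N := X.V) (r := c)).symm.trans (congrArg _ key)
    _ = X.ρ h (c • x) := (map_smul _ _ _).symm

theorem rid_tensorρ (X : HMod H) (h : H) :
    (TensorProduct.rid ℂ X.V).toLinearMap ∘ₗ tensorρ X ⟨𝟙_ _, unitρ⟩ h =
      X.ρ h ∘ₗ (TensorProduct.rid ℂ X.V).toLinearMap := by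
  let r := Coalgebra.Repr.arbitrary ℂ h
  rw [tensorρ_sum _ _ _ r]
  refine TensorProduct.ext' fun x c => ?_
  have key := Coalgebra.sum_tmul_counit_eq r
  apply_fun fun t => TensorProduct.rid ℂ X.V
    (TensorProduct.map (X.ρ.toLinearMap.flip x) LinearMap.id t) at key
  simp only [map_sum, TensorProduct.map_tmul, LinearMap.flip_apply, AlgHom.toLinearMap_apply,
    TensorProduct.rid_tmul, LinearMap.id_apply, one_smul] at key
  simp only [LinearMap.comp_apply, LinearMap.sum_apply, LinearEquiv.coe_coe, map_sum]
  calc _ = ∑ i ∈ r.index, c • (Coalgebra.counit (R := ℂ) (r.right i) • X.ρ (r.left i) x) :=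
        Finset.sum_congr rfl fun i _ => by
          change (Coalgebra.counit (R := ℂ) (r.right i) * c) • X.ρ (r.left i) x = _
          rw [mul_comm, mul_smul]
    _ = c • X.ρ h x := (Finset.smul_sum (M := ℂ) (N := X.V) (r := c)).symm.trans (congrArg _ key)
    _ = X.ρ h (c • x) := (map_smul _ _ _).symm

instance : MonoidalCategoryStruct (HMod H) where
  tensorObj X Y := ⟨X.V ⊗ Y.V, tensorρ X Y⟩
  tensorUnit := ⟨𝟙_ _, unitρ⟩
  whiskerLeft X _ _ f := ⟨X.V ◁ f.hom, map_tensorρ (𝟙 X) f⟩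
  whiskerRight f Y := ⟨f.hom ▷ Y.V, map_tensorρ f (𝟙 Y)⟩
  tensorHom f g := ⟨f.hom ⊗ₘ g.hom, map_tensorρ f g⟩
  associator X Y Z := isoMk (α_ X.V Y.V Z.V) fun h => by
    exact assoc_tensorρ X Y Z h
  leftUnitor X := isoMk (λ_ X.V) fun h => by
    exact lid_tensorρ X h
  rightUnitor X := isoMk (ρ_ X.V) fun h => by
    exact rid_tensorρ X h

instance : MonoidalCategory (HMod H) := Monoidal.induced (forget H)
  { μIso := fun X Y => Iso.refl _
    εIso := Iso.refl _
    whiskerLeft_eq := fun X Y Z f => by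
      change X.V ◁ f.hom = 𝟙 _ ≫ X.V ◁ f.hom ≫ 𝟙 _
      rw [Category.id_comp, Category.comp_id]
    whiskerRight_eq := fun f Y => by
      change f.hom ▷ Y.V = 𝟙 _ ≫ f.hom ▷ Y.V ≫ 𝟙 _
      rw [Category.id_comp, Category.comp_id]
    tensorHom_eq := fun f g => by
      change f.hom ⊗ₘ g.hom = 𝟙 _ ≫ (f.hom ⊗ₘ g.hom) ≫ 𝟙 _
      rw [Category.id_comp, Category.comp_id]
    associator_eq := fun X Y Z => by
      change (α_ X.V Y.V Z.V).hom = 𝟙 _ ≫ (𝟙 (tensorObj X.V Y.V) ▷ Z.V) ≫ (α_ X.V Y.V Z.V).hom ≫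
        (𝟙 X.V ⊗ₘ 𝟙 (tensorObj Y.V Z.V)) ≫ 𝟙 _
      rw [id_whiskerRight, id_tensorHom_id, Category.id_comp, Category.id_comp, Category.comp_id]
      exact (Category.comp_id _).symm
    leftUnitor_eq := fun X => by
      change (λ_ X.V).hom = 𝟙 _ ≫ (𝟙 (𝟙_ (FGModuleCat.{0} ℂ)) ▷ X.V) ≫ (λ_ X.V).hom
      rw [id_whiskerRight, Category.id_comp, Category.id_comp]
    rightUnitor_eq := fun X => by
      change (ρ_ X.V).hom = 𝟙 _ ≫ (X.V ◁ 𝟙 (𝟙_ (FGModuleCat.{0} ℂ))) ≫ (ρ_ X.V).hom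
      rw [whiskerLeft_id, Category.id_comp, Category.id_comp] }

instance : (forget H).Monoidal := Functor.CoreMonoidal.toMonoidal
  { εIso := Iso.refl _
    μIso := fun _ _ => Iso.refl _
    μIso_hom_natural_left := fun f Y => by
      change f.hom ▷ Y.V ≫ 𝟙 _ = 𝟙 _ ≫ f.hom ▷ Y.V; simp
    μIso_hom_natural_right := fun X f => by
      change X.V ◁ f.hom ≫ 𝟙 _ = 𝟙 _ ≫ X.V ◁ f.hom; simp
    associativity := fun X Y Z => by
      change 𝟙 _ ▷ Z.V ≫ 𝟙 _ ≫ (α_ X.V Y.V Z.V).hom = (α_ X.V Y.V Z.V).hom ≫ X.V ◁ 𝟙 _ ≫ 𝟙 _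
      simp
    left_unitality := fun X => by
      change (λ_ X.V).hom = 𝟙 _ ▷ X.V ≫ 𝟙 _ ≫ (λ_ X.V).hom; simp
    right_unitality := fun X => by
      change (ρ_ X.V).hom = X.V ◁ 𝟙 _ ≫ 𝟙 _ ≫ (ρ_ X.V).hom; simp }

end HMod
end HMod
section Fusion

universe v u

attribute [local instance] Abelian.hasFiniteBiproducts

/-- A fusion category over `ℂ`: a finite semisimple `ℂ`-linear abelian rigid monoidal category with
bilinear tensor product whose unit object has only scalar endomorphisms. -/
class FusionCategory (C : Type u) [Category.{v} C] [Abelian C] [Linear ℂ C] [MonoidalCategory C]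
    [MonoidalPreadditive C] [MonoidalLinear ℂ C] [RigidCategory C] : Prop where
  finite_hom (X Y : C) : Module.Finite ℂ (X ⟶ Y)
  semisimple (X : C) : ∃ (n : ℕ) (S : Fin n → C), (∀ i, Simple (S i)) ∧ Nonempty (X ≅ ⨁ S)
  finite_simple : ∃ (n : ℕ) (S : Fin n → C), ∀ X : C, Simple X → ∃ i, Nonempty (X ≅ S i)
  finrank_end_unit : Module.finrank ℂ (𝟙_ C ⟶ 𝟙_ C) = 1

/-- A pivotal structure: a monoidal natural isomorphism `ω : ** ⇒ id`. The dual `Xᘁ` is the one with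
evaluation `Xᘁ ⊗ X ⟶ 𝟙` and coevaluation `𝟙 ⟶ X ⊗ Xᘁ`; the isomorphism `(X ⊗ Y)ᘁᘁ ≅ Xᘁᘁ ⊗ Yᘁᘁ`
is the canonical one. -/
structure PivotalStructure (C : Type u) [Category.{v} C] [MonoidalCategory C]
    [RightRigidCategory C] where
  iso (X : C) : (Xᘁ)ᘁ ≅ X
  naturality {X Y : C} (f : X ⟶ Y) : (fᘁ)ᘁ ≫ (iso Y).hom = (iso X).hom ≫ f
  monoidal (X Y : C) : (iso (X ⊗ Y)).hom =
    ((rightDualTensorIso X Y).inv)ᘁ ≫ (rightDualTensorIso (Yᘁ) (Xᘁ)).hom ≫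
      ((iso X).hom ⊗ₘ (iso Y).hom)

namespace PivotalStructure

variable {C : Type u} [Category.{v} C] [MonoidalCategory C] [RightRigidCategory C]
  (ω : PivotalStructure C)

/-- The second coevaluation `𝟙 ⟶ Xᘁ ⊗ X`. -/
def coev (X : C) : 𝟙_ C ⟶ Xᘁ ⊗ X := η_ (Xᘁ) ((Xᘁ)ᘁ) ≫ (Xᘁ ◁ (ω.iso X).hom)

/-- The second evaluation `X ⊗ Xᘁ ⟶ 𝟙`. -/
def ev (X : C) : X ⊗ Xᘁ ⟶ 𝟙_ C := ((ω.iso X).inv ▷ Xᘁ) ≫ ε_ (Xᘁ) ((Xᘁ)ᘁ)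

/-- The right trace of an endomorphism. -/
def traceR {X : C} (f : X ⟶ X) : 𝟙_ C ⟶ 𝟙_ C := η_ X (Xᘁ) ≫ (f ▷ Xᘁ) ≫ ω.ev X

/-- The left trace of an endomorphism. -/
def traceL {X : C} (f : X ⟶ X) : 𝟙_ C ⟶ 𝟙_ C := ω.coev X ≫ (Xᘁ ◁ f) ≫ ε_ X (Xᘁ)

/-- A pivotal structure is spherical if left and right traces agree. -/
def IsSpherical : Prop := ∀ (X : C) (f : X ⟶ X), ω.traceL f = ω.traceR f

end PivotalStructure

/-- For a monoidal functor `F`, the evaluation `F(Xᘁ) ⊗ F(X) ⟶ 𝟙` that exhibits `F(Xᘁ)` as a dual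
of `F(X)`. -/
def transportEv {C D : Type*} [Category* C] [MonoidalCategory C] [RightRigidCategory C]
    [Category* D] [MonoidalCategory D] (F : C ⥤ D) [F.Monoidal] (X : C) :
    F.obj (Xᘁ) ⊗ F.obj X ⟶ 𝟙_ D :=
  Functor.LaxMonoidal.μ F (Xᘁ) X ≫ F.map (ε_ X (Xᘁ)) ≫ Functor.OplaxMonoidal.η F

end Fusion

section Bimodule

universe v₁ v₂ v₃ u₁ u₂ u₃

/-- The action functor of a left module category is `ℂ`-bilinear on morphisms and exact in the
acting variable. -/
class LinearLeftAction (C : Type u₁) [Category.{v₁} C] [Preadditive C] [Linear ℂ C]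
    [MonoidalCategory C] (M : Type u₃) [Category.{v₃} M] [Preadditive M] [Linear ℂ M]
    [MonoidalLeftAction C M] : Prop where
  add_act {x y : C} (f g : x ⟶ y) (m : M) : (f + g) ⊵ₗ m = f ⊵ₗ m + g ⊵ₗ m
  smul_act {x y : C} (z : ℂ) (f : x ⟶ y) (m : M) : (z • f) ⊵ₗ m = z • (f ⊵ₗ m)
  act_add (x : C) {m n : M} (α β : m ⟶ n) : x ⊴ₗ (α + β) = x ⊴ₗ α + x ⊴ₗ β
  act_smul (x : C) {m n : M} (z : ℂ) (α : m ⟶ n) : x ⊴ₗ (z • α) = z • (x ⊴ₗ α)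
  left_exact (m : M) : PreservesFiniteLimits (MonoidalLeftAction.actionRight C m)
  right_exact (m : M) : PreservesFiniteColimits (MonoidalLeftAction.actionRight C m)

/-- The action functor of a right module category is `ℂ`-bilinear on morphisms and exact in the
acting variable. -/
class LinearRightAction (B : Type u₂) [Category.{v₂} B] [Preadditive B] [Linear ℂ B]
    [MonoidalCategory B] (M : Type u₃) [Category.{v₃} M] [Preadditive M] [Linear ℂ M]
    [MonoidalRightAction B M] : Prop where
  act_add (m : M) {u v : B} (f g : u ⟶ v) : m ⊴ᵣ (f + g) = m ⊴ᵣ f + m ⊴ᵣ g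
  act_smul (m : M) {u v : B} (z : ℂ) (f : u ⟶ v) : m ⊴ᵣ (z • f) = z • (m ⊴ᵣ f)
  add_act {m n : M} (α β : m ⟶ n) (u : B) : (α + β) ⊵ᵣ u = α ⊵ᵣ u + β ⊵ᵣ u
  smul_act {m n : M} (z : ℂ) (α : m ⟶ n) (u : B) : (z • α) ⊵ᵣ u = z • (α ⊵ᵣ u)
  left_exact (m : M) : PreservesFiniteLimits (MonoidalRightAction.actionLeft B m)
  right_exact (m : M) : PreservesFiniteColimits (MonoidalRightAction.actionLeft B m)

/-- The compatibility isomorphism of a `(C, B)`-bimodule category and its coherence axioms. -/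
class BimoduleCategory (C : Type u₁) [Category.{v₁} C] [MonoidalCategory C]
    (B : Type u₂) [Category.{v₂} B] [MonoidalCategory B] (M : Type u₃) [Category.{v₃} M]
    [MonoidalLeftAction C M] [MonoidalRightAction B M] where
  mid (x : C) (m : M) (u : B) : (x ⊙ₗ m) ⊙ᵣ u ≅ x ⊙ₗ (m ⊙ᵣ u)
  mid_naturality {x x' : C} {m m' : M} {u u' : B} (f : x ⟶ x') (α : m ⟶ m') (g : u ⟶ u') :
    ((f ⊙ₗₘ α) ⊙ᵣₘ g) ≫ (mid x' m' u').hom = (mid x m u).hom ≫ (f ⊙ₗₘ (α ⊙ᵣₘ g))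
  mid_tensor_left (x y : C) (m : M) (u : B) :
    (mid (x ⊗ y) m u).hom ≫ (αₗ x y (m ⊙ᵣ u)).hom =
      ((αₗ x y m).hom ⊵ᵣ u) ≫ (mid x (y ⊙ₗ m) u).hom ≫ (x ⊴ₗ (mid y m u).hom)
  mid_tensor_right (x : C) (m : M) (u v : B) :
    (αᵣ (x ⊙ₗ m) u v).inv ≫ (mid x m (u ⊗ v)).hom =
      ((mid x m u).hom ⊵ᵣ v) ≫ (mid x (m ⊙ᵣ u) v).hom ≫ (x ⊴ₗ (αᵣ m u v).inv)

variable {C : Type u₁} [Category.{v₁} C] [MonoidalCategory C]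
  {B : Type u₂} [Category.{v₂} B] [MonoidalCategory B] {M : Type u₃} [Category.{v₃} M]
  [MonoidalLeftAction C M] [MonoidalRightAction B M]

/-- The partial trace `End(c ▷ m) → End(m)` with respect to the left action. -/
def partialTraceL [RightRigidCategory C] (ω : PivotalStructure C) (c : C) (m : M)
    (α : c ⊙ₗ m ⟶ c ⊙ₗ m) : m ⟶ m :=
  (λₗ[C] m).inv ≫ (ω.coev c ⊵ₗ m) ≫ (αₗ (cᘁ : C) c m).hom ≫ (cᘁ ⊴ₗ α) ≫ (αₗ (cᘁ : C) c m).inv ≫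
    (ε_ c (cᘁ) ⊵ₗ m) ≫ (λₗ[C] m).hom

/-- The partial trace `End(m ◁ b) → End(m)` with respect to the right action. -/
def partialTraceR [RightRigidCategory B] (ω : PivotalStructure B) (b : B) (m : M)
    (α : m ⊙ᵣ b ⟶ m ⊙ᵣ b) : m ⟶ m :=
  (ρᵣ[B] m).inv ≫ (m ⊴ᵣ η_ b (bᘁ)) ≫ (αᵣ m b (bᘁ)).hom ≫ (α ⊵ᵣ bᘁ) ≫ (αᵣ m b (bᘁ)).inv ≫
    (m ⊴ᵣ ω.ev b) ≫ (ρᵣ[B] m).hom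

/-- A bimodule trace on a `(C, B)`-bimodule category. -/
structure BimoduleTrace (M : Type u₃) [Category.{v₃} M] [MonoidalLeftAction C M]
    [MonoidalRightAction B M] [RightRigidCategory C] [RightRigidCategory B]
    [Preadditive M] [Linear ℂ M] (ωC : PivotalStructure C) (ωB : PivotalStructure B) where
  tr (m : M) : (m ⟶ m) →ₗ[ℂ] ℂ
  cyclic {m n : M} (α : m ⟶ n) (β : n ⟶ m) : tr m (α ≫ β) = tr n (β ≫ α)
  nondeg {m n : M} (α : m ⟶ n) : (∀ β : n ⟶ m, tr m (α ≫ β) = 0) → α = 0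
  left_trace (c : C) (m : M) (α : c ⊙ₗ m ⟶ c ⊙ₗ m) :
    tr (c ⊙ₗ m) α = tr m (partialTraceL ωC c m α)
  right_trace (b : B) (m : M) (α : m ⊙ᵣ b ⟶ m ⊙ᵣ b) :
    tr (m ⊙ᵣ b) α = tr m (partialTraceR ωB b m α)

end Bimodule

section BimodEnd

universe v₁ v₂ v₃ u₁ u₂ u₃

/-- A `(C, B)`-bimodule endofunctor of `M`: a `ℂ`-linear right exact functor with coherence
isomorphisms `s : F(x ▷ m) ≅ x ▷ F(m)` and `t : F(m) ◁ u ≅ F(m ◁ u)`. -/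
structure BimodEnd (C : Type u₁) [Category.{v₁} C] [MonoidalCategory C]
    (B : Type u₂) [Category.{v₂} B] [MonoidalCategory B] (M : Type u₃) [Category.{v₃} M]
    [Preadditive M] [Linear ℂ M] [MonoidalLeftAction C M] [MonoidalRightAction B M]
    [BimoduleCategory C B M] where
  functor : M ⥤ M
  [additive : functor.Additive]
  [linear : functor.Linear ℂ]
  [rightExact : PreservesFiniteColimits functor]
  s (x : C) (m : M) : functor.obj (x ⊙ₗ m) ≅ x ⊙ₗ functor.obj m
  s_naturality {x y : C} {m n : M} (f : x ⟶ y) (α : m ⟶ n) :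
    functor.map (f ⊙ₗₘ α) ≫ (s y n).hom = (s x m).hom ≫ (f ⊙ₗₘ functor.map α)
  s_tensor (x y : C) (m : M) : (s (x ⊗ y) m).hom ≫ (αₗ x y (functor.obj m)).hom =
    functor.map (αₗ x y m).hom ≫ (s x (y ⊙ₗ m)).hom ≫ (x ⊴ₗ (s y m).hom)
  s_unit (m : M) : (s (𝟙_ C) m).hom ≫ (λₗ[C] (functor.obj m)).hom = functor.map (λₗ[C] m).hom
  t (m : M) (u : B) : functor.obj m ⊙ᵣ u ≅ functor.obj (m ⊙ᵣ u)
  t_naturality {m n : M} {u v : B} (α : m ⟶ n) (f : u ⟶ v) :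
    (functor.map α ⊙ᵣₘ f) ≫ (t n v).hom = (t m u).hom ≫ functor.map (α ⊙ᵣₘ f)
  t_tensor (m : M) (u v : B) : (αᵣ (functor.obj m) u v).inv ≫ (t m (u ⊗ v)).hom =
    ((t m u).hom ⊵ᵣ v) ≫ (t (m ⊙ᵣ u) v).hom ≫ functor.map (αᵣ m u v).inv
  t_unit (m : M) : (t m (𝟙_ B)).hom ≫ functor.map (ρᵣ[B] m).hom = (ρᵣ[B] (functor.obj m)).hom
  hexagon (x : C) (m : M) (u : B) :
    (t (x ⊙ₗ m) u).hom ≫ functor.map (BimoduleCategory.mid x m u).hom ≫ (s x (m ⊙ᵣ u)).hom =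
      ((s x m).hom ⊵ᵣ u) ≫ (BimoduleCategory.mid x (functor.obj m) u).hom ≫
        (x ⊴ₗ (t m u).hom)

attribute [instance] BimodEnd.additive BimodEnd.linear BimodEnd.rightExact

namespace BimodEnd

variable {C : Type u₁} [Category.{v₁} C] [MonoidalCategory C]
  {B : Type u₂} [Category.{v₂} B] [MonoidalCategory B] {M : Type u₃} [Category.{v₃} M]
  [Preadditive M] [Linear ℂ M] [MonoidalLeftAction C M] [MonoidalRightAction B M]
  [BimoduleCategory C B M]

/-- Bimodule natural transformations. -/
@[ext]
structure Hom (F G : BimodEnd C B M) where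
  nat : F.functor ⟶ G.functor
  s_comm (x : C) (m : M) :
    nat.app (x ⊙ₗ m) ≫ (G.s x m).hom = (F.s x m).hom ≫ (x ⊴ₗ nat.app m)
  t_comm (m : M) (u : B) :
    (nat.app m ⊵ᵣ u) ≫ (G.t m u).hom = (F.t m u).hom ≫ nat.app (m ⊙ᵣ u)

instance : Category (BimodEnd C B M) where
  Hom := Hom
  id F := ⟨𝟙 _, by simp, by simp⟩
  comp f g := ⟨f.nat ≫ g.nat,
    fun x m => by
      simp only [NatTrans.comp_app, Category.assoc, g.s_comm, MonoidalLeftAction.actionHomRight_comp]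
      rw [← Category.assoc, f.s_comm, Category.assoc],
    fun m u => by
      simp only [NatTrans.comp_app, Category.assoc, g.t_comm, MonoidalRightAction.comp_actionHomLeft]
      rw [← Category.assoc, f.t_comm, Category.assoc]⟩

@[ext] theorem hom_ext {F G : BimodEnd C B M} {f g : F ⟶ G} (h : ∀ m, f.nat.app m = g.nat.app m) :
    f = g := Hom.ext (NatTrans.ext (funext h))
@[simp] theorem id_nat_app (F : BimodEnd C B M) (m : M) :
    (Hom.nat (𝟙 F)).app m = 𝟙 (F.functor.obj m) := rfl
@[simp] theorem comp_nat_app {F G K : BimodEnd C B M} (f : F ⟶ G) (g : G ⟶ K) (m : M) :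
    (Hom.nat (f ≫ g)).app m = f.nat.app m ≫ g.nat.app m := rfl

variable (C B M) in
/-- The functor that forgets the coherence isomorphisms. -/
@[simps] def forget : BimodEnd C B M ⥤ (M ⥤ M) where
  obj F := F.functor
  map f := f.nat

/-- A natural isomorphism of functors that is a bimodule natural transformation. -/
@[simps] def isoMk {F G : BimodEnd C B M} (e : F.functor ≅ G.functor)
    (hs : ∀ x m, e.hom.app (x ⊙ₗ m) ≫ (G.s x m).hom = (F.s x m).hom ≫ (x ⊴ₗ e.hom.app m))
    (ht : ∀ m u, (e.hom.app m ⊵ᵣ u) ≫ (G.t m u).hom = (F.t m u).hom ≫ e.hom.app (m ⊙ᵣ u)) :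
    F ≅ G where
  hom := ⟨e.hom, hs, ht⟩
  inv := ⟨e.inv, fun x m => by
      rw [← cancel_epi (e.hom.app (x ⊙ₗ m)), Iso.hom_inv_id_app_assoc, ← Category.assoc, hs,
        Category.assoc, ← MonoidalLeftAction.actionHomRight_comp, Iso.hom_inv_id_app, MonoidalLeftAction.actionHomRight_id,
        Category.comp_id],
    fun m u => by
      rw [← cancel_epi (e.hom.app m ⊵ᵣ u), ← Category.assoc, ← MonoidalRightAction.comp_actionHomLeft,
        Iso.hom_inv_id_app, MonoidalRightAction.id_actionHomLeft, Category.id_comp, ← Category.assoc, ht,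
        Category.assoc, Iso.hom_inv_id_app, Category.comp_id]⟩

variable (C B M) in
/-- The identity functor. -/
@[simps] def one : BimodEnd C B M where
  functor := 𝟭 M
  s _ _ := Iso.refl _
  s_naturality := by simp
  s_tensor := by simp
  s_unit := by simp
  t _ _ := Iso.refl _
  t_naturality := by simp
  t_tensor := by simp
  t_unit := by simp
  hexagon := by simp

/-- The composite functor `m ↦ F(G(m))`. -/
@[simps] def comp (F G : BimodEnd C B M) : BimodEnd C B M where
  functor := G.functor ⋙ F.functor
  rightExact := comp_preservesFiniteColimits _ _
  s x m := F.functor.mapIso (G.s x m) ≪≫ F.s x (G.functor.obj m)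
  s_naturality f α := by
    simp only [Functor.comp_map, Iso.trans_hom, Functor.mapIso_hom, Category.assoc]
    rw [← F.s_naturality, ← Functor.map_comp_assoc, G.s_naturality, Functor.map_comp_assoc]
  s_tensor x y m := by
    have h := F.s_naturality (𝟙 x) (G.s y m).hom
    simp only [MonoidalLeftAction.id_actionHom] at h
    simp only [Functor.comp_obj, Functor.comp_map, Iso.trans_hom, Functor.mapIso_hom,
      Category.assoc, F.s_tensor, MonoidalLeftAction.actionHomRight_comp]
    rw [← Functor.map_comp_assoc, G.s_tensor, Functor.map_comp_assoc, Functor.map_comp_assoc,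
      reassoc_of% h]
  s_unit m := by
    simp only [Functor.comp_obj, Functor.comp_map, Iso.trans_hom, Functor.mapIso_hom,
      Category.assoc, F.s_unit, ← G.s_unit, Functor.map_comp]
  t m u := F.t (G.functor.obj m) u ≪≫ F.functor.mapIso (G.t m u)
  t_naturality α f := by
    simp only [Functor.comp_map, Iso.trans_hom, Functor.mapIso_hom, Category.assoc]
    rw [← Functor.map_comp, ← G.t_naturality, ← Category.assoc, F.t_naturality, Category.assoc,
      ← Functor.map_comp]
  t_tensor m u v := by
    have h := F.t_naturality (G.t m u).hom (𝟙 v)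
    simp only [MonoidalRightAction.actionHom_id] at h
    simp only [Functor.comp_obj, Functor.comp_map, Iso.trans_hom, Functor.mapIso_hom,
      Category.assoc, MonoidalRightAction.comp_actionHomLeft]
    rw [← Category.assoc, F.t_tensor, Category.assoc, Category.assoc, ← Functor.map_comp,
      G.t_tensor, Functor.map_comp, Functor.map_comp, reassoc_of% h]
  t_unit m := by
    simp only [Functor.comp_obj, Functor.comp_map, Iso.trans_hom, Functor.mapIso_hom,
      Category.assoc]
    rw [← Functor.map_comp, G.t_unit, F.t_unit]
  hexagon x m u := by
    have h1 := F.t_naturality (G.s x m).hom (𝟙 u)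
    have h2 := F.s_naturality (𝟙 x) (G.t m u).hom
    simp only [MonoidalRightAction.actionHom_id] at h1
    simp only [MonoidalLeftAction.id_actionHom] at h2
    simp only [Functor.comp_obj, Functor.comp_map, Iso.trans_hom, Functor.mapIso_hom,
      Category.assoc, MonoidalRightAction.comp_actionHomLeft, MonoidalLeftAction.actionHomRight_comp]
    rw [← Functor.map_comp_assoc, ← Functor.map_comp_assoc, Category.assoc, G.hexagon,
      Functor.map_comp_assoc, Functor.map_comp_assoc, ← reassoc_of% h1, h2,
      ← Category.assoc (F.functor.map (BimoduleCategory.mid x (G.functor.obj m) u).hom),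
      ← Category.assoc (F.t _ u).hom, F.hexagon]
    simp only [Category.assoc]

instance : MonoidalCategoryStruct (BimodEnd C B M) where
  tensorObj F G := F.comp G
  tensorUnit := one C B M
  whiskerLeft F G G' f := ⟨Functor.whiskerRight f.nat F.functor,
    fun x m => by
      change F.functor.map (f.nat.app (x ⊙ₗ m)) ≫
          F.functor.map (G'.s x m).hom ≫ (F.s x (G'.functor.obj m)).hom =
        (F.functor.map (G.s x m).hom ≫ (F.s x (G.functor.obj m)).hom) ≫
          (x ⊴ₗ F.functor.map (f.nat.app m))
      have h := F.s_naturality (𝟙 x) (f.nat.app m)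
      simp only [MonoidalLeftAction.id_actionHom] at h
      rw [Category.assoc, ← h, ← Functor.map_comp_assoc, f.s_comm, Functor.map_comp_assoc],
    fun m u => by
      change (F.functor.map (f.nat.app m) ⊵ᵣ u) ≫
          (F.t (G'.functor.obj m) u).hom ≫ F.functor.map (G'.t m u).hom =
        ((F.t (G.functor.obj m) u).hom ≫ F.functor.map (G.t m u).hom) ≫
          F.functor.map (f.nat.app (m ⊙ᵣ u))
      have h := F.t_naturality (f.nat.app m) (𝟙 u)
      simp only [MonoidalRightAction.actionHom_id] at h
      rw [reassoc_of% h, Category.assoc, ← Functor.map_comp, ← Functor.map_comp, f.t_comm]⟩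
  whiskerRight {F F'} f G := ⟨Functor.whiskerLeft G.functor f.nat,
    fun x m => by
      change f.nat.app (G.functor.obj (x ⊙ₗ m)) ≫
          F'.functor.map (G.s x m).hom ≫ (F'.s x (G.functor.obj m)).hom =
        (F.functor.map (G.s x m).hom ≫ (F.s x (G.functor.obj m)).hom) ≫
          (x ⊴ₗ f.nat.app (G.functor.obj m))
      rw [← NatTrans.naturality_assoc, f.s_comm, Category.assoc],
    fun m u => by
      change (f.nat.app (G.functor.obj m) ⊵ᵣ u) ≫
          (F'.t (G.functor.obj m) u).hom ≫ F'.functor.map (G.t m u).hom =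
        ((F.t (G.functor.obj m) u).hom ≫ F.functor.map (G.t m u).hom) ≫
          f.nat.app (G.functor.obj (m ⊙ᵣ u))
      rw [← Category.assoc, f.t_comm, Category.assoc, Category.assoc, NatTrans.naturality]⟩
  associator F G K := isoMk (Iso.refl (K.functor ⋙ G.functor ⋙ F.functor))
    (fun x m => by
      change 𝟙 _ ≫ F.functor.map (G.functor.map (K.s x m).hom ≫ (G.s x (K.functor.obj m)).hom) ≫
          (F.s x (G.functor.obj (K.functor.obj m))).hom =
        (F.functor.map (G.functor.map (K.s x m).hom) ≫
          F.functor.map (G.s x (K.functor.obj m)).hom ≫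
          (F.s x (G.functor.obj (K.functor.obj m))).hom) ≫ (x ⊴ₗ 𝟙 _)
      simp)
    (fun m u => by
      change (𝟙 _ ⊵ᵣ u) ≫ (F.t (G.functor.obj (K.functor.obj m)) u).hom ≫
          F.functor.map ((G.t (K.functor.obj m) u).hom ≫ G.functor.map (K.t m u).hom) =
        (((F.t (G.functor.obj (K.functor.obj m)) u).hom ≫
          F.functor.map (G.t (K.functor.obj m) u).hom) ≫
          F.functor.map (G.functor.map (K.t m u).hom)) ≫ 𝟙 _
      simp)
  leftUnitor F := isoMk (Iso.refl F.functor)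
    (fun x m => by
      change 𝟙 _ ≫ (F.s x m).hom = ((F.s x m).hom ≫ 𝟙 _) ≫ (x ⊴ₗ 𝟙 _)
      simp)
    (fun m u => by
      change (𝟙 _ ⊵ᵣ u) ≫ (F.t m u).hom = (𝟙 _ ≫ (F.t m u).hom) ≫ 𝟙 _
      simp)
  rightUnitor F := isoMk (Iso.refl F.functor)
    (fun x m => by
      change 𝟙 _ ≫ (F.s x m).hom = (F.functor.map (𝟙 _) ≫ (F.s x m).hom) ≫ (x ⊴ₗ 𝟙 _)
      simp)
    (fun m u => by
      change (𝟙 _ ⊵ᵣ u) ≫ (F.t m u).hom = ((F.t m u).hom ≫ F.functor.map (𝟙 _)) ≫ 𝟙 _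
      simp)

section

variable {F F' G G' K : BimodEnd C B M} (m : M)

@[simp] theorem tensor_obj : (F ⊗ G).functor.obj m = F.functor.obj (G.functor.obj m) := rfl
@[simp] theorem tensor_map {m n : M} (α : m ⟶ n) :
    (F ⊗ G).functor.map α = F.functor.map (G.functor.map α) := rfl
@[simp] theorem unit_obj : (𝟙_ (BimodEnd C B M)).functor.obj m = m := rfl
@[simp] theorem unit_map {m n : M} (α : m ⟶ n) :
    (𝟙_ (BimodEnd C B M)).functor.map α = α := rfl
@[simp] theorem whiskerLeft_app (f : G ⟶ G') :
    (F ◁ f).nat.app m = F.functor.map (f.nat.app m) := rfl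
@[simp] theorem whiskerRight_app (f : F ⟶ F') :
    (f ▷ G).nat.app m = f.nat.app (G.functor.obj m) := rfl
@[simp] theorem tensorHom_app (f : F ⟶ F') (g : G ⟶ G') :
    (f ⊗ₘ g).nat.app m = f.nat.app (G.functor.obj m) ≫ F'.functor.map (g.nat.app m) := rfl
@[simp] theorem associator_hom_app : (α_ F G K).hom.nat.app m = 𝟙 _ := rfl
@[simp] theorem leftUnitor_hom_app : (λ_ F).hom.nat.app m = 𝟙 _ := rfl
@[simp] theorem rightUnitor_hom_app : (ρ_ F).hom.nat.app m = 𝟙 _ := rfl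

end

/-- The monoidal structure of `End(M)` is the composition of functors. -/
instance : MonoidalCategory (BimodEnd C B M) where
  tensorHom_def f g := by ext m; rfl
  id_tensorHom_id F G := by ext m; simp
  tensorHom_comp_tensorHom f g f' g' := by ext m; simp
  whiskerLeft_id F G := by ext m; simp
  id_whiskerRight F G := by ext m; simp
  associator_naturality f g h := by ext m; simp
  leftUnitor_naturality f := by ext m; simp
  rightUnitor_naturality f := by ext m; simp
  pentagon F G K L := by ext m; simp
  triangle F G := by ext m; simp

end BimodEnd

end BimodEnd

section Realization

universe v v₁ v₂ v₃ u u₁ u₂ u₃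

/-- The category of finite-dimensional complex vector spaces. -/
abbrev Vect : Type 1 := FGModuleCat.{0} ℂ

/-- `Φ : A ⥤ End(M)` is compatible with the pivotal structures, where the pivotal structure
`ω^F : F^{ll} ⇒ F` of `End(M)` is the one determined by the bimodule trace through
`tr(β ∘ ε^F_m ∘ F^l(α)) = tr(ε^{F^l}_n ∘ F^{ll}(β) ∘ (ω^F_m)⁻¹ ∘ α)`. The functor `Φ` transports
the duals of `A` to duals in `End(M)`, so that it is pivotal iff `Φ(ω_a)` satisfies this identity
for `F = Φ(a)`, `F^l = Φ(aᘁ)` and `F^{ll} = Φ(aᘁᘁ)`. -/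
def IsPivotalFunctor {A : Type u} [Category.{v} A] [MonoidalCategory A] [RightRigidCategory A]
    {C : Type u₁} [Category.{v₁} C] [MonoidalCategory C] [RightRigidCategory C]
    {B : Type u₂} [Category.{v₂} B] [MonoidalCategory B] [RightRigidCategory B]
    {M : Type u₃} [Category.{v₃} M] [Preadditive M] [Linear ℂ M]
    [MonoidalLeftAction C M] [MonoidalRightAction B M] [BimoduleCategory C B M]
    (ωA : PivotalStructure A) {ωC : PivotalStructure C} {ωB : PivotalStructure B}
    (tr : BimoduleTrace M ωC ωB) (Φ : A ⥤ BimodEnd C B M) [Φ.Monoidal] : Prop :=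
  ∀ (a : A) (m n : M) (α : n ⟶ (Φ.obj a).functor.obj m) (β : m ⟶ (Φ.obj (aᘁ)).functor.obj n),
    tr.tr _ ((Φ.obj (aᘁ)).functor.map α ≫ (transportEv Φ a).nat.app m ≫ β) =
      tr.tr n (α ≫ (Φ.map (ωA.iso a).inv).nat.app m ≫ (Φ.obj ((aᘁ)ᘁ)).functor.map β ≫
        (transportEv Φ (aᘁ)).nat.app n)

/-- A pivotal tensor equivalence `C ≌ H-Mod`. Since the duals and the pivotal structure of `H-Mod`
are those of vector spaces, pivotality is expressed by the underlying fibre functor `F` : under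
the evaluation pairings, `F(ω_X) : F(Xᘁᘁ) → F(X)` is the canonical map `V** → V`. -/
structure PivotalTensorEquiv {C : Type u} [Category.{v} C] [Preadditive C] [Linear ℂ C]
    [MonoidalCategory C] [RightRigidCategory C] (ω : PivotalStructure C)
    (H : Type) [Ring H] [Bialgebra ℂ H] where
  functor : C ⥤ HMod H
  [monoidal : functor.Monoidal]
  [isEquivalence : functor.IsEquivalence]
  [additive : (functor ⋙ HMod.forget H).Additive]
  [linear : (functor ⋙ HMod.forget H).Linear ℂ]
  pivotal (X : C) :
    (β_ ((functor ⋙ HMod.forget H).obj ((Xᘁ)ᘁ)) ((functor ⋙ HMod.forget H).obj (Xᘁ))).hom ≫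
      ((functor ⋙ HMod.forget H).obj (Xᘁ) ◁ (functor ⋙ HMod.forget H).map (ω.iso X).hom) ≫
        transportEv (functor ⋙ HMod.forget H) X =
      transportEv (functor ⋙ HMod.forget H) (Xᘁ)

attribute [instance] PivotalTensorEquiv.monoidal PivotalTensorEquiv.isEquivalence
  PivotalTensorEquiv.additive PivotalTensorEquiv.linear

namespace PivotalTensorEquiv

variable {C : Type u} [Category.{v} C] [Preadditive C] [Linear ℂ C] [MonoidalCategory C]
  [RightRigidCategory C] {ω : PivotalStructure C} {H : Type} [Ring H] [Bialgebra ℂ H]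
  (E : PivotalTensorEquiv ω H)

/-- The underlying fibre functor. -/
abbrev fib : C ⥤ Vect := E.functor ⋙ HMod.forget H

/-- The action of `H` on the image of an object. -/
def act (X : C) : H →ₗ[ℂ] Module.End ℂ (E.fib.obj X) := (E.functor.obj X).ρ.toLinearMap

end PivotalTensorEquiv

/-- The action of an element `x = x₁ ⊗ x₂` of `R ⊗ S` on `V ⊗ W`, by `v ⊗ w ↦ x₁ v ⊗ x₂ w`. -/
def tensorAct {R S : Type} [AddCommGroup R] [Module ℂ R] [AddCommGroup S] [Module ℂ S]
    {V W : Vect} (ρ : R →ₗ[ℂ] Module.End ℂ V) (ρ' : S →ₗ[ℂ] Module.End ℂ W) (x : R ⊗[ℂ] S) :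
    tensorObj V W ⟶ tensorObj V W :=
  ConcreteCategory.ofHom (C := Vect)
    (TensorProduct.homTensorHomMap (RingHom.id ℂ) V W V W (TensorProduct.map ρ ρ' x))

variable {𝒜 : Type u₁} [Category.{v₁} 𝒜] [Preadditive 𝒜] [Linear ℂ 𝒜] [MonoidalCategory 𝒜]
  [RightRigidCategory 𝒜]
  {ℬ : Type u₂} [Category.{v₂} ℬ] [Preadditive ℬ] [Linear ℂ ℬ] [MonoidalCategory ℬ]
  [RightRigidCategory ℬ]
  {𝒞 : Type u₃} [Category.{v₃} 𝒞] [Preadditive 𝒞] [Linear ℂ 𝒞] [MonoidalCategory 𝒞]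
  [RightRigidCategory 𝒞]

/-- A realization of the datum `(𝒜, ℬ, 𝒞, Vect, Φ)` by a Hopf triplet `(A, B, C)`: pivotal tensor
equivalences `𝒜 ≌ A^{*cop}-Mod`, `ℬ ≌ B^*-Mod`, `𝒞 ≌ C^{*op}-Mod` (with underlying vector spaces
`M_a`, `N_u`, `P_x`) and natural isomorphisms `x ▷ V ≅ P_x ⊗ V`, `V ◁ u ≅ N_u ⊗ V` and
`Φ(a)(V) ≅ M_a ⊗ V` that identify
* the coherence isomorphisms of the two actions and of `Φ` with those of `Vect`,
* the bimodule coherence isomorphism with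
  `q : N ⊗ P ⊗ V → P ⊗ N ⊗ V`, `n ⊗ p ⊗ v ↦ τ_{BC(2)} p ⊗ τ_{BC(1)} n ⊗ v`,
* the bimodule functor structures of `Φ(a)` with
  `s : M ⊗ P ⊗ V → P ⊗ M ⊗ V`, `m ⊗ p ⊗ v ↦ τ⁻¹_{CA(1)} p ⊗ τ⁻¹_{CA(2)} m ⊗ v` and
  `t : N ⊗ M ⊗ V → M ⊗ N ⊗ V`, `n ⊗ m ⊗ v ↦ τ_{AB(1)} m ⊗ τ_{AB(2)} n ⊗ v`. -/
structure HopfTriplet.Realization (T : HopfTriplet) (ωA : PivotalStructure 𝒜)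
    (ωB : PivotalStructure ℬ) (ωC : PivotalStructure 𝒞)
    [MonoidalLeftAction 𝒞 Vect] [MonoidalRightAction ℬ Vect] [BimoduleCategory 𝒞 ℬ Vect]
    (Φ : 𝒜 ⥤ BimodEnd 𝒞 ℬ Vect) [Φ.Monoidal] where
  EA : PivotalTensorEquiv ωA (Cop (HDual T.A))
  EB : PivotalTensorEquiv ωB (HDual T.B)
  EC : PivotalTensorEquiv ωC (HDual T.C)ᵐᵒᵖ
  κ (x : 𝒞) (V : Vect) : x ⊙ₗ V ≅ tensorObj (EC.fib.obj x) V
  κ_naturality {x y : 𝒞} {V W : Vect} (f : x ⟶ y) (α : V ⟶ W) :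
    (f ⊙ₗₘ α) ≫ (κ y W).hom = (κ x V).hom ≫ (EC.fib.map f ⊗ₘ α)
  κ_tensor (x y : 𝒞) (V : Vect) :
    (αₗ x y V).hom ≫ (κ x (y ⊙ₗ V)).hom ≫ (EC.fib.obj x ◁ (κ y V).hom) ≫ (α_ _ _ _).inv ≫
      (Functor.LaxMonoidal.μ EC.fib x y ▷ V) = (κ (x ⊗ y) V).hom
  κ_unit (V : Vect) :
    (κ (𝟙_ 𝒞) V).hom = (λₗ[𝒞] V).hom ≫ (λ_ V).inv ≫ (Functor.LaxMonoidal.ε EC.fib ▷ V)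
  κr (V : Vect) (u : ℬ) : V ⊙ᵣ u ≅ tensorObj (EB.fib.obj u) V
  κr_naturality {u v : ℬ} {V W : Vect} (α : V ⟶ W) (f : u ⟶ v) :
    (α ⊙ᵣₘ f) ≫ (κr W v).hom = (κr V u).hom ≫ (EB.fib.map f ⊗ₘ α)
  κr_tensor (V : Vect) (u v : ℬ) :
    (αᵣ V u v).hom ≫ (κr (V ⊙ᵣ u) v).hom ≫ (EB.fib.obj v ◁ (κr V u).hom) ≫ (α_ _ _ _).inv ≫
      ((β_ (EB.fib.obj v) (EB.fib.obj u)).hom ▷ V) ≫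
      (Functor.LaxMonoidal.μ EB.fib u v ▷ V) = (κr V (u ⊗ v)).hom
  κr_unit (V : Vect) :
    (κr V (𝟙_ ℬ)).hom = (ρᵣ[ℬ] V).hom ≫ (λ_ V).inv ≫ (Functor.LaxMonoidal.ε EB.fib ▷ V)
  θ (a : 𝒜) (V : Vect) : (Φ.obj a).functor.obj V ≅ tensorObj (EA.fib.obj a) V
  θ_naturality_left {a b : 𝒜} (f : a ⟶ b) (V : Vect) :
    (Φ.map f).nat.app V ≫ (θ b V).hom = (θ a V).hom ≫ (EA.fib.map f ▷ V)
  θ_naturality_right (a : 𝒜) {V W : Vect} (α : V ⟶ W) :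
    (Φ.obj a).functor.map α ≫ (θ a W).hom = (θ a V).hom ≫ (EA.fib.obj a ◁ α)
  θ_tensor (a b : 𝒜) (V : Vect) :
    (Functor.LaxMonoidal.μ Φ a b).nat.app V ≫ (θ (a ⊗ b) V).hom =
      (θ a ((Φ.obj b).functor.obj V)).hom ≫ (EA.fib.obj a ◁ (θ b V).hom) ≫ (α_ _ _ _).inv ≫
        (Functor.LaxMonoidal.μ EA.fib a b ▷ V)
  θ_unit (V : Vect) : (Functor.LaxMonoidal.ε Φ).nat.app V ≫ (θ (𝟙_ 𝒜) V).hom =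
    (λ_ V).inv ≫ (Functor.LaxMonoidal.ε EA.fib ▷ V)
  q_eq (x : 𝒞) (V : Vect) (u : ℬ) :
    (BimoduleCategory.mid x V u).hom ≫ (κ x (V ⊙ᵣ u)).hom ≫ (EC.fib.obj x ◁ (κr V u).hom) =
      (κr (x ⊙ₗ V) u).hom ≫ (EB.fib.obj u ◁ (κ x V).hom) ≫ (α_ _ _ _).inv ≫
        ((tensorAct (EB.act u) (EC.act x ∘ₗ (MulOpposite.opLinearEquiv ℂ).toLinearMap)
            (pairingElt T.τBC) ≫ (β_ (EB.fib.obj u) (EC.fib.obj x)).hom) ▷ V) ≫ (α_ _ _ _).hom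
  s_eq (a : 𝒜) (x : 𝒞) (V : Vect) :
    ((Φ.obj a).s x V).hom ≫ (κ x ((Φ.obj a).functor.obj V)).hom ≫
        (EC.fib.obj x ◁ (θ a V).hom) =
      (θ a (x ⊙ₗ V)).hom ≫ (EA.fib.obj a ◁ (κ x V).hom) ≫ (α_ _ _ _).inv ≫
        (((β_ (EA.fib.obj a) (EC.fib.obj x)).hom ≫
          tensorAct (EC.act x ∘ₗ (MulOpposite.opLinearEquiv ℂ).toLinearMap)
            (EA.act a ∘ₗ (Cop.algEquiv (HDual T.A)).symm.toLinearMap)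
            (pairingElt (convInv T.τCA))) ▷ V) ≫ (α_ _ _ _).hom
  t_eq (a : 𝒜) (V : Vect) (u : ℬ) :
    ((Φ.obj a).t V u).hom ≫ (θ a (V ⊙ᵣ u)).hom ≫ (EA.fib.obj a ◁ (κr V u).hom) =
      (κr ((Φ.obj a).functor.obj V) u).hom ≫ (EB.fib.obj u ◁ (θ a V).hom) ≫ (α_ _ _ _).inv ≫
        (((β_ (EB.fib.obj u) (EA.fib.obj a)).hom ≫
          tensorAct (EA.act a ∘ₗ (Cop.algEquiv (HDual T.A)).symm.toLinearMap) (EB.act u)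
            (pairingElt T.τAB)) ▷ V) ≫ (α_ _ _ _).hom

end Realization

end HopfTrip

end

universe v₁ v₂ v₃ u₁ u₂ u₃

/-!
Every linear endofunctor `G` of the category of finite-dimensional vector spaces is `V ↦ G(ℂ) ⊗ V`
(`dotEquiv`). Evaluating the two actions and `Φ` at `V = ℂ` therefore loses nothing, and yields
tensor functors to `Vect`, namely `a ↦ Φ(a)(ℂ)`, `x ↦ x ▷ ℂ` and, up to a flip of the tensor
factors, `u ↦ ℂ ◁ u`.

*Reconstruction.* The natural endomorphisms of a fibre functor of a fusion category form a
finite-dimensional Hopf algebra (`Tan`), and the category is equivalent to its category of modules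
(`Tan.lift_isEquivalence`). The bimodule trace, together with the pivotality of `Φ`, says that the
pairing of `F(X)` and `F(Xᘁ)` is compatible with the identification of the double duals
(`evPair_left_pivotal`, `evPair_right_pivotal`, `evPair_functor_pivotal`). Hence the equivalence is
pivotal for the standard structure of the module category (`Tan.pivotalEquiv`) and the antipode is
involutive (`Tan.antipode_antipode`). An involutive antipode makes the opposite and co-opposite of
the Hopf algebra into Hopf algebras with the same antipode, and makes its dual semisimple: the
character of the regular representation is an integral of the dual on which the counit does not
vanish (`HDual.isSemisimpleRing`).

*Crossings.* At `V = ℂ` the isomorphisms `q`, `s` and `t` become natural families of isomorphisms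
`F X ⊗ G Y ≅ G Y ⊗ F X` for two of the three fibre functors. Such a crossing is the flip followed by
the action of an element of the tensor product of the two Hopf algebras (`Crossing.exists_isRepr`).
The two pentagon axioms for `q`, and the axioms for the structure isomorphisms of `Φ(a)` and of `Φ`,
express the coproducts of the two legs of this element as products of its copies
(`IsRepr.comul_fst_of_left`, `IsRepr.comul_fst_of_right`, `IsRepr.comul_snd`), which says that it is
a skew pairing of the dual Hopf algebras. The compatibility of `s` and `t` with `q` is a hexagon of
three crossings and becomes the Yang–Baxter identity for the three elements (`IsRepr.hexagon`).

*The triplet.* The Yang–Baxter identity is invariant under cyclic permutations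
(`YangBaxter.rotate`), and says that the form `τ_{AB}` intertwines the two orders of multiplication
of the images of `A^{op}` and `B^{cop}` in `C^*`, that is, that `φ_{ABC}` is multiplicative on the
generalised double (`YangBaxter.isDoubleHom`). Let `H_A`, `H_B`, `H_C` be the Hopf algebras of the
three fibre functors. Then `A = (H_A^{cop})^*`, `B = H_B^*`, `C = (H_C^{op})^*` form a Hopf triplet
(`CrossingElements.triplet`), and the reconstruction equivalences, together with `G(ℂ) ⊗ V ≅ G(V)`,
realize the given datum by it (`realization`).
-/

noncomputable section

namespace HopfTrip

/-! ### Hopf algebras: duals, opposites, semisimplicity -/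

section Opposites

variable {L : Type} [Ring L] [Bialgebra ℂ L]

/-- The components of the comultiplication of `L^{cop}`, in terms of those of `L`. -/
@[simps] def Cop.repr {x : L} {ι : Type*} (r : Coalgebra.Repr ℂ x ι) :
    Coalgebra.Repr ℂ ((Cop.algEquiv L).symm x) ι where
  index := r.index
  left i := (Cop.algEquiv L).symm (r.right i)
  right i := (Cop.algEquiv L).symm (r.left i)
  eq := (Cop.comul_eq_sum _ r).symm

/-- The components of the comultiplication of `L^{op}`, in terms of those of `L`. -/
@[simps] def opRepr {x : L} {ι : Type*} (r : Coalgebra.Repr ℂ x ι) :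
    Coalgebra.Repr ℂ (MulOpposite.op x) ι where
  index := r.index
  left i := MulOpposite.op (r.left i)
  right i := MulOpposite.op (r.right i)
  eq := by
    rw [MulOpposite.comul_def]
    simp only [LinearMap.comp_apply, LinearEquiv.coe_coe, MulOpposite.coe_opLinearEquiv_symm,
      MulOpposite.unop_op]
    rw [← r.eq]
    simp [map_sum]

end Opposites

section HopfDual

variable {L : Type} [Ring L] [HopfAlgebra ℂ L]

/-- `∑ S(x₂) x₁ = ε(x)`, obtained by applying `S` to the antipode identity. -/
theorem antipode_mul_reversed (hS : ∀ x : L, HopfAlgebra.antipode ℂ (HopfAlgebra.antipode ℂ x) = x)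
    (x : L) {ι : Type*} (r : Coalgebra.Repr ℂ x ι) :
    ∑ i ∈ r.index, HopfAlgebra.antipode ℂ (r.right i) * r.left i =
      algebraMap ℂ L (Coalgebra.counit (R := ℂ) x) := by
  have h := congrArg (HopfAlgebra.antipode ℂ) (HopfAlgebra.sum_antipode_mul_eq_algebraMap_counit r)
  simpa [map_sum, HopfAlgebra.antipode_mul_antidistrib, hS, Algebra.algebraMap_eq_smul_one] using h

/-- `∑ x₂ S(x₁) = ε(x)`, obtained by applying `S` to the antipode identity. -/
theorem mul_antipode_reversed (hS : ∀ x : L, HopfAlgebra.antipode ℂ (HopfAlgebra.antipode ℂ x) = x)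
    (x : L) {ι : Type*} (r : Coalgebra.Repr ℂ x ι) :
    ∑ i ∈ r.index, r.right i * HopfAlgebra.antipode ℂ (r.left i) =
      algebraMap ℂ L (Coalgebra.counit (R := ℂ) x) := by
  have h := congrArg (HopfAlgebra.antipode ℂ) (HopfAlgebra.sum_mul_antipode_eq_algebraMap_counit r)
  simpa [map_sum, HopfAlgebra.antipode_mul_antidistrib, hS, Algebra.algebraMap_eq_smul_one] using h

/-- The dual of a finite-dimensional Hopf algebra, with antipode `f ↦ f ∘ S`. -/
instance HDual.instHopfAlgebra [Module.Finite ℂ L] : HopfAlgebra ℂ (HDual L) where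
  antipode := (WithConv.linearEquiv ℂ (L →ₗ[ℂ] ℂ)).symm.toLinearMap ∘ₗ
    (HopfAlgebra.antipode ℂ (A := L)).dualMap ∘ₗ (WithConv.linearEquiv ℂ (L →ₗ[ℂ] ℂ)).toLinearMap
  mul_antipode_rTensor_comul := by
    ext f x
    let r := Coalgebra.Repr.arbitrary ℂ f
    let s := Coalgebra.Repr.arbitrary ℂ x
    simp only [LinearMap.comp_apply]
    rw [← r.eq]
    simp only [map_sum, LinearMap.rTensor_tmul, LinearMap.mul'_apply, HDual.counit_apply]
    have h : ∀ i, (((WithConv.linearEquiv ℂ (L →ₗ[ℂ] ℂ)).symm.toLinearMap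
        ((HopfAlgebra.antipode ℂ (A := L)).dualMap ((WithConv.linearEquiv ℂ (L →ₗ[ℂ] ℂ)).toLinearMap
          (r.left i))) * r.right i : HDual L) x) = ∑ j ∈ s.index,
          r.left i (HopfAlgebra.antipode ℂ (s.left j)) * r.right i (s.right j) := fun i => by
      rw [s.convMul_apply]; rfl
    have h2 := congrArg f (HopfAlgebra.sum_antipode_mul_eq_algebraMap_counit s)
    simp only [LinearMap.sum_apply, WithConv.ofConv_sum, map_sum] at h2 ⊢
    refine (Finset.sum_congr rfl fun i _ => h i).trans ?_
    rw [Finset.sum_comm]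
    simp only [HDual.repr_apply]
    rw [h2, Algebra.algebraMap_eq_smul_one, map_smul]
    simp [mul_comm]
  mul_antipode_lTensor_comul := by
    ext f x
    let r := Coalgebra.Repr.arbitrary ℂ f
    let s := Coalgebra.Repr.arbitrary ℂ x
    simp only [LinearMap.comp_apply]
    rw [← r.eq]
    simp only [map_sum, LinearMap.lTensor_tmul, LinearMap.mul'_apply, HDual.counit_apply]
    have h : ∀ i, ((r.left i * ((WithConv.linearEquiv ℂ (L →ₗ[ℂ] ℂ)).symm.toLinearMap
        ((HopfAlgebra.antipode ℂ (A := L)).dualMap ((WithConv.linearEquiv ℂ (L →ₗ[ℂ] ℂ)).toLinearMap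
          (r.right i)))) : HDual L) x) = ∑ j ∈ s.index,
          r.left i (s.left j) * r.right i (HopfAlgebra.antipode ℂ (s.right j)) := fun i => by
      rw [s.convMul_apply]; rfl
    have h2 := congrArg f (HopfAlgebra.sum_mul_antipode_eq_algebraMap_counit s)
    simp only [LinearMap.sum_apply, WithConv.ofConv_sum, map_sum] at h2 ⊢
    refine (Finset.sum_congr rfl fun i _ => h i).trans ?_
    rw [Finset.sum_comm]
    simp only [HDual.repr_apply]
    rw [h2, Algebra.algebraMap_eq_smul_one, map_smul]
    simp [mul_comm]

/-- If `S² = id`, then `S` is also an antipode of `L^{cop}`. -/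
@[reducible] def Cop.hopfAlgebra
    (hS : ∀ x : L, HopfAlgebra.antipode ℂ (HopfAlgebra.antipode ℂ x) = x) :
    HopfAlgebra ℂ (Cop L) where
  antipode := (Cop.algEquiv L).symm.toLinearMap ∘ₗ HopfAlgebra.antipode ℂ ∘ₗ
    (Cop.algEquiv L).toLinearMap
  mul_antipode_rTensor_comul := by
    ext x
    have h := antipode_mul_reversed hS (Cop.algEquiv L x) (Coalgebra.Repr.arbitrary ℂ _)
    apply_fun (Cop.algEquiv L).symm at h
    simp only [LinearMap.comp_apply]
    rw [Cop.comul_eq_sum x (Coalgebra.Repr.arbitrary ℂ _)]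
    simpa [map_sum, Cop.counit_apply] using h
  mul_antipode_lTensor_comul := by
    ext x
    have h := mul_antipode_reversed hS (Cop.algEquiv L x) (Coalgebra.Repr.arbitrary ℂ _)
    apply_fun (Cop.algEquiv L).symm at h
    simp only [LinearMap.comp_apply]
    rw [Cop.comul_eq_sum x (Coalgebra.Repr.arbitrary ℂ _)]
    simpa [map_sum, Cop.counit_apply] using h

/-- If `S² = id`, then `S` is also an antipode of `L^{op}`. -/
@[reducible] def opHopfAlgebra
    (hS : ∀ x : L, HopfAlgebra.antipode ℂ (HopfAlgebra.antipode ℂ x) = x) :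
    HopfAlgebra ℂ Lᵐᵒᵖ where
  antipode := (MulOpposite.opLinearEquiv ℂ).toLinearMap ∘ₗ HopfAlgebra.antipode ℂ ∘ₗ
    (MulOpposite.opLinearEquiv ℂ).symm.toLinearMap
  mul_antipode_rTensor_comul := by
    refine LinearMap.ext (MulOpposite.rec' fun x => ?_)
    have h := mul_antipode_reversed hS x (Coalgebra.Repr.arbitrary ℂ x)
    apply_fun MulOpposite.op at h
    simp only [LinearMap.comp_apply]
    rw [← (opRepr (Coalgebra.Repr.arbitrary ℂ x)).eq]
    simpa [map_sum, MulOpposite.counit_def] using h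
  mul_antipode_lTensor_comul := by
    refine LinearMap.ext (MulOpposite.rec' fun x => ?_)
    have h := antipode_mul_reversed hS x (Coalgebra.Repr.arbitrary ℂ x)
    apply_fun MulOpposite.op at h
    simp only [LinearMap.comp_apply]
    rw [← (opRepr (Coalgebra.Repr.arbitrary ℂ x)).eq]
    simpa [map_sum, MulOpposite.counit_def] using h

/-- `∑ y₂ S(y₁) ⊗ y₃ = 1 ⊗ y`, valid when `S² = id`. -/
theorem sum_comul_mul_antipode
    (hS : ∀ x : L, HopfAlgebra.antipode ℂ (HopfAlgebra.antipode ℂ x) = x)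
    (y : L) {ι : Type*} (r : Coalgebra.Repr ℂ y ι) :
    ∑ i ∈ r.index, Coalgebra.comul (R := ℂ) (r.right i) *
      (HopfAlgebra.antipode ℂ (r.left i) ⊗ₜ[ℂ] 1) = 1 ⊗ₜ y := by
  let a₁ := fun i => Coalgebra.Repr.arbitrary ℂ (r.left i)
  let a₂ := fun i => Coalgebra.Repr.arbitrary ℂ (r.right i)
  have key := Coalgebra.sum_tmul_tmul_eq r a₁ a₂
  apply_fun TensorProduct.lift ((LinearMap.rTensorHom L).comp
    ((LinearMap.mul ℂ L).flip.comp (HopfAlgebra.antipode ℂ (A := L)))) at key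
  simp only [map_sum, TensorProduct.lift.tmul, LinearMap.comp_apply, LinearMap.coe_rTensorHom,
    LinearMap.rTensor_tmul, LinearMap.flip_apply, LinearMap.mul_apply'] at key
  have h2 : ∀ i, Coalgebra.comul (R := ℂ) (r.right i) *
      (HopfAlgebra.antipode ℂ (r.left i) ⊗ₜ[ℂ] 1) = ∑ j ∈ (a₂ i).index,
      ((a₂ i).left j * HopfAlgebra.antipode ℂ (r.left i)) ⊗ₜ[ℂ] (a₂ i).right j := fun i => by
    rw [← (a₂ i).eq, Finset.sum_mul]
    simp
  simp only [h2]
  rw [← key]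
  simp only [← TensorProduct.sum_tmul, mul_antipode_reversed hS _ (a₁ _),
    Algebra.algebraMap_eq_smul_one, TensorProduct.smul_tmul]
  rw [← TensorProduct.tmul_sum, Coalgebra.sum_counit_smul]

/-- `∑ y₁ S(y₂) ⊗ y₃ = 1 ⊗ y`. -/
theorem sum_mul_antipode_tmul (y : L) {ι : Type*} (r : Coalgebra.Repr ℂ y ι) {κ : ι → Type*}
    (a₂ : (i : ι) → Coalgebra.Repr ℂ (r.right i) (κ i)) :
    ∑ i ∈ r.index, ∑ j ∈ (a₂ i).index,
      (r.left i * HopfAlgebra.antipode ℂ ((a₂ i).left j)) ⊗ₜ[ℂ] (a₂ i).right j = 1 ⊗ₜ y := by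
  let a₁ := fun i => Coalgebra.Repr.arbitrary ℂ (r.left i)
  have key := Coalgebra.sum_tmul_tmul_eq r a₁ a₂
  apply_fun TensorProduct.lift ((LinearMap.rTensorHom L).comp
    ((LinearMap.mul ℂ L).compl₂ (HopfAlgebra.antipode ℂ (A := L)))) at key
  simp only [map_sum, TensorProduct.lift.tmul, LinearMap.comp_apply, LinearMap.coe_rTensorHom,
    LinearMap.rTensor_tmul, LinearMap.compl₂_apply, LinearMap.mul_apply'] at key
  rw [← key]
  simp only [← TensorProduct.sum_tmul, HopfAlgebra.sum_mul_antipode_eq_algebraMap_counit (a₁ _),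
    Algebra.algebraMap_eq_smul_one, TensorProduct.smul_tmul]
  rw [← TensorProduct.tmul_sum, Coalgebra.sum_counit_smul]

/-- The contraction `x ⊗ y ↦ f(y) x`. -/
def contract (f : L →ₗ[ℂ] ℂ) : L ⊗[ℂ] L →ₗ[ℂ] L :=
  (TensorProduct.rid ℂ L).toLinearMap ∘ₗ f.lTensor L

theorem contract_tmul (f : L →ₗ[ℂ] ℂ) (x y : L) : contract f (x ⊗ₜ y) = f y • x := by
  simp [contract]

/-- If `S² = id`, the character of the regular representation is an integral of the dual: the
contraction of `h₁ ⊗ Tr(h₂)` is `Tr(h)`. Since `1 ⊗ y = ∑ y₂ S(y₁) ⊗ y₃`, the left multiplication by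
`Δ(h)` is conjugate to that by `1 ⊗ h`, and a cyclic permutation turns the conjugating factors into
`∑ y₁ S(y₂) ⊗ y₃ = 1 ⊗ y`. -/
theorem contract_trace_comul [Module.Finite ℂ L]
    (hS : ∀ x : L, HopfAlgebra.antipode ℂ (HopfAlgebra.antipode ℂ x) = x) (h : L) :
    contract (LinearMap.trace ℂ L ∘ₗ LinearMap.mul ℂ L) (Coalgebra.comul (R := ℂ) h) =
      LinearMap.trace ℂ L (LinearMap.mul ℂ L h) • 1 := by
  let b := Module.finBasis ℂ L
  let D := fun k => contract (b.coord k) ∘ₗ Coalgebra.comul (R := ℂ) (A := L)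
  let r := fun k => Coalgebra.Repr.arbitrary ℂ (b k)
  have htr : ∀ x : L, LinearMap.trace ℂ L (LinearMap.mul ℂ L x) = ∑ k, b.coord k (x * b k) := by
    intro x
    rw [LinearMap.trace_eq_matrix_trace ℂ b, Matrix.trace]
    simp [LinearMap.toMatrix_apply]
  have h1 : contract (LinearMap.trace ℂ L ∘ₗ LinearMap.mul ℂ L) (Coalgebra.comul (R := ℂ) h) =
      ∑ k, contract (b.coord k) (Coalgebra.comul (R := ℂ) h * (1 ⊗ₜ b k)) := by
    rw [← (Coalgebra.Repr.arbitrary ℂ h).eq]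
    simp only [map_sum, contract_tmul, Finset.sum_mul, Algebra.TensorProduct.tmul_mul_tmul,
      mul_one, LinearMap.comp_apply, htr, Finset.sum_smul]
    exact Finset.sum_comm
  have hmul : ∀ k (t : L ⊗[ℂ] L) (x : L),
      contract (b.coord k) (t * (x ⊗ₜ 1)) = contract (b.coord k) t * x := by
    intro k t x
    induction t with
    | zero => simp
    | tmul u v => simp [contract_tmul]
    | add u v hu hv => simp only [add_mul, map_add, hu, hv]
  have h2 : ∀ k, contract (b.coord k) (Coalgebra.comul (R := ℂ) h * (1 ⊗ₜ b k)) =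
      ∑ i ∈ (r k).index, D k (h * (r k).right i) * HopfAlgebra.antipode ℂ ((r k).left i) := by
    intro k
    rw [← sum_comul_mul_antipode hS (b k) (r k), Finset.mul_sum, map_sum]
    refine Finset.sum_congr rfl fun i _ => ?_
    rw [← mul_assoc, ← Bialgebra.comul_mul, hmul]
    rfl
  let U := fun l => contract (b.coord l ∘ₗ LinearMap.mulLeft ℂ h) ∘ₗ
    (HopfAlgebra.antipode ℂ (A := L)).rTensor L ∘ₗ Coalgebra.comul (R := ℂ) (A := L)
  have hU : ∀ (l) (y : L) {ι : Type} (s : Coalgebra.Repr ℂ y ι), U l y =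
      ∑ i ∈ s.index, b.coord l (h * s.right i) • HopfAlgebra.antipode ℂ (s.left i) := by
    intro l y ι s
    simp only [U, LinearMap.comp_apply]
    rw [← s.eq]
    simp [map_sum, contract_tmul]
  have h3 : ∀ k, ∑ i ∈ (r k).index, D k (h * (r k).right i) * HopfAlgebra.antipode ℂ ((r k).left i)
      = ∑ l, D k (b l) * U l (b k) := by
    intro k
    simp only [hU _ _ (r k), Finset.mul_sum]
    rw [Finset.sum_comm]
    refine Finset.sum_congr rfl fun i _ => ?_
    conv_lhs => rw [← b.sum_repr (h * (r k).right i)]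
    simp [-Module.Basis.sum_repr, map_sum, Finset.sum_mul]
  have h4 : ∀ l, ∑ k, D k (b l) * U l (b k) = b.coord l (h * b l) • 1 := by
    intro l
    let s := fun i => Coalgebra.Repr.arbitrary ℂ ((r l).right i)
    have e1 : ∀ k, D k (b l) = ∑ i ∈ (r l).index, b.coord k ((r l).right i) • (r l).left i := by
      intro k
      simp only [D, LinearMap.comp_apply]
      rw [← (r l).eq]
      simp only [map_sum, contract_tmul]
    have e2 : ∀ y, ∑ k, b.coord k y • U l (b k) = U l y := by
      intro y
      conv_rhs => rw [← b.sum_repr y]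
      simp [-Module.Basis.sum_repr, map_sum]
    calc ∑ k, D k (b l) * U l (b k)
        = ∑ i ∈ (r l).index, (r l).left i * U l ((r l).right i) := by
          simp only [e1, Finset.sum_mul]
          rw [Finset.sum_comm]
          refine Finset.sum_congr rfl fun i _ => ?_
          rw [← e2 ((r l).right i), Finset.mul_sum]
          simp
      _ = contract (b.coord l ∘ₗ LinearMap.mulLeft ℂ h) (∑ i ∈ (r l).index, ∑ j ∈ (s i).index,
          ((r l).left i * HopfAlgebra.antipode ℂ ((s i).left j)) ⊗ₜ[ℂ] (s i).right j) := by
          simp only [hU _ _ (s _), map_sum, contract_tmul, Finset.mul_sum]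
          simp
      _ = _ := by rw [sum_mul_antipode_tmul]; simp [contract_tmul]
  rw [h1]
  simp only [h2, h3]
  rw [Finset.sum_comm]
  simp only [h4]
  rw [← Finset.sum_smul, ← htr]

end HopfDual

/-- Maschke's theorem: a Hopf algebra with a left integral `Λ` such that `ε(Λ) ≠ 0` is a semisimple
ring, because `∑ Λ₁ p(S(Λ₂) x)` makes a linear projection `p` onto a left ideal linear over the
Hopf algebra. -/
theorem isSemisimpleRing_of_integral {K : Type} [Ring K] [HopfAlgebra ℂ K] (Λ : K)
    (hΛ : ∀ h : K, h * Λ = Coalgebra.counit (R := ℂ) h • Λ)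
    (h0 : Coalgebra.counit (R := ℂ) Λ ≠ 0) : IsSemisimpleRing K := by
  let r := Coalgebra.Repr.arbitrary ℂ Λ
  let E : K ⊗[ℂ] K := (HopfAlgebra.antipode ℂ (A := K)).lTensor K (Coalgebra.comul (R := ℂ) Λ)
  have hE' : E = ∑ i ∈ r.index, r.left i ⊗ₜ HopfAlgebra.antipode ℂ (r.right i) := by
    simp only [E]
    rw [← r.eq]
    simp [map_sum]
  -- `E` is a Casimir element
  have hE : ∀ h : K, (h ⊗ₜ[ℂ] (1 : K)) * E = E * ((1 : K) ⊗ₜ[ℂ] h) := by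
    intro h
    let s := Coalgebra.Repr.arbitrary ℂ h
    let a₁ := fun i => Coalgebra.Repr.arbitrary ℂ (s.left i)
    let a₂ := fun i => Coalgebra.Repr.arbitrary ℂ (s.right i)
    have key := Coalgebra.sum_tmul_tmul_eq s a₁ a₂
    let W : K ⊗[ℂ] (K ⊗[ℂ] K) →ₗ[ℂ] K ⊗[ℂ] K := ∑ i ∈ r.index,
      TensorProduct.map (LinearMap.mulRight ℂ (r.left i))
        (LinearMap.mul' ℂ K ∘ₗ TensorProduct.map
          (LinearMap.mulLeft ℂ (HopfAlgebra.antipode ℂ (r.right i)) ∘ₗ HopfAlgebra.antipode ℂ)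
            LinearMap.id)
    have hW : ∀ x y z, W (x ⊗ₜ (y ⊗ₜ z)) =
        (HopfAlgebra.antipode ℂ (A := K)).lTensor K ((x ⊗ₜ y) * Coalgebra.comul (R := ℂ) Λ) *
          (1 ⊗ₜ z) := by
      intro x y z
      rw [← r.eq, Finset.mul_sum, map_sum, Finset.sum_mul]
      simp [W, LinearMap.sum_apply, HopfAlgebra.antipode_mul_antidistrib]
    apply_fun W at key
    simp only [map_sum, hW] at key
    have l1 : ∀ i, ∑ j ∈ (a₁ i).index, (HopfAlgebra.antipode ℂ (A := K)).lTensor K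
        (((a₁ i).left j ⊗ₜ (a₁ i).right j) * Coalgebra.comul (R := ℂ) Λ) * (1 ⊗ₜ s.right i) =
          E * (1 ⊗ₜ (Coalgebra.counit (R := ℂ) (s.left i) • s.right i)) := by
      intro i
      rw [← Finset.sum_mul, ← map_sum, ← Finset.sum_mul, (a₁ i).eq, ← Bialgebra.comul_mul, hΛ]
      simp [E, TensorProduct.tmul_smul]
    have l2 : ∀ i, ∑ j ∈ (a₂ i).index, (HopfAlgebra.antipode ℂ (A := K)).lTensor K
        ((s.left i ⊗ₜ (a₂ i).left j) * Coalgebra.comul (R := ℂ) Λ) * (1 ⊗ₜ (a₂ i).right j) =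
          ((Coalgebra.counit (R := ℂ) (s.right i) • s.left i) ⊗ₜ 1) * E := by
      intro i
      have : ∀ j, (HopfAlgebra.antipode ℂ (A := K)).lTensor K
        ((s.left i ⊗ₜ (a₂ i).left j) * Coalgebra.comul (R := ℂ) Λ) * (1 ⊗ₜ (a₂ i).right j) =
          ∑ k ∈ r.index, (s.left i * r.left k) ⊗ₜ (HopfAlgebra.antipode ℂ (r.right k) *
            (HopfAlgebra.antipode ℂ ((a₂ i).left j) * (a₂ i).right j)) := by
        intro j
        rw [← hW]
        simp [W, LinearMap.sum_apply, mul_assoc]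
      simp only [this]
      rw [Finset.sum_comm, hE', Finset.mul_sum]
      refine Finset.sum_congr rfl fun k _ => ?_
      rw [← TensorProduct.tmul_sum, ← Finset.mul_sum,
        HopfAlgebra.sum_antipode_mul_eq_algebraMap_counit (a₂ i)]
      simp [Algebra.algebraMap_eq_smul_one, TensorProduct.smul_tmul]
    simp only [l1, l2] at key
    rw [← Finset.mul_sum, ← Finset.sum_mul, ← TensorProduct.tmul_sum, ← TensorProduct.sum_tmul,
      Coalgebra.sum_counit_smul] at key
    have h5 := Coalgebra.sum_tmul_counit_eq s
    apply_fun TensorProduct.rid ℂ K at h5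
    simp only [map_sum, TensorProduct.rid_tmul, one_smul] at h5
    rw [h5] at key
    exact key.symm
  refine isSemisimpleModule_iff _ _ |>.mpr ⟨fun N => ?_⟩
  obtain ⟨p, hp⟩ := (N.restrictScalars ℂ).subtype.exists_leftInverse_of_injective
    (LinearMap.ker_eq_bot.mpr Subtype.val_injective)
  have hp' : ∀ x (hx : x ∈ N), (p x : K) = x := fun x hx => by
    have := LinearMap.congr_fun hp ⟨x, hx⟩
    exact congrArg Subtype.val this
  let P : K →ₗ[ℂ] K := (N.restrictScalars ℂ).subtype ∘ₗ p
  let A : K → K ⊗[ℂ] K →ₗ[ℂ] K := fun x => LinearMap.mul' ℂ K ∘ₗ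
    TensorProduct.map LinearMap.id (P ∘ₗ LinearMap.mulRight ℂ x)
  have hA1 : ∀ x h t, A x ((h ⊗ₜ 1) * t) = h * A x t := by
    intro x h t
    induction t with
    | zero => simp
    | tmul u v => simp [A, mul_assoc]
    | add u v hu hv => simp only [mul_add, map_add, hu, hv]
  have hA2 : ∀ x h t, A x (t * (1 ⊗ₜ h)) = A (h * x) t := by
    intro x h t
    induction t with
    | zero => simp
    | tmul u v => simp [A, mul_assoc]
    | add u v hu hv => simp only [add_mul, map_add, hu, hv]
  have hAE : ∀ x, A x E = ∑ i ∈ r.index, r.left i *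
      P (HopfAlgebra.antipode ℂ (r.right i) * x) := by
    intro x; rw [hE']; simp [A, map_sum]
  have hmem : ∀ x, A x E ∈ N := by
    intro x
    rw [hAE]
    exact N.sum_mem fun i _ => N.smul_mem _ (p _).2
  let π : K →ₗ[K] N :=
    { toFun := fun x => (Coalgebra.counit (R := ℂ) Λ)⁻¹ • ⟨A x E, hmem x⟩
      map_add' := fun x y => by
        rw [← smul_add]
        congr 1
        ext
        simp [hAE, mul_add, Finset.sum_add_distrib]
      map_smul' := fun h x => by
        have : (⟨A (h * x) E, hmem _⟩ : N) = h • ⟨A x E, hmem x⟩ := by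
          ext
          simp only [Submodule.coe_smul, smul_eq_mul]
          rw [← hA2, ← hE, hA1]
        simp only [smul_eq_mul, RingHom.id_apply, this]
        rw [smul_comm] }
  refine ⟨LinearMap.ker π, LinearMap.isCompl_of_proj (f := π) fun x => ?_⟩
  have : A x E = Coalgebra.counit (R := ℂ) Λ • (x : K) := by
    rw [hAE]
    have : ∀ i, r.left i * P (HopfAlgebra.antipode ℂ (r.right i) * x) =
        (r.left i * HopfAlgebra.antipode ℂ (r.right i)) * x := fun i => by
      rw [mul_assoc]; congr 1
      exact hp' _ (N.smul_mem _ x.2)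
    simp only [this]
    rw [← Finset.sum_mul, HopfAlgebra.sum_mul_antipode_eq_algebraMap_counit r]
    simp [Algebra.algebraMap_eq_smul_one]
  ext
  simp only [π, LinearMap.coe_mk, AddHom.coe_mk, this]
  change (Coalgebra.counit (R := ℂ) Λ)⁻¹ • (Coalgebra.counit (R := ℂ) Λ • (x : K)) = x
  rw [smul_smul, inv_mul_cancel₀ h0, one_smul]

/-- The dual of a finite-dimensional Hopf algebra with `S² = id` is semisimple. -/
theorem HDual.isSemisimpleRing {L : Type} [Ring L] [HopfAlgebra ℂ L] [Module.Finite ℂ L]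
    (hS : ∀ x : L, HopfAlgebra.antipode ℂ (HopfAlgebra.antipode ℂ x) = x) :
    IsSemisimpleRing (HDual L) := by
  rcases subsingleton_or_nontrivial L with hL | hL
  · have : Subsingleton (HDual L) := ⟨fun f g => by ext x; simp [Subsingleton.elim x 0]⟩
    infer_instance
  let Λ : HDual L := WithConv.toConv (LinearMap.trace ℂ L ∘ₗ LinearMap.mul ℂ L)
  refine isSemisimpleRing_of_integral Λ (fun f => ?_) ?_
  · ext x
    let r := Coalgebra.Repr.arbitrary ℂ x
    have h := congrArg f (contract_trace_comul hS x)
    rw [← r.eq] at h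
    rw [r.convMul_apply]
    simp only [map_sum, contract_tmul, map_smul] at h
    simpa [-LinearMap.mul_apply', Λ, mul_comm, HDual.counit_apply] using h
  · rw [HDual.counit_apply]
    change LinearMap.trace ℂ L (LinearMap.mul ℂ L 1) ≠ 0
    have : LinearMap.mul ℂ L 1 = LinearMap.id := by ext; simp
    rw [this, LinearMap.trace_id]
    exact_mod_cast Module.finrank_pos.ne'

/-! ### Skew pairings from elements of tensor products -/

section Forms

variable {L L' : Type} [Ring L] [Bialgebra ℂ L] [Module.Finite ℂ L]
  [Ring L'] [Bialgebra ℂ L'] [Module.Finite ℂ L']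

instance HDual.instFinite : Module.Finite ℂ (HDual L) :=
  Module.Finite.equiv (WithConv.linearEquiv ℂ (L →ₗ[ℂ] ℂ)).symm

/-- The evaluation isomorphism `L ≅ L^{**}`, `x ↦ (f ↦ f(x))`, of algebras. -/
def HDual.eval (L : Type) [Ring L] [Bialgebra ℂ L] [Module.Finite ℂ L] :
    L ≃ₐ[ℂ] HDual (HDual L) :=
  AlgEquiv.ofLinearEquiv
    (Module.evalEquiv ℂ L ≪≫ₗ (WithConv.linearEquiv ℂ (L →ₗ[ℂ] ℂ)).dualMap ≪≫ₗ
      (WithConv.linearEquiv ℂ (HDual L →ₗ[ℂ] ℂ)).symm)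
    (by ext f; simp [HDual.counit_apply])
    (fun x y => by
      ext f
      rw [(Coalgebra.Repr.arbitrary ℂ f).convMul_apply]
      exact (HDual.repr_apply (Coalgebra.Repr.arbitrary ℂ f) x y).symm)

theorem HDual.eval_apply (x : L) (f : HDual L) : HDual.eval L x f = f x := rfl

/-- The evaluation isomorphism is compatible with the comultiplications. -/
theorem HDual.comul_eval (x : L) {ι : Type*} (r : Coalgebra.Repr ℂ x ι) :
    Coalgebra.comul (R := ℂ) (HDual.eval L x) =
      ∑ i ∈ r.index, HDual.eval L (r.left i) ⊗ₜ HDual.eval L (r.right i) := by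
  apply HDual.tensor_ext
  intro f g
  rw [HDual.pairEquiv_comul, HDual.eval_apply, r.convMul_apply]
  simp [map_sum, HDual.eval_apply]

/-- The bilinear form `(f, g) ↦ (f ⊗ g)(R)` on `L^* × L'^*` given by an element `R` of `L ⊗ L'`. -/
def form : L ⊗[ℂ] L' →ₗ[ℂ] HDual L →ₗ[ℂ] HDual L' →ₗ[ℂ] ℂ :=
  TensorProduct.lift (LinearMap.mk₂ ℂ
    (fun x y => (LinearMap.mul ℂ ℂ).compl₁₂ (HDual.eval L x).ofConv (HDual.eval L' y).ofConv)
    (fun x x' y => by ext f g; simp [HDual.eval_apply])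
    (fun c x y => by ext f g; simp [HDual.eval_apply, mul_assoc])
    (fun x y y' => by ext f g; simp [HDual.eval_apply, mul_add])
    (fun c x y => by ext f g; simp [HDual.eval_apply]; ring))

@[simp] theorem form_tmul (x : L) (y : L') (f : HDual L) (g : HDual L') :
    form (x ⊗ₜ y) f g = f x * g y := rfl

theorem form_sum {ι : Type*} (s : Finset ι) (r : ι → L) (r' : ι → L') (f : HDual L)
    (g : HDual L') : form (∑ i ∈ s, r i ⊗ₜ r' i) f g = ∑ i ∈ s, f (r i) * g (r' i) := by
  simp [map_sum, LinearMap.sum_apply]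

/-- The tensor of the form of `R` is `R` itself, read in `L^{**} ⊗ L'^{**}`. -/
theorem pairingElt_form (R : L ⊗[ℂ] L') : pairingElt (form R) =
    TensorProduct.map (HDual.eval L).toLinearMap (HDual.eval L').toLinearMap R := by
  rw [pairingElt, LinearEquiv.symm_apply_eq]
  ext f g
  induction R with
  | zero => simp
  | tmul x y =>
    simp only [TensorProduct.AlgebraTensorModule.curry_apply, TensorProduct.curry_apply,
      LinearMap.restrictScalars_self, TensorProduct.lift.tmul, TensorProduct.map_tmul]
    rw [HDual.pairEquiv_tmul]
    rfl
  | add x y hx hy =>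
    simp only [map_add, LinearMap.add_apply] at hx hy ⊢
    simpa using congrArg₂ (· + ·) hx hy

/-- An element `R = ∑ rᵢ ⊗ r'ᵢ` of `L ⊗ L'` with `(Δ ⊗ 1)R = R₁₃R₂₃` and `(1 ⊗ Δ)R = R₁₃R₁₂` defines
a skew pairing of `L^*` and `L'^*`. -/
theorem isSkewPairing_form {ι : Type*} (s : Finset ι) (r : ι → L) (r' : ι → L')
    (h1 : ∑ i ∈ s, Coalgebra.comul (R := ℂ) (r i) ⊗ₜ[ℂ] r' i =
      ∑ i ∈ s, ∑ j ∈ s, (r i ⊗ₜ[ℂ] r j) ⊗ₜ[ℂ] (r' i * r' j))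
    (h2 : ∑ i ∈ s, r i ⊗ₜ[ℂ] Coalgebra.comul (R := ℂ) (r' i) =
      ∑ i ∈ s, ∑ j ∈ s, (r i * r j) ⊗ₜ[ℂ] (r' j ⊗ₜ[ℂ] r' i))
    (h3 : ∑ i ∈ s, Coalgebra.counit (R := ℂ) (r i) • r' i = 1)
    (h4 : ∑ i ∈ s, Coalgebra.counit (R := ℂ) (r' i) • r i = 1) :
    IsSkewPairing (form (∑ i ∈ s, r i ⊗ₜ r' i)) where
  mul_left f f' g := by
    let rg := Coalgebra.Repr.arbitrary ℂ g
    have h := congrArg (LinearMap.mul' ℂ ℂ ∘ₗ TensorProduct.map (LinearMap.mul' ℂ ℂ ∘ₗ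
      TensorProduct.map f.ofConv f'.ofConv) g.ofConv) h1
    simp only [LinearMap.comp_apply, map_sum, TensorProduct.map_tmul, LinearMap.mul'_apply] at h
    rw [form_sum]
    refine Eq.trans (Finset.sum_congr rfl fun i _ => ?_) (h.trans ?_)
    · rw [LinearMap.convMul_apply]
    · rw [← rg.eq]
      simp only [map_sum (TensorProduct.map _ _), map_sum (LinearMap.mul' ℂ ℂ),
        TensorProduct.map_tmul, LinearMap.mul'_apply, form_sum, Finset.sum_mul_sum]
      rw [Finset.sum_comm (s := rg.index)]
      refine Finset.sum_congr rfl fun i _ => ?_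
      rw [Finset.sum_comm (s := rg.index)]
      refine Finset.sum_congr rfl fun j _ => ?_
      rw [← HDual.repr_apply rg, Finset.mul_sum]
      refine Finset.sum_congr rfl fun k _ => by ring
  mul_right f g g' := by
    let rf := Coalgebra.Repr.arbitrary ℂ f
    have h := congrArg (LinearMap.mul' ℂ ℂ ∘ₗ TensorProduct.map f.ofConv (LinearMap.mul' ℂ ℂ ∘ₗ
      TensorProduct.map g.ofConv g'.ofConv)) h2
    simp only [LinearMap.comp_apply, map_sum, TensorProduct.map_tmul, LinearMap.mul'_apply] at h
    rw [form_sum]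
    refine Eq.trans (Finset.sum_congr rfl fun i _ => ?_) (h.trans ?_)
    · rw [LinearMap.convMul_apply]
    · rw [← rf.eq]
      simp only [map_sum (TensorProduct.map _ _), map_sum (LinearMap.mul' ℂ ℂ),
        TensorProduct.map_tmul, LinearMap.mul'_apply, LinearMap.flip_apply,
        form_sum, Finset.sum_mul_sum]
      rw [Finset.sum_comm (s := rf.index)]
      refine Finset.sum_congr rfl fun i _ => ?_
      rw [Finset.sum_comm (s := rf.index)]
      refine Finset.sum_congr rfl fun j _ => ?_
      rw [← HDual.repr_apply rf, Finset.sum_mul]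
      refine Finset.sum_congr rfl fun k _ => by ring
  one_right f := by
    have h := congrArg f h4
    rw [form_sum, HDual.counit_apply, ← h]
    simp [map_sum, mul_comm]
  one_left g := by
    have h := congrArg g h3
    rw [form_sum, HDual.counit_apply, ← h]
    simp [map_sum]

/-- The form of an element of `L ⊗ L'`, as an element of the convolution algebra. -/
def convForm : L ⊗[ℂ] L' →ₗ[ℂ] WithConv (HDual L ⊗[ℂ] HDual L' →ₗ[ℂ] ℂ) :=
  (WithConv.linearEquiv ℂ (HDual L ⊗[ℂ] HDual L' →ₗ[ℂ] ℂ)).symm.toLinearMap ∘ₗ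
    (TensorProduct.uncurry (.id ℂ) (HDual L) (HDual L') ℂ) ∘ₗ form

theorem convForm_apply (R : L ⊗[ℂ] L') :
    convForm R = WithConv.toConv (TensorProduct.lift (form R)) := rfl

/-- The convolution product of the forms of `R` and `R'` is the form of `R R'`. -/
theorem convForm_mul (R R' : L ⊗[ℂ] L') : convForm R * convForm R' = convForm (R * R') := by
  induction R with
  | zero => simp
  | add x y hx hy => simp only [add_mul, map_add, hx, hy]
  | tmul x y =>
    induction R' with
    | zero => simp
    | add a b ha hb => simp only [mul_add, map_add, ha, hb]
    | tmul x' y' =>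
      ext f g
      let rf := Coalgebra.Repr.arbitrary ℂ f
      let rg := Coalgebra.Repr.arbitrary ℂ g
      have h := (rf.tmul rg).convMul_apply (convForm (x ⊗ₜ y)) (convForm (x' ⊗ₜ y'))
      simp only [TensorProduct.AlgebraTensorModule.curry_apply, TensorProduct.curry_apply,
        LinearMap.restrictScalars_self]
      refine h.trans ?_
      simp only [Algebra.TensorProduct.tmul_mul_tmul, convForm_apply, TensorProduct.lift.tmul,
        form_tmul]
      rw [← HDual.repr_apply rf, ← HDual.repr_apply rg, Finset.sum_mul_sum,
        ← Finset.sum_product']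
      refine Finset.sum_congr rfl fun i _ => ?_
      simp [Coalgebra.Repr.tmul]
      ring

theorem convForm_one : convForm (1 : L ⊗[ℂ] L') = 1 := by
  ext f g
  simp [convForm_apply, Algebra.TensorProduct.one_def, HDual.counit_apply, LinearMap.convOne_def,
    mul_comm]

/-- The convolution inverse of the form of `R` is the form of `R⁻¹`. -/
theorem convInv_form {R R' : L ⊗[ℂ] L'} (h : R * R' = 1) (h' : R' * R = 1) :
    convInv (form R) = form R' := by
  let u : (WithConv (HDual L ⊗[ℂ] HDual L' →ₗ[ℂ] ℂ))ˣ :=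
    ⟨convForm R, convForm R', by rw [convForm_mul, h, convForm_one],
      by rw [convForm_mul, h', convForm_one]⟩
  have : Ring.inverse (WithConv.toConv (TensorProduct.lift (form R))) = (↑u⁻¹ : WithConv _) :=
    Ring.inverse_unit u
  rw [convInv, this]
  ext f g
  rfl

end Forms

/-! ### Hopf algebra maps out of generalised doubles -/

section Doubles

variable {A B C : Type} [Ring A] [Bialgebra ℂ A] [Ring B] [Bialgebra ℂ B] [Ring C] [Bialgebra ℂ C]

/-- The compatibility of the three pairings of a Hopf triplet,
`τ_{AB}(a₁, b₂) τ_{CA}(c₁, a₂) τ_{BC}(b₁, c₂) = τ_{BC}(b₂, c₁) τ_{CA}(c₂, a₁) τ_{AB}(a₂, b₁)`,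
which is invariant under cyclic permutations. -/
def YangBaxter (τAB : A →ₗ[ℂ] B →ₗ[ℂ] ℂ) (τBC : B →ₗ[ℂ] C →ₗ[ℂ] ℂ) (τCA : C →ₗ[ℂ] A →ₗ[ℂ] ℂ) :
    Prop :=
  ∀ (a : A) (b : B) (c : C),
    let ra := Coalgebra.Repr.arbitrary ℂ a
    let rb := Coalgebra.Repr.arbitrary ℂ b
    let rc := Coalgebra.Repr.arbitrary ℂ c
    ∑ i ∈ ra.index, ∑ j ∈ rb.index, ∑ k ∈ rc.index,
      τAB (ra.left i) (rb.right j) * τCA (rc.left k) (ra.right i) * τBC (rb.left j) (rc.right k) =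
    ∑ i ∈ ra.index, ∑ j ∈ rb.index, ∑ k ∈ rc.index,
      τBC (rb.right j) (rc.left k) * τCA (rc.right k) (ra.left i) * τAB (ra.right i) (rb.left j)

theorem YangBaxter.rotate {τAB : A →ₗ[ℂ] B →ₗ[ℂ] ℂ} {τBC : B →ₗ[ℂ] C →ₗ[ℂ] ℂ}
    {τCA : C →ₗ[ℂ] A →ₗ[ℂ] ℂ} (h : YangBaxter τAB τBC τCA) : YangBaxter τBC τCA τAB := by
  intro b c a
  have h := h a b c
  dsimp only at h ⊢
  have e : ∀ (x : A × A → B × B → C × C → ℂ) (s : Finset (A × A)) (t : Finset (B × B))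
      (u : Finset (C × C)), ∑ j ∈ t, ∑ k ∈ u, ∑ i ∈ s, x i j k =
        ∑ i ∈ s, ∑ j ∈ t, ∑ k ∈ u, x i j k := by
    intro x s t u
    rw [Finset.sum_comm (s := s)]
    exact Finset.sum_congr rfl fun j _ => Finset.sum_comm
  rw [e (fun i j k => _), e (fun i j k => _)]
  refine Eq.trans ?_ (h.trans ?_) <;>
  exact Finset.sum_congr rfl fun i _ => Finset.sum_congr rfl fun j _ =>
    Finset.sum_congr rfl fun k _ => by ring

/-- The map `p ↦ u(p₁) φ(p₂) v(p₃)` is a convolution product with the scalar-valued maps `u`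
and `v`. -/
theorem twist_eq {P D : Type} [AddCommGroup P] [Module ℂ P] [Coalgebra ℂ P] [Ring D] [Algebra ℂ D]
    (u v : WithConv (P →ₗ[ℂ] ℂ)) (φ : P →ₗ[ℂ] D) :
    φ ∘ₗ twist u.ofConv v.ofConv =
      (WithConv.toConv (Algebra.linearMap ℂ D ∘ₗ u.ofConv) * (WithConv.toConv φ *
        WithConv.toConv (Algebra.linearMap ℂ D ∘ₗ v.ofConv))).ofConv := by
  simp only [twist, LinearMap.convMul_def, WithConv.ofConv_toConv]
  have h1 : ∀ G : P →ₗ[ℂ] P, φ ∘ₗ (TensorProduct.lid ℂ P).toLinearMap ∘ₗ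
      TensorProduct.map u.ofConv G = LinearMap.mul' ℂ D ∘ₗ
        TensorProduct.map (Algebra.linearMap ℂ D ∘ₗ u.ofConv) (φ ∘ₗ G) := by
    intro G
    ext x y
    simp [Algebra.algebraMap_eq_smul_one]
  have h2 : φ ∘ₗ (TensorProduct.rid ℂ P).toLinearMap ∘ₗ v.ofConv.lTensor P = LinearMap.mul' ℂ D ∘ₗ
      TensorProduct.map φ (Algebra.linearMap ℂ D ∘ₗ v.ofConv) := by
    ext x y
    simp [Algebra.algebraMap_eq_smul_one]
  have h3 : φ ∘ₗ ((TensorProduct.rid ℂ P).toLinearMap ∘ₗ v.ofConv.lTensor P ∘ₗ Coalgebra.comul) =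
      LinearMap.mul' ℂ D ∘ₗ TensorProduct.map φ (Algebra.linearMap ℂ D ∘ₗ v.ofConv) ∘ₗ
        Coalgebra.comul := LinearMap.ext fun p => LinearMap.congr_fun h2 (Coalgebra.comul p)
  rw [← h3]
  exact LinearMap.ext fun p => LinearMap.congr_fun (h1 _) (Coalgebra.comul p)

/-- Convolution inverse functionals remain convolution inverse as maps to an algebra. -/
theorem scalar_conv_mul {P D : Type} [AddCommGroup P] [Module ℂ P] [Coalgebra ℂ P] [Ring D]
    [Algebra ℂ D] {u v : WithConv (P →ₗ[ℂ] ℂ)} (h : u * v = 1) :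
    WithConv.toConv (Algebra.linearMap ℂ D ∘ₗ u.ofConv) *
        WithConv.toConv (Algebra.linearMap ℂ D ∘ₗ v.ofConv) = 1 := by
  have := LinearMap.algHom_comp_convMul_distrib (Algebra.ofId ℂ D) u v
  rw [h] at this
  apply WithConv.ofConv_injective
  exact this.symm

end Doubles

section DoubleHom

variable {A B C : Type} [Ring A] [Bialgebra ℂ A] [Ring B] [HopfAlgebra ℂ B] [Ring C]
  [Bialgebra ℂ C]

/-- The convolution inverse of a skew pairing on `A^{op} × B^{cop}` is `(a, b) ↦ τ(a, S(b))`. -/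
theorem opCop_conv_inverse {τ : A →ₗ[ℂ] B →ₗ[ℂ] ℂ} (hτ : IsSkewPairing τ) :
    let u := WithConv.toConv (TensorProduct.lift (opCop τ))
    let v := WithConv.toConv (TensorProduct.lift (opCop (τ.compl₂ (HopfAlgebra.antipode ℂ))))
    u * v = 1 ∧ v * u = 1 := by
  have hmul : ∀ a b b', τ a (b * b') = ∑ i ∈ (Coalgebra.Repr.arbitrary ℂ a).index,
      τ ((Coalgebra.Repr.arbitrary ℂ a).right i) b *
        τ ((Coalgebra.Repr.arbitrary ℂ a).left i) b' := by
    intro a b b'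
    rw [hτ.mul_right, ← (Coalgebra.Repr.arbitrary ℂ a).eq]
    simp [map_sum, mul_comm]
  intro u v
  constructor
  all_goals
    ext a b
    obtain ⟨a, rfl⟩ := MulOpposite.op_surjective a
    obtain ⟨b, rfl⟩ := (Cop.algEquiv B).symm.surjective b
    let ra := Coalgebra.Repr.arbitrary ℂ a
    let rb := Coalgebra.Repr.arbitrary ℂ b
    simp only [TensorProduct.AlgebraTensorModule.curry_apply, TensorProduct.curry_apply,
      LinearMap.restrictScalars_self]
    refine (((opRepr ra).tmul (Cop.repr rb)).convMul_apply _ _).trans ?_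
    simp only [Coalgebra.Repr.tmul, opRepr, Cop.repr, u, v, TensorProduct.lift.tmul]
    rw [Finset.sum_product, Finset.sum_comm]
  · have h := congrArg (τ a) (HopfAlgebra.sum_antipode_mul_eq_algebraMap_counit rb)
    rw [map_sum] at h
    simp only [hmul] at h
    refine Eq.trans (Finset.sum_congr rfl fun i _ => Finset.sum_congr rfl fun j _ => ?_)
      (h.trans ?_)
    · exact mul_comm _ _
    · rw [Algebra.algebraMap_eq_smul_one, map_smul, hτ.one_right]
      simp [LinearMap.convOne_def, MulOpposite.counit_def, Cop.counit_apply]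
  · have h := congrArg (τ a) (HopfAlgebra.sum_mul_antipode_eq_algebraMap_counit rb)
    rw [map_sum] at h
    simp only [hmul] at h
    refine Eq.trans (Finset.sum_congr rfl fun i _ => Finset.sum_congr rfl fun j _ => ?_)
      (h.trans ?_)
    · exact mul_comm _ _
    · rw [Algebra.algebraMap_eq_smul_one, map_smul, hτ.one_right]
      simp [LinearMap.convOne_def, MulOpposite.counit_def, Cop.counit_apply]

end DoubleHom

/-! ### The Yang–Baxter identity and the maps of a Hopf triplet -/

section DoubleHom

variable {A B C : Type} [Ring A] [Bialgebra ℂ A] [Ring B] [HopfAlgebra ℂ B] [Ring C]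
  [Bialgebra ℂ C]

theorem IsSkewPairing.mul_left_repr {H K : Type} [Ring H] [Bialgebra ℂ H] [Ring K] [Bialgebra ℂ K]
    {τ : H →ₗ[ℂ] K →ₗ[ℂ] ℂ} (hτ : IsSkewPairing τ) (h h' : H) (k : K) {ι : Type*}
    (r : Coalgebra.Repr ℂ k ι) :
    τ (h * h') k = ∑ i ∈ r.index, τ h (r.left i) * τ h' (r.right i) := by
  rw [hτ.mul_left, ← r.eq]
  simp [map_sum]

theorem IsSkewPairing.mul_right_repr {H K : Type} [Ring H] [Bialgebra ℂ H] [Ring K]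
    [Bialgebra ℂ K] {τ : H →ₗ[ℂ] K →ₗ[ℂ] ℂ} (hτ : IsSkewPairing τ) (h : H) (k k' : K) {ι : Type*}
    (r : Coalgebra.Repr ℂ h ι) :
    τ h (k * k') = ∑ i ∈ r.index, τ (r.left i) k' * τ (r.right i) k := by
  rw [hτ.mul_right, ← r.eq]
  simp [map_sum]

/-- The functional `τ(-, a)` on `C`. -/
def functionalRight (τ : C →ₗ[ℂ] A →ₗ[ℂ] ℂ) : A →ₗ[ℂ] HDual C :=
  (WithConv.linearEquiv ℂ (C →ₗ[ℂ] ℂ)).symm.toLinearMap ∘ₗ τ.flip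

/-- The functional `τ(b, -)` on `C`. -/
def functionalLeft (τ : B →ₗ[ℂ] C →ₗ[ℂ] ℂ) : B →ₗ[ℂ] HDual C :=
  (WithConv.linearEquiv ℂ (C →ₗ[ℂ] ℂ)).symm.toLinearMap ∘ₗ τ

theorem functionalRight_apply (τ : C →ₗ[ℂ] A →ₗ[ℂ] ℂ) (a : A) (c : C) :
    functionalRight τ a c = τ c a := rfl

theorem functionalLeft_apply (τ : B →ₗ[ℂ] C →ₗ[ℂ] ℂ) (b : B) (c : C) :
    functionalLeft τ b c = τ b c := rfl

/-- `φ_{ABC}(a ⊗ b) = τ_{CA}(-, a) * τ_{BC}(b, -)` in the convolution algebra `C^*`. -/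
theorem tripletMap_eq (τBC : B →ₗ[ℂ] C →ₗ[ℂ] ℂ) (τCA : C →ₗ[ℂ] A →ₗ[ℂ] ℂ) (a : Aᵐᵒᵖ) (b : Cop B) :
    tripletMap τBC τCA (a ⊗ₜ b) =
      functionalRight τCA a.unop * functionalLeft τBC (Cop.algEquiv B b) := by
  simp [tripletMap, functionalRight, functionalLeft]

theorem IsSkewPairing.functionalRight_mul {τ : C →ₗ[ℂ] A →ₗ[ℂ] ℂ} (hτ : IsSkewPairing τ)
    (a a' : A) : functionalRight τ (a * a') = functionalRight τ a' * functionalRight τ a := by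
  ext c
  rw [(Coalgebra.Repr.arbitrary ℂ c).convMul_apply]
  exact hτ.mul_right_repr c a a' _

theorem IsSkewPairing.functionalLeft_mul {τ : B →ₗ[ℂ] C →ₗ[ℂ] ℂ} (hτ : IsSkewPairing τ)
    (b b' : B) : functionalLeft τ (b * b') = functionalLeft τ b * functionalLeft τ b' := by
  ext c
  rw [(Coalgebra.Repr.arbitrary ℂ c).convMul_apply]
  exact hτ.mul_left_repr b b' c _

theorem IsSkewPairing.comul_functionalRight [Module.Finite ℂ C] {τ : C →ₗ[ℂ] A →ₗ[ℂ] ℂ}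
    (hτ : IsSkewPairing τ) (a : A) {ι : Type*} (r : Coalgebra.Repr ℂ a ι) :
    Coalgebra.comul (R := ℂ) (functionalRight τ a) =
      ∑ i ∈ r.index, functionalRight τ (r.left i) ⊗ₜ functionalRight τ (r.right i) := by
  apply HDual.tensor_ext
  intro c c'
  rw [HDual.pairEquiv_comul, functionalRight_apply, hτ.mul_left_repr c c' a r]
  simp [map_sum, functionalRight_apply]

theorem IsSkewPairing.comul_functionalLeft [Module.Finite ℂ C] {τ : B →ₗ[ℂ] C →ₗ[ℂ] ℂ}
    (hτ : IsSkewPairing τ) (b : B) {ι : Type*} (r : Coalgebra.Repr ℂ b ι) :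
    Coalgebra.comul (R := ℂ) (functionalLeft τ b) =
      ∑ i ∈ r.index, functionalLeft τ (r.right i) ⊗ₜ functionalLeft τ (r.left i) := by
  apply HDual.tensor_ext
  intro c c'
  rw [HDual.pairEquiv_comul, functionalLeft_apply, hτ.mul_right_repr b c c' r]
  simp [map_sum, functionalLeft_apply, mul_comm]

/-- The Yang–Baxter identity says that the form `u` on `A^{op} ⊗ B^{cop}` intertwines the products
`φ(a) φ(b)` and `φ(b) φ(a)` in the convolution algebra. -/
theorem YangBaxter.conv_eq {τAB : A →ₗ[ℂ] B →ₗ[ℂ] ℂ} {τBC : B →ₗ[ℂ] C →ₗ[ℂ] ℂ}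
    {τCA : C →ₗ[ℂ] A →ₗ[ℂ] ℂ} (h : YangBaxter τAB τBC τCA)
    (ψ : Aᵐᵒᵖ ⊗[ℂ] Cop B →ₗ[ℂ] HDual C)
    (hψ : ∀ a b, ψ (a ⊗ₜ b) =
      functionalLeft τBC (Cop.algEquiv B b) * functionalRight τCA a.unop) :
    WithConv.toConv (Algebra.linearMap ℂ (HDual C) ∘ₗ TensorProduct.lift (opCop τAB)) *
        WithConv.toConv (tripletMap τBC τCA) =
      WithConv.toConv ψ *
        WithConv.toConv (Algebra.linearMap ℂ (HDual C) ∘ₗ TensorProduct.lift (opCop τAB)) := by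
  ext a b c
  obtain ⟨a, rfl⟩ := MulOpposite.op_surjective a
  obtain ⟨b, rfl⟩ := (Cop.algEquiv B).symm.surjective b
  let ra := Coalgebra.Repr.arbitrary ℂ a
  let rb := Coalgebra.Repr.arbitrary ℂ b
  let rc := Coalgebra.Repr.arbitrary ℂ c
  have h := h a b c
  simp only [TensorProduct.AlgebraTensorModule.curry_apply, TensorProduct.curry_apply,
    LinearMap.restrictScalars_self]
  have e := fun f g : WithConv (Aᵐᵒᵖ ⊗[ℂ] Cop B →ₗ[ℂ] HDual C) =>
    ((opRepr ra).tmul (Cop.repr rb)).convMul_apply f g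
  have e1 := congrArg (fun f : HDual C => f c)
    (e (WithConv.toConv (Algebra.linearMap ℂ (HDual C) ∘ₗ TensorProduct.lift (opCop τAB)))
      (WithConv.toConv (tripletMap τBC τCA)))
  have e2 := congrArg (fun f : HDual C => f c)
    (e (WithConv.toConv ψ)
    (WithConv.toConv (Algebra.linearMap ℂ (HDual C) ∘ₗ TensorProduct.lift (opCop τAB))))
  refine e1.trans (Eq.trans ?_ e2.symm)
  have hs : ∀ (s : Finset ((A × A) × (B × B))) (f : (A × A) × (B × B) → HDual C),
      (∑ i ∈ s, f i : HDual C) c = ∑ i ∈ s, f i c := fun s f => by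
    simp [LinearMap.sum_apply]
  rw [hs, hs]
  simp only [Coalgebra.Repr.tmul, opRepr, Cop.repr]
  rw [Finset.sum_product, Finset.sum_product]
  refine Eq.trans (Finset.sum_congr rfl fun i _ => Finset.sum_congr rfl fun j _ => ?_)
    (h.trans (Eq.symm (Finset.sum_congr rfl fun i _ => Finset.sum_congr rfl fun j _ => ?_)))
  · simp only [LinearMap.comp_apply, TensorProduct.lift.tmul, tripletMap_eq,
      Algebra.linearMap_apply, Algebra.algebraMap_eq_smul_one, smul_mul_assoc, one_mul,
      MulOpposite.unop_op, AlgEquiv.apply_symm_apply]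
    rw [WithConv.ofConv_smul, LinearMap.smul_apply, rc.convMul_apply, smul_eq_mul, Finset.mul_sum]
    exact Finset.sum_congr rfl fun k _ => (mul_assoc _ _ _).symm
  · simp only [LinearMap.comp_apply, TensorProduct.lift.tmul, hψ,
      Algebra.linearMap_apply, Algebra.algebraMap_eq_smul_one, mul_smul_comm, mul_one,
      MulOpposite.unop_op, AlgEquiv.apply_symm_apply]
    rw [WithConv.ofConv_smul, LinearMap.smul_apply, rc.convMul_apply, smul_eq_mul, Finset.mul_sum]
    exact Finset.sum_congr rfl fun k _ => mul_comm _ _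

/-- Three skew pairings that satisfy the Yang–Baxter identity induce a homomorphism of Hopf algebras
`D(A^{op}, B^{cop}) → C^*`. -/
theorem YangBaxter.isDoubleHom [Module.Finite ℂ C] {τAB : A →ₗ[ℂ] B →ₗ[ℂ] ℂ}
    {τBC : B →ₗ[ℂ] C →ₗ[ℂ] ℂ} {τCA : C →ₗ[ℂ] A →ₗ[ℂ] ℂ} (hAB : IsSkewPairing τAB)
    (hBC : IsSkewPairing τBC) (hCA : IsSkewPairing τCA) (h : YangBaxter τAB τBC τCA) :
    IsDoubleHom (opCop τAB) (tripletMap τBC τCA) where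
  map_mul x y := by
    let φ := tripletMap τBC τCA
    let ψ : Aᵐᵒᵖ ⊗[ℂ] Cop B →ₗ[ℂ] HDual C := TensorProduct.lift
      ((LinearMap.mul ℂ (HDual C)).flip.compl₁₂
        (functionalRight τCA ∘ₗ (MulOpposite.opLinearEquiv ℂ).symm.toLinearMap)
        (functionalLeft τBC ∘ₗ (Cop.algEquiv B).toLinearMap))
    have hψ : ∀ a b, ψ (a ⊗ₜ b) =
      functionalLeft τBC (Cop.algEquiv B b) * functionalRight τCA a.unop := fun a b => rfl
    let u := WithConv.toConv (TensorProduct.lift (opCop τAB))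
    obtain ⟨huv, hvu⟩ := opCop_conv_inverse hAB
    let v := WithConv.toConv
      (TensorProduct.lift (opCop (τAB.compl₂ (HopfAlgebra.antipode ℂ))))
    have hinv : TensorProduct.lift (convInv (opCop τAB)) = v.ofConv := by
      have : Ring.inverse u = v := Ring.inverse_unit (⟨u, v, huv, hvu⟩ : (WithConv _)ˣ)
      have h2 : convInv (opCop τAB) = TensorProduct.curry v.ofConv := by
        rw [← this]; rfl
      rw [h2]
      ext a b
      rfl
    have htw : ∀ p, φ (twist (TensorProduct.lift (opCop τAB))
        (TensorProduct.lift (convInv (opCop τAB))) p) = ψ p := by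
      have e := twist_eq u v φ
      have hc := h.conv_eq ψ hψ
      rw [← mul_assoc, hc, mul_assoc, scalar_conv_mul huv, mul_one] at e
      intro p
      rw [hinv]
      exact LinearMap.congr_fun e p
    change φ _ = φ x * φ y
    induction x with
    | zero => simp
    | add x x' hx hx' => simp only [TensorProduct.add_tmul, map_add, add_mul, hx, hx']
    | tmul a b =>
      induction y with
      | zero => simp
      | add y y' hy hy' => simp only [TensorProduct.tmul_add, map_add, mul_add, hy, hy']
      | tmul a' b' =>
        have hLR : ∀ p : Aᵐᵒᵖ ⊗[ℂ] Cop B,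
            φ (TensorProduct.map (LinearMap.mulLeft ℂ a) (LinearMap.mulRight ℂ b') p) =
              functionalRight τCA a.unop * φ p * functionalLeft τBC (Cop.algEquiv B b') := by
          intro p
          induction p with
          | zero => simp
          | add p q hp hq => simp only [map_add, mul_add, add_mul, hp, hq]
          | tmul a'' b'' =>
            simp only [TensorProduct.map_tmul, LinearMap.mulLeft_apply, LinearMap.mulRight_apply, φ,
              tripletMap_eq, MulOpposite.unop_mul, map_mul, hCA.functionalRight_mul,
              hBC.functionalLeft_mul, mul_assoc]
        rw [doubleMul_tmul, hLR, htw, hψ]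
        simp only [φ, tripletMap_eq, mul_assoc]
  map_one := by
    rw [tripletMap_eq]
    ext c
    rw [(Coalgebra.Repr.arbitrary ℂ c).convMul_apply]
    simp only [MulOpposite.unop_one, map_one, functionalRight_apply, functionalLeft_apply,
      hCA.one_right, hBC.one_left]
    have := congrArg (Coalgebra.counit (R := ℂ))
      (Coalgebra.sum_counit_smul (Coalgebra.Repr.arbitrary ℂ c))
    simpa [map_sum, LinearMap.convOne_def] using this
  map_comul := by
    ext a b
    obtain ⟨a, rfl⟩ := MulOpposite.op_surjective a
    obtain ⟨b, rfl⟩ := (Cop.algEquiv B).symm.surjective b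
    let ra := Coalgebra.Repr.arbitrary ℂ a
    let rb := Coalgebra.Repr.arbitrary ℂ b
    simp only [TensorProduct.AlgebraTensorModule.curry_apply, TensorProduct.curry_apply,
      LinearMap.restrictScalars_self, LinearMap.comp_apply]
    rw [tripletMap_eq, Bialgebra.comul_mul, ← ((opRepr ra).tmul (Cop.repr rb)).eq]
    simp only [AlgEquiv.apply_symm_apply, MulOpposite.unop_op, hBC.comul_functionalLeft _ rb,
      hCA.comul_functionalRight _ ra]
    rw [Finset.sum_mul_sum, ← Finset.sum_product']
    simp [map_sum, Coalgebra.Repr.tmul, tripletMap_eq]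
  map_counit := by
    ext a b
    obtain ⟨a, rfl⟩ := MulOpposite.op_surjective a
    obtain ⟨b, rfl⟩ := (Cop.algEquiv B).symm.surjective b
    simp only [TensorProduct.AlgebraTensorModule.curry_apply, TensorProduct.curry_apply,
      LinearMap.restrictScalars_self, LinearMap.comp_apply, tripletMap_eq, Bialgebra.counit_mul,
      HDual.counit_apply]
    rw [functionalRight_apply, functionalLeft_apply, hCA.one_left, hBC.one_right]
    simp [MulOpposite.counit_def, Cop.counit_apply, mul_comm]

end DoubleHom

section YangBaxterForm

/-- The interchange of summation that turns values of three forms on triples of elements into values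
of three functionals on products of the components of the forms. -/
theorem sum_triple_interchange {α β γ ι κ l : Type*} (sa : Finset α) (sb : Finset β) (sc : Finset γ)
    (s : Finset ι) (s' : Finset κ) (s'' : Finset l) (F : α → ι → ℂ) (F' : α → l → ℂ)
    (G : β → κ → ℂ) (G' : β → ι → ℂ) (E : γ → l → ℂ) (E' : γ → κ → ℂ) :
    ∑ a ∈ sa, ∑ b ∈ sb, ∑ c ∈ sc, (∑ i ∈ s, F a i * G' b i) * (∑ j ∈ s'', E c j * F' a j) *
        (∑ k ∈ s', G b k * E' c k) =
      ∑ i ∈ s, ∑ j ∈ s'', ∑ k ∈ s', (∑ a ∈ sa, F a i * F' a j) *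
        ((∑ b ∈ sb, G b k * G' b i) * (∑ c ∈ sc, E c j * E' c k)) := by
  have hL : ∀ a b c, (∑ i ∈ s, F a i * G' b i) * (∑ j ∈ s'', E c j * F' a j) *
      (∑ k ∈ s', G b k * E' c k) = ∑ i ∈ s, ∑ j ∈ s'', ∑ k ∈ s',
        (F a i * F' a j) * ((G b k * G' b i) * (E c j * E' c k)) := by
    intro a b c
    rw [Finset.sum_mul_sum, Finset.sum_mul]
    refine Finset.sum_congr rfl fun i _ => ?_
    rw [Finset.sum_mul]
    refine Finset.sum_congr rfl fun j _ => ?_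
    rw [Finset.mul_sum]
    exact Finset.sum_congr rfl fun k _ => by ring
  have hR : ∀ i j k, (∑ a ∈ sa, F a i * F' a j) *
      ((∑ b ∈ sb, G b k * G' b i) * (∑ c ∈ sc, E c j * E' c k)) = ∑ a ∈ sa, ∑ b ∈ sb, ∑ c ∈ sc,
        (F a i * F' a j) * ((G b k * G' b i) * (E c j * E' c k)) := by
    intro i j k
    rw [Finset.sum_mul_sum sb sc, Finset.sum_mul_sum]
    refine Finset.sum_congr rfl fun a _ => Finset.sum_congr rfl fun b _ => ?_
    rw [Finset.mul_sum]
  simp only [hL, hR]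
  have h := Finset.sum_comm (s := (sa ×ˢ sb) ×ˢ sc) (t := (s ×ˢ s'') ×ˢ s')
    (f := fun x y => F x.1.1 y.1.1 * F' x.1.1 y.1.2 *
      (G x.1.2 y.2 * G' x.1.2 y.1.1 * (E x.2 y.1.2 * E' x.2 y.2)))
  simpa only [Finset.sum_product] using h

variable {L M N : Type} [Ring L] [Bialgebra ℂ L] [Module.Finite ℂ L]
  [Ring M] [Bialgebra ℂ M] [Module.Finite ℂ M] [Ring N] [Bialgebra ℂ N] [Module.Finite ℂ N]

/-- The Yang–Baxter identity for the forms of three elements of tensor products. -/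
theorem yangBaxter_form {ι κ l : Type*} (s : Finset ι) (t : ι → L) (t' : ι → M)
    (s' : Finset κ) (q : κ → M) (q' : κ → N) (s'' : Finset l) (p : l → N) (p' : l → L)
    (h : ∑ i ∈ s, ∑ j ∈ s'', ∑ k ∈ s', (t i * p' j) ⊗ₜ[ℂ] ((q k * t' i) ⊗ₜ[ℂ] (p j * q' k)) =
      ∑ i ∈ s, ∑ j ∈ s'', ∑ k ∈ s', (p' j * t i) ⊗ₜ[ℂ] ((t' i * q k) ⊗ₜ[ℂ] (q' k * p j))) :
    YangBaxter (form (∑ i ∈ s, t i ⊗ₜ t' i)) (form (∑ i ∈ s', q i ⊗ₜ q' i))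
      (form (∑ i ∈ s'', p i ⊗ₜ p' i)) := by
  intro f g e
  let rf := Coalgebra.Repr.arbitrary ℂ f
  let rg := Coalgebra.Repr.arbitrary ℂ g
  let re := Coalgebra.Repr.arbitrary ℂ e
  have h := congrArg (LinearMap.mul' ℂ ℂ ∘ₗ TensorProduct.map f.ofConv (LinearMap.mul' ℂ ℂ ∘ₗ
      TensorProduct.map g.ofConv e.ofConv)) h
  simp only [LinearMap.comp_apply, map_sum (TensorProduct.map _ _), map_sum (LinearMap.mul' ℂ ℂ),
    TensorProduct.map_tmul, LinearMap.mul'_apply] at h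
  have h1 := sum_triple_interchange rf.index rg.index re.index s s' s''
    (fun a i => rf.left a (t i)) (fun a j => rf.right a (p' j)) (fun b k => rg.left b (q k))
    (fun b i => rg.right b (t' i)) (fun c j => re.left c (p j)) (fun c k => re.right c (q' k))
  have h2 := sum_triple_interchange rf.index rg.index re.index s s' s''
    (fun a i => rf.right a (t i)) (fun a j => rf.left a (p' j)) (fun b k => rg.right b (q k))
    (fun b i => rg.left b (t' i)) (fun c j => re.right c (p j)) (fun c k => re.left c (q' k))
  dsimp only
  simp only [form_sum]
  simp only [HDual.repr_apply] at h1
  refine h1.trans (h.trans ?_)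
  refine Eq.trans ?_ (h2.symm.trans ?_)
  · refine Finset.sum_congr rfl fun i _ => Finset.sum_congr rfl fun j _ =>
      Finset.sum_congr rfl fun k _ => ?_
    have e1 : f.ofConv (p' j * t i) = _ := (HDual.repr_apply rf (p' j) (t i)).symm
    have e2 : g.ofConv (t' i * q k) = _ := (HDual.repr_apply rg (t' i) (q k)).symm
    have e3 : e.ofConv (q' k * p j) = _ := (HDual.repr_apply re (q' k) (p j)).symm
    rw [e1, e2, e3]
    refine congrArg₂ _ (Finset.sum_congr rfl fun a _ => mul_comm _ _) (congrArg₂ _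
      (Finset.sum_congr rfl fun a _ => mul_comm _ _) (Finset.sum_congr rfl fun a _ => mul_comm _ _))
  · refine Finset.sum_congr rfl fun a _ => Finset.sum_congr rfl fun b _ =>
      Finset.sum_congr rfl fun c _ => ?_
    have reverse : ∀ x y z : ℂ, x * y * z = z * y * x := fun x y z => by ring
    exact reverse _ _ _

end YangBaxterForm

/-! ### Fibre functors and duals -/

section FibreFunctor

universe v u

variable {𝒟 : Type u} [Category.{v} 𝒟]

/-- The linear map underlying the image of a morphism under a functor to vector spaces. -/
abbrev fmap (F : 𝒟 ⥤ Vect) {X Y : 𝒟} (f : X ⟶ Y) : F.obj X →ₗ[ℂ] F.obj Y := (F.map f).hom.hom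

@[simp] theorem fmap_id (F : 𝒟 ⥤ Vect) (X : 𝒟) : fmap F (𝟙 X) = LinearMap.id := by
  simp [fmap]

theorem fmap_comp (F : 𝒟 ⥤ Vect) {X Y Z : 𝒟} (f : X ⟶ Y) (g : Y ⟶ Z) :
    fmap F (f ≫ g) = fmap F g ∘ₗ fmap F f := by simp [fmap]

theorem fmap_comp_apply (F : 𝒟 ⥤ Vect) {X Y Z : 𝒟} (f : X ⟶ Y) (g : Y ⟶ Z) (v : F.obj X) :
    fmap F (f ≫ g) v = fmap F g (fmap F f v) := by rw [fmap_comp]; rfl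

section Linear

variable [Preadditive 𝒟] [Linear ℂ 𝒟] (F : 𝒟 ⥤ Vect) [F.Additive] [F.Linear ℂ] {X Y : 𝒟}

@[simp] theorem fmap_zero : fmap F (0 : X ⟶ Y) = 0 := by simp [fmap]

theorem fmap_smul (c : ℂ) (f : X ⟶ Y) : fmap F (c • f) = c • fmap F f := by
  simp only [fmap, F.map_smul]; rfl

theorem fmap_add (f g : X ⟶ Y) : fmap F (f + g) = fmap F f + fmap F g := by
  simp only [fmap, F.map_add]; rfl

theorem fmap_sum {ι : Type*} (s : Finset ι) (f : ι → (X ⟶ Y)) :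
    fmap F (∑ i ∈ s, f i) = ∑ i ∈ s, fmap F (f i) :=
  map_sum (AddMonoidHom.mk' (fun f : X ⟶ Y => fmap F f) (fmap_add F)) f s

end Linear

section Monoidal

variable [MonoidalCategory 𝒟] (F : 𝒟 ⥤ Vect) [F.Monoidal]

/-- The tensor structure of a monoidal functor to vector spaces. -/
def mu (X Y : 𝒟) : F.obj X ⊗[ℂ] F.obj Y ≃ₗ[ℂ] F.obj (X ⊗ Y) :=
  LinearEquiv.ofLinearMap (Functor.LaxMonoidal.μ F X Y).hom.hom
    (Functor.OplaxMonoidal.δ F X Y).hom.hom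
    (by rw [← FGModuleCat.hom_hom_comp, Functor.Monoidal.δ_μ]; rfl)
    (by erw [← FGModuleCat.hom_hom_comp, Functor.Monoidal.μ_δ]; rfl)

/-- The unit structure of a monoidal functor to vector spaces. -/
def unitEquiv : ℂ ≃ₗ[ℂ] F.obj (𝟙_ 𝒟) :=
  LinearEquiv.ofLinearMap (Functor.LaxMonoidal.ε F).hom.hom (Functor.OplaxMonoidal.η F).hom.hom
    (by rw [← FGModuleCat.hom_hom_comp, Functor.Monoidal.η_ε]; rfl)
    (by erw [← FGModuleCat.hom_hom_comp, Functor.Monoidal.ε_η]; rfl)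

variable {F}

theorem mu_natural {X X' Y Y' : 𝒟} (f : X ⟶ X') (g : Y ⟶ Y') (v : F.obj X) (w : F.obj Y) :
    fmap F (f ⊗ₘ g) (mu F X Y (v ⊗ₜ w)) = mu F X' Y' (fmap F f v ⊗ₜ fmap F g w) := by
  have h := Functor.LaxMonoidal.μ_natural F f g
  exact (LinearMap.congr_fun (congrArg (fun k => k.hom.hom) h) (v ⊗ₜ w)).symm

theorem mu_assoc {X Y Z : 𝒟} (u : F.obj X) (v : F.obj Y) (w : F.obj Z) :
    fmap F (α_ X Y Z).hom (mu F (X ⊗ Y) Z (mu F X Y (u ⊗ₜ v) ⊗ₜ w)) =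
      mu F X (Y ⊗ Z) (u ⊗ₜ mu F Y Z (v ⊗ₜ w)) := by
  have h := Functor.LaxMonoidal.associativity F X Y Z
  exact LinearMap.congr_fun (congrArg (fun k => k.hom.hom) h) ((u ⊗ₜ v) ⊗ₜ w)

theorem mu_left_unit {X : 𝒟} (v : F.obj X) :
    fmap F (λ_ X).hom (mu F (𝟙_ 𝒟) X (unitEquiv F 1 ⊗ₜ v)) = v := by
  have h := Functor.LaxMonoidal.left_unitality F X
  exact (LinearMap.congr_fun (congrArg (fun k => k.hom.hom) h) ((1 : ℂ) ⊗ₜ v)).symm.trans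
    (one_smul ℂ v)

theorem mu_right_unit {X : 𝒟} (v : F.obj X) :
    fmap F (ρ_ X).hom (mu F X (𝟙_ 𝒟) (v ⊗ₜ unitEquiv F 1)) = v := by
  have h := Functor.LaxMonoidal.right_unitality F X
  exact (LinearMap.congr_fun (congrArg (fun k => k.hom.hom) h) (v ⊗ₜ (1 : ℂ))).symm.trans
    (one_smul ℂ v)

end Monoidal

section Duality

variable [MonoidalCategory 𝒟] [RightRigidCategory 𝒟] (F : 𝒟 ⥤ Vect) [F.Monoidal]

/-- The evaluation pairing between the images of a dual object and of the object. -/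
def evPair (X : 𝒟) : F.obj (Xᘁ) →ₗ[ℂ] F.obj X →ₗ[ℂ] ℂ :=
  TensorProduct.curry ((unitEquiv F).symm.toLinearMap ∘ₗ fmap F (ε_ X (Xᘁ)) ∘ₗ
    (mu F (Xᘁ) X).toLinearMap)

theorem evPair_apply {X : 𝒟} (f : F.obj (Xᘁ)) (v : F.obj X) :
    evPair F X f v = (unitEquiv F).symm (fmap F (ε_ X (Xᘁ)) (mu F (Xᘁ) X (f ⊗ₜ v))) := rfl

/-- The image of the coevaluation. -/
def coevElt (X : 𝒟) : F.obj X ⊗[ℂ] F.obj (Xᘁ) :=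
  (mu F X (Xᘁ)).symm (fmap F (η_ X (Xᘁ)) (unitEquiv F 1))

variable {F}

/-- The image of the dual of a morphism is its transpose for the pairings. -/
theorem evPair_map {X Y : 𝒟} (f : X ⟶ Y) (φ : F.obj (Yᘁ)) (v : F.obj X) :
    evPair F X (fmap F (fᘁ) φ) v = evPair F Y φ (fmap F f v) := by
  have h1 := mu_natural (F := F) (fᘁ) (𝟙 X) φ v
  have h2 := mu_natural (F := F) (𝟙 (Yᘁ)) f φ v
  rw [fmap_id] at h1 h2
  rw [evPair_apply, evPair_apply]
  erw [← h1, ← h2]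
  rw [← fmap_comp_apply, ← fmap_comp_apply, tensorHom_id, id_tensorHom,
    rightAdjointMate_comp_evaluation]

/-- One snake identity, read in the images under `F`. -/
theorem coevElt_contract_left {X : 𝒟} (v : F.obj X) :
    TensorProduct.rid ℂ _ ((LinearMap.lTensor (F.obj X) ((evPair F X).flip v)) (coevElt F X)) =
      v := by
  have h := congrArg (fun k => fmap F (k ≫ (ρ_ X).hom) (mu F (𝟙_ 𝒟) X (unitEquiv F 1 ⊗ₜ v)))
    (ExactPairing.evaluation_coevaluation X (Xᘁ))
  simp only [Category.assoc, Iso.inv_hom_id, Category.comp_id] at h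
  rw [mu_left_unit, fmap_comp_apply, ← tensorHom_id, mu_natural] at h
  refine Eq.trans ?_ h
  simp only [fmap_id, LinearMap.id_apply]
  have hc : fmap F (η_ X (Xᘁ)) (unitEquiv F 1) = mu F X (Xᘁ) (coevElt F X) := by simp [coevElt]
  rw [hc]
  generalize coevElt F X = t
  induction t with
  | zero => simp
  | add s t hs ht => simp only [map_add, TensorProduct.add_tmul, hs, ht]
  | tmul a f =>
    rw [fmap_comp_apply, mu_assoc, fmap_comp_apply, ← id_tensorHom, mu_natural]
    have : fmap F (ε_ X (Xᘁ)) (mu F (Xᘁ) X (f ⊗ₜ v)) = evPair F X f v • unitEquiv F 1 := by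
      rw [← map_smul, smul_eq_mul, mul_one, evPair_apply, LinearEquiv.apply_symm_apply]
    rw [this, TensorProduct.tmul_smul, map_smul, map_smul, fmap_id, LinearMap.id_apply,
      mu_right_unit]
    simp

/-- The other snake identity, read in the images under `F`. -/
theorem coevElt_contract_right {X : 𝒟} (f : F.obj (Xᘁ)) :
    TensorProduct.lid ℂ _ ((LinearMap.rTensor (F.obj (Xᘁ)) (evPair F X f)) (coevElt F X)) = f := by
  have h := congrArg (fun k => fmap F (k ≫ (λ_ (Xᘁ)).hom) (mu F (Xᘁ) (𝟙_ 𝒟) (f ⊗ₜ unitEquiv F 1)))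
    (ExactPairing.coevaluation_evaluation X (Xᘁ))
  simp only [Category.assoc, Iso.inv_hom_id, Category.comp_id] at h
  rw [mu_right_unit, fmap_comp_apply, ← id_tensorHom, mu_natural] at h
  refine Eq.trans ?_ h
  simp only [fmap_id, LinearMap.id_apply]
  have hc : fmap F (η_ X (Xᘁ)) (unitEquiv F 1) = mu F X (Xᘁ) (coevElt F X) := by simp [coevElt]
  rw [hc]
  generalize coevElt F X = t
  induction t with
  | zero => simp
  | add s t hs ht => simp only [map_add, TensorProduct.tmul_add, hs, ht]
  | tmul a g =>
    have h3 := mu_assoc (F := F) f a g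
    have h4 := congrArg (fmap F (α_ (Xᘁ) X (Xᘁ)).inv) h3
    rw [← fmap_comp_apply, Iso.hom_inv_id, fmap_id, LinearMap.id_apply] at h4
    rw [fmap_comp_apply, ← h4, fmap_comp_apply, ← tensorHom_id, mu_natural]
    have : fmap F (ε_ X (Xᘁ)) (mu F (Xᘁ) X (f ⊗ₜ a)) = evPair F X f a • unitEquiv F 1 := by
      rw [← map_smul, smul_eq_mul, mul_one, evPair_apply, LinearEquiv.apply_symm_apply]
    rw [this, ← TensorProduct.smul_tmul', map_smul, map_smul, fmap_id, LinearMap.id_apply,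
      mu_left_unit]
    simp

theorem evPair_injective (X : 𝒟) : Function.Injective (evPair F X) := by
  intro f g h
  rw [← coevElt_contract_right f, ← coevElt_contract_right g, h]

theorem evPair_flip_injective (X : 𝒟) : Function.Injective (evPair F X).flip := by
  intro v w h
  rw [← coevElt_contract_left v, ← coevElt_contract_left w, h]

variable (F) in
/-- The image of the dual of an object is the dual vector space. -/
def dualEquiv (X : 𝒟) : F.obj (Xᘁ) ≃ₗ[ℂ] Module.Dual ℂ (F.obj X) :=
  LinearEquiv.ofInjectiveOfFinrankEq (evPair F X) (evPair_injective X) <| le_antisymm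
    ((LinearMap.finrank_le_finrank_of_injective (evPair_injective X)))
    (by
      have h := LinearMap.finrank_le_finrank_of_injective (evPair_flip_injective (F := F) X)
      rw [Subspace.dual_finrank_eq] at h ⊢
      exact h)

end Duality

end FibreFunctor

/-! ### The algebra of natural endomorphisms of a fibre functor -/

section SimpleBasis

universe v u

/-- A decomposition of an object into simple objects from a family `S`. -/
structure Decomposition {𝒟 : Type u} [Category.{v} 𝒟] [Preadditive 𝒟] {I : Type} (S : I → 𝒟)
    (X : 𝒟) where
  n : ℕ
  c : Fin n → I
  p (j : Fin n) : X ⟶ S (c j)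
  ι (j : Fin n) : S (c j) ⟶ X
  sum_eq : ∑ j, p j ≫ ι j = 𝟙 X
  ι_p_self (j : Fin n) : ι j ≫ p j = 𝟙 _

/-- A finite set of representatives of the isomorphism classes of simple objects of a semisimple
category with finite-dimensional morphism spaces; simplicity enters through Schur's lemma. -/
structure SimpleBasis (𝒟 : Type u) [Category.{v} 𝒟] [Preadditive 𝒟] [Linear ℂ 𝒟] where
  I : Type
  [fintype : Fintype I]
  [decEq : DecidableEq I]
  S : I → 𝒟
  hom_self (i : I) (f : S i ⟶ S i) : ∃ c : ℂ, f = c • 𝟙 (S i)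
  hom_ne {i j : I} (h : i ≠ j) (f : S i ⟶ S j) : f = 0
  id_ne_zero (i : I) : 𝟙 (S i) ≠ 0
  decomp (X : 𝒟) : Decomposition S X

attribute [instance] SimpleBasis.fintype SimpleBasis.decEq

attribute [local instance] Abelian.hasFiniteBiproducts

theorem FusionCategory.nonempty_simpleBasis (𝒟 : Type u) [Category.{v} 𝒟] [Abelian 𝒟] [Linear ℂ 𝒟]
    [MonoidalCategory 𝒟] [MonoidalPreadditive 𝒟] [MonoidalLinear ℂ 𝒟] [RigidCategory 𝒟]
    [FusionCategory 𝒟] : Nonempty (SimpleBasis 𝒟) := by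
  classical
  -- the given finite list may contain repetitions and objects that are not simple
  obtain ⟨n, S, hS⟩ := FusionCategory.finite_simple (C := 𝒟)
  haveI := FusionCategory.finite_hom (C := 𝒟)
  let J := {i : Fin n // Simple (S i)}
  let r : Setoid J :=
    { r := fun i j => Nonempty (S i.1 ≅ S j.1)
      iseqv := ⟨fun i => ⟨Iso.refl _⟩, fun ⟨e⟩ => ⟨e.symm⟩, fun ⟨e⟩ ⟨e'⟩ => ⟨e ≪≫ e'⟩⟩ }
  let S' : Quotient r → 𝒟 := fun i => S i.out.1
  haveI hsimple : ∀ i, Simple (S' i) := fun i => i.out.2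
  have hrep : ∀ X : 𝒟, Simple X → ∃ i, Nonempty (X ≅ S' i) := by
    intro X hX
    obtain ⟨i, ⟨e⟩⟩ := hS X hX
    have hi : Simple (S i) := Simple.of_iso e.symm
    obtain ⟨e'⟩ := Quotient.mk_out (s := r) (⟨i, hi⟩ : J)
    exact ⟨Quotient.mk r ⟨i, hi⟩, ⟨e ≪≫ e'.symm⟩⟩
  haveI : Fintype (Quotient r) := Fintype.ofFinite _
  refine ⟨⟨Quotient r, S', fun i f => ?_, fun {i j} h f => ?_, fun i => id_nonzero _,
    fun X => Classical.choice ?_⟩⟩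
  · have h1 := finrank_endomorphism_simple_eq_one ℂ (S' i)
    obtain ⟨c, hc⟩ := (finrank_eq_one_iff_of_nonzero' (𝟙 (S' i)) (id_nonzero _)).1 h1 f
    exact ⟨c, hc.symm⟩
  · by_contra hf
    haveI := isIso_of_hom_simple hf
    refine h ?_
    rw [← i.out_eq, ← j.out_eq]
    exact Quotient.sound ⟨asIso f⟩
  · obtain ⟨m, T, hT, ⟨e⟩⟩ := FusionCategory.semisimple X
    choose c hc using fun j => hrep (T j) (hT j)
    let g := fun j => (hc j).some
    refine ⟨⟨m, c, fun j => e.hom ≫ biproduct.π T j ≫ (g j).hom,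
      fun j => (g j).inv ≫ biproduct.ι T j ≫ e.inv, ?_, fun j => ?_⟩⟩
    · have : ∀ j, (e.hom ≫ biproduct.π T j ≫ (g j).hom) ≫ (g j).inv ≫ biproduct.ι T j ≫ e.inv =
          e.hom ≫ (biproduct.π T j ≫ biproduct.ι T j) ≫ e.inv := fun j => by simp
      simp only [this, ← Preadditive.comp_sum, ← Preadditive.sum_comp]
      simp [biproduct.total]
    · simp

end SimpleBasis

theorem linearMap_comp_sum {ι : Type*} (s : Finset ι) {V W U : Type*} [AddCommGroup V]
    [Module ℂ V] [AddCommGroup W] [Module ℂ W] [AddCommGroup U] [Module ℂ U] (f : W →ₗ[ℂ] U)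
    (g : ι → V →ₗ[ℂ] W) : f ∘ₗ (∑ i ∈ s, g i) = ∑ i ∈ s, f ∘ₗ g i := by
  ext; simp

theorem linearMap_sum_comp {ι : Type*} (s : Finset ι) {V W U : Type*} [AddCommGroup V]
    [Module ℂ V] [AddCommGroup W] [Module ℂ W] [AddCommGroup U] [Module ℂ U] (f : V →ₗ[ℂ] W)
    (g : ι → W →ₗ[ℂ] U) : (∑ i ∈ s, g i) ∘ₗ f = ∑ i ∈ s, g i ∘ₗ f := by
  ext; simp

section Algebra

universe v u

variable {𝒟 : Type u} [Category.{v} 𝒟] [Preadditive 𝒟] [Linear ℂ 𝒟] (B : SimpleBasis 𝒟)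
  (F : 𝒟 ⥤ Vect)

/-- The algebra of natural endomorphisms of the linear functor `F`, as the product of the
endomorphism algebras of the images of the simple objects. -/
def Tan : Type := ∀ i : B.I, Module.End ℂ (F.obj (B.S i))

namespace Tan

instance : Ring (Tan B F) := inferInstanceAs (Ring (∀ i : B.I, Module.End ℂ (F.obj (B.S i))))
instance : Algebra ℂ (Tan B F) :=
  inferInstanceAs (Algebra ℂ (∀ i : B.I, Module.End ℂ (F.obj (B.S i))))
instance : Module.Finite ℂ (Tan B F) :=
  inferInstanceAs (Module.Finite ℂ (∀ i : B.I, Module.End ℂ (F.obj (B.S i))))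

variable {B F}

/-- The natural endomorphism that is supported on one simple object. -/
def single (i : B.I) : Module.End ℂ (F.obj (B.S i)) →ₗ[ℂ] Tan B F :=
  LinearMap.single ℂ (fun i : B.I => Module.End ℂ (F.obj (B.S i))) i

theorem sum_single (h : Tan B F) : ∑ i, single i (h i) = h :=
  Finset.univ_sum_single (M := fun i : B.I => Module.End ℂ (F.obj (B.S i))) h

theorem single_same (i : B.I) (a : Module.End ℂ (F.obj (B.S i))) : single (F := F) i a i = a :=
  Pi.single_eq_same (M := fun i : B.I => Module.End ℂ (F.obj (B.S i))) i a

theorem single_ne {i j : B.I} (h : j ≠ i) (a : Module.End ℂ (F.obj (B.S i))) :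
    single (F := F) i a j = 0 :=
  Pi.single_eq_of_ne (M := fun i : B.I => Module.End ℂ (F.obj (B.S i))) h a

@[simp] theorem one_apply (i : B.I) : (1 : Tan B F) i = 1 := rfl
@[simp] theorem mul_apply (h k : Tan B F) (i : B.I) : (h * k) i = h i * k i := rfl

@[ext] theorem ext {h k : Tan B F} (H : ∀ i, h i = k i) : h = k := funext H

theorem single_mul_single (i : B.I) (a b : Module.End ℂ (F.obj (B.S i))) :
    single (F := F) i a * single i b = single i (a * b) := by
  ext1 j
  by_cases h : j = i
  · subst h; simp [single_same]
  · simp [single_ne h]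

theorem mul_single (h : Tan B F) (i : B.I) (b : Module.End ℂ (F.obj (B.S i))) :
    h * single i b = single i (h i * b) := by
  ext1 j
  by_cases h : j = i
  · subst h; simp [single_same]
  · simp [single_ne h]

theorem single_mul_single_ne {i j : B.I} (h : i ≠ j) (a : Module.End ℂ (F.obj (B.S i)))
    (b : Module.End ℂ (F.obj (B.S j))) : single (F := F) i a * single j b = 0 := by
  rw [mul_single, single_ne h.symm, zero_mul, map_zero]

variable [F.Additive] [F.Linear ℂ]

theorem fmap_simple (h : Tan B F) {i j : B.I} (g : B.S i ⟶ B.S j) :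
    fmap F g ∘ₗ h i = h j ∘ₗ fmap F g := by
  by_cases hij : i = j
  · subst hij
    obtain ⟨c, rfl⟩ := B.hom_self _ g
    rw [fmap_smul, fmap_id, LinearMap.smul_comp, LinearMap.comp_smul]
    rfl
  · rw [B.hom_ne hij g, fmap_zero, LinearMap.zero_comp, LinearMap.comp_zero]

/-- The component of a natural endomorphism at an object, as a linear map. -/
def actₗ (X : 𝒟) : Tan B F →ₗ[ℂ] Module.End ℂ (F.obj X) :=
  ∑ j, LinearMap.llcomp ℂ _ _ _ (fmap F ((B.decomp X).ι j)) ∘ₗ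
    LinearMap.lcomp ℂ _ (fmap F ((B.decomp X).p j)) ∘ₗ
      LinearMap.proj (φ := fun i : B.I => Module.End ℂ (F.obj (B.S i))) ((B.decomp X).c j)

theorem actₗ_apply (X : 𝒟) (h : Tan B F) : actₗ X h = ∑ j,
    fmap F ((B.decomp X).ι j) ∘ₗ h ((B.decomp X).c j) ∘ₗ fmap F ((B.decomp X).p j) := by
  simp only [actₗ, LinearMap.sum_apply]
  rfl

theorem sum_fmap_decomp (X : 𝒟) : ∑ j, fmap F ((B.decomp X).ι j) ∘ₗ fmap F ((B.decomp X).p j) =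
    LinearMap.id := by
  simp only [← fmap_comp, ← fmap_sum, (B.decomp X).sum_eq, fmap_id]

theorem actₗ_simple (i : B.I) (h : Tan B F) : actₗ (B.S i) h = h i := by
  simp only [actₗ_apply, ← fmap_simple]
  simp only [← LinearMap.comp_assoc, ← linearMap_sum_comp, sum_fmap_decomp]
  rfl

theorem fmap_actₗ {X Y : 𝒟} (f : X ⟶ Y) (h : Tan B F) :
    fmap F f ∘ₗ actₗ X h = actₗ Y h ∘ₗ fmap F f := by
  calc fmap F f ∘ₗ actₗ X h = ∑ k, ∑ j, fmap F ((B.decomp Y).ι k) ∘ₗ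
        (fmap F ((B.decomp X).ι j ≫ f ≫ (B.decomp Y).p k) ∘ₗ h ((B.decomp X).c j)) ∘ₗ
          fmap F ((B.decomp X).p j) := by
        have h1 : ∀ k, ∑ j, fmap F ((B.decomp Y).ι k) ∘ₗ
          (fmap F ((B.decomp X).ι j ≫ f ≫ (B.decomp Y).p k) ∘ₗ h ((B.decomp X).c j)) ∘ₗ
            fmap F ((B.decomp X).p j) = (fmap F ((B.decomp Y).ι k) ∘ₗ fmap F ((B.decomp Y).p k)) ∘ₗ
              fmap F f ∘ₗ actₗ X h := by
          intro k
          simp only [actₗ_apply, linearMap_comp_sum, fmap_comp, LinearMap.comp_assoc]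
        simp only [h1, ← linearMap_sum_comp, sum_fmap_decomp, LinearMap.id_comp]
    _ = actₗ Y h ∘ₗ fmap F f := by
        have h1 : ∀ k, ∑ j, fmap F ((B.decomp Y).ι k) ∘ₗ
          (fmap F ((B.decomp X).ι j ≫ f ≫ (B.decomp Y).p k) ∘ₗ h ((B.decomp X).c j)) ∘ₗ
            fmap F ((B.decomp X).p j) = fmap F ((B.decomp Y).ι k) ∘ₗ h ((B.decomp Y).c k) ∘ₗ
              fmap F ((B.decomp Y).p k) ∘ₗ fmap F f := by
          intro k
          simp only [fmap_simple]
          simp only [fmap_comp, LinearMap.comp_assoc]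
          simp only [← linearMap_comp_sum, sum_fmap_decomp, LinearMap.comp_id]
        rw [Finset.sum_congr rfl fun k _ => h1 k]
        simp only [actₗ_apply, linearMap_sum_comp, LinearMap.comp_assoc]

/-- A natural family of maps is determined by its values on the simple objects. -/
theorem natural_ext {G : 𝒟 → Type*} [∀ X, AddCommGroup (G X)] [∀ X, Module ℂ (G X)]
    (T T' : ∀ X, F.obj X →ₗ[ℂ] G X) (γ : ∀ {X Y : 𝒟}, (X ⟶ Y) → (G X →ₗ[ℂ] G Y))
    (hT : ∀ {X Y : 𝒟} (f : X ⟶ Y), T Y ∘ₗ fmap F f = γ f ∘ₗ T X)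
    (hT' : ∀ {X Y : 𝒟} (f : X ⟶ Y), T' Y ∘ₗ fmap F f = γ f ∘ₗ T' X)
    (h : ∀ i, T (B.S i) = T' (B.S i)) (X : 𝒟) : T X = T' X := by
  rw [← LinearMap.comp_id (T X), ← LinearMap.comp_id (T' X), ← sum_fmap_decomp (B := B),
    linearMap_comp_sum, linearMap_comp_sum]
  refine Finset.sum_congr rfl fun j _ => ?_
  rw [← LinearMap.comp_assoc, hT, h, ← hT', LinearMap.comp_assoc]

/-- The component of a natural endomorphism at an object. -/
def act (X : 𝒟) : Tan B F →ₐ[ℂ] Module.End ℂ (F.obj X) :=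
  AlgHom.ofLinearMap (actₗ X)
    (natural_ext (B := B) (fun X => actₗ X (1 : Tan B F)) (fun X => LinearMap.id)
      (fun f => fmap F f)
      (fun f => (fmap_actₗ f _).symm) (fun f => rfl) (fun i => by rw [actₗ_simple]; rfl) X)
    (fun h k => natural_ext (B := B) (fun X => actₗ X (h * k)) (fun X => actₗ X h ∘ₗ actₗ X k)
      (fun f => fmap F f) (fun f => (fmap_actₗ f _).symm)
      (fun f => by rw [LinearMap.comp_assoc, ← fmap_actₗ, ← LinearMap.comp_assoc, ← fmap_actₗ,
        LinearMap.comp_assoc])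
      (fun i => by simp only [actₗ_simple]; rfl) X)

theorem act_simple (i : B.I) (h : Tan B F) : act (B.S i) h = h i := actₗ_simple i h

theorem fmap_act {X Y : 𝒟} (f : X ⟶ Y) (h : Tan B F) (v : F.obj X) :
    fmap F f (act X h v) = act Y h (fmap F f v) := LinearMap.congr_fun (fmap_actₗ f h) v

/-- The orbit map of a vector. -/
def ev {X : 𝒟} (v : F.obj X) : Tan B F →ₗ[ℂ] F.obj X := (act X).toLinearMap.flip v

@[simp] theorem ev_apply {X : 𝒟} (v : F.obj X) (h : Tan B F) : ev v h = act X h v := rfl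

theorem ext_act {h k : Tan B F} (H : ∀ (X : 𝒟) (v : F.obj X), act X h v = act X k v) : h = k := by
  refine Tan.ext fun i => ?_
  have h1 := LinearMap.ext (H (B.S i))
  rwa [act_simple, act_simple] at h1

/-- Every natural family of endomorphisms is the action of an element. -/
theorem act_of_natural (T : ∀ X, F.obj X →ₗ[ℂ] F.obj X)
    (hT : ∀ {X Y : 𝒟} (f : X ⟶ Y), T Y ∘ₗ fmap F f = fmap F f ∘ₗ T X) (X : 𝒟) :
    act X (fun i => T (B.S i) : Tan B F) = T X :=
  natural_ext (B := B) (fun X => act X (fun i => T (B.S i) : Tan B F)) T (fun f => fmap F f)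
    (fun f => (fmap_actₗ f _).symm) hT (fun i => act_simple i _) X

variable (B F) in
/-- An element can be recovered linearly from its action on finitely many vectors. -/
theorem exists_recover : ∃ (ι : Type) (_ : Fintype ι) (X : ι → 𝒟) (v : ∀ a, F.obj (X a))
    (g : ∀ a, F.obj (X a) →ₗ[ℂ] Tan B F), ∑ a, g a ∘ₗ ev (v a) = LinearMap.id := by
  let b := fun i : B.I => Module.finBasis ℂ (F.obj (B.S i))
  let e : ∀ (i : B.I), Fin (Module.finrank ℂ (F.obj (B.S i))) →
      F.obj (B.S i) →ₗ[ℂ] Module.End ℂ (F.obj (B.S i)) := fun i k =>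
    LinearMap.smulRightₗ ((b i).coord k)
  refine ⟨Σ i : B.I, Fin (Module.finrank ℂ (F.obj (B.S i))), inferInstance, fun a => B.S a.1,
    fun a => b a.1 a.2, fun a => single a.1 ∘ₗ e a.1 a.2, ?_⟩
  refine LinearMap.ext fun h => ?_
  have h1 : ∀ i, ∑ k, e i k (h i (b i k)) = h i := fun i => (b i).ext fun k => by
    rw [LinearMap.sum_apply]
    simp [e, Finsupp.single_apply]
  have h2 := sum_single h
  rw [Fintype.sum_sigma]
  refine Eq.trans ?_ h2
  simp only [LinearMap.sum_apply]
  refine Finset.sum_congr rfl fun i _ => ?_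
  conv_rhs => rw [← h1 i]
  rw [map_sum]
  exact Finset.sum_congr rfl fun k _ => by
    rw [LinearMap.comp_apply, LinearMap.comp_apply, ev_apply, act_simple]

end Tan

end Algebra

/-! ### The bialgebra of natural endomorphisms -/

section TensorDensity

universe v v' v'' u u' u''

variable {𝒟 : Type u} [Category.{v} 𝒟] [Preadditive 𝒟] [Linear ℂ 𝒟] {B : SimpleBasis 𝒟}
  {F : 𝒟 ⥤ Vect} [F.Additive] [F.Linear ℂ]
  {𝒟' : Type u'} [Category.{v'} 𝒟'] [Preadditive 𝒟'] [Linear ℂ 𝒟'] {B' : SimpleBasis 𝒟'}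
  {F' : 𝒟' ⥤ Vect} [F'.Additive] [F'.Linear ℂ]
  {𝒟'' : Type u''} [Category.{v''} 𝒟''] [Preadditive 𝒟''] [Linear ℂ 𝒟''] {B'' : SimpleBasis 𝒟''}
  {F'' : 𝒟'' ⥤ Vect} [F''.Additive] [F''.Linear ℂ]

namespace Tan

/-- Elements of `H ⊗ H'` are determined by their actions. -/
theorem tensor_ext {R R' : Tan B F ⊗[ℂ] Tan B' F'}
    (h : ∀ (X : 𝒟) (Y : 𝒟') (v : F.obj X) (w : F'.obj Y),
      TensorProduct.map (ev v) (ev w) R = TensorProduct.map (ev v) (ev w) R') : R = R' := by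
  obtain ⟨ι, _, X, v, g, hg⟩ := exists_recover B F
  obtain ⟨ι', _, X', v', g', hg'⟩ := exists_recover B' F'
  have key : ∀ R : Tan B F ⊗[ℂ] Tan B' F', R = ∑ a, ∑ b, TensorProduct.map (g a) (g' b)
      (TensorProduct.map (ev (v a)) (ev (v' b)) R) := by
    intro R
    refine LinearMap.congr_fun (f := LinearMap.id) (g := ∑ a, ∑ b, TensorProduct.map (g a) (g' b) ∘ₗ
      TensorProduct.map (ev (v a)) (ev (v' b))) (TensorProduct.ext' fun x y => ?_) R |>.trans ?_
    · have hx := LinearMap.congr_fun hg x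
      have hy := LinearMap.congr_fun hg' y
      simp only [LinearMap.sum_apply, LinearMap.comp_apply, LinearMap.id_apply] at hx hy ⊢
      simp only [TensorProduct.map_tmul, ← TensorProduct.tmul_sum, ← TensorProduct.sum_tmul, hx, hy]
    · simp only [LinearMap.sum_apply, LinearMap.comp_apply]
  rw [key R, key R']
  simp only [h]

/-- Elements of `H ⊗ H' ⊗ H''` are determined by their actions. -/
theorem tensor_ext₃ {R R' : Tan B F ⊗[ℂ] (Tan B' F' ⊗[ℂ] Tan B'' F'')}
    (h : ∀ (X : 𝒟) (Y : 𝒟') (Z : 𝒟'') (v : F.obj X) (w : F'.obj Y) (u : F''.obj Z),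
      TensorProduct.map (ev v) (TensorProduct.map (ev w) (ev u)) R =
        TensorProduct.map (ev v) (TensorProduct.map (ev w) (ev u)) R') : R = R' := by
  obtain ⟨ι, _, X, v, g, hg⟩ := exists_recover B F
  obtain ⟨ι', _, X', v', g', hg'⟩ := exists_recover B' F'
  obtain ⟨ι'', _, X'', v'', g'', hg''⟩ := exists_recover B'' F''
  have key : ∀ R : Tan B F ⊗[ℂ] (Tan B' F' ⊗[ℂ] Tan B'' F''), R = ∑ a, ∑ b, ∑ c,
      TensorProduct.map (g a) (TensorProduct.map (g' b) (g'' c))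
      (TensorProduct.map (ev (v a)) (TensorProduct.map (ev (v' b)) (ev (v'' c))) R) := by
    intro R
    refine LinearMap.congr_fun (f := LinearMap.id) (g := ∑ a, ∑ b, ∑ c,
      TensorProduct.map (g a) (TensorProduct.map (g' b) (g'' c)) ∘ₗ
      TensorProduct.map (ev (v a)) (TensorProduct.map (ev (v' b)) (ev (v'' c))))
      (TensorProduct.ext (LinearMap.ext fun x => TensorProduct.ext' fun y z => ?_)) R |>.trans ?_
    · have hx := LinearMap.congr_fun hg x
      have hy := LinearMap.congr_fun hg' y
      have hz := LinearMap.congr_fun hg'' z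
      simp only [LinearMap.sum_apply, LinearMap.comp_apply, LinearMap.id_apply,
        LinearMap.compr₂ₛₗ_apply, TensorProduct.mk_apply] at hx hy hz ⊢
      simp only [TensorProduct.map_tmul, ← TensorProduct.tmul_sum, ← TensorProduct.sum_tmul, hx, hy,
        hz]
    · simp only [LinearMap.sum_apply, LinearMap.comp_apply]
  rw [key R, key R']
  simp only [h]

/-- The action of an element of `H ⊗ H'` on a pair of objects. -/
def act₂ (X : 𝒟) (Y : 𝒟') :
    Tan B F ⊗[ℂ] Tan B' F' →ₗ[ℂ] Module.End ℂ (F.obj X ⊗[ℂ] F'.obj Y) :=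
  TensorProduct.homTensorHomMap (RingHom.id ℂ) _ _ _ _ ∘ₗ
    TensorProduct.map (act X).toLinearMap (act Y).toLinearMap

theorem act₂_tmul (X : 𝒟) (Y : 𝒟') (h : Tan B F) (k : Tan B' F') :
    act₂ X Y (h ⊗ₜ k) = TensorProduct.map (act X h) (act Y k) := rfl

theorem act₂_apply {X : 𝒟} {Y : 𝒟'} (R : Tan B F ⊗[ℂ] Tan B' F') (v : F.obj X) (w : F'.obj Y) :
    act₂ X Y R (v ⊗ₜ w) = TensorProduct.map (ev v) (ev w) R := by
  induction R with
  | zero => simp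
  | add R R' h h' => simp only [map_add, LinearMap.add_apply, h, h']
  | tmul h k => rfl

theorem map_fmap_act₂ {X X' : 𝒟} {Y Y' : 𝒟'} (f : X ⟶ X') (g : Y ⟶ Y')
    (R : Tan B F ⊗[ℂ] Tan B' F') (t : F.obj X ⊗[ℂ] F'.obj Y) :
    act₂ X' Y' R (TensorProduct.map (fmap F f) (fmap F' g) t) =
      TensorProduct.map (fmap F f) (fmap F' g) (act₂ X Y R t) := by
  induction R with
  | zero => simp
  | add R R' h h' => simp only [map_add, LinearMap.add_apply, h, h']
  | tmul h k =>
    induction t with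
    | zero => simp
    | add t t' h h' => simp only [map_add, h, h']
    | tmul v w => simp [act₂_tmul, fmap_act]

theorem act₂_mul {X : 𝒟} {Y : 𝒟'} (R R' : Tan B F ⊗[ℂ] Tan B' F') :
    act₂ X Y (R * R') = act₂ X Y R * act₂ X Y R' := by
  induction R with
  | zero => simp
  | add R S h h' => simp only [map_add, add_mul, h, h']
  | tmul h k =>
    induction R' with
    | zero => simp
    | add R S h h' => simp only [map_add, mul_add, h, h']
    | tmul h' k' =>
      rw [Algebra.TensorProduct.tmul_mul_tmul]
      simp only [act₂_tmul, map_mul]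
      exact TensorProduct.map_mul _ _ _ _

theorem act₂_one {X : 𝒟} {Y : 𝒟'} : act₂ X Y (1 : Tan B F ⊗[ℂ] Tan B' F') = 1 := by
  rw [Algebra.TensorProduct.one_def, act₂_tmul, map_one, map_one]
  exact TensorProduct.map_one

/-- The element of `H ⊗ H'` with prescribed actions on pairs of simple objects. -/
def tensorElt : (∀ (i : B.I) (j : B'.I), Module.End ℂ (F.obj (B.S i) ⊗[ℂ] F'.obj (B'.S j))) →ₗ[ℂ]
    Tan B F ⊗[ℂ] Tan B' F' :=
  ∑ i, ∑ j, TensorProduct.map (single i) (single j) ∘ₗ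
    (homTensorHomEquiv ℂ (F.obj (B.S i)) (F'.obj (B'.S j)) (F.obj (B.S i))
      (F'.obj (B'.S j))).symm.toLinearMap ∘ₗ LinearMap.proj j ∘ₗ LinearMap.proj i

theorem act₂_single {i k : B.I} {j l : B'.I}
    (t : Module.End ℂ (F.obj (B.S i)) ⊗[ℂ] Module.End ℂ (F'.obj (B'.S j))) (h : ¬ (i = k ∧ j = l)) :
    act₂ (B.S k) (B'.S l) (TensorProduct.map (single i) (single j) t) = 0 := by
  induction t with
  | zero => simp
  | add t s ht hs => simp only [map_add, ht, hs, add_zero]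
  | tmul a b =>
    rw [TensorProduct.map_tmul, act₂_tmul, act_simple, act_simple]
    by_cases hi : k = i
    · have hj : l ≠ j := fun e => h ⟨hi.symm, e.symm⟩
      rw [single_ne hj, TensorProduct.map_zero_right]
    · rw [single_ne hi, TensorProduct.map_zero_left]

theorem act₂_single_same {i : B.I} {j : B'.I}
    (t : Module.End ℂ (F.obj (B.S i)) ⊗[ℂ] Module.End ℂ (F'.obj (B'.S j))) :
    act₂ (B.S i) (B'.S j) (TensorProduct.map (single i) (single j) t) =
      homTensorHomEquiv ℂ _ _ _ _ t := by
  induction t with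
  | zero => simp
  | add t s ht hs => simp only [map_add, ht, hs]
  | tmul a b =>
    rw [TensorProduct.map_tmul, act₂_tmul, act_simple, act_simple, single_same, single_same]
    simp [homTensorHomEquiv_apply]

theorem act₂_tensorElt_simple
    (T : ∀ (i : B.I) (j : B'.I), Module.End ℂ (F.obj (B.S i) ⊗[ℂ] F'.obj (B'.S j))) (k : B.I)
    (l : B'.I) : act₂ (B.S k) (B'.S l) (tensorElt T) = T k l := by
  simp only [tensorElt, LinearMap.sum_apply, map_sum]
  rw [Finset.sum_eq_single k, Finset.sum_eq_single l]
  · simp only [LinearMap.comp_apply]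
    rw [act₂_single_same]
    exact LinearEquiv.apply_symm_apply _ _
  · intro j _ hj
    exact act₂_single _ fun h => hj h.2
  · simp
  · intro i _ hi
    exact Finset.sum_eq_zero fun j _ => act₂_single _ fun h => hi h.1
  · simp

/-- Every family of endomorphisms that is natural in two variables is the action of an element of
`H ⊗ H'`. -/
theorem act₂_tensorElt (T : ∀ (X : 𝒟) (Y : 𝒟'), Module.End ℂ (F.obj X ⊗[ℂ] F'.obj Y))
    (hT : ∀ {X X' : 𝒟} {Y Y' : 𝒟'} (f : X ⟶ X') (g : Y ⟶ Y') (v : F.obj X) (w : F'.obj Y),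
      T X' Y' (fmap F f v ⊗ₜ fmap F' g w) =
        TensorProduct.map (fmap F f) (fmap F' g) (T X Y (v ⊗ₜ w))) (X : 𝒟) (Y : 𝒟') :
    act₂ X Y (tensorElt (B := B) (B' := B') fun i j => T (B.S i) (B'.S j)) = T X Y := by
  set R := tensorElt (B := B) (B' := B') fun i j => T (B.S i) (B'.S j) with hR
  have hn : ∀ {X X' : 𝒟} {Y Y' : 𝒟'} (f : X ⟶ X') (g : Y ⟶ Y') (v : F.obj X) (w : F'.obj Y),
      act₂ X' Y' R (fmap F f v ⊗ₜ fmap F' g w) =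
        TensorProduct.map (fmap F f) (fmap F' g) (act₂ X Y R (v ⊗ₜ w)) := fun f g v w => by
    rw [← map_fmap_act₂, TensorProduct.map_tmul]
  have step1 : ∀ (i : B.I) (v : F.obj (B.S i)) (Y : 𝒟'),
      act₂ (B.S i) Y R ∘ₗ TensorProduct.mk ℂ _ _ v = T (B.S i) Y ∘ₗ TensorProduct.mk ℂ _ _ v := by
    intro i v
    refine natural_ext (B := B') (F := F') (G := fun Y => F.obj (B.S i) ⊗[ℂ] F'.obj Y) _ _
      (fun g => TensorProduct.map LinearMap.id (fmap F' g)) ?_ ?_ ?_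
    · intro Y Y' g
      ext w
      have := hn (𝟙 (B.S i)) g v w
      rw [fmap_id] at this
      exact this
    · intro Y Y' g
      ext w
      have := hT (𝟙 (B.S i)) g v w
      rw [fmap_id] at this
      exact this
    · intro j
      rw [hR, act₂_tensorElt_simple]
  have step2 : ∀ (w : F'.obj Y) (X : 𝒟), act₂ X Y R ∘ₗ (TensorProduct.mk ℂ _ _).flip w =
      T X Y ∘ₗ (TensorProduct.mk ℂ _ _).flip w := by
    intro w
    refine natural_ext (B := B) (F := F) (G := fun X => F.obj X ⊗[ℂ] F'.obj Y) _ _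
      (fun f => TensorProduct.map (fmap F f) LinearMap.id) ?_ ?_ ?_
    · intro X X' f
      ext v
      have := hn f (𝟙 Y) v w
      rw [fmap_id] at this
      exact this
    · intro X X' f
      ext v
      have := hT f (𝟙 Y) v w
      rw [fmap_id] at this
      exact this
    · intro i
      ext v
      exact LinearMap.congr_fun (step1 i v Y) w
  exact TensorProduct.ext' fun v w => LinearMap.congr_fun (step2 w X) v

end Tan

end TensorDensity

section Bialgebra

universe v u

variable {𝒟 : Type u} [Category.{v} 𝒟] [Preadditive 𝒟] [Linear ℂ 𝒟] [MonoidalCategory 𝒟]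
  (B : SimpleBasis 𝒟) (F : 𝒟 ⥤ Vect) [F.Additive] [F.Linear ℂ] [F.Monoidal]

namespace Tan

/-- The comultiplication describes the action on tensor products, the counit the action on the
unit object. -/
instance : CoalgebraStruct ℂ (Tan B F) where
  comul := tensorElt ∘ₗ LinearMap.pi fun i => LinearMap.pi fun j =>
    (mu F (B.S i) (B.S j)).symm.conj.toLinearMap ∘ₗ (act (B.S i ⊗ B.S j)).toLinearMap
  counit := (unitEquiv F).symm.toLinearMap ∘ₗ ev (unitEquiv F 1)

variable {B F}

/-- The comultiplication describes the action on tensor products. -/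
theorem act₂_comul (X Y : 𝒟) (h : Tan B F) : act₂ X Y (Coalgebra.comul (R := ℂ) h) =
    (mu F X Y).symm.conj (act (X ⊗ Y) h) := by
  refine act₂_tensorElt (B := B) (B' := B)
    (fun X Y => (mu F X Y).symm.conj (act (X ⊗ Y) h)) ?_ X Y
  intro X X' Y Y' f g v w
  have e : ∀ (X Y : 𝒟) (t), (mu F X Y).symm.conj (act (X ⊗ Y) h) t =
    (mu F X Y).symm (act (X ⊗ Y) h (mu F X Y t)) := fun _ _ _ => rfl
  rw [e, e, LinearEquiv.symm_apply_eq, ← mu_natural, ← fmap_act]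
  have : ∀ t : F.obj X ⊗[ℂ] F.obj Y, mu F X' Y' (TensorProduct.map (fmap F f) (fmap F g) t) =
      fmap F (f ⊗ₘ g) (mu F X Y t) := fun t => by
    induction t with
    | zero => simp
    | add s t hs ht => simp only [map_add, hs, ht]
    | tmul v w => rw [mu_natural]; rfl
  rw [this, LinearEquiv.apply_symm_apply]

theorem mu_map_ev_comul {X Y : 𝒟} (v : F.obj X) (w : F.obj Y) (h : Tan B F) :
    mu F X Y (TensorProduct.map (ev v) (ev w) (Coalgebra.comul (R := ℂ) h)) =
      act (X ⊗ Y) h (mu F X Y (v ⊗ₜ w)) := by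
  rw [← act₂_apply, act₂_comul]
  exact LinearEquiv.apply_symm_apply _ _

/-- The counit describes the action on the unit object. -/
theorem act_unit (h : Tan B F) (c : ℂ) : act (𝟙_ 𝒟) h (unitEquiv F c) =
    unitEquiv F (Coalgebra.counit (R := ℂ) h * c) := by
  have h1 : Coalgebra.counit (R := ℂ) h = (unitEquiv F).symm (act (𝟙_ 𝒟) h (unitEquiv F 1)) := rfl
  have h2 : unitEquiv F c = c • unitEquiv F 1 := by rw [← map_smul, smul_eq_mul, mul_one]
  rw [mul_comm, ← smul_eq_mul, map_smul, h1, LinearEquiv.apply_symm_apply, h2, map_smul]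

instance : Coalgebra ℂ (Tan B F) where
  coassoc := by
    refine LinearMap.ext fun h => tensor_ext₃ fun X Y Z u v w => ?_
    -- both sides become the action of `h` on `u ⊗ (v ⊗ w)`
    have inj : Function.Injective ((mu F X (Y ⊗ Z)).toLinearMap ∘ₗ
        (mu F Y Z).toLinearMap.lTensor (F.obj X)) :=
      (mu F X (Y ⊗ Z)).injective.comp
        (LinearEquiv.lTensor (F.obj X) (mu F Y Z)).injective
    apply inj
    have hR : ∀ t : Tan B F ⊗[ℂ] Tan B F, (mu F Y Z).toLinearMap.lTensor (F.obj X)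
        (TensorProduct.map (ev u) (TensorProduct.map (ev v) (ev w))
          (Coalgebra.comul.lTensor (Tan B F) t)) =
        TensorProduct.map (ev u) (ev (mu F Y Z (v ⊗ₜ w))) t := by
      intro t
      induction t with
      | zero => simp
      | add s t hs ht => simp only [map_add, hs, ht]
      | tmul x y =>
        simp only [LinearMap.lTensor_tmul, TensorProduct.map_tmul, LinearEquiv.coe_coe]
        rw [mu_map_ev_comul, ev_apply, ev_apply]
    have hL : ∀ t : Tan B F ⊗[ℂ] Tan B F, mu F X (Y ⊗ Z) ((mu F Y Z).toLinearMap.lTensor (F.obj X)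
        (TensorProduct.map (ev u) (TensorProduct.map (ev v) (ev w))
          (TensorProduct.assoc ℂ _ _ _ (Coalgebra.comul.rTensor (Tan B F) t)))) =
        fmap F (α_ X Y Z).hom (mu F (X ⊗ Y) Z
          (TensorProduct.map (ev (mu F X Y (u ⊗ₜ v))) (ev w) t)) := by
      intro t
      induction t with
      | zero => simp
      | add s t hs ht => simp only [map_add, hs, ht]
      | tmul x y =>
        simp only [LinearMap.rTensor_tmul, TensorProduct.map_tmul]
        rw [ev_apply, ← mu_map_ev_comul]
        induction Coalgebra.comul (R := ℂ) x with
        | zero => simp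
        | add s t hs ht => simp only [map_add, TensorProduct.add_tmul, hs, ht]
        | tmul a b =>
          simp only [TensorProduct.assoc_tmul, TensorProduct.map_tmul, LinearMap.lTensor_tmul,
            LinearEquiv.coe_coe, mu_assoc]
    simp only [LinearMap.comp_apply, LinearEquiv.coe_coe]
    rw [hL, hR, mu_map_ev_comul, mu_map_ev_comul, fmap_act, mu_assoc]
  rTensor_counit_comp_comul := by
    refine LinearMap.ext fun h => (TensorProduct.lid ℂ (Tan B F)).injective ?_
    refine ext_act fun X v => ?_
    have key : ∀ t : Tan B F ⊗[ℂ] Tan B F,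
        act X (TensorProduct.lid ℂ (Tan B F) (Coalgebra.counit.rTensor (Tan B F) t)) v =
        fmap F (λ_ X).hom (mu F (𝟙_ 𝒟) X
          (TensorProduct.map (ev (unitEquiv F 1)) (ev v) t)) := by
      intro t
      induction t with
      | zero => simp
      | add s t hs ht => simp only [map_add, LinearMap.add_apply, hs, ht]
      | tmul a b =>
        rw [TensorProduct.map_tmul, ev_apply, act_unit]
        simp only [mul_one, LinearMap.rTensor_tmul, TensorProduct.lid_tmul, map_smul,
          LinearMap.smul_apply, ev_apply]
        have h2 : ∀ c : ℂ, unitEquiv F c = c • unitEquiv F 1 := fun c => by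
          rw [← map_smul, smul_eq_mul, mul_one]
        rw [h2, ← TensorProduct.smul_tmul', map_smul, map_smul, mu_left_unit]
    rw [LinearMap.comp_apply, key, mu_map_ev_comul, fmap_act, mu_left_unit]
    simp
  lTensor_counit_comp_comul := by
    refine LinearMap.ext fun h => (TensorProduct.rid ℂ (Tan B F)).injective ?_
    refine ext_act fun X v => ?_
    have key : ∀ t : Tan B F ⊗[ℂ] Tan B F,
        act X (TensorProduct.rid ℂ (Tan B F) (Coalgebra.counit.lTensor (Tan B F) t)) v =
        fmap F (ρ_ X).hom (mu F X (𝟙_ 𝒟)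
          (TensorProduct.map (ev v) (ev (unitEquiv F 1)) t)) := by
      intro t
      induction t with
      | zero => simp
      | add s t hs ht => simp only [map_add, LinearMap.add_apply, hs, ht]
      | tmul a b =>
        rw [TensorProduct.map_tmul, ev_apply, ev_apply, act_unit]
        simp only [mul_one, LinearMap.lTensor_tmul, TensorProduct.rid_tmul, map_smul,
          LinearMap.smul_apply]
        have h2 : ∀ c : ℂ, unitEquiv F c = c • unitEquiv F 1 := fun c => by
          rw [← map_smul, smul_eq_mul, mul_one]
        rw [h2, TensorProduct.tmul_smul, map_smul, map_smul, mu_right_unit]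
    rw [LinearMap.comp_apply, key, mu_map_ev_comul, fmap_act, mu_right_unit]
    simp

instance : Bialgebra ℂ (Tan B F) := Bialgebra.mk' ℂ (Tan B F)
  (by
    apply (unitEquiv F).injective
    have := act_unit (1 : Tan B F) 1
    rw [map_one, mul_one] at this
    exact this.symm)
  (by
    intro a b
    apply (unitEquiv F).injective
    have := act_unit (a * b : Tan B F) 1
    rw [map_mul, Module.End.mul_apply, act_unit, act_unit] at this
    simpa [mul_comm] using this.symm)
  (by
    refine tensor_ext fun X Y v w => ?_
    rw [← act₂_apply, ← act₂_apply, act₂_comul, act₂_one, map_one]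
    exact LinearMap.congr_fun (LinearEquiv.conj_id _) _)
  (by
    intro a b
    refine tensor_ext fun X Y v w => ?_
    rw [← act₂_apply, ← act₂_apply, act₂_mul]
    simp only [act₂_comul]
    rw [map_mul, Module.End.mul_eq_comp, LinearEquiv.conj_comp]
    rfl)

end Tan

end Bialgebra

/-! ### The antipode, and modules over the natural endomorphisms -/

section Antipode

universe v u

variable {𝒟 : Type u} [Category.{v} 𝒟] [Preadditive 𝒟] [Linear ℂ 𝒟] [MonoidalCategory 𝒟]
  [RightRigidCategory 𝒟] (B : SimpleBasis 𝒟) (F : 𝒟 ⥤ Vect) [F.Additive] [F.Linear ℂ] [F.Monoidal]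

/-- The image of an object as the dual vector space of the image of its dual. -/
def predualEquiv (X : 𝒟) : F.obj X ≃ₗ[ℂ] Module.Dual ℂ (F.obj (Xᘁ)) :=
  LinearEquiv.ofInjectiveOfFinrankEq (evPair F X).flip (evPair_flip_injective X) <| by
    rw [Subspace.dual_finrank_eq, (dualEquiv F X).finrank_eq, Subspace.dual_finrank_eq]

namespace Tan

variable {B F}

/-- The transpose of the action on the dual object. -/
def coact (X : 𝒟) : Tan B F →ₗ[ℂ] Module.End ℂ (F.obj X) :=
  (predualEquiv F X).symm.conj.toLinearMap ∘ₗ Module.Dual.transpose ∘ₗ (act (Xᘁ)).toLinearMap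

theorem evPair_coact {X : 𝒟} (h : Tan B F) (f : F.obj (Xᘁ)) (v : F.obj X) :
    evPair F X f (coact X h v) = evPair F X (act (Xᘁ) h f) v := by
  have h1 : ∀ w, predualEquiv F X w f = evPair F X f w := fun _ => rfl
  have h2 : coact X h v = (predualEquiv F X).symm
    (Module.Dual.transpose (act (Xᘁ) h) (predualEquiv F X v)) := rfl
  rw [← h1, h2, LinearEquiv.apply_symm_apply]
  rfl

/-- The antipode is determined by `⟨f, S(h) v⟩ = ⟨h f, v⟩`. -/
def antipode : Tan B F →ₗ[ℂ] Tan B F where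
  toFun h := fun i => coact (B.S i) h
  map_add' h k := by ext1 i; simp only [map_add]; rfl
  map_smul' c h := by ext1 i; simp only [map_smul]; rfl

theorem act_antipode (X : 𝒟) (h : Tan B F) : act X (antipode h) = coact X h := by
  refine act_of_natural (B := B) (fun X => coact X h) ?_ X
  intro X Y f
  refine LinearMap.ext fun v => evPair_flip_injective (F := F) Y (LinearMap.ext fun g => ?_)
  simp only [LinearMap.flip_apply, LinearMap.comp_apply]
  rw [evPair_coact, ← evPair_map f _ v, ← evPair_map f g, evPair_coact, fmap_act]

theorem evPair_antipode {X : 𝒟} (h : Tan B F) (f : F.obj (Xᘁ)) (v : F.obj X) :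
    evPair F X f (act X (antipode h) v) = evPair F X (act (Xᘁ) h f) v := by
  rw [act_antipode, evPair_coact]

theorem act₂_comul_coevElt (X : 𝒟) (h : Tan B F) :
    act₂ X (Xᘁ) (Coalgebra.comul (R := ℂ) h) (coevElt F X) =
      Coalgebra.counit (R := ℂ) h • coevElt F X := by
  rw [act₂_comul]
  change (mu F X (Xᘁ)).symm (act (X ⊗ Xᘁ) h (mu F X (Xᘁ) (coevElt F X))) = _
  have hc : mu F X (Xᘁ) (coevElt F X) = fmap F (η_ X (Xᘁ)) (unitEquiv F 1) := by simp [coevElt]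
  rw [hc, ← fmap_act, act_unit, LinearEquiv.symm_apply_eq, map_smul, hc, ← map_smul, ← map_smul,
    smul_eq_mul]

instance : HopfAlgebra ℂ (Tan B F) where
  antipode := antipode
  mul_antipode_rTensor_comul := by
    refine LinearMap.ext fun h => ext_act fun X v =>
      evPair_flip_injective (F := F) X (LinearMap.ext fun f => ?_)
    have key : ∀ t : Tan B F ⊗[ℂ] Tan B F,
        evPair F X f (act X (LinearMap.mul' ℂ (Tan B F) (antipode.rTensor (Tan B F) t)) v) =
          (unitEquiv F).symm (fmap F (ε_ X (Xᘁ)) (mu F (Xᘁ) X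
            (TensorProduct.map (ev f) (ev v) t))) := by
      intro t
      induction t with
      | zero => simp
      | add s t hs ht => simp only [map_add, LinearMap.add_apply, hs, ht]
      | tmul a b =>
        simp only [LinearMap.rTensor_tmul, LinearMap.mul'_apply, map_mul, Module.End.mul_apply]
        rw [evPair_antipode]
        rfl
    simp only [LinearMap.flip_apply, LinearMap.comp_apply]
    rw [key, mu_map_ev_comul, fmap_act]
    have h2 : fmap F (ε_ X (Xᘁ)) (mu F (Xᘁ) X (f ⊗ₜ v)) = unitEquiv F (evPair F X f v) := by
      rw [evPair_apply, LinearEquiv.apply_symm_apply]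
    rw [h2, act_unit, LinearEquiv.symm_apply_apply]
    simp [Algebra.algebraMap_eq_smul_one]
  mul_antipode_lTensor_comul := by
    refine LinearMap.ext fun h => ext_act fun X v => ?_
    have key : ∀ t : Tan B F ⊗[ℂ] Tan B F,
        act X (LinearMap.mul' ℂ (Tan B F) (antipode.lTensor (Tan B F) t)) v =
          TensorProduct.rid ℂ _ ((LinearMap.lTensor (F.obj X) ((evPair F X).flip v))
            (act₂ X (Xᘁ) t (coevElt F X))) := by
      intro t
      induction t with
      | zero => simp
      | add s t hs ht => simp only [map_add, LinearMap.add_apply, hs, ht]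
      | tmul a b =>
        simp only [LinearMap.lTensor_tmul, LinearMap.mul'_apply, map_mul, Module.End.mul_apply]
        conv_lhs => rw [← coevElt_contract_left (act X (antipode b) v)]
        rw [act₂_tmul]
        generalize coevElt F X = c
        induction c with
        | zero => simp
        | add s t hs ht => simp only [map_add, hs, ht]
        | tmul x f =>
          simp only [LinearMap.lTensor_tmul, TensorProduct.rid_tmul, TensorProduct.map_tmul,
            LinearMap.flip_apply, map_smul, evPair_antipode]
    simp only [LinearMap.comp_apply]
    rw [key, act₂_comul_coevElt, map_smul, map_smul, coevElt_contract_left]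
    simp [Algebra.algebraMap_eq_smul_one]

/-- The compatibility of the fibre functor with the pivotal structure makes the antipode an
involution. -/
theorem antipode_antipode {ω : PivotalStructure 𝒟}
    (hω : ∀ (X : 𝒟) (f : F.obj (Xᘁ)) (v : F.obj X),
      evPair F (Xᘁ) (fmap F (ω.iso X).inv v) f = evPair F X f v) (h : Tan B F) :
    HopfAlgebra.antipode ℂ (HopfAlgebra.antipode ℂ h) = h := by
  refine ext_act fun X v => evPair_flip_injective (F := F) X (LinearMap.ext fun f => ?_)
  change evPair F X f (act X (antipode (antipode h)) v) = evPair F X f (act X h v)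
  rw [evPair_antipode, ← hω, evPair_antipode, ← fmap_act, hω]

end Tan

end Antipode

section Modules

universe v u

variable {𝒟 : Type u} [Category.{v} 𝒟] [Preadditive 𝒟] [Linear ℂ 𝒟] {B : SimpleBasis 𝒟}
  {F : 𝒟 ⥤ Vect} [F.Additive] [F.Linear ℂ]

namespace Tan

/-- A functor that does not annihilate simple objects is faithful. -/
theorem fmap_injective (hF : ∀ i, Nontrivial (F.obj (B.S i))) {X Y : 𝒟} {f g : X ⟶ Y}
    (h : fmap F f = fmap F g) : f = g := by
  have hs : ∀ (i j : B.I) (k : B.S i ⟶ B.S j), fmap F k = 0 → k = 0 := by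
    intro i j k hk
    by_cases hij : i = j
    · subst hij
      obtain ⟨c, rfl⟩ := B.hom_self _ k
      rw [fmap_smul, fmap_id] at hk
      obtain ⟨w, hw⟩ := exists_ne (0 : F.obj (B.S i))
      have h0 : c • w = 0 := LinearMap.congr_fun hk w
      rw [(smul_eq_zero.1 h0).resolve_right hw, zero_smul]
    · exact B.hom_ne hij k
  have hd : ∀ j k, (B.decomp X).ι j ≫ (f - g) ≫ (B.decomp Y).p k = 0 := by
    intro j k
    refine hs _ _ _ ?_
    rw [Preadditive.sub_comp, Preadditive.comp_sub, sub_eq_add_neg, fmap_add,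
      ← neg_one_smul ℂ (_ ≫ g ≫ _), fmap_smul]
    simp only [fmap_comp, h]
    simp
  have : f - g = 0 := by
    calc f - g = (∑ j, (B.decomp X).p j ≫ (B.decomp X).ι j) ≫ (f - g) ≫
          (∑ k, (B.decomp Y).p k ≫ (B.decomp Y).ι k) := by
          rw [(B.decomp X).sum_eq, (B.decomp Y).sum_eq, Category.id_comp, Category.comp_id]
      _ = ∑ k, ∑ j, (B.decomp X).p j ≫ ((B.decomp X).ι j ≫ (f - g) ≫ (B.decomp Y).p k) ≫
          (B.decomp Y).ι k := by
          simp only [Preadditive.comp_sum, Preadditive.sum_comp, Category.assoc]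
      _ = 0 := by simp only [hd, zero_comp, comp_zero, Finset.sum_const_zero]
  exact sub_eq_zero.1 this

/-- Maps between images of simple objects that commute with all natural endomorphisms come from
morphisms: endomorphism algebras of vector spaces are central, and there are natural endomorphisms
that are supported on one simple object. -/
theorem exists_fmap_eq_of_simple {i j : B.I} (g : F.obj (B.S i) →ₗ[ℂ] F.obj (B.S j))
    (hg : ∀ (h : Tan B F) v, g (h i v) = h j (g v)) : ∃ f : B.S i ⟶ B.S j, fmap F f = g := by
  by_cases hij : i = j
  · subst hij
    have hc : g ∈ Subalgebra.center ℂ (Module.End ℂ (F.obj (B.S i))) := by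
      rw [Subalgebra.mem_center_iff]
      intro a
      refine LinearMap.ext fun v => ?_
      have := hg (single i a) v
      rw [single_same] at this
      exact this.symm
    rw [Algebra.IsCentral.center_eq_bot] at hc
    obtain ⟨c, hc⟩ := Algebra.mem_bot.1 hc
    refine ⟨c • 𝟙 _, ?_⟩
    rw [fmap_smul, fmap_id, ← hc, Algebra.algebraMap_eq_smul_one]
    rfl
  · refine ⟨0, ?_⟩
    rw [fmap_zero]
    refine LinearMap.ext fun v => ?_
    have := hg (single i 1) v
    rw [single_same, single_ne (fun e => hij e.symm)] at this
    exact this.symm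

/-- Maps that commute with all natural endomorphisms come from morphisms. -/
theorem exists_fmap_eq {X Y : 𝒟} (g : F.obj X →ₗ[ℂ] F.obj Y)
    (hg : ∀ (h : Tan B F) v, g (act X h v) = act Y h (g v)) : ∃ f : X ⟶ Y, fmap F f = g := by
  have h1 : ∀ j k, ∃ f : B.S ((B.decomp X).c j) ⟶ B.S ((B.decomp Y).c k), fmap F f =
      fmap F ((B.decomp Y).p k) ∘ₗ g ∘ₗ fmap F ((B.decomp X).ι j) := by
    intro j k
    refine exists_fmap_eq_of_simple _ fun h v => ?_
    have h1 := act_simple ((B.decomp X).c j) h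
    have h2 := act_simple ((B.decomp Y).c k) h
    rw [← h1, ← h2]
    simp only [LinearMap.comp_apply]
    rw [fmap_act, hg, fmap_act]
  choose f hf using h1
  refine ⟨∑ j, ∑ k, (B.decomp X).p j ≫ f j k ≫ (B.decomp Y).ι k, ?_⟩
  simp only [fmap_sum, fmap_comp, hf]
  have h2 : ∀ j, ∑ k, (fmap F ((B.decomp Y).ι k) ∘ₗ fmap F ((B.decomp Y).p k) ∘ₗ g ∘ₗ
      fmap F ((B.decomp X).ι j)) ∘ₗ fmap F ((B.decomp X).p j) =
      g ∘ₗ fmap F ((B.decomp X).ι j) ∘ₗ fmap F ((B.decomp X).p j) := by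
    intro j
    simp only [← LinearMap.comp_assoc, ← linearMap_sum_comp, sum_fmap_decomp, LinearMap.id_comp]
  refine (Finset.sum_congr rfl fun j _ => h2 j).trans ?_
  rw [← linearMap_comp_sum, sum_fmap_decomp, LinearMap.comp_id]

/-- The canonical map from the image of a simple object to a module that corresponds to a vector
of the module. -/
def orbitMap {V : Type} [AddCommGroup V] [Module ℂ V] (ρ : Tan B F →ₐ[ℂ] Module.End ℂ V) (i : B.I)
    (φ : Module.Dual ℂ (F.obj (B.S i))) (u : V) : F.obj (B.S i) →ₗ[ℂ] V :=
  LinearMap.applyₗ u ∘ₗ ρ.toLinearMap ∘ₗ single i ∘ₗ LinearMap.smulRightₗ φ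

theorem orbitMap_apply {V : Type} [AddCommGroup V] [Module ℂ V]
    (ρ : Tan B F →ₐ[ℂ] Module.End ℂ V) (i : B.I) (φ : Module.Dual ℂ (F.obj (B.S i))) (u : V)
    (w : F.obj (B.S i)) : orbitMap ρ i φ u w = ρ (single i (φ.smulRight w)) u := rfl

theorem orbitMap_act {V : Type} [AddCommGroup V] [Module ℂ V]
    (ρ : Tan B F →ₐ[ℂ] Module.End ℂ V) (i : B.I) (φ : Module.Dual ℂ (F.obj (B.S i))) (u : V)
    (h : Tan B F) (w : F.obj (B.S i)) :
    orbitMap ρ i φ u (act (B.S i) h w) = ρ h (orbitMap ρ i φ u w) := by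
  rw [orbitMap_apply, orbitMap_apply, ← Module.End.mul_apply, ← map_mul, mul_single, act_simple]
  have : h i * φ.smulRight w = φ.smulRight (h i w) := by ext; simp
  rw [this]

/-- Every finite-dimensional module over the algebra of natural endomorphisms is the image of an
object. -/
theorem exists_obj_equiv [HasFiniteBiproducts 𝒟] (hF : ∀ i, Nontrivial (F.obj (B.S i))) {V : Type}
    [AddCommGroup V] [Module ℂ V] [Module.Finite ℂ V] (ρ : Tan B F →ₐ[ℂ] Module.End ℂ V) :
    ∃ (X : 𝒟) (e : F.obj X ≃ₗ[ℂ] V), ∀ (h : Tan B F) v, e (act X h v) = ρ h (e v) := by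
  classical
  -- `P i` is the action of an idempotent of rank one; a basis of its range counts the copies of the
  -- `i`-th simple object in `V`, and `ι a`, `π a` are the inclusion and projection of a copy
  have hw : ∀ i, ∃ (w : F.obj (B.S i)) (φ : Module.Dual ℂ (F.obj (B.S i))), φ w = 1 := fun i => by
    obtain ⟨w, hw⟩ := exists_ne (0 : F.obj (B.S i))
    obtain ⟨φ, hφ⟩ := Module.Projective.exists_dual_eq_one ℂ hw
    exact ⟨w, φ, hφ⟩
  choose w φ hφ using hw
  let P : B.I → Module.End ℂ V := fun i => ρ (single i ((φ i).smulRight (w i)))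
  let b := fun i => Module.finBasis ℂ (LinearMap.range (P i))
  let e := fun i : B.I => Module.finBasis ℂ (F.obj (B.S i))
  let J := Σ i : B.I, Fin (Module.finrank ℂ (LinearMap.range (P i)))
  let ι : ∀ a : J, F.obj (B.S a.1) →ₗ[ℂ] V := fun a => orbitMap ρ a.1 (φ a.1) (b a.1 a.2)
  let π : ∀ a : J, V →ₗ[ℂ] F.obj (B.S a.1) := fun a => ∑ k,
    ((b a.1).coord a.2 ∘ₗ (P a.1).rangeRestrict ∘ₗ
      ρ (single a.1 (((e a.1).coord k).smulRight (w a.1)))).smulRight (e a.1 k)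
  have hmul : ∀ (i : B.I) (ψ ψ' : Module.Dual ℂ (F.obj (B.S i))) (x x' : F.obj (B.S i)) (v : V),
      ρ (single i (ψ.smulRight x)) (ρ (single i (ψ'.smulRight x')) v) =
        ψ x' • ρ (single i (ψ'.smulRight x)) v := by
    intro i ψ ψ' x x' v
    have : ψ.smulRight x * ψ'.smulRight x' = ψ x' • ψ'.smulRight x := by
      ext; simp [smul_smul, mul_comm]
    rw [← Module.End.mul_apply, ← map_mul, single_mul_single, this, map_smul, map_smul,
      LinearMap.smul_apply]
  have hP : ∀ (i : B.I) (u : LinearMap.range (P i)), P i u = u := by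
    rintro i ⟨_, v, rfl⟩
    change P i (P i v) = P i v
    simp only [P, hmul, hφ, one_smul]
  have hr : ∀ i v, ((P i).rangeRestrict v : V) = P i v := fun _ _ => rfl
  have hπ : ∀ a v, π a v = ∑ k, (b a.1).coord a.2 ((P a.1).rangeRestrict
      (ρ (single a.1 (((e a.1).coord k).smulRight (w a.1))) v)) • e a.1 k := fun a v => by
    simp only [π, LinearMap.sum_apply, LinearMap.smulRight_apply, LinearMap.comp_apply]
  have hsum : ∑ a, ι a ∘ₗ π a = LinearMap.id := by
    refine LinearMap.ext fun v => ?_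
    rw [Fintype.sum_sigma, LinearMap.sum_apply]
    have h1 : ∀ i, (∑ l, ι ⟨i, l⟩ ∘ₗ π ⟨i, l⟩) v = ρ (single i 1) v := by
      intro i
      have h2 : ∀ k, ∑ l, (b i).coord l ((P i).rangeRestrict
          (ρ (single i (((e i).coord k).smulRight (w i))) v)) • ι ⟨i, l⟩ (e i k) =
            ρ (single i (((e i).coord k).smulRight (e i k))) v := by
        intro k
        have h3 := (b i).sum_repr ((P i).rangeRestrict
          (ρ (single i (((e i).coord k).smulRight (w i))) v))
        have h4 := congrArg (fun u : LinearMap.range (P i) =>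
          ρ (single i ((φ i).smulRight (e i k))) (u : V)) h3
        simp only [AddSubmonoidClass.coe_finsetSum, map_sum, Submodule.coe_smul, map_smul] at h4
        refine h4.trans ?_
        simp only [hr, P, hmul, hφ, one_smul]
      have hπ' : ∀ l, π ⟨i, l⟩ v = ∑ k, (b i).coord l ((P i).rangeRestrict
          (ρ (single i (((e i).coord k).smulRight (w i))) v)) • e i k := fun l => hπ ⟨i, l⟩ v
      simp only [LinearMap.sum_apply, LinearMap.comp_apply, hπ', map_sum, map_smul]
      rw [Finset.sum_comm]
      refine (Finset.sum_congr rfl fun k _ => h2 k).trans ?_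
      rw [← LinearMap.sum_apply, ← map_sum, ← map_sum]
      congr 3
      refine (e i).ext fun m => ?_
      simp [LinearMap.sum_apply, Finsupp.single_apply]
    simp only [h1]
    rw [← LinearMap.sum_apply, ← map_sum]
    have h5 : ∑ i, single i (1 : Module.End ℂ (F.obj (B.S i))) = (1 : Tan B F) := sum_single 1
    rw [h5, map_one]
    rfl
  have hself : ∀ a, π a ∘ₗ ι a = LinearMap.id := by
    intro a
    refine LinearMap.ext fun x => ?_
    simp only [LinearMap.comp_apply, hπ, ι, orbitMap_apply, hmul, map_smul]
    have h1 : (P a.1).rangeRestrict (ρ (single a.1 ((φ a.1).smulRight (w a.1))) (b a.1 a.2)) =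
        b a.1 a.2 := Subtype.ext (by
      rw [hr]
      exact (congrArg (P a.1) (hP a.1 _)).trans (hP a.1 _))
    simp only [h1, Module.Basis.coord_apply, Module.Basis.repr_self, Finsupp.single_eq_same,
      smul_eq_mul, mul_one]
    exact (e a.1).sum_repr x
  have hne : ∀ a a', a ≠ a' → ∀ x, π a (ι a' x) = 0 := by
    intro a a' haa x
    rw [hπ]
    refine Finset.sum_eq_zero fun k _ => ?_
    obtain ⟨i, l⟩ := a
    obtain ⟨i', l'⟩ := a'
    by_cases hi : i = i'
    · subst hi
      have hl : l' ≠ l := fun h => haa (by rw [h])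
      simp only [ι, orbitMap_apply, hmul, map_smul]
      have h1 : (P i).rangeRestrict (ρ (single i ((φ i).smulRight (w i))) (b i l')) =
          b i l' := Subtype.ext (by
        rw [hr]
        exact (congrArg (P i) (hP i _)).trans (hP i _))
      have h2 : (b i).coord l (b i l') = 0 := by simp [Finsupp.single_apply, hl]
      rw [h1, h2, smul_zero, zero_smul]
    · have h0 : ρ (single i (((e i).coord k).smulRight (w i))) (ι ⟨i', l'⟩ x) = 0 := by
        simp only [ι, orbitMap_apply]
        rw [← Module.End.mul_apply, ← map_mul, single_mul_single_ne hi, map_zero,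
          LinearMap.zero_apply]
      rw [h0, map_zero, map_zero, zero_smul]
  let f : J → 𝒟 := fun a => B.S a.1
  -- the direct sum of the copies is mapped isomorphically to `V`
  let E : F.obj (⨁ f) →ₗ[ℂ] V := ∑ a, ι a ∘ₗ fmap F (biproduct.π f a)
  let E' : V →ₗ[ℂ] F.obj (⨁ f) := ∑ a, fmap F (biproduct.ι f a) ∘ₗ π a
  refine ⟨⨁ f, LinearEquiv.ofLinearMap E E' ?_ ?_, ?_⟩
  · rw [← hsum]
    refine (linearMap_sum_comp _ _ _).trans (Finset.sum_congr rfl fun a _ => ?_)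
    simp only [E', LinearMap.comp_assoc, linearMap_comp_sum]
    rw [Finset.sum_eq_single a]
    · rw [← LinearMap.comp_assoc (π a), ← fmap_comp, biproduct.ι_π_self, fmap_id, LinearMap.id_comp]
    · intro a' _ ha
      rw [← LinearMap.comp_assoc (π a'), ← fmap_comp, biproduct.ι_π_ne f ha, fmap_zero,
        LinearMap.zero_comp, LinearMap.comp_zero]
    · simp
  · have hid : LinearMap.id = ∑ a, fmap F (biproduct.ι f a) ∘ₗ fmap F (biproduct.π f a) := by
      simp only [← fmap_comp, ← fmap_sum, biproduct.total, fmap_id]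
    rw [hid]
    refine (linearMap_sum_comp _ _ _).trans (Finset.sum_congr rfl fun a _ => ?_)
    simp only [E, LinearMap.comp_assoc, linearMap_comp_sum]
    rw [Finset.sum_eq_single a]
    · rw [← LinearMap.comp_assoc (fmap F (biproduct.π f a)), hself, LinearMap.id_comp]
    · intro a' _ ha
      have : π a ∘ₗ ι a' = 0 := LinearMap.ext (hne a a' ha.symm)
      rw [← LinearMap.comp_assoc (fmap F (biproduct.π f a')), this,
        LinearMap.zero_comp, LinearMap.comp_zero]
    · simp
  · intro h v
    simp only [LinearEquiv.coe_ofLinearMap, E, LinearMap.sum_apply, LinearMap.comp_apply, map_sum,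
      fmap_act, ι, orbitMap_act]

end Tan

end Modules

/-! ### Tannaka reconstruction -/

section FibreOfSimple

universe v u

variable {𝒟 : Type u} [Category.{v} 𝒟] [Preadditive 𝒟] [Linear ℂ 𝒟] [MonoidalCategory 𝒟]
  [RightRigidCategory 𝒟] [MonoidalPreadditive 𝒟] (B : SimpleBasis 𝒟) (F : 𝒟 ⥤ Vect) [F.Additive]
  [F.Linear ℂ] [F.Monoidal]

/-- A fibre functor does not annihilate a simple object `S`: otherwise it would annihilate
`Sᘁ ⊗ S`, of which the unit object is a direct summand. -/
theorem nontrivial_obj_simple (h1 : ∀ f : 𝟙_ 𝒟 ⟶ 𝟙_ 𝒟, ∃ c : ℂ, f = c • 𝟙 _) (i : B.I) :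
    Nontrivial (F.obj (B.S i)) := by
  by_contra hS
  rw [not_nontrivial_iff_subsingleton] at hS
  set S := B.S i with hSdef
  -- `F` annihilates the identities of retracts of `Sᘁ ⊗ S`
  have hzero : fmap F (𝟙 (Sᘁ ⊗ S)) = 0 := by
    rw [fmap_id]
    refine LinearMap.ext fun t => ?_
    obtain ⟨t, rfl⟩ := (mu F (Sᘁ) S).surjective t
    have : t = 0 := by
      induction t with
      | zero => rfl
      | add s t hs ht => rw [hs, ht, add_zero]
      | tmul f v => rw [Subsingleton.elim v 0, TensorProduct.tmul_zero]
    rw [this, map_zero, map_zero]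
    rfl
  have hfactor : ∀ {X Y : 𝒟} (f : X ⟶ Sᘁ ⊗ S) (g : Sᘁ ⊗ S ⟶ Y), fmap F (f ≫ g) = 0 := by
    intro X Y f g
    rw [← Category.comp_id f, Category.assoc, fmap_comp, fmap_comp, hzero, LinearMap.comp_zero,
      LinearMap.zero_comp] <;> simp
  have hε : ε_ S (Sᘁ) ≠ 0 := by
    intro h0
    have hz := ExactPairing.evaluation_coevaluation S (Sᘁ)
    rw [h0, MonoidalPreadditive.whiskerLeft_zero, comp_zero, comp_zero] at hz
    refine B.id_ne_zero i ?_
    rw [← hSdef]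
    calc 𝟙 S = (λ_ S).inv ≫ ((λ_ S).hom ≫ (ρ_ S).inv) ≫ (ρ_ S).hom := by simp
      _ = 0 := by rw [← hz, zero_comp, comp_zero]
  -- a component of the evaluation between simple summands is nonzero
  let d := B.decomp (Sᘁ ⊗ S)
  let d' := B.decomp (𝟙_ 𝒟)
  obtain ⟨j, k, hjk⟩ : ∃ j k, d.ι j ≫ ε_ S (Sᘁ) ≫ d'.p k ≠ 0 := by
    by_contra hall
    push Not at hall
    refine hε ?_
    calc ε_ S (Sᘁ) = (∑ j, d.p j ≫ d.ι j) ≫ ε_ S (Sᘁ) ≫ (∑ k, d'.p k ≫ d'.ι k) := by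
          rw [d.sum_eq, d'.sum_eq, Category.id_comp, Category.comp_id]
      _ = ∑ k, ∑ j, d.p j ≫ (d.ι j ≫ ε_ S (Sᘁ) ≫ d'.p k) ≫ d'.ι k := by
          simp only [Preadditive.comp_sum, Preadditive.sum_comp, Category.assoc]
      _ = 0 := by simp only [hall, zero_comp, comp_zero, Finset.sum_const_zero]
  have hc : d.c j = d'.c k := by
    by_contra hne
    exact hjk (B.hom_ne hne _)
  -- hence the simple summand of the unit object is a retract of `Sᘁ ⊗ S`
  have hk : fmap F (𝟙 (B.S (d'.c k))) = 0 := by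
    rw [← hc, ← d.ι_p_self j]
    exact hfactor _ _
  have hp : fmap F (d'.p k ≫ d'.ι k) = 0 := by
    rw [← Category.id_comp (d'.ι k), fmap_comp, fmap_comp, hk, LinearMap.comp_zero,
      LinearMap.zero_comp]
  obtain ⟨c, hc'⟩ := h1 (d'.p k ≫ d'.ι k)
  have hc0 : c ≠ 0 := by
    rintro rfl
    rw [zero_smul] at hc'
    refine B.id_ne_zero (d'.c k) ?_
    calc 𝟙 _ = d'.ι k ≫ (d'.p k ≫ d'.ι k) ≫ d'.p k := by simp [d'.ι_p_self]
      _ = 0 := by rw [hc', zero_comp, comp_zero]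
  rw [hc', fmap_smul, fmap_id] at hp
  have h2 := LinearMap.congr_fun hp (unitEquiv F 1)
  rw [LinearMap.smul_apply, LinearMap.id_apply, LinearMap.zero_apply, smul_eq_zero] at h2
  have h3 := h2.resolve_left hc0
  rw [map_eq_zero_iff _ (unitEquiv F).injective] at h3
  exact one_ne_zero h3

end FibreOfSimple

section Reconstruction

universe v u

variable {𝒟 : Type u} [Category.{v} 𝒟] [Preadditive 𝒟] [Linear ℂ 𝒟] [MonoidalCategory 𝒟]
  {B : SimpleBasis 𝒟} {F : 𝒟 ⥤ Vect} [F.Additive] [F.Linear ℂ] [F.Monoidal]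
  {K : Type} [Ring K] [Bialgebra ℂ K] (e : K ≃ₐ[ℂ] Tan B F)

namespace Tan

/-- The fibre functor, lifted to modules over a bialgebra that is isomorphic to the bialgebra of
natural endomorphisms. -/
def lift : 𝒟 ⥤ HMod K where
  obj X := ⟨F.obj X, (act X).comp e.toAlgHom⟩
  map f := ⟨F.map f, fun h => LinearMap.ext fun v => fmap_act f (e h) v⟩
  map_id X := by ext1; exact F.map_id X
  map_comp f g := by ext1; exact F.map_comp f g

/-- The tensor product of modules over `K` corresponds to the tensor product of objects. -/
theorem mu_tensorρ
    (hΔ : ∀ k : K, TensorProduct.map e.toLinearMap e.toLinearMap (Coalgebra.comul (R := ℂ) k) =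
      Coalgebra.comul (R := ℂ) (e k))
    (X Y : 𝒟) (k : K) (t : F.obj X ⊗[ℂ] F.obj Y) :
    mu F X Y (HMod.tensorρ ((lift e).obj X) ((lift e).obj Y) k t) =
      act (X ⊗ Y) (e k) (mu F X Y t) := by
  have h : HMod.tensorρ ((lift e).obj X) ((lift e).obj Y) k =
      act₂ X Y (Coalgebra.comul (R := ℂ) (e k)) := by
    rw [HMod.tensorρ_eq, ← hΔ]
    generalize Coalgebra.comul (R := ℂ) k = s
    induction s with
    | zero => simp only [map_zero]; rfl
    | add s t hs ht => simp only [map_add, hs, ht]; rfl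
    | tmul a b => rfl
  rw [h, act₂_comul]
  exact LinearEquiv.apply_symm_apply _ _

/-- The monoidal structure of the lifted functor is that of the fibre functor. -/
def liftMonoidal
    (hΔ : ∀ k : K, TensorProduct.map e.toLinearMap e.toLinearMap (Coalgebra.comul (R := ℂ) k) =
      Coalgebra.comul (R := ℂ) (e k))
    (hε : ∀ k : K, Coalgebra.counit (R := ℂ) k = Coalgebra.counit (R := ℂ) (e k)) :
    (lift e).Monoidal := Functor.CoreMonoidal.toMonoidal
  { εIso := HMod.isoMk (X := 𝟙_ (HMod K)) (Y := (lift e).obj (𝟙_ 𝒟))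
      (Functor.Monoidal.εIso F) fun h => by
      refine LinearMap.ext fun c => ?_
      change unitEquiv F (Coalgebra.counit (R := ℂ) h * c) = act (𝟙_ 𝒟) (e h) (unitEquiv F c)
      rw [act_unit, hε]
    μIso := fun X Y => HMod.isoMk (X := (lift e).obj X ⊗ (lift e).obj Y) (Y := (lift e).obj (X ⊗ Y))
      (Functor.Monoidal.μIso F X Y) fun h => LinearMap.ext fun t => mu_tensorρ e hΔ X Y h t
    μIso_hom_natural_left := fun f Y => by ext1; exact Functor.LaxMonoidal.μ_natural_left F f Y
    μIso_hom_natural_right := fun X f => by ext1; exact Functor.LaxMonoidal.μ_natural_right F X f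
    associativity := fun X Y Z => by ext1; exact Functor.LaxMonoidal.associativity F X Y Z
    left_unitality := fun X => by ext1; exact Functor.LaxMonoidal.left_unitality F X
    right_unitality := fun X => by ext1; exact Functor.LaxMonoidal.right_unitality F X }

/-- The lifted fibre functor is faithful and full because maps that commute with all natural
endomorphisms come from morphisms, and essentially surjective because every module is a direct sum
of images of simple objects. -/
theorem lift_isEquivalence [HasFiniteBiproducts 𝒟] (hF : ∀ i, Nontrivial (F.obj (B.S i))) :
    (lift e).IsEquivalence where
  faithful := ⟨fun {X Y f g} h => fmap_injective hF (by
    exact congrArg (fun k : (lift e).obj X ⟶ (lift e).obj Y => k.hom.hom.hom) h)⟩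
  full := ⟨fun {X Y} g => by
    obtain ⟨f, hf⟩ := exists_fmap_eq (B := B) (F := F) (X := X) (Y := Y) g.hom.hom.hom fun h v => by
      have := LinearMap.congr_fun (g.comm (e.symm h)) v
      have hX : ((lift e).obj X).ρ (e.symm h) = act X h := congrArg (act X) (e.apply_symm_apply h)
      have hY : ((lift e).obj Y).ρ (e.symm h) = act Y h := congrArg (act Y) (e.apply_symm_apply h)
      rw [hX, hY] at this
      exact this
    refine ⟨f, ?_⟩
    ext1
    exact FGModuleCat.hom_ext hf⟩
  essSurj := ⟨fun M => by
    obtain ⟨X, g, hg⟩ := exists_obj_equiv hF (M.ρ.comp e.symm.toAlgHom)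
    refine ⟨X, ⟨HMod.isoMk (X := (lift e).obj X) (Y := M) (LinearEquiv.toFGModuleCatIso g)
      fun h => LinearMap.ext fun v => ?_⟩⟩
    have h1 := hg (e h) v
    have h2 : (M.ρ.comp e.symm.toAlgHom) (e h) = M.ρ h := congrArg M.ρ (e.symm_apply_apply h)
    rw [h2] at h1
    exact h1⟩

theorem μ_lift_forget
    (hΔ : ∀ k : K, TensorProduct.map e.toLinearMap e.toLinearMap (Coalgebra.comul (R := ℂ) k) =
      Coalgebra.comul (R := ℂ) (e k))
    (hε : ∀ k : K, Coalgebra.counit (R := ℂ) k = Coalgebra.counit (R := ℂ) (e k)) (X Y : 𝒟) :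
    letI := liftMonoidal e hΔ hε
    Functor.LaxMonoidal.μ (lift e ⋙ HMod.forget K) X Y = Functor.LaxMonoidal.μ F X Y :=
  Category.id_comp _

theorem transportEv_lift_forget [RightRigidCategory 𝒟]
    (hΔ : ∀ k : K, TensorProduct.map e.toLinearMap e.toLinearMap (Coalgebra.comul (R := ℂ) k) =
      Coalgebra.comul (R := ℂ) (e k))
    (hε : ∀ k : K, Coalgebra.counit (R := ℂ) k = Coalgebra.counit (R := ℂ) (e k)) (X : 𝒟) :
    letI := liftMonoidal e hΔ hε
    transportEv (lift e ⋙ HMod.forget K) X = transportEv F X := by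
  letI := liftMonoidal e hΔ hε
  change _ ≫ F.map _ ≫ (Functor.OplaxMonoidal.η F ≫ 𝟙 _) = _
  rw [μ_lift_forget, Category.comp_id]
  rfl

/-- Tannaka reconstruction: a fusion category with a pivotal fibre functor is equivalent to the
category of modules over the bialgebra of natural endomorphisms. -/
def pivotalEquiv [RightRigidCategory 𝒟] {ω : PivotalStructure 𝒟} [HasFiniteBiproducts 𝒟]
    (hΔ : ∀ k : K, TensorProduct.map e.toLinearMap e.toLinearMap (Coalgebra.comul (R := ℂ) k) =
      Coalgebra.comul (R := ℂ) (e k))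
    (hε : ∀ k : K, Coalgebra.counit (R := ℂ) k = Coalgebra.counit (R := ℂ) (e k))
    (hF : ∀ i, Nontrivial (F.obj (B.S i)))
    (hω : ∀ (X : 𝒟) (f : F.obj (Xᘁ)) (v : F.obj X),
      evPair F (Xᘁ) (fmap F (ω.iso X).inv v) f = evPair F X f v) : PivotalTensorEquiv ω K :=
  letI := liftMonoidal e hΔ hε
  { functor := lift e
    isEquivalence := lift_isEquivalence e hF
    additive := inferInstanceAs F.Additive
    linear := inferInstanceAs (F.Linear ℂ)
    pivotal := fun X => by
      rw [transportEv_lift_forget, transportEv_lift_forget]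
      refine FGModuleCat.hom_ext (TensorProduct.ext' fun g f => ?_)
      have key : ∀ (g : F.obj ((Xᘁ)ᘁ)) (f : F.obj (Xᘁ)),
          evPair F X f (fmap F (ω.iso X).hom g) = evPair F (Xᘁ) g f := fun g f => by
        rw [← hω, ← fmap_comp_apply, Iso.hom_inv_id, fmap_id, LinearMap.id_apply]
      exact key g f }

end Tan

end Reconstruction

/-! ### Linear endofunctors of vector spaces -/

section LinearFunctor

/-- The morphism `ℂ ⟶ V` that corresponds to a vector. -/
def pt {V : Vect} (v : V) : 𝟙_ Vect ⟶ V :=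
  ConcreteCategory.ofHom (C := Vect) (LinearMap.toSpanSingleton ℂ V v)

/-- The morphism `V ⟶ ℂ` that corresponds to a linear functional. -/
def copt {V : Vect} (φ : V →ₗ[ℂ] ℂ) : V ⟶ 𝟙_ Vect := ConcreteCategory.ofHom (C := Vect) φ

theorem hom_ext_apply {V W : Vect} {f g : V ⟶ W} (h : ∀ v, f.hom.hom v = g.hom.hom v) : f = g :=
  FGModuleCat.hom_ext (LinearMap.ext h)

theorem pt_hom_apply {V : Vect} (v : V) (c : ℂ) : (pt v).hom.hom c = c • v := rfl

theorem pt_comp {V W : Vect} (v : V) (f : V ⟶ W) : pt v ≫ f = pt (f.hom.hom v) :=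
  hom_ext_apply fun c => map_smul f.hom.hom c v

theorem pt_add {V : Vect} (v w : V) : pt (v + w) = pt v + pt w :=
  hom_ext_apply fun (c : ℂ) => smul_add c v w

theorem pt_smul {V : Vect} (c : ℂ) (v : V) : pt (c • v) = c • pt v :=
  hom_ext_apply fun d => smul_comm d c v

theorem pt_one : pt (V := 𝟙_ Vect) (1 : ℂ) = 𝟙 (𝟙_ Vect) :=
  hom_ext_apply fun (c : ℂ) => mul_one c

variable (G : Vect ⥤ Vect)

/-- For a linear functor `G`, the element of `G(V)` that corresponds to `p ⊗ v` under
`G(V) ≅ G(ℂ) ⊗ V`. -/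
def dot {V : Vect} (p : G.obj (𝟙_ Vect)) (v : V) : G.obj V := fmap G (pt v) p

theorem map_dot {V W : Vect} (f : V ⟶ W) (p : G.obj (𝟙_ Vect)) (v : V) :
    (G.map f).hom.hom (dot G p v) = dot G p (f.hom.hom v) := by
  rw [dot, dot, ← fmap_comp_apply, pt_comp]

theorem dot_one (p : G.obj (𝟙_ Vect)) : dot G (V := 𝟙_ Vect) p (1 : ℂ) = p := by
  rw [dot, pt_one, fmap_id, LinearMap.id_apply]

theorem app_dot {G G' : Vect ⥤ Vect} (η : G ⟶ G') {V : Vect} (p : G.obj (𝟙_ Vect)) (v : V) :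
    (η.app V).hom.hom (dot G p v) = dot G' ((η.app (𝟙_ Vect)).hom.hom p) v :=
  LinearMap.congr_fun (congrArg (fun k => k.hom.hom) (η.naturality (pt v))) p

variable [G.Additive] [G.Linear ℂ]

/-- The bilinear map `dot`. -/
def dotₗ (V : Vect) : G.obj (𝟙_ Vect) →ₗ[ℂ] V →ₗ[ℂ] G.obj V :=
  LinearMap.mk₂ ℂ (dot G) (fun p q v => map_add _ p q) (fun c p v => map_smul _ c p)
    (fun p v w => by rw [dot, pt_add, fmap_add]; rfl)
    (fun c p v => by rw [dot, pt_smul, fmap_smul]; rfl)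

@[simp] theorem dotₗ_apply {V : Vect} (p : G.obj (𝟙_ Vect)) (v : V) :
    dotₗ G V p v = dot G p v := rfl

/-- The isomorphism `G(ℂ) ⊗ V ≅ G(V)`. -/
def dotEquiv (V : Vect) : G.obj (𝟙_ Vect) ⊗[ℂ] V ≃ₗ[ℂ] G.obj V :=
  let b := Module.finBasis ℂ V
  LinearEquiv.ofLinearMap (TensorProduct.lift (dotₗ G V))
    (∑ k, (TensorProduct.mk ℂ (G.obj (𝟙_ Vect)) V).flip (b k) ∘ₗ fmap G (copt (b.coord k)))
    (by
      have h1 : ∑ k, copt (b.coord k) ≫ pt (b k) = 𝟙 V := by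
        refine hom_ext_apply fun v => ?_
        have h2 : (∑ k, copt (b.coord k) ≫ pt (b k)).hom.hom =
            ∑ k, (copt (b.coord k) ≫ pt (b k)).hom.hom :=
          map_sum (AddMonoidHom.mk' (fun f : V ⟶ V => f.hom.hom) fun f g => rfl) _ _
        rw [h2, LinearMap.sum_apply]
        exact b.sum_repr v
      have h3 := congrArg (fmap G) h1
      rw [fmap_sum, fmap_id] at h3
      rw [linearMap_comp_sum, ← h3]
      refine Finset.sum_congr rfl fun k _ => ?_
      rw [fmap_comp]
      rfl)
    (by
      refine TensorProduct.ext' fun p v => ?_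
      have h1 : ∀ k, fmap G (copt (b.coord k)) (dot G p v) = b.coord k v • p := by
        intro k
        have h2 : pt v ≫ copt (b.coord k) = b.coord k v • 𝟙 (𝟙_ Vect) :=
          hom_ext_apply fun (c : ℂ) => by
            change b.coord k (c • v) = b.coord k v * c
            rw [map_smul, smul_eq_mul, mul_comm]
        rw [dot, ← fmap_comp_apply, h2, fmap_smul, fmap_id]
        rfl
      rw [LinearMap.comp_apply, LinearMap.sum_apply, TensorProduct.lift.tmul]
      simp only [LinearMap.comp_apply, dotₗ_apply, h1, map_smul, LinearMap.flip_apply,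
        TensorProduct.mk_apply, LinearMap.id_apply]
      simp only [← TensorProduct.tmul_smul, ← TensorProduct.tmul_sum]
      exact congrArg _ (b.sum_repr v))

/-- Linear maps out of `G(V)` are determined by their values on the elements `dot p v`. -/
theorem ext_dot {V : Vect} {W : Type*} [AddCommGroup W] [Module ℂ W] {f g : G.obj V →ₗ[ℂ] W}
    (h : ∀ p v, f (dot G p v) = g (dot G p v)) : f = g := by
  refine LinearMap.ext fun z => ?_
  obtain ⟨t, rfl⟩ := (dotEquiv G V).surjective z
  exact LinearMap.congr_fun (f := f ∘ₗ (dotEquiv G V).toLinearMap)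
    (g := g ∘ₗ (dotEquiv G V).toLinearMap) (TensorProduct.ext' h) t

end LinearFunctor

section MonoidalOfMul

universe v u

variable {𝒟 : Type u} [Category.{v} 𝒟] [MonoidalCategory 𝒟] {F : 𝒟 ⥤ Vect}

/-- A monoidal structure on a functor to vector spaces, from products of vectors. -/
def monoidalOfMul (m : ∀ X Y, F.obj X ⊗[ℂ] F.obj Y ≃ₗ[ℂ] F.obj (X ⊗ Y))
    (e : ℂ ≃ₗ[ℂ] F.obj (𝟙_ 𝒟))
    (natural : ∀ {X X' Y Y' : 𝒟} (f : X ⟶ X') (g : Y ⟶ Y') (v : F.obj X) (w : F.obj Y),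
      fmap F (f ⊗ₘ g) (m X Y (v ⊗ₜ w)) = m X' Y' (fmap F f v ⊗ₜ fmap F g w))
    (assoc : ∀ {X Y Z : 𝒟} (u : F.obj X) (v : F.obj Y) (w : F.obj Z),
      fmap F (α_ X Y Z).hom (m (X ⊗ Y) Z (m X Y (u ⊗ₜ v) ⊗ₜ w)) =
        m X (Y ⊗ Z) (u ⊗ₜ m Y Z (v ⊗ₜ w)))
    (left_unit : ∀ {X : 𝒟} (v : F.obj X), fmap F (λ_ X).hom (m (𝟙_ 𝒟) X (e 1 ⊗ₜ v)) = v)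
    (right_unit : ∀ {X : 𝒟} (v : F.obj X), fmap F (ρ_ X).hom (m X (𝟙_ 𝒟) (v ⊗ₜ e 1)) = v) :
    F.Monoidal := Functor.CoreMonoidal.toMonoidal
  { εIso := LinearEquiv.toFGModuleCatIso e
    μIso := fun X Y => LinearEquiv.toFGModuleCatIso (m X Y)
    μIso_hom_natural_left := fun {X Y} f Z => FGModuleCat.hom_ext <|
      TensorProduct.ext' fun v w => by
      have h := natural f (𝟙 Z) v w
      rw [tensorHom_id, fmap_id] at h
      exact h.symm
    μIso_hom_natural_right := fun {X Y} Z f => FGModuleCat.hom_ext <|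
      TensorProduct.ext' fun v w => by
      have h := natural (𝟙 Z) f v w
      rw [id_tensorHom, fmap_id] at h
      exact h.symm
    associativity := fun X Y Z => FGModuleCat.hom_ext <|
      TensorProduct.ext_threefold fun u v w => assoc u v w
    left_unitality := fun X => FGModuleCat.hom_ext <| TensorProduct.ext' fun c v => by
      have h : ∀ (c : ℂ) (v : F.obj X), c • v = fmap F (λ_ X).hom (m (𝟙_ 𝒟) X (e c ⊗ₜ v)) :=
        fun c v => by
          have hc : e c = c • e 1 := by rw [← map_smul, smul_eq_mul, mul_one]
          rw [hc, ← TensorProduct.smul_tmul', map_smul, map_smul, left_unit]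
      exact h c v
    right_unitality := fun X => FGModuleCat.hom_ext <| TensorProduct.ext' fun v c => by
      have h : ∀ (c : ℂ) (v : F.obj X), c • v = fmap F (ρ_ X).hom (m X (𝟙_ 𝒟) (v ⊗ₜ e c)) :=
        fun c v => by
          have hc : e c = c • e 1 := by rw [← map_smul, smul_eq_mul, mul_one]
          rw [hc, TensorProduct.tmul_smul, map_smul, map_smul, right_unit]
      exact h c v }

end MonoidalOfMul

section Coherence

universe v u

variable {𝒟 : Type u} [Category.{v} 𝒟] [MonoidalCategory 𝒟]

/-- The functor `X ↦ G(X)(ℂ)`. -/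
abbrev fibre (G : 𝒟 ⥤ Vect ⥤ Vect) : 𝒟 ⥤ Vect := G.flip.obj (𝟙_ Vect)

/-- Coherence isomorphisms `G(X) G(Y) ≅ G(X ⊗ Y)` that make `G` an action from the left. -/
structure LeftCoherence (G : 𝒟 ⥤ Vect ⥤ Vect) where
  c (X Y : 𝒟) (V : Vect) : (G.obj X).obj ((G.obj Y).obj V) ≅ (G.obj (X ⊗ Y)).obj V
  c_nat {X X' Y Y' : 𝒟} {V W : Vect} (f : X ⟶ X') (g : Y ⟶ Y') (α : V ⟶ W) :
    (G.map f).app ((G.obj Y).obj V) ≫ (G.obj X').map ((G.map g).app V ≫ (G.obj Y').map α) ≫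
      (c X' Y' W).hom = (c X Y V).hom ≫ (G.map (f ⊗ₘ g)).app V ≫ (G.obj (X' ⊗ Y')).map α
  assoc (X Y Z : 𝒟) (V : Vect) :
    (c X Y ((G.obj Z).obj V)).hom ≫ (c (X ⊗ Y) Z V).hom ≫ (G.map (α_ X Y Z).hom).app V =
      (G.obj X).map (c Y Z V).hom ≫ (c X (Y ⊗ Z) V).hom
  u (V : Vect) : V ≅ (G.obj (𝟙_ 𝒟)).obj V
  u_nat {V W : Vect} (f : V ⟶ W) : f ≫ (u W).hom = (u V).hom ≫ (G.obj (𝟙_ 𝒟)).map f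
  left_unit (X : 𝒟) (V : Vect) : (u ((G.obj X).obj V)).hom ≫ (c (𝟙_ 𝒟) X V).hom ≫
    (G.map (λ_ X).hom).app V = 𝟙 _
  right_unit (X : 𝒟) (V : Vect) : (G.obj X).map (u V).hom ≫ (c X (𝟙_ 𝒟) V).hom ≫
    (G.map (ρ_ X).hom).app V = 𝟙 _

/-- Coherence isomorphisms `G(Y) G(X) ≅ G(X ⊗ Y)` that make `G` an action from the right. -/
structure RightCoherence (G : 𝒟 ⥤ Vect ⥤ Vect) where
  c (X Y : 𝒟) (V : Vect) : (G.obj Y).obj ((G.obj X).obj V) ≅ (G.obj (X ⊗ Y)).obj V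
  c_nat {X X' Y Y' : 𝒟} {V W : Vect} (f : X ⟶ X') (g : Y ⟶ Y') (α : V ⟶ W) :
    (G.map g).app ((G.obj X).obj V) ≫ (G.obj Y').map ((G.map f).app V ≫ (G.obj X').map α) ≫
      (c X' Y' W).hom = (c X Y V).hom ≫ (G.map (f ⊗ₘ g)).app V ≫ (G.obj (X' ⊗ Y')).map α
  assoc (X Y Z : 𝒟) (V : Vect) :
    (G.obj Z).map (c X Y V).hom ≫ (c (X ⊗ Y) Z V).hom ≫ (G.map (α_ X Y Z).hom).app V =
      (c Y Z ((G.obj X).obj V)).hom ≫ (c X (Y ⊗ Z) V).hom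
  u (V : Vect) : V ≅ (G.obj (𝟙_ 𝒟)).obj V
  u_nat {V W : Vect} (f : V ⟶ W) : f ≫ (u W).hom = (u V).hom ≫ (G.obj (𝟙_ 𝒟)).map f
  left_unit (X : 𝒟) (V : Vect) : (G.obj X).map (u V).hom ≫ (c (𝟙_ 𝒟) X V).hom ≫
    (G.map (λ_ X).hom).app V = 𝟙 _
  right_unit (X : 𝒟) (V : Vect) : (u ((G.obj X).obj V)).hom ≫ (c X (𝟙_ 𝒟) V).hom ≫
    (G.map (ρ_ X).hom).app V = 𝟙 _

theorem hom_congr_apply {V W : Vect} {f g : V ⟶ W} (h : f = g) (v : V) :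
    f.hom.hom v = g.hom.hom v := by rw [h]

namespace LeftCoherence

variable {G : 𝒟 ⥤ Vect ⥤ Vect} (L : LeftCoherence G)

theorem c_map {X Y : 𝒟} {V W : Vect} (α : V ⟶ W) (z : (G.obj X).obj ((G.obj Y).obj V)) :
    (L.c X Y W).hom.hom.hom (((G.obj X).map ((G.obj Y).map α)).hom.hom z) =
      ((G.obj (X ⊗ Y)).map α).hom.hom ((L.c X Y V).hom.hom.hom z) := by
  have h := L.c_nat (𝟙 X) (𝟙 Y) α
  simp only [CategoryTheory.Functor.map_id, NatTrans.id_app, Category.id_comp, id_tensorHom_id] at h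
  exact hom_congr_apply h z

theorem c_dot_dot {X Y : 𝒟} {V : Vect} (p : (fibre G).obj X) (q : (fibre G).obj Y) (v : V) :
    (L.c X Y V).hom.hom.hom (dot (G.obj X) p (dot (G.obj Y) q v)) =
      dot (G.obj (X ⊗ Y)) ((L.c X Y (𝟙_ Vect)).hom.hom.hom (dot (G.obj X) p q)) v := by
  have h := L.c_map (X := X) (Y := Y) (pt v) (dot (G.obj X) p q)
  rw [map_dot] at h
  exact h

theorem u_dot {V : Vect} (v : V) :
    (L.u V).hom.hom.hom v = dot (G.obj (𝟙_ 𝒟)) ((L.u (𝟙_ Vect)).hom.hom.hom (1 : ℂ)) v := by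
  have h := hom_congr_apply (L.u_nat (pt v)) (1 : ℂ)
  refine Eq.trans ?_ h
  change _ = (L.u V).hom.hom.hom ((pt v).hom.hom (1 : ℂ))
  rw [pt_hom_apply, one_smul]

variable [∀ X, (G.obj X).Additive] [∀ X, (G.obj X).Linear ℂ]

/-- The tensor structure of the fibre functor of an action from the left. -/
def mul (X Y : 𝒟) : (fibre G).obj X ⊗[ℂ] (fibre G).obj Y ≃ₗ[ℂ] (fibre G).obj (X ⊗ Y) :=
  dotEquiv (G.obj X) ((G.obj Y).obj (𝟙_ Vect)) ≪≫ₗ FGModuleCat.isoToLinearEquiv (L.c X Y (𝟙_ Vect))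

/-- The fibre functor of an action from the left is monoidal. -/
abbrev monoidal : (fibre G).Monoidal :=
  monoidalOfMul L.mul (FGModuleCat.isoToLinearEquiv (L.u (𝟙_ Vect)))
    (fun {X X' Y Y'} f g p q => by
      have h := L.c_nat f g (𝟙 (𝟙_ Vect))
      rw [CategoryTheory.Functor.map_id, CategoryTheory.Functor.map_id, Category.comp_id,
        Category.comp_id] at h
      have h1 := hom_congr_apply h (dot (G.obj X) p q)
      refine h1.symm.trans ?_
      change (L.c X' Y' (𝟙_ Vect)).hom.hom.hom (((G.obj X').map ((G.map g).app (𝟙_ Vect))).hom.hom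
        (((G.map f).app _).hom.hom (dot (G.obj X) p q))) = _
      rw [app_dot, map_dot]
      rfl)
    (fun {X Y Z} p q r => by
      have h := hom_congr_apply (L.assoc X Y Z (𝟙_ Vect)) (dot (G.obj X) p (dot (G.obj Y) q r))
      refine Eq.trans ?_ (h.trans ?_)
      · change _ = ((G.map (α_ X Y Z).hom).app (𝟙_ Vect)).hom.hom
          ((L.c (X ⊗ Y) Z (𝟙_ Vect)).hom.hom.hom ((L.c X Y _).hom.hom.hom
            (dot (G.obj X) p (dot (G.obj Y) q r))))
        rw [c_dot_dot]
        rfl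
      · change (L.c X (Y ⊗ Z) (𝟙_ Vect)).hom.hom.hom (((G.obj X).map (L.c Y Z _).hom).hom.hom
            (dot (G.obj X) p (dot (G.obj Y) q r))) = _
        rw [map_dot]
        rfl)
    (fun {X} v => by
      have h := hom_congr_apply (L.left_unit X (𝟙_ Vect)) v
      refine Eq.trans ?_ h
      change _ = ((G.map (λ_ X).hom).app (𝟙_ Vect)).hom.hom
        ((L.c (𝟙_ 𝒟) X (𝟙_ Vect)).hom.hom.hom ((L.u _).hom.hom.hom v))
      rw [u_dot]
      rfl)
    (fun {X} v => by
      have h := hom_congr_apply (L.right_unit X (𝟙_ Vect)) v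
      refine Eq.trans ?_ h
      change _ = ((G.map (ρ_ X).hom).app (𝟙_ Vect)).hom.hom
        ((L.c X (𝟙_ 𝒟) (𝟙_ Vect)).hom.hom.hom (((G.obj X).map (L.u _).hom).hom.hom v))
      conv_rhs => rw [← dot_one (G.obj X) v, map_dot]
      rfl)

end LeftCoherence

namespace RightCoherence

variable {G : 𝒟 ⥤ Vect ⥤ Vect} (L : RightCoherence G)

theorem c_map {X Y : 𝒟} {V W : Vect} (α : V ⟶ W) (z : (G.obj Y).obj ((G.obj X).obj V)) :
    (L.c X Y W).hom.hom.hom (((G.obj Y).map ((G.obj X).map α)).hom.hom z) =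
      ((G.obj (X ⊗ Y)).map α).hom.hom ((L.c X Y V).hom.hom.hom z) := by
  have h := L.c_nat (𝟙 X) (𝟙 Y) α
  simp only [CategoryTheory.Functor.map_id, NatTrans.id_app, Category.id_comp, id_tensorHom_id] at h
  exact hom_congr_apply h z

theorem c_dot_dot {X Y : 𝒟} {V : Vect} (p : (fibre G).obj X) (q : (fibre G).obj Y) (v : V) :
    (L.c X Y V).hom.hom.hom (dot (G.obj Y) q (dot (G.obj X) p v)) =
      dot (G.obj (X ⊗ Y)) ((L.c X Y (𝟙_ Vect)).hom.hom.hom (dot (G.obj Y) q p)) v := by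
  have h := L.c_map (X := X) (Y := Y) (pt v) (dot (G.obj Y) q p)
  rw [map_dot] at h
  exact h

theorem u_dot {V : Vect} (v : V) :
    (L.u V).hom.hom.hom v = dot (G.obj (𝟙_ 𝒟)) ((L.u (𝟙_ Vect)).hom.hom.hom (1 : ℂ)) v := by
  have h := hom_congr_apply (L.u_nat (pt v)) (1 : ℂ)
  refine Eq.trans ?_ h
  change _ = (L.u V).hom.hom.hom ((pt v).hom.hom (1 : ℂ))
  rw [pt_hom_apply, one_smul]

variable [∀ X, (G.obj X).Additive] [∀ X, (G.obj X).Linear ℂ]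

/-- The tensor structure of the fibre functor of an action from the right. -/
def mul (X Y : 𝒟) : (fibre G).obj X ⊗[ℂ] (fibre G).obj Y ≃ₗ[ℂ] (fibre G).obj (X ⊗ Y) :=
  TensorProduct.comm ℂ _ _ ≪≫ₗ dotEquiv (G.obj Y) ((G.obj X).obj (𝟙_ Vect)) ≪≫ₗ
    FGModuleCat.isoToLinearEquiv (L.c X Y (𝟙_ Vect))

/-- The fibre functor of an action from the right is monoidal. -/
abbrev monoidal : (fibre G).Monoidal :=
  monoidalOfMul L.mul (FGModuleCat.isoToLinearEquiv (L.u (𝟙_ Vect)))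
    (fun {X X' Y Y'} f g p q => by
      have h := L.c_nat f g (𝟙 (𝟙_ Vect))
      rw [CategoryTheory.Functor.map_id, CategoryTheory.Functor.map_id, Category.comp_id,
        Category.comp_id] at h
      have h1 := hom_congr_apply h (dot (G.obj Y) q p)
      refine h1.symm.trans ?_
      change (L.c X' Y' (𝟙_ Vect)).hom.hom.hom (((G.obj Y').map ((G.map f).app (𝟙_ Vect))).hom.hom
        (((G.map g).app _).hom.hom (dot (G.obj Y) q p))) = _
      rw [app_dot, map_dot]
      rfl)
    (fun {X Y Z} p q r => by
      have h := hom_congr_apply (L.assoc X Y Z (𝟙_ Vect)) (dot (G.obj Z) r (dot (G.obj Y) q p))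
      refine Eq.trans ?_ (h.trans ?_)
      · change _ = ((G.map (α_ X Y Z).hom).app (𝟙_ Vect)).hom.hom
          ((L.c (X ⊗ Y) Z (𝟙_ Vect)).hom.hom.hom (((G.obj Z).map (L.c X Y _).hom).hom.hom
            (dot (G.obj Z) r (dot (G.obj Y) q p))))
        rw [map_dot]
        rfl
      · change (L.c X (Y ⊗ Z) (𝟙_ Vect)).hom.hom.hom ((L.c Y Z _).hom.hom.hom
            (dot (G.obj Z) r (dot (G.obj Y) q p))) = _
        rw [c_dot_dot]
        rfl)
    (fun {X} v => by
      have h := hom_congr_apply (L.left_unit X (𝟙_ Vect)) v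
      refine Eq.trans ?_ h
      change _ = ((G.map (λ_ X).hom).app (𝟙_ Vect)).hom.hom
        ((L.c (𝟙_ 𝒟) X (𝟙_ Vect)).hom.hom.hom (((G.obj X).map (L.u _).hom).hom.hom v))
      conv_rhs => rw [← dot_one (G.obj X) v, map_dot]
      rfl)
    (fun {X} v => by
      have h := hom_congr_apply (L.right_unit X (𝟙_ Vect)) v
      refine Eq.trans ?_ h
      change _ = ((G.map (ρ_ X).hom).app (𝟙_ Vect)).hom.hom
        ((L.c X (𝟙_ 𝒟) (𝟙_ Vect)).hom.hom.hom ((L.u _).hom.hom.hom v))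
      rw [u_dot]
      rfl)

end RightCoherence

end Coherence

/-! ### The tensor structures of the fibre functors -/

section Instances

universe v u

variable {𝒟 : Type u} [Category.{v} 𝒟] [MonoidalCategory 𝒟]

variable (𝒟) in
/-- The coherence isomorphisms of a left module category structure. -/
def leftCoherence [MonoidalLeftAction 𝒟 Vect] :
    LeftCoherence (MonoidalLeftAction.curriedAction 𝒟 Vect) where
  c X Y V := (αₗ X Y V).symm
  c_nat {X X' Y Y' V W} f g α := by
    change f ⊵ₗ (Y ⊙ₗ V) ≫ X' ⊴ₗ (g ⊵ₗ V ≫ Y' ⊴ₗ α) ≫ (αₗ X' Y' W).inv =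
      (αₗ X Y V).inv ≫ (f ⊗ₘ g) ⊵ₗ V ≫ (X' ⊗ Y') ⊴ₗ α
    rw [← MonoidalLeftAction.actionHom_def, ← MonoidalLeftAction.actionHom_def_assoc,
      ← MonoidalLeftAction.actionHom_def]
    exact MonoidalLeftAction.actionAssocIso_inv_naturality f g α
  assoc X Y Z V := by
    change (αₗ X Y (Z ⊙ₗ V)).inv ≫ (αₗ (X ⊗ Y) Z V).inv ≫ (α_ X Y Z).hom ⊵ₗ V =
      X ⊴ₗ (αₗ Y Z V).inv ≫ (αₗ X (Y ⊗ Z) V).inv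
    have h := MonoidalLeftAction.associator_actionHom X Y Z V
    rw [Iso.inv_comp_eq, Iso.inv_comp_eq, ← reassoc_of% h,
      MonoidalLeftAction.actionHomRight_hom_inv_assoc, Iso.hom_inv_id, Category.comp_id]
  u V := (λₗ[𝒟] V).symm
  u_nat f := (MonoidalLeftAction.actionUnitIso_inv_naturality f).symm
  left_unit X V := by
    change (λₗ[𝒟] (X ⊙ₗ V)).inv ≫ (αₗ (𝟙_ 𝒟) X V).inv ≫ (λ_ X).hom ⊵ₗ V = 𝟙 _
    simp
  right_unit X V := by
    change X ⊴ₗ (λₗ[𝒟] V).inv ≫ (αₗ X (𝟙_ 𝒟) V).inv ≫ (ρ_ X).hom ⊵ₗ V = 𝟙 _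
    simp

variable (𝒟) in
/-- The coherence isomorphisms of a right module category structure. -/
def rightCoherence [MonoidalRightAction 𝒟 Vect] :
    RightCoherence (MonoidalRightAction.curriedAction 𝒟 Vect) where
  c X Y V := (αᵣ V X Y).symm
  c_nat {X X' Y Y' V W} f g α := by
    change (V ⊙ᵣ X) ⊴ᵣ g ≫ (V ⊴ᵣ f ≫ α ⊵ᵣ X') ⊵ᵣ Y' ≫ (αᵣ W X' Y').inv =
      (αᵣ V X Y).inv ≫ V ⊴ᵣ (f ⊗ₘ g) ≫ α ⊵ᵣ (X' ⊗ Y')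
    rw [← MonoidalRightAction.actionHom_def', ← MonoidalRightAction.actionHom_def'_assoc,
      ← MonoidalRightAction.actionHom_def']
    exact MonoidalRightAction.actionAssocIso_inv_naturality α f g
  assoc X Y Z V := by
    change (αᵣ V X Y).inv ⊵ᵣ Z ≫ (αᵣ V (X ⊗ Y) Z).inv ≫ V ⊴ᵣ (α_ X Y Z).hom =
      (αᵣ (V ⊙ᵣ X) Y Z).inv ≫ (αᵣ V X (Y ⊗ Z)).inv
    have h := MonoidalRightAction.actionHom_associator X Y Z V
    rw [← cancel_mono (αᵣ V X (Y ⊗ Z)).hom, ← cancel_mono (αᵣ (V ⊙ᵣ X) Y Z).hom]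
    simp only [Category.assoc, h, Iso.inv_hom_id, Category.comp_id, Iso.inv_hom_id_assoc,
      MonoidalRightAction.inv_hom_actionHomLeft]
  u V := (ρᵣ[𝒟] V).symm
  u_nat f := (MonoidalRightAction.actionUnitIso_inv_naturality f).symm
  left_unit X V := by
    change (ρᵣ[𝒟] V).inv ⊵ᵣ X ≫ (αᵣ V (𝟙_ 𝒟) X).inv ≫ V ⊴ᵣ (λ_ X).hom = 𝟙 _
    simp
  right_unit X V := by
    change (ρᵣ[𝒟] (V ⊙ᵣ X)).inv ≫ (αᵣ V X (𝟙_ 𝒟)).inv ≫ V ⊴ᵣ (ρ_ X).hom = 𝟙 _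
    simp

variable {C : Type u₂} [Category.{v₂} C] [MonoidalCategory C] {B : Type u₃} [Category.{v₃} B]
  [MonoidalCategory B] [MonoidalLeftAction C Vect] [MonoidalRightAction B Vect]
  [BimoduleCategory C B Vect] (Φ : 𝒟 ⥤ BimodEnd C B Vect) [Φ.Monoidal]

theorem comp_map_comp_eq (F : Vect ⥤ Vect) {P Q R S T S' T' : Vect} {a : P ⟶ F.obj Q} {b : Q ⟶ R}
    {c : R ⟶ S} {d : F.obj S ⟶ T} {m : F.obj R ⟶ S'} {z : S' ⟶ T} {x : P ⟶ T'} {y : T' ⟶ S'}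
    (h1 : (a ≫ F.map b) ≫ m = x ≫ y) (h2 : F.map c ≫ d = m ≫ z) :
    a ≫ F.map (b ≫ c) ≫ d = x ≫ y ≫ z := by
  rw [Functor.map_comp, Category.assoc, h2, ← Category.assoc, ← Category.assoc, h1, Category.assoc]

/-- The coherence isomorphisms of a monoidal functor to bimodule endofunctors. -/
def functorCoherence : LeftCoherence (Φ ⋙ BimodEnd.forget C B Vect) where
  c X Y V :=
    { hom := (Functor.LaxMonoidal.μ Φ X Y).nat.app V
      inv := (Functor.OplaxMonoidal.δ Φ X Y).nat.app V
      hom_inv_id := congrArg (fun k : Φ.obj X ⊗ Φ.obj Y ⟶ Φ.obj X ⊗ Φ.obj Y => k.nat.app V)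
        (Functor.Monoidal.μ_δ Φ X Y)
      inv_hom_id := congrArg (fun k : Φ.obj (X ⊗ Y) ⟶ Φ.obj (X ⊗ Y) => k.nat.app V)
        (Functor.Monoidal.δ_μ Φ X Y) }
  c_nat {X X' Y Y' V W} f g α := by
    change (Φ.map f).nat.app ((Φ.obj Y).functor.obj V) ≫
        (Φ.obj X').functor.map ((Φ.map g).nat.app V ≫ (Φ.obj Y').functor.map α) ≫
          (Functor.LaxMonoidal.μ Φ X' Y').nat.app W =
      (Functor.LaxMonoidal.μ Φ X Y).nat.app V ≫ (Φ.map (f ⊗ₘ g)).nat.app V ≫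
        (Φ.obj (X' ⊗ Y')).functor.map α
    have h1 := congrArg (fun k : Φ.obj X ⊗ Φ.obj Y ⟶ Φ.obj (X' ⊗ Y') => k.nat.app V)
      (Functor.LaxMonoidal.μ_natural Φ f g)
    have h2 := (Functor.LaxMonoidal.μ Φ X' Y').nat.naturality α
    exact comp_map_comp_eq (Φ.obj X').functor h1 h2
  assoc X Y Z V := by
    have h := congrArg (fun k : (Φ.obj X ⊗ Φ.obj Y) ⊗ Φ.obj Z ⟶ Φ.obj (X ⊗ Y ⊗ Z) => k.nat.app V)
      (Functor.LaxMonoidal.associativity Φ X Y Z)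
    simp only [BimodEnd.comp_nat_app, BimodEnd.whiskerRight_app, BimodEnd.whiskerLeft_app,
      BimodEnd.associator_hom_app, BimodEnd.leftUnitor_hom_app, BimodEnd.rightUnitor_hom_app,
      Category.id_comp] at h
    exact h
  u V :=
    { hom := (Functor.LaxMonoidal.ε Φ).nat.app V
      inv := (Functor.OplaxMonoidal.η Φ).nat.app V
      hom_inv_id := congrArg
        (fun k : 𝟙_ (BimodEnd C B Vect) ⟶ 𝟙_ (BimodEnd C B Vect) => k.nat.app V)
        (Functor.Monoidal.ε_η Φ)
      inv_hom_id := congrArg (fun k : Φ.obj (𝟙_ 𝒟) ⟶ Φ.obj (𝟙_ 𝒟) => k.nat.app V)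
        (Functor.Monoidal.η_ε Φ) }
  u_nat f := (Functor.LaxMonoidal.ε Φ).nat.naturality f
  left_unit X V := by
    have h := congrArg (fun k : 𝟙_ _ ⊗ Φ.obj X ⟶ Φ.obj X => k.nat.app V)
      (Functor.LaxMonoidal.left_unitality Φ X)
    simp only [BimodEnd.comp_nat_app, BimodEnd.whiskerRight_app, BimodEnd.whiskerLeft_app,
      BimodEnd.associator_hom_app, BimodEnd.leftUnitor_hom_app, BimodEnd.rightUnitor_hom_app,
      Category.id_comp] at h
    exact h.symm
  right_unit X V := by
    have h := congrArg (fun k : Φ.obj X ⊗ 𝟙_ _ ⟶ Φ.obj X => k.nat.app V)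
      (Functor.LaxMonoidal.right_unitality Φ X)
    simp only [BimodEnd.comp_nat_app, BimodEnd.whiskerRight_app, BimodEnd.whiskerLeft_app,
      BimodEnd.associator_hom_app, BimodEnd.leftUnitor_hom_app, BimodEnd.rightUnitor_hom_app,
      Category.id_comp] at h
    exact h.symm

end Instances

/-! ### Pivotality of the fibre functors -/

section Linearity

universe v u

variable {𝒟 : Type u} [Category.{v} 𝒟] [MonoidalCategory 𝒟]

instance [Preadditive 𝒟] [Linear ℂ 𝒟] [MonoidalLeftAction 𝒟 Vect]
    [LinearLeftAction 𝒟 Vect] (X : 𝒟) :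
    ((MonoidalLeftAction.curriedAction 𝒟 Vect).obj X).Additive where
  map_add := LinearLeftAction.act_add X _ _

instance [Preadditive 𝒟] [Linear ℂ 𝒟] [MonoidalLeftAction 𝒟 Vect]
    [LinearLeftAction 𝒟 Vect] (X : 𝒟) :
    ((MonoidalLeftAction.curriedAction 𝒟 Vect).obj X).Linear ℂ where
  map_smul f c := LinearLeftAction.act_smul X c f

instance [Preadditive 𝒟] [Linear ℂ 𝒟] [MonoidalLeftAction 𝒟 Vect] [LinearLeftAction 𝒟 Vect] :
    (fibre (MonoidalLeftAction.curriedAction 𝒟 Vect)).Additive where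
  map_add := LinearLeftAction.add_act _ _ _

instance [Preadditive 𝒟] [Linear ℂ 𝒟] [MonoidalLeftAction 𝒟 Vect] [LinearLeftAction 𝒟 Vect] :
    (fibre (MonoidalLeftAction.curriedAction 𝒟 Vect)).Linear ℂ where
  map_smul f c := LinearLeftAction.smul_act c f _

instance [Preadditive 𝒟] [Linear ℂ 𝒟] [MonoidalRightAction 𝒟 Vect]
    [LinearRightAction 𝒟 Vect] (X : 𝒟) :
    ((MonoidalRightAction.curriedAction 𝒟 Vect).obj X).Additive where
  map_add := LinearRightAction.add_act _ _ X

instance [Preadditive 𝒟] [Linear ℂ 𝒟] [MonoidalRightAction 𝒟 Vect]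
    [LinearRightAction 𝒟 Vect] (X : 𝒟) :
    ((MonoidalRightAction.curriedAction 𝒟 Vect).obj X).Linear ℂ where
  map_smul f c := LinearRightAction.smul_act c f X

instance [Preadditive 𝒟] [Linear ℂ 𝒟] [MonoidalRightAction 𝒟 Vect] [LinearRightAction 𝒟 Vect] :
    (fibre (MonoidalRightAction.curriedAction 𝒟 Vect)).Additive where
  map_add := LinearRightAction.act_add _ _ _

instance [Preadditive 𝒟] [Linear ℂ 𝒟] [MonoidalRightAction 𝒟 Vect] [LinearRightAction 𝒟 Vect] :
    (fibre (MonoidalRightAction.curriedAction 𝒟 Vect)).Linear ℂ where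
  map_smul f c := LinearRightAction.act_smul _ c f

instance fibre_additive [Preadditive 𝒟] (G : 𝒟 ⥤ Vect ⥤ Vect) [G.Additive] :
    (fibre G).Additive where
  map_add {X Y f g} := congrArg (fun k => k.app (𝟙_ Vect)) (G.map_add (f := f) (g := g))

instance fibre_linear [Preadditive 𝒟] [Linear ℂ 𝒟] (G : 𝒟 ⥤ Vect ⥤ Vect) [G.Additive] [G.Linear ℂ] :
    (fibre G).Linear ℂ where
  map_smul f c := congrArg (fun k => k.app (𝟙_ Vect)) (Functor.map_smul G c f)

variable {C : Type u₂} [Category.{v₂} C] [MonoidalCategory C] {B : Type u₃} [Category.{v₃} B]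
  [MonoidalCategory B] [MonoidalLeftAction C Vect] [MonoidalRightAction B Vect]
  [BimoduleCategory C B Vect] (Φ : 𝒟 ⥤ BimodEnd C B Vect)

instance (X : 𝒟) : ((Φ ⋙ BimodEnd.forget C B Vect).obj X).Additive := (Φ.obj X).additive

instance (X : 𝒟) : ((Φ ⋙ BimodEnd.forget C B Vect).obj X).Linear ℂ := (Φ.obj X).linear

end Linearity

section Pivotality

universe v u

variable {𝒜 : Type u} [Category.{v} 𝒜] [MonoidalCategory 𝒜] [RightRigidCategory 𝒜]
  {𝒞 : Type u₂} [Category.{v₂} 𝒞] [MonoidalCategory 𝒞] [RightRigidCategory 𝒞]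
  {ℬ : Type u₃} [Category.{v₃} ℬ] [MonoidalCategory ℬ] [RightRigidCategory ℬ]
  [MonoidalLeftAction 𝒞 Vect] [MonoidalRightAction ℬ Vect]
  {ωC : PivotalStructure 𝒞} {ωB : PivotalStructure ℬ}

/-- The scalar that corresponds to an endomorphism of `ℂ`. -/
def unitScalar (α : 𝟙_ Vect ⟶ 𝟙_ Vect) : ℂ := α.hom.hom (1 : ℂ)

namespace BimoduleTrace

variable (tr : BimoduleTrace Vect ωC ωB)

/-- The trace on `ℂ` is determined by the trace of the identity. -/
theorem tr_unit (α : 𝟙_ Vect ⟶ 𝟙_ Vect) :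
    tr.tr _ α = unitScalar α * tr.tr _ (𝟙 (𝟙_ Vect)) := by
  have h : α = unitScalar α • 𝟙 (𝟙_ Vect) := hom_ext_apply fun (c : ℂ) => by
    have h1 : unitScalar α * c = c • unitScalar α := mul_comm _ _
    refine Eq.trans ?_ ((α.hom.hom.map_smul c (1 : ℂ)).trans h1.symm)
    exact congrArg α.hom.hom (mul_one c).symm
  conv_lhs => rw [h]
  rw [map_smul, smul_eq_mul]

/-- The trace of an endomorphism of rank one. -/
theorem tr_rank_one {V : Vect} (φ : V →ₗ[ℂ] ℂ) (v : V) :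
    tr.tr V (copt φ ≫ pt v) = φ v * tr.tr _ (𝟙 (𝟙_ Vect)) := by
  rw [tr.cyclic, tr_unit]
  congr 1
  exact congrArg φ (one_smul ℂ v)

/-- A consequence of the non-degeneracy of the trace. -/
theorem tr_id_ne_zero : tr.tr _ (𝟙 (𝟙_ Vect)) ≠ 0 := by
  intro h
  have h1 : 𝟙 (𝟙_ Vect) = 0 := tr.nondeg _ fun β => by rw [Category.id_comp, tr_unit, h, mul_zero]
  exact one_ne_zero (α := ℂ) (hom_congr_apply h1 (1 : ℂ))

end BimoduleTrace

/-- Compatibility of the trace with the left action makes the fibre functor of the action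
pivotal. -/
theorem evPair_left_pivotal (tr : BimoduleTrace Vect ωC ωB)
    [∀ X : 𝒞, ((MonoidalLeftAction.curriedAction 𝒞 Vect).obj X).Additive]
    [∀ X : 𝒞, ((MonoidalLeftAction.curriedAction 𝒞 Vect).obj X).Linear ℂ] :
    letI := (leftCoherence 𝒞).monoidal
    let F := fibre (MonoidalLeftAction.curriedAction 𝒞 Vect)
    ∀ (X : 𝒞) (f : F.obj (Xᘁ)) (v : F.obj X),
      evPair F (Xᘁ) (fmap F (ωC.iso X).inv v) f = evPair F X f v := by
  letI := (leftCoherence 𝒞).monoidal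
  intro F X f v
  -- the partial trace of an endomorphism, computed through the coevaluation
  have key : ∀ β : F.obj X ⟶ F.obj X,
      unitScalar (partialTraceL ωC X (𝟙_ Vect) β) = TensorProduct.lift (evPair F X)
        ((β.hom.hom ∘ₗ fmap F (ωC.iso X).hom).lTensor (F.obj (Xᘁ)) (coevElt F (Xᘁ))) := by
    intro β
    have h1 : fmap F (ωC.coev X) (unitEquiv F 1) =
        mu F (Xᘁ) X ((fmap F (ωC.iso X).hom).lTensor (F.obj (Xᘁ)) (coevElt F (Xᘁ))) := by
      rw [PivotalStructure.coev, fmap_comp_apply]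
      have hc : fmap F (η_ (Xᘁ) ((Xᘁ)ᘁ)) (unitEquiv F 1) = mu F (Xᘁ) ((Xᘁ)ᘁ) (coevElt F (Xᘁ)) := by
        simp [coevElt]
      rw [hc]
      generalize coevElt F (Xᘁ) = t
      induction t with
      | zero => simp
      | add s t hs ht => simp only [map_add, hs, ht]
      | tmul a b =>
        rw [← id_tensorHom, mu_natural, fmap_id]
        rfl
    have h2 : unitScalar (partialTraceL ωC X (𝟙_ Vect) β) =
        (unitEquiv F).symm (fmap F (ε_ X (Xᘁ)) (((leftCoherence 𝒞).c (Xᘁ) X (𝟙_ Vect)).hom.hom.hom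
          (((Xᘁ : 𝒞) ⊴ₗ β).hom.hom (((leftCoherence 𝒞).c (Xᘁ) X (𝟙_ Vect)).inv.hom.hom
            (fmap F (ωC.coev X) (unitEquiv F 1)))))) := rfl
    have h4 : (β.hom.hom ∘ₗ fmap F (ωC.iso X).hom).lTensor (F.obj (Xᘁ)) (coevElt F (Xᘁ)) =
        LinearMap.lTensor (F.obj (Xᘁ)) β.hom.hom
          ((fmap F (ωC.iso X).hom).lTensor (F.obj (Xᘁ)) (coevElt F (Xᘁ))) :=
      LinearMap.lTensor_comp_apply _ _ _ _
    rw [h2, h1, h4]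
    generalize (fmap F (ωC.iso X).hom).lTensor (F.obj (Xᘁ)) (coevElt F (Xᘁ)) = t
    have h3 : ((leftCoherence 𝒞).c (Xᘁ) X (𝟙_ Vect)).inv.hom.hom (mu F (Xᘁ) X t) =
        dotEquiv ((MonoidalLeftAction.curriedAction 𝒞 Vect).obj (Xᘁ)) (F.obj X) t :=
      hom_congr_apply ((leftCoherence 𝒞).c (Xᘁ) X (𝟙_ Vect)).hom_inv_id _
    rw [h3]
    refine LinearMap.congr_fun (f := (unitEquiv F).symm.toLinearMap ∘ₗ fmap F (ε_ X (Xᘁ)) ∘ₗ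
        ((leftCoherence 𝒞).c (Xᘁ) X (𝟙_ Vect)).hom.hom.hom ∘ₗ ((Xᘁ : 𝒞) ⊴ₗ β).hom.hom ∘ₗ
        (dotEquiv ((MonoidalLeftAction.curriedAction 𝒞 Vect).obj (Xᘁ)) (F.obj X)).toLinearMap)
      (g := TensorProduct.lift (evPair F X) ∘ₗ LinearMap.lTensor
        (F.obj (Xᘁ)) β.hom.hom) (TensorProduct.ext' fun a b => ?_) t
    exact congrArg (fun z => (unitEquiv F).symm (fmap F (ε_ X (Xᘁ))
      (((leftCoherence 𝒞).c (Xᘁ) X (𝟙_ Vect)).hom.hom.hom z)))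
      (map_dot ((MonoidalLeftAction.curriedAction 𝒞 Vect).obj (Xᘁ)) β a b)
  -- the trace property for endomorphisms of rank one
  have h3 : ∀ φ : F.obj X →ₗ[ℂ] ℂ, φ v = φ (fmap F (ωC.iso X).hom (TensorProduct.lid ℂ _
      ((evPair F X).flip v |>.rTensor (F.obj ((Xᘁ)ᘁ)) (coevElt F (Xᘁ))))) := by
    intro φ
    have h4 := tr.left_trace X (𝟙_ Vect) (copt (V := F.obj X) φ ≫ pt v)
    have h5 : tr.tr (X ⊙ₗ 𝟙_ Vect) (copt (V := F.obj X) φ ≫ pt v) = _ := tr.tr_rank_one φ v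
    refine (mul_right_cancel₀ tr.tr_id_ne_zero ((h5.symm.trans h4).trans (tr.tr_unit _))).trans
      ((key (copt (V := F.obj X) φ ≫ pt (V := F.obj X) v)).trans ?_)
    generalize coevElt F (Xᘁ) = t
    have h6 : (copt (V := F.obj X) φ ≫ pt (V := F.obj X) v).hom.hom = φ.smulRight v := rfl
    rw [h6]
    induction t with
    | zero => simp
    | add s t hs ht => simp only [map_add, hs, ht]
    | tmul a b => simp [mul_comm]
  have h4 : v = fmap F (ωC.iso X).hom (TensorProduct.lid ℂ _
      ((evPair F X).flip v |>.rTensor (F.obj ((Xᘁ)ᘁ)) (coevElt F (Xᘁ)))) := by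
    rw [← sub_eq_zero]
    refine (Module.forall_dual_apply_eq_zero_iff ℂ _).mp fun φ => ?_
    rw [map_sub, ← h3, sub_self]
  have h5 : fmap F (ωC.iso X).inv v = TensorProduct.lid ℂ _
      ((evPair F X).flip v |>.rTensor (F.obj ((Xᘁ)ᘁ)) (coevElt F (Xᘁ))) := by
    conv_lhs => rw [h4]
    rw [← fmap_comp_apply, Iso.hom_inv_id, fmap_id, LinearMap.id_apply]
  rw [h5]
  have h6 := congrArg (fun g => evPair F X g v) (coevElt_contract_left (F := F) f)
  refine Eq.trans ?_ h6
  generalize coevElt F (Xᘁ) = t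
  induction t with
  | zero => simp
  | add s t hs ht => simp only [map_add, LinearMap.add_apply, hs, ht]
  | tmul a b => simp [mul_comm]

/-- Compatibility of the trace with the right action makes the fibre functor of the action
pivotal. -/
theorem evPair_right_pivotal (tr : BimoduleTrace Vect ωC ωB)
    [∀ X : ℬ, ((MonoidalRightAction.curriedAction ℬ Vect).obj X).Additive]
    [∀ X : ℬ, ((MonoidalRightAction.curriedAction ℬ Vect).obj X).Linear ℂ] :
    letI := (rightCoherence ℬ).monoidal
    let F := fibre (MonoidalRightAction.curriedAction ℬ Vect)
    ∀ (X : ℬ) (f : F.obj (Xᘁ)) (v : F.obj X),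
      evPair F (Xᘁ) (fmap F (ωB.iso X).inv v) f = evPair F X f v := by
  letI := (rightCoherence ℬ).monoidal
  intro F X f v
  -- the partial trace of an endomorphism, computed through the coevaluation
  have key : ∀ β : F.obj X ⟶ F.obj X,
      unitScalar (partialTraceR ωB X (𝟙_ Vect) β) = TensorProduct.lift (evPair F (Xᘁ))
        ((fmap F (ωB.iso X).inv ∘ₗ β.hom.hom).rTensor (F.obj (Xᘁ)) (coevElt F X)) := by
    intro β
    have h1 : fmap F (η_ X (Xᘁ)) (unitEquiv F 1) = mu F X (Xᘁ) (coevElt F X) := by simp [coevElt]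
    have h2 : unitScalar (partialTraceR ωB X (𝟙_ Vect) β) =
        (unitEquiv F).symm (fmap F (ωB.ev X) (((rightCoherence ℬ).c X (Xᘁ) (𝟙_ Vect)).hom.hom.hom
          ((β ⊵ᵣ (Xᘁ : ℬ)).hom.hom (((rightCoherence ℬ).c X (Xᘁ) (𝟙_ Vect)).inv.hom.hom
            (fmap F (η_ X (Xᘁ)) (unitEquiv F 1)))))) := rfl
    rw [h2, h1]
    generalize coevElt F X = t
    have h3 : ((rightCoherence ℬ).c X (Xᘁ) (𝟙_ Vect)).inv.hom.hom (mu F X (Xᘁ) t) =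
        dotEquiv ((MonoidalRightAction.curriedAction ℬ Vect).obj (Xᘁ)) (F.obj X)
          (TensorProduct.comm ℂ _ _ t) :=
      hom_congr_apply ((rightCoherence ℬ).c X (Xᘁ) (𝟙_ Vect)).hom_inv_id _
    rw [h3]
    refine LinearMap.congr_fun (f := (unitEquiv F).symm.toLinearMap ∘ₗ fmap F (ωB.ev X) ∘ₗ
        ((rightCoherence ℬ).c X (Xᘁ) (𝟙_ Vect)).hom.hom.hom ∘ₗ (β ⊵ᵣ (Xᘁ : ℬ)).hom.hom ∘ₗ
        (dotEquiv ((MonoidalRightAction.curriedAction ℬ Vect).obj (Xᘁ)) (F.obj X)).toLinearMap ∘ₗ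
        (TensorProduct.comm ℂ (F.obj X) (F.obj (Xᘁ))).toLinearMap)
      (g := TensorProduct.lift (evPair F (Xᘁ)) ∘ₗ LinearMap.rTensor (F.obj (Xᘁ))
        (fmap F (ωB.iso X).inv ∘ₗ β.hom.hom)) (TensorProduct.ext' fun a b => ?_) t
    refine (congrArg (fun z => (unitEquiv F).symm (fmap F (ωB.ev X)
      (((rightCoherence ℬ).c X (Xᘁ) (𝟙_ Vect)).hom.hom.hom z)))
      (map_dot ((MonoidalRightAction.curriedAction ℬ Vect).obj (Xᘁ)) β b a)).trans ?_
    have h5 : ∀ a' : F.obj X, fmap F (ωB.ev X) (mu F X (Xᘁ) (a' ⊗ₜ b)) =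
        fmap F (ε_ (Xᘁ) ((Xᘁ)ᘁ)) (mu F ((Xᘁ)ᘁ) (Xᘁ) (fmap F (ωB.iso X).inv a' ⊗ₜ b)) := fun a' => by
      rw [PivotalStructure.ev, fmap_comp_apply, ← tensorHom_id, mu_natural, fmap_id]
      rfl
    exact congrArg (unitEquiv F).symm (h5 (β.hom.hom a))
  -- the trace property for endomorphisms of rank one
  have h3 : ∀ φ : F.obj X →ₗ[ℂ] ℂ, φ v = φ (TensorProduct.rid ℂ _
      ((evPair F (Xᘁ) (fmap F (ωB.iso X).inv v)).lTensor (F.obj X) (coevElt F X))) := by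
    intro φ
    have h4 := tr.right_trace X (𝟙_ Vect) (copt (V := F.obj X) φ ≫ pt v)
    have h5 : tr.tr (𝟙_ Vect ⊙ᵣ X) (copt (V := F.obj X) φ ≫ pt v) = _ := tr.tr_rank_one φ v
    refine (mul_right_cancel₀ tr.tr_id_ne_zero ((h5.symm.trans h4).trans (tr.tr_unit _))).trans
      ((key (copt (V := F.obj X) φ ≫ pt (V := F.obj X) v)).trans ?_)
    generalize coevElt F X = t
    have h6 : (copt (V := F.obj X) φ ≫ pt (V := F.obj X) v).hom.hom = φ.smulRight v := rfl
    rw [h6]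
    induction t with
    | zero => simp
    | add s t hs ht => simp only [map_add, hs, ht]
    | tmul a b => simp [mul_comm]
  have h4 : v = TensorProduct.rid ℂ _
      ((evPair F (Xᘁ) (fmap F (ωB.iso X).inv v)).lTensor (F.obj X) (coevElt F X)) := by
    rw [← sub_eq_zero]
    refine (Module.forall_dual_apply_eq_zero_iff ℂ _).mp fun φ => ?_
    rw [map_sub, ← h3, sub_self]
  conv_rhs => rw [h4]
  have h6 := congrArg (evPair F (Xᘁ) (fmap F (ωB.iso X).inv v)) (coevElt_contract_right (F := F) f)
  refine h6.symm.trans ?_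
  generalize coevElt F X = t
  generalize evPair F (Xᘁ) (fmap F (ωB.iso X).inv v) = φ
  induction t with
  | zero => simp
  | add s t hs ht => simp only [map_add, hs, ht]
  | tmul a b => simp [mul_comm]

/-- A pivotal functor to bimodule endofunctors has a pivotal fibre functor. -/
theorem evPair_functor_pivotal [BimoduleCategory 𝒞 ℬ Vect] {ωA : PivotalStructure 𝒜}
    (tr : BimoduleTrace Vect ωC ωB) {Φ : 𝒜 ⥤ BimodEnd 𝒞 ℬ Vect} [Φ.Monoidal]
    (hΦ : IsPivotalFunctor ωA tr Φ) :
    letI := (functorCoherence Φ).monoidal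
    let F := fibre (Φ ⋙ BimodEnd.forget 𝒞 ℬ Vect)
    ∀ (X : 𝒜) (f : F.obj (Xᘁ)) (v : F.obj X),
      evPair F (Xᘁ) (fmap F (ωA.iso X).inv v) f = evPair F X f v := by
  letI := (functorCoherence Φ).monoidal
  intro F X f v
  have h := hΦ X (𝟙_ Vect) (𝟙_ Vect) (pt (V := F.obj X) v) (pt (V := F.obj (Xᘁ)) f)
  have h1 : (Φ.obj (Xᘁ)).functor.map (pt (V := F.obj X) v) ≫ (transportEv Φ X).nat.app (𝟙_ Vect) =
      copt (V := F.obj (Xᘁ)) ((evPair F X).flip v) := hom_ext_apply fun g => rfl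
  have h2 : tr.tr ((Φ.obj (Xᘁ)).functor.obj (𝟙_ Vect))
      ((Φ.obj (Xᘁ)).functor.map (pt (V := F.obj X) v) ≫ (transportEv Φ X).nat.app (𝟙_ Vect) ≫
        pt (V := F.obj (Xᘁ)) f) = evPair F X f v * tr.tr _ (𝟙 (𝟙_ Vect)) := by
    refine Eq.trans ?_ (tr.tr_rank_one (V := F.obj (Xᘁ)) ((evPair F X).flip v) f)
    exact congrArg (tr.tr _) ((Category.assoc _ _ _).symm.trans
      (congrArg (fun k => k ≫ pt (V := F.obj (Xᘁ)) f) h1))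
  rw [mul_right_cancel₀ tr.tr_id_ne_zero ((h2.symm.trans h).trans (tr.tr_unit _))]
  change _ = evPair F (Xᘁ) (fmap F (ωA.iso X).inv ((pt (V := F.obj X) v).hom.hom (1 : ℂ))) f
  rw [pt_hom_apply, one_smul]

end Pivotality

/-! ### Crossings and the elements that represent them -/

section Crossing

universe v v' v'' u u' u''

variable {𝒟 : Type u} [Category.{v} 𝒟] {𝒟' : Type u'} [Category.{v'} 𝒟']

/-- A natural isomorphism `G(X) G'(Y) ≅ G'(Y) G(X)` between two families of functors. -/
structure Crossing (G : 𝒟 ⥤ Vect ⥤ Vect) (G' : 𝒟' ⥤ Vect ⥤ Vect) where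
  σ (X : 𝒟) (Y : 𝒟') (V : Vect) :
    (G.obj X).obj ((G'.obj Y).obj V) ≅ (G'.obj Y).obj ((G.obj X).obj V)
  naturality {X X' : 𝒟} {Y Y' : 𝒟'} {V W : Vect} (f : X ⟶ X') (g : Y ⟶ Y') (α : V ⟶ W) :
    (G.map f).app ((G'.obj Y).obj V) ≫ (G.obj X').map ((G'.map g).app V ≫ (G'.obj Y').map α) ≫
      (σ X' Y' W).hom = (σ X Y V).hom ≫ (G'.map g).app ((G.obj X).obj V) ≫
        (G'.obj Y').map ((G.map f).app V ≫ (G.obj X').map α)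

namespace Crossing

variable {G : 𝒟 ⥤ Vect ⥤ Vect} {G' : 𝒟' ⥤ Vect ⥤ Vect}

/-- The inverse crossing. -/
def symm (S : Crossing G G') : Crossing G' G where
  σ Y X V := (S.σ X Y V).symm
  naturality {Y Y' X X' V W} g f α := by
    have h := S.naturality f g α
    rw [Iso.symm_hom, Iso.symm_hom, Iso.eq_inv_comp, ← Category.assoc, ← Category.assoc,
      Iso.comp_inv_eq, Category.assoc, Category.assoc]
    exact h.symm

variable [∀ X, (G.obj X).Additive] [∀ X, (G.obj X).Linear ℂ]
  [∀ X, (G'.obj X).Additive] [∀ X, (G'.obj X).Linear ℂ]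

variable (G G') in
/-- The linear map `p ⊗ q ↦ q · (p · v)`. -/
def swapDot (X : 𝒟) (Y : 𝒟') {V : Vect} (v : V) :
    (fibre G).obj X ⊗[ℂ] (fibre G').obj Y →ₗ[ℂ] (G'.obj Y).obj ((G.obj X).obj V) :=
  TensorProduct.lift ((dotₗ (G'.obj Y) ((G.obj X).obj V)).flip ∘ₗ (dotₗ (G.obj X) V).flip v)

theorem swapDot_tmul {X : 𝒟} {Y : 𝒟'} {V : Vect} (p : (fibre G).obj X) (q : (fibre G').obj Y)
    (v : V) : swapDot G G' X Y v (p ⊗ₜ q) = dot (G'.obj Y) q (dot (G.obj X) p v) := rfl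

/-- Identities in `G(ℂ) ⊗ G'(ℂ)` can be checked in `G'(G(ℂ))`. -/
theorem swapDot_one_injective (X : 𝒟) (Y : 𝒟') :
    Function.Injective (swapDot G G' X Y (V := 𝟙_ Vect) (1 : ℂ)) := by
  have h : swapDot G G' X Y (V := 𝟙_ Vect) (1 : ℂ) =
      (dotEquiv (G'.obj Y) ((fibre G).obj X)).toLinearMap ∘ₗ
        (TensorProduct.comm ℂ ((fibre G).obj X) ((fibre G').obj Y)).toLinearMap :=
    TensorProduct.ext' fun p q => by
      rw [swapDot_tmul, dot_one]
      rfl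
  rw [h]
  exact (dotEquiv (G'.obj Y) ((fibre G).obj X)).injective.comp (LinearEquiv.injective _)

theorem map_swapDot {X : 𝒟} {Y : 𝒟'} {V W : Vect} (f : V ⟶ W) (v : V)
    (t : (fibre G).obj X ⊗[ℂ] (fibre G').obj Y) :
    ((G'.obj Y).map ((G.obj X).map f)).hom.hom (swapDot G G' X Y v t) =
      swapDot G G' X Y (f.hom.hom v) t :=
  LinearMap.congr_fun (f := ((G'.obj Y).map ((G.obj X).map f)).hom.hom ∘ₗ swapDot G G' X Y v)
    (TensorProduct.ext' fun p q => by
      change ((G'.obj Y).map ((G.obj X).map f)).hom.hom (swapDot G G' X Y v (p ⊗ₜ q)) = _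
      rw [swapDot_tmul, swapDot_tmul, map_dot, map_dot]) t

theorem map_app_swapDot {X X' : 𝒟} {Y Y' : 𝒟'} {V : Vect} (f : X ⟶ X') (g : Y ⟶ Y') (v : V)
    (t : (fibre G).obj X ⊗[ℂ] (fibre G').obj Y) :
    ((G'.obj Y').map ((G.map f).app V)).hom.hom
        (((G'.map g).app ((G.obj X).obj V)).hom.hom (swapDot G G' X Y v t)) =
      swapDot G G' X' Y' v (TensorProduct.map (fmap (fibre G) f) (fmap (fibre G') g) t) :=
  LinearMap.congr_fun (f := ((G'.obj Y').map ((G.map f).app V)).hom.hom ∘ₗ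
      ((G'.map g).app ((G.obj X).obj V)).hom.hom ∘ₗ swapDot G G' X Y v)
    (g := swapDot G G' X' Y' v ∘ₗ TensorProduct.map (fmap (fibre G) f) (fmap (fibre G') g))
    (TensorProduct.ext' fun p q => by
      change ((G'.obj Y').map ((G.map f).app V)).hom.hom
        (((G'.map g).app ((G.obj X).obj V)).hom.hom (swapDot G G' X Y v (p ⊗ₜ q))) = _
      rw [swapDot_tmul, app_dot, map_dot, app_dot]
      rfl) t

variable (S : Crossing G G')

/-- The action of a crossing on the tensor product of the fibres. -/
def fibreMap (X : 𝒟) (Y : 𝒟') : Module.End ℂ ((fibre G).obj X ⊗[ℂ] (fibre G').obj Y) :=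
  (TensorProduct.comm ℂ ((fibre G').obj Y) ((fibre G).obj X)).toLinearMap ∘ₗ
    (dotEquiv (G'.obj Y) ((fibre G).obj X)).symm.toLinearMap ∘ₗ (S.σ X Y (𝟙_ Vect)).hom.hom.hom ∘ₗ
      (dotEquiv (G.obj X) ((fibre G').obj Y)).toLinearMap

theorem swapDot_fibreMap {X : 𝒟} {Y : 𝒟'} (p : (fibre G).obj X) (q : (fibre G').obj Y) :
    swapDot G G' X Y (V := 𝟙_ Vect) (1 : ℂ) (S.fibreMap X Y (p ⊗ₜ q)) =
      (S.σ X Y (𝟙_ Vect)).hom.hom.hom (dot (G.obj X) p q) := by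
  have h : ∀ t, swapDot G G' X Y (V := 𝟙_ Vect) (1 : ℂ) t =
      dotEquiv (G'.obj Y) ((fibre G).obj X) (TensorProduct.comm ℂ _ _ t) := by
    intro t
    induction t with
    | zero => simp
    | add s t hs ht => simp only [map_add, hs, ht]
    | tmul p q =>
      rw [swapDot_tmul, dot_one]
      rfl
  rw [h]
  exact (congrArg (dotEquiv (G'.obj Y) ((fibre G).obj X)) (LinearEquiv.apply_symm_apply
    (TensorProduct.comm ℂ ((fibre G).obj X) ((fibre G').obj Y)) _)).trans
      (LinearEquiv.apply_symm_apply _ _)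

/-- A crossing is determined by its action on the tensor product of the fibres. -/
theorem σ_dot_dot {X : 𝒟} {Y : 𝒟'} {V : Vect} (p : (fibre G).obj X) (q : (fibre G').obj Y) (v : V) :
    (S.σ X Y V).hom.hom.hom (dot (G.obj X) p (dot (G'.obj Y) q v)) =
      swapDot G G' X Y v (S.fibreMap X Y (p ⊗ₜ q)) := by
  have h := S.naturality (𝟙 X) (𝟙 Y) (pt v)
  simp only [CategoryTheory.Functor.map_id, NatTrans.id_app, Category.id_comp] at h
  have h1 := hom_congr_apply h (dot (G.obj X) p q)
  have h2 : ((G.obj X).map ((G'.obj Y).map (pt v))).hom.hom (dot (G.obj X) p q) =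
      dot (G.obj X) p (dot (G'.obj Y) q v) := map_dot _ _ _ _
  have h3 := map_swapDot (G := G) (G' := G') (pt v) (1 : ℂ) (S.fibreMap X Y (p ⊗ₜ q))
  rw [swapDot_fibreMap, pt_hom_apply, one_smul] at h3
  rw [← h2]
  exact h1.trans h3

theorem fibreMap_natural {X X' : 𝒟} {Y Y' : 𝒟'} (f : X ⟶ X') (g : Y ⟶ Y') (p : (fibre G).obj X)
    (q : (fibre G').obj Y) : S.fibreMap X' Y' (fmap (fibre G) f p ⊗ₜ fmap (fibre G') g q) =
      TensorProduct.map (fmap (fibre G) f) (fmap (fibre G') g) (S.fibreMap X Y (p ⊗ₜ q)) := by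
  apply swapDot_one_injective
  rw [swapDot_fibreMap, ← map_app_swapDot, swapDot_fibreMap]
  have h := hom_congr_apply (S.naturality f g (𝟙 (𝟙_ Vect))) (dot (G.obj X) p q)
  simp only [CategoryTheory.Functor.map_id, Category.comp_id] at h
  refine Eq.trans ?_ h
  have h2 : dot (G.obj X') (fmap (fibre G) f p) (fmap (fibre G') g q) =
    ((G.obj X').map ((G'.map g).app (𝟙_ Vect))).hom.hom
      (((G.map f).app ((G'.obj Y).obj (𝟙_ Vect))).hom.hom (dot (G.obj X) p q)) := by
    rw [app_dot, map_dot]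
    rfl
  rw [h2]
  rfl

variable [Preadditive 𝒟] [Linear ℂ 𝒟] [Preadditive 𝒟'] [Linear ℂ 𝒟']
  {B : SimpleBasis 𝒟} {B' : SimpleBasis 𝒟'} [(fibre G).Additive] [(fibre G).Linear ℂ]
  [(fibre G').Additive] [(fibre G').Linear ℂ]

/-- A finite family of pairs `(r, r')` represents a crossing if
`σ(p · (q · v)) = ∑ r'q · (rp · v)`. -/
def IsRepr (s : Finset (Tan B (fibre G) × Tan B' (fibre G'))) : Prop :=
  ∀ {X : 𝒟} {Y : 𝒟'} {V : Vect} (p : (fibre G).obj X) (q : (fibre G').obj Y) (v : V),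
    (S.σ X Y V).hom.hom.hom (dot (G.obj X) p (dot (G'.obj Y) q v)) =
      ∑ i ∈ s, dot (G'.obj Y) (Tan.act Y i.2 q) (dot (G.obj X) (Tan.act X i.1 p) v)

variable (B B') in
/-- Every crossing is represented by an element of the tensor product, because its action on the
fibres is a natural family of endomorphisms in two variables. -/
theorem exists_isRepr : ∃ s : Finset (Tan B (fibre G) × Tan B' (fibre G')), S.IsRepr s := by
  obtain ⟨s, hs⟩ := TensorProduct.exists_finset (R := ℂ)
    (Tan.tensorElt (B := B) (B' := B') fun i j => S.fibreMap (B.S i) (B'.S j))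
  refine ⟨s, fun {X Y V} p q v => ?_⟩
  have h := Tan.act₂_tensorElt (B := B) (B' := B') S.fibreMap S.fibreMap_natural X Y
  rw [hs] at h
  rw [σ_dot_dot, ← h, map_sum, LinearMap.sum_apply, map_sum]
  rfl

end Crossing

end Crossing

/-! ### Coproducts of representing elements -/

section CrossingLaws

universe v v' u u'

theorem assoc_symm_map_assoc {M M' N N' P P' : Type*} [AddCommGroup M] [Module ℂ M]
    [AddCommGroup M'] [Module ℂ M'] [AddCommGroup N] [Module ℂ N] [AddCommGroup N'] [Module ℂ N']
    [AddCommGroup P] [Module ℂ P] [AddCommGroup P'] [Module ℂ P'] (f : M →ₗ[ℂ] M')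
    (g : N →ₗ[ℂ] N') (h : P →ₗ[ℂ] P') (t : (M ⊗[ℂ] N) ⊗[ℂ] P) :
    (TensorProduct.assoc ℂ M' N' P').symm
      (TensorProduct.map f (TensorProduct.map g h) (TensorProduct.assoc ℂ M N P t)) =
        TensorProduct.map (TensorProduct.map f g) h t := by
  rw [TensorProduct.map_map_assoc, LinearEquiv.symm_apply_apply]

theorem dot_sum (G : Vect ⥤ Vect) [G.Additive] [G.Linear ℂ] {V : Vect} (p : G.obj (𝟙_ Vect))
    {ι : Type*} (s : Finset ι) (v : ι → V) :
    dot G p (∑ i ∈ s, v i) = ∑ i ∈ s, dot G p (v i) :=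
  map_sum (dotₗ G V p) v s

variable {𝒟 : Type u} [Category.{v} 𝒟] {𝒟' : Type u'} [Category.{v'} 𝒟']
  {G : 𝒟 ⥤ Vect ⥤ Vect} {G' : 𝒟' ⥤ Vect ⥤ Vect}
  [∀ X, (G.obj X).Additive] [∀ X, (G.obj X).Linear ℂ]
  [∀ X, (G'.obj X).Additive] [∀ X, (G'.obj X).Linear ℂ]
  (S : Crossing G G') [Preadditive 𝒟] [Linear ℂ 𝒟] [Preadditive 𝒟'] [Linear ℂ 𝒟']
  {B : SimpleBasis 𝒟} {B' : SimpleBasis 𝒟'} [(fibre G).Additive] [(fibre G).Linear ℂ]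
  [(fibre G').Additive] [(fibre G').Linear ℂ]

namespace Crossing

variable {S}

/-- Applying a crossing and its inverse multiplies the representing elements. -/
theorem IsRepr.mul_symm {s : Finset (Tan B (fibre G) × Tan B' (fibre G'))}
    {s' : Finset (Tan B' (fibre G') × Tan B (fibre G))} (hs : S.IsRepr s) (hs' : S.symm.IsRepr s') :
    (∑ i ∈ s, i.1 ⊗ₜ[ℂ] i.2) * (∑ j ∈ s', j.2 ⊗ₜ[ℂ] j.1) = 1 ∧
      (∑ j ∈ s', j.2 ⊗ₜ[ℂ] j.1) * (∑ i ∈ s, i.1 ⊗ₜ[ℂ] i.2) = 1 := by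
  constructor
  · rw [Finset.sum_mul_sum]
    refine Tan.tensor_ext fun X Y p q => swapDot_one_injective (G := G) (G' := G') X Y ?_
    have h := hom_congr_apply (S.σ X Y (𝟙_ Vect)).inv_hom_id
      (dot (G'.obj Y) q (dot (G.obj X) (V := 𝟙_ Vect) p (1 : ℂ)))
    have h1 := hs' (V := 𝟙_ Vect) q p (1 : ℂ)
    have h2 := congrArg (S.σ X Y (𝟙_ Vect)).hom.hom.hom h1
    rw [map_sum] at h2
    have h3 := h2.symm.trans h
    simp only [Algebra.TensorProduct.tmul_mul_tmul, map_sum, TensorProduct.map_tmul,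
      Tan.ev_apply, map_mul, Module.End.mul_apply, Algebra.TensorProduct.one_def, map_one,
      Module.End.one_apply, swapDot_tmul]
    rw [Finset.sum_comm]
    refine Eq.trans ?_ h3
    exact Finset.sum_congr rfl fun j _ => (hs _ _ _).symm
  · rw [Finset.sum_mul_sum]
    refine Tan.tensor_ext fun X Y p q => (TensorProduct.comm ℂ _ _).injective
      (swapDot_one_injective (G := G') (G' := G) Y X ?_)
    have h := hom_congr_apply (S.σ X Y (𝟙_ Vect)).hom_inv_id
      (dot (G.obj X) p (dot (G'.obj Y) (V := 𝟙_ Vect) q (1 : ℂ)))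
    have h1 := hs (V := 𝟙_ Vect) p q (1 : ℂ)
    have h2 := congrArg (S.σ X Y (𝟙_ Vect)).inv.hom.hom h1
    rw [map_sum] at h2
    have h3 := h2.symm.trans h
    simp only [Algebra.TensorProduct.tmul_mul_tmul, map_sum, TensorProduct.map_tmul,
      Tan.ev_apply, map_mul, Module.End.mul_apply, Algebra.TensorProduct.one_def, map_one,
      Module.End.one_apply, swapDot_tmul, TensorProduct.comm_tmul]
    rw [Finset.sum_comm]
    refine Eq.trans ?_ h3
    exact Finset.sum_congr rfl fun j _ => (hs' _ _ _).symm

variable [MonoidalCategory 𝒟] [MonoidalCategory 𝒟'] [(fibre G).Monoidal] [(fibre G').Monoidal]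

/-- The representing element of a crossing that is compatible with an action from the left in the
second argument. -/
theorem IsRepr.comul_snd {s : Finset (Tan B (fibre G) × Tan B' (fibre G'))} (hs : S.IsRepr s)
    (L' : LeftCoherence G')
    (hmu : ∀ {Y Z : 𝒟'} (q : (fibre G').obj Y) (q' : (fibre G').obj Z),
      mu (fibre G') Y Z (q ⊗ₜ q') = (L'.c Y Z (𝟙_ Vect)).hom.hom.hom (dot (G'.obj Y) q q'))
    (hσ : ∀ (X : 𝒟) (Y Z : 𝒟') (V : Vect), (S.σ X Y ((G'.obj Z).obj V)).hom ≫
      (G'.obj Y).map (S.σ X Z V).hom ≫ (L'.c Y Z ((G.obj X).obj V)).hom =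
        (G.obj X).map (L'.c Y Z V).hom ≫ (S.σ X (Y ⊗ Z) V).hom) :
    ∑ i ∈ s, i.1 ⊗ₜ[ℂ] Coalgebra.comul (R := ℂ) i.2 =
      ∑ i ∈ s, ∑ j ∈ s, (j.1 * i.1) ⊗ₜ[ℂ] (i.2 ⊗ₜ[ℂ] j.2) := by
  refine Tan.tensor_ext₃ fun X Y Z p q q' => ?_
  have inj : Function.Injective (swapDot G G' X (Y ⊗ Z) (V := 𝟙_ Vect) (1 : ℂ) ∘ₗ
      ((mu (fibre G') Y Z).lTensor ((fibre G).obj X)).toLinearMap) :=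
    (swapDot_one_injective X (Y ⊗ Z)).comp (LinearEquiv.injective _)
  apply inj
  simp only [map_sum, TensorProduct.map_tmul, LinearMap.comp_apply, LinearEquiv.coe_coe,
    LinearEquiv.lTensor_tmul, Tan.ev_apply, swapDot_tmul, Tan.mu_map_ev_comul]
  have h := hom_congr_apply (hσ X Y Z (𝟙_ Vect))
    (dot (G.obj X) p (dot (G'.obj Y) q (dot (G'.obj Z) (V := 𝟙_ Vect) q' (1 : ℂ))))
  have hL : ((G.obj X).map (L'.c Y Z (𝟙_ Vect)).hom ≫ (S.σ X (Y ⊗ Z) (𝟙_ Vect)).hom).hom.hom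
      (dot (G.obj X) p (dot (G'.obj Y) q (dot (G'.obj Z) (V := 𝟙_ Vect) q' (1 : ℂ)))) =
      (S.σ X (Y ⊗ Z) (𝟙_ Vect)).hom.hom.hom (dot (G.obj X) p
        (dot (G'.obj (Y ⊗ Z)) (V := 𝟙_ Vect) (mu (fibre G') Y Z (q ⊗ₜ q')) (1 : ℂ))) := by
    rw [hmu, ← L'.c_dot_dot]
    exact congrArg (S.σ X (Y ⊗ Z) (𝟙_ Vect)).hom.hom.hom (map_dot _ _ _ _)
  rw [hL, hs] at h
  rw [← h]
  have hR : ((S.σ X Y ((G'.obj Z).obj (𝟙_ Vect))).hom ≫ (G'.obj Y).map (S.σ X Z (𝟙_ Vect)).hom ≫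
      (L'.c Y Z ((G.obj X).obj (𝟙_ Vect))).hom).hom.hom
        (dot (G.obj X) p (dot (G'.obj Y) q (dot (G'.obj Z) (V := 𝟙_ Vect) q' (1 : ℂ)))) =
      (L'.c Y Z ((G.obj X).obj (𝟙_ Vect))).hom.hom.hom
        (((G'.obj Y).map (S.σ X Z (𝟙_ Vect)).hom).hom.hom
        ((S.σ X Y ((G'.obj Z).obj (𝟙_ Vect))).hom.hom.hom
          (dot (G.obj X) p (dot (G'.obj Y) q (dot (G'.obj Z) (V := 𝟙_ Vect) q' (1 : ℂ)))))) := rfl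
  rw [hR, hs, map_sum, map_sum]
  refine Finset.sum_congr rfl fun i _ => ?_
  rw [map_dot, hs, dot_sum, map_sum]
  refine Finset.sum_congr rfl fun j _ => ?_
  rw [L'.c_dot_dot, ← hmu, map_mul]
  rfl

/-- The representing element of a crossing that is compatible with an action from the left in the
first argument. -/
theorem IsRepr.comul_fst_of_left {s : Finset (Tan B (fibre G) × Tan B' (fibre G'))}
    (hs : S.IsRepr s) (L : LeftCoherence G)
    (hmu : ∀ {X Y : 𝒟} (p : (fibre G).obj X) (q : (fibre G).obj Y),
      mu (fibre G) X Y (p ⊗ₜ q) = (L.c X Y (𝟙_ Vect)).hom.hom.hom (dot (G.obj X) p q))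
    (hσ : ∀ (X Y : 𝒟) (Z : 𝒟') (V : Vect), (G.obj X).map (S.σ Y Z V).hom ≫
      (S.σ X Z ((G.obj Y).obj V)).hom ≫ (G'.obj Z).map (L.c X Y V).hom =
        (L.c X Y ((G'.obj Z).obj V)).hom ≫ (S.σ (X ⊗ Y) Z V).hom) :
    ∑ i ∈ s, Coalgebra.comul (R := ℂ) i.1 ⊗ₜ[ℂ] i.2 =
      ∑ i ∈ s, ∑ j ∈ s, (j.1 ⊗ₜ[ℂ] i.1) ⊗ₜ[ℂ] (j.2 * i.2) := by
  apply (TensorProduct.assoc ℂ _ _ _).injective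
  refine Tan.tensor_ext₃ fun X Y Z p p' q => (TensorProduct.assoc ℂ _ _ _).symm.injective ?_
  have inj : Function.Injective (swapDot G G' (X ⊗ Y) Z (V := 𝟙_ Vect) (1 : ℂ) ∘ₗ
      ((mu (fibre G) X Y).rTensor ((fibre G').obj Z)).toLinearMap) :=
    (swapDot_one_injective (X ⊗ Y) Z).comp (LinearEquiv.injective _)
  apply inj
  rw [assoc_symm_map_assoc, assoc_symm_map_assoc]
  simp only [map_sum, TensorProduct.map_tmul, LinearMap.comp_apply, LinearEquiv.coe_coe,
    LinearEquiv.rTensor_tmul, Tan.ev_apply, swapDot_tmul, Tan.mu_map_ev_comul]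
  have h := hom_congr_apply (hσ X Y Z (𝟙_ Vect))
    (dot (G.obj X) p (dot (G.obj Y) p' (dot (G'.obj Z) (V := 𝟙_ Vect) q (1 : ℂ))))
  have hL : ((L.c X Y ((G'.obj Z).obj (𝟙_ Vect))).hom ≫ (S.σ (X ⊗ Y) Z (𝟙_ Vect)).hom).hom.hom
      (dot (G.obj X) p (dot (G.obj Y) p' (dot (G'.obj Z) (V := 𝟙_ Vect) q (1 : ℂ)))) =
      (S.σ (X ⊗ Y) Z (𝟙_ Vect)).hom.hom.hom (dot (G.obj (X ⊗ Y)) (mu (fibre G) X Y (p ⊗ₜ p'))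
        (dot (G'.obj Z) (V := 𝟙_ Vect) q (1 : ℂ))) := by
    rw [hmu, ← L.c_dot_dot]
    rfl
  rw [hL, hs] at h
  rw [← h]
  have hR : ((G.obj X).map (S.σ Y Z (𝟙_ Vect)).hom ≫ (S.σ X Z ((G.obj Y).obj (𝟙_ Vect))).hom ≫
      (G'.obj Z).map (L.c X Y (𝟙_ Vect)).hom).hom.hom
        (dot (G.obj X) p (dot (G.obj Y) p' (dot (G'.obj Z) (V := 𝟙_ Vect) q (1 : ℂ)))) =
      ((G'.obj Z).map (L.c X Y (𝟙_ Vect)).hom).hom.hom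
        ((S.σ X Z ((G.obj Y).obj (𝟙_ Vect))).hom.hom.hom
          (((G.obj X).map (S.σ Y Z (𝟙_ Vect)).hom).hom.hom
          (dot (G.obj X) p (dot (G.obj Y) p' (dot (G'.obj Z) (V := 𝟙_ Vect) q (1 : ℂ)))))) := rfl
  rw [hR, map_dot, hs, dot_sum, map_sum, map_sum]
  refine Finset.sum_congr rfl fun i _ => ?_
  rw [hs, map_sum]
  refine Finset.sum_congr rfl fun j _ => ?_
  rw [map_dot, L.c_dot_dot, ← hmu, map_mul]
  rfl

/-- The representing element of a crossing that is compatible with an action from the right in the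
first argument. -/
theorem IsRepr.comul_fst_of_right {s : Finset (Tan B (fibre G) × Tan B' (fibre G'))}
    (hs : S.IsRepr s) (L : RightCoherence G)
    (hmu : ∀ {X Y : 𝒟} (p : (fibre G).obj X) (q : (fibre G).obj Y),
      mu (fibre G) X Y (p ⊗ₜ q) = (L.c X Y (𝟙_ Vect)).hom.hom.hom (dot (G.obj Y) q p))
    (hσ : ∀ (X Y : 𝒟) (Z : 𝒟') (V : Vect), (G.obj Y).map (S.σ X Z V).hom ≫
      (S.σ Y Z ((G.obj X).obj V)).hom ≫ (G'.obj Z).map (L.c X Y V).hom =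
        (L.c X Y ((G'.obj Z).obj V)).hom ≫ (S.σ (X ⊗ Y) Z V).hom) :
    ∑ i ∈ s, Coalgebra.comul (R := ℂ) i.1 ⊗ₜ[ℂ] i.2 =
      ∑ i ∈ s, ∑ j ∈ s, (i.1 ⊗ₜ[ℂ] j.1) ⊗ₜ[ℂ] (j.2 * i.2) := by
  apply (TensorProduct.assoc ℂ _ _ _).injective
  refine Tan.tensor_ext₃ fun X Y Z p p' q => (TensorProduct.assoc ℂ _ _ _).symm.injective ?_
  have inj : Function.Injective (swapDot G G' (X ⊗ Y) Z (V := 𝟙_ Vect) (1 : ℂ) ∘ₗ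
      ((mu (fibre G) X Y).rTensor ((fibre G').obj Z)).toLinearMap) :=
    (swapDot_one_injective (X ⊗ Y) Z).comp (LinearEquiv.injective _)
  apply inj
  rw [assoc_symm_map_assoc, assoc_symm_map_assoc]
  simp only [map_sum, TensorProduct.map_tmul, LinearMap.comp_apply, LinearEquiv.coe_coe,
    LinearEquiv.rTensor_tmul, Tan.ev_apply, swapDot_tmul, Tan.mu_map_ev_comul]
  have h := hom_congr_apply (hσ X Y Z (𝟙_ Vect))
    (dot (G.obj Y) p' (dot (G.obj X) p (dot (G'.obj Z) (V := 𝟙_ Vect) q (1 : ℂ))))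
  have hL : ((L.c X Y ((G'.obj Z).obj (𝟙_ Vect))).hom ≫ (S.σ (X ⊗ Y) Z (𝟙_ Vect)).hom).hom.hom
      (dot (G.obj Y) p' (dot (G.obj X) p (dot (G'.obj Z) (V := 𝟙_ Vect) q (1 : ℂ)))) =
      (S.σ (X ⊗ Y) Z (𝟙_ Vect)).hom.hom.hom (dot (G.obj (X ⊗ Y)) (mu (fibre G) X Y (p ⊗ₜ p'))
        (dot (G'.obj Z) (V := 𝟙_ Vect) q (1 : ℂ))) := by
    rw [hmu, ← L.c_dot_dot]
    rfl
  rw [hL, hs] at h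
  rw [← h]
  have hR : ((G.obj Y).map (S.σ X Z (𝟙_ Vect)).hom ≫ (S.σ Y Z ((G.obj X).obj (𝟙_ Vect))).hom ≫
      (G'.obj Z).map (L.c X Y (𝟙_ Vect)).hom).hom.hom
        (dot (G.obj Y) p' (dot (G.obj X) p (dot (G'.obj Z) (V := 𝟙_ Vect) q (1 : ℂ)))) =
      ((G'.obj Z).map (L.c X Y (𝟙_ Vect)).hom).hom.hom
        ((S.σ Y Z ((G.obj X).obj (𝟙_ Vect))).hom.hom.hom
          (((G.obj Y).map (S.σ X Z (𝟙_ Vect)).hom).hom.hom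
          (dot (G.obj Y) p' (dot (G.obj X) p (dot (G'.obj Z) (V := 𝟙_ Vect) q (1 : ℂ)))))) := rfl
  rw [hR, map_dot, hs, dot_sum, map_sum, map_sum]
  refine Finset.sum_congr rfl fun i _ => ?_
  rw [hs, map_sum]
  refine Finset.sum_congr rfl fun j _ => ?_
  rw [map_dot, L.c_dot_dot, ← hmu, map_mul]
  rfl

end Crossing

end CrossingLaws

/-! ### The crossings of a bimodule category -/

section Iso

universe v u

variable {K : Type u} [Category.{v} K] {P Q R S T U : K}

theorem inv_comp_inv_comp (e : P ≅ Q) (e' : Q ≅ R) (n : R ⟶ S) (s : T ≅ S) (m : P ⟶ T)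
    (h : m ≫ s.hom = e.hom ≫ e'.hom ≫ n) : e'.inv ≫ e.inv ≫ m = n ≫ s.inv := by
  rw [Iso.inv_comp_eq, Iso.inv_comp_eq, ← Category.assoc, ← Category.assoc, Iso.eq_comp_inv, h,
    Category.assoc]

theorem inv_comp_comp_eq (e : P ≅ Q) (t : P ⟶ R) (m : R ⟶ S) (s : S ≅ T) (m' : Q ⟶ U) (t' : U ⟶ T)
    (h : t ≫ m ≫ s.hom = e.hom ≫ m' ≫ t') : e.inv ≫ t ≫ m = m' ≫ t' ≫ s.inv := by
  rw [Iso.inv_comp_eq, ← Category.assoc, ← Category.assoc, Iso.eq_comp_inv, Category.assoc, h,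
    Category.assoc]

end Iso

section BimoduleCrossings

universe v u

variable {𝒜 : Type u} [Category.{v} 𝒜] {𝒞 : Type u₂} [Category.{v₂} 𝒞] [MonoidalCategory 𝒞]
  {ℬ : Type u₃} [Category.{v₃} ℬ] [MonoidalCategory ℬ]
  [MonoidalLeftAction 𝒞 Vect] [MonoidalRightAction ℬ Vect] [BimoduleCategory 𝒞 ℬ Vect]

variable (𝒞 ℬ) in
/-- The crossing of the two actions of a bimodule category. -/
def midCrossing :
    Crossing (MonoidalRightAction.curriedAction ℬ Vect)
      (MonoidalLeftAction.curriedAction 𝒞 Vect) where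
  σ u x V := BimoduleCategory.mid x V u
  naturality {u u' x x' V W} f g α := by
    have h := BimoduleCategory.mid_naturality (M := Vect) g α f
    rw [MonoidalRightAction.actionHom_def', MonoidalLeftAction.actionHom_def,
      MonoidalLeftAction.actionHom_def, MonoidalRightAction.actionHom_def'] at h
    refine Eq.trans ?_ h
    exact (Category.assoc _ _ _).symm

/-- The crossing of the right action and a family of bimodule functors. -/
def tCrossing (Φ : 𝒜 ⥤ BimodEnd 𝒞 ℬ Vect) :
    Crossing (MonoidalRightAction.curriedAction ℬ Vect) (Φ ⋙ BimodEnd.forget 𝒞 ℬ Vect) where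
  σ u a V := (Φ.obj a).t V u
  naturality {u u' a a' V W} f g α := by
    change (Φ.obj a).functor.obj V ⊴ᵣ f ≫
      ((Φ.map g).nat.app V ≫ (Φ.obj a').functor.map α) ⊵ᵣ u' ≫ ((Φ.obj a').t W u').hom =
        ((Φ.obj a).t V u).hom ≫ (Φ.map g).nat.app (V ⊙ᵣ u) ≫
          (Φ.obj a').functor.map (V ⊴ᵣ f ≫ α ⊵ᵣ u')
    have h1 := (Φ.obj a').t_naturality α f
    have h2 := (Φ.map g).t_comm V u
    rw [MonoidalRightAction.actionHom_def', MonoidalRightAction.actionHom_def',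
      Category.assoc] at h1
    rw [← Category.assoc ((Φ.obj a).t V u).hom, ← h2, Category.assoc, ← h1,
      MonoidalRightAction.comp_actionHomLeft, Category.assoc,
      MonoidalRightAction.action_exchange_assoc]

/-- The crossing of the left action and a family of bimodule functors. -/
def sCrossing (Φ : 𝒜 ⥤ BimodEnd 𝒞 ℬ Vect) :
    Crossing (Φ ⋙ BimodEnd.forget 𝒞 ℬ Vect) (MonoidalLeftAction.curriedAction 𝒞 Vect) where
  σ a x V := (Φ.obj a).s x V
  naturality {a a' x x' V W} g f α := by
    change (Φ.map g).nat.app (x ⊙ₗ V) ≫ (Φ.obj a').functor.map (f ⊵ₗ V ≫ x' ⊴ₗ α) ≫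
      ((Φ.obj a').s x' W).hom = ((Φ.obj a).s x V).hom ≫ f ⊵ₗ ((Φ.obj a).functor.obj V) ≫
        x' ⊴ₗ ((Φ.map g).nat.app V ≫ (Φ.obj a').functor.map α)
    have h1 := (Φ.obj a').s_naturality f α
    have h2 := (Φ.map g).s_comm x V
    rw [MonoidalLeftAction.actionHom_def, MonoidalLeftAction.actionHom_def] at h1
    rw [h1, ← Category.assoc, h2, Category.assoc, MonoidalLeftAction.actionHomRight_comp,
      MonoidalLeftAction.action_exchange_assoc]

/-- The compatibility of the bimodule structure with the tensor product of `ℬ`. -/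
theorem midCrossing_right (u v : ℬ) (x : 𝒞) (V : Vect) :
    (BimoduleCategory.mid x V u).hom ⊵ᵣ v ≫ (BimoduleCategory.mid x (V ⊙ᵣ u) v).hom ≫
      x ⊴ₗ (αᵣ V u v).inv = (αᵣ (x ⊙ₗ V) u v).inv ≫ (BimoduleCategory.mid x V (u ⊗ v)).hom :=
  (BimoduleCategory.mid_tensor_right x V u v).symm

/-- The compatibility of the bimodule structure with the tensor product of `𝒞`. -/
theorem midCrossing_left (u : ℬ) (x y : 𝒞) (V : Vect) :
    (BimoduleCategory.mid x (y ⊙ₗ V) u).hom ≫ x ⊴ₗ (BimoduleCategory.mid y V u).hom ≫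
      (αₗ x y (V ⊙ᵣ u)).inv = (αₗ x y V).inv ⊵ᵣ u ≫ (BimoduleCategory.mid (x ⊗ y) V u).hom := by
  have h := BimoduleCategory.mid_tensor_left x y V u
  rw [← Category.assoc, Iso.comp_inv_eq, Category.assoc, h,
    MonoidalRightAction.inv_hom_actionHomLeft_assoc]

variable [MonoidalCategory 𝒜] (Φ : 𝒜 ⥤ BimodEnd 𝒞 ℬ Vect) [Φ.Monoidal]

/-- The structure isomorphisms of `Φ` are compatible with the crossing of the right action. -/
theorem tCrossing_left (u : ℬ) (a b : 𝒜) (V : Vect) :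
    ((Φ.obj a).t ((Φ.obj b).functor.obj V) u).hom ≫ (Φ.obj a).functor.map ((Φ.obj b).t V u).hom ≫
      (Functor.LaxMonoidal.μ Φ a b).nat.app (V ⊙ᵣ u) =
        (Functor.LaxMonoidal.μ Φ a b).nat.app V ⊵ᵣ u ≫ ((Φ.obj (a ⊗ b)).t V u).hom := by
  have h := (Functor.LaxMonoidal.μ Φ a b).t_comm V u
  exact (h.trans (Category.assoc _ _ _)).symm

/-- The compatibility of the inverse crossing of the left action with the tensor product of `𝒞`. -/
theorem sCrossing_left (F : BimodEnd 𝒞 ℬ Vect) (x y : 𝒞) (V : Vect) :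
    x ⊴ₗ (F.s y V).inv ≫ (F.s x (y ⊙ₗ V)).inv ≫ F.functor.map (αₗ x y V).inv =
      (αₗ x y (F.functor.obj V)).inv ≫ (F.s (x ⊗ y) V).inv := by
  have h : F.s (x ⊗ y) V ≪≫ αₗ x y (F.functor.obj V) = (F.functor.mapIso (αₗ x y V) ≪≫
      F.s x (y ⊙ₗ V)) ≪≫ ((MonoidalLeftAction.curriedAction 𝒞 Vect).obj x).mapIso (F.s y V) :=
    Iso.ext ((F.s_tensor x y V).trans (Category.assoc _ _ _).symm)
  exact (congrArg Iso.inv h).symm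

/-- The structure isomorphisms of `Φ` are compatible with the inverse crossing of the left
action. -/
theorem sCrossing_functor (x : 𝒞) (a b : 𝒜) (V : Vect) :
    ((Φ.obj a).s x ((Φ.obj b).functor.obj V)).inv ≫ (Φ.obj a).functor.map ((Φ.obj b).s x V).inv ≫
      (Functor.LaxMonoidal.μ Φ a b).nat.app (x ⊙ₗ V) =
        x ⊴ₗ (Functor.LaxMonoidal.μ Φ a b).nat.app V ≫ ((Φ.obj (a ⊗ b)).s x V).inv := by
  have h := (Functor.LaxMonoidal.μ Φ a b).s_comm x V
  have h' : (Functor.LaxMonoidal.μ Φ a b).nat.app (x ⊙ₗ V) ≫ ((Φ.obj (a ⊗ b)).s x V).hom =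
    (Φ.obj a).functor.map ((Φ.obj b).s x V).hom ≫ ((Φ.obj a).s x ((Φ.obj b).functor.obj V)).hom ≫
      x ⊴ₗ (Functor.LaxMonoidal.μ Φ a b).nat.app V := h.trans (Category.assoc _ _ _)
  exact inv_comp_inv_comp ((Φ.obj a).functor.mapIso ((Φ.obj b).s x V)) _ _ _ _ h'

/-- The compatibility of the three crossings. -/
theorem crossing_hexagon (F : BimodEnd 𝒞 ℬ Vect) (x : 𝒞) (u : ℬ) (V : Vect) :
    (F.s x V).inv ⊵ᵣ u ≫ (F.t (x ⊙ₗ V) u).hom ≫ F.functor.map (BimoduleCategory.mid x V u).hom =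
      (BimoduleCategory.mid x (F.functor.obj V) u).hom ≫ x ⊴ₗ (F.t V u).hom ≫
        (F.s x (V ⊙ᵣ u)).inv := by
  have h := F.hexagon x V u
  exact inv_comp_comp_eq
    (((MonoidalRightAction.curriedAction ℬ Vect).obj u).mapIso (F.s x V)) _ _ _ _ _ h

end BimoduleCrossings

/-! ### Skew pairings on opposite and co-opposite duals -/

section SkewPairings

variable {K L : Type} [Ring K] [Bialgebra ℂ K] [Ring L]

/-- If `R = ∑ r ⊗ r'` is invertible and `(Δ ⊗ 1)(R)` is a product of two copies of `R`, then
`(ε ⊗ 1)(R)` is an invertible idempotent. -/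
theorem sum_counit_smul [Algebra ℂ L] {ι : Type*} (s : Finset ι) (r : ι → K) (r' : ι → L)
    (hu : IsUnit (∑ i ∈ s, r i ⊗ₜ[ℂ] r' i)) (f : ι → ι → K ⊗[ℂ] K)
    (hf : ∀ i j, LinearMap.mul' ℂ ℂ (TensorProduct.map Coalgebra.counit Coalgebra.counit (f i j)) =
      Coalgebra.counit (R := ℂ) (r i) * Coalgebra.counit (R := ℂ) (r j))
    (h : ∑ i ∈ s, Coalgebra.comul (R := ℂ) (r i) ⊗ₜ[ℂ] r' i =
      ∑ i ∈ s, ∑ j ∈ s, f i j ⊗ₜ[ℂ] (r' j * r' i)) :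
    ∑ i ∈ s, Coalgebra.counit (R := ℂ) (r i) • r' i = 1 := by
  have hc : ∀ x : K, LinearMap.mul' ℂ ℂ (TensorProduct.map Coalgebra.counit Coalgebra.counit
      (Coalgebra.comul (R := ℂ) x)) = Coalgebra.counit (R := ℂ) x := fun x => by
    let r := Coalgebra.Repr.arbitrary ℂ x
    have h1 := congrArg (Coalgebra.counit (R := ℂ)) (Coalgebra.sum_counit_smul r)
    rw [← r.eq]
    simpa [map_sum] using h1
  have h1 := congrArg ((TensorProduct.lid ℂ L).toLinearMap ∘ₗ (LinearMap.mul' ℂ ℂ ∘ₗ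
    TensorProduct.map Coalgebra.counit Coalgebra.counit).rTensor L) h
  simp only [map_sum, LinearMap.comp_apply, LinearMap.rTensor_tmul, LinearEquiv.coe_coe,
    TensorProduct.lid_tmul, hc, hf] at h1
  have h2 : (∑ i ∈ s, Coalgebra.counit (R := ℂ) (r i) • r' i) *
      (∑ i ∈ s, Coalgebra.counit (R := ℂ) (r i) • r' i) =
        ∑ i ∈ s, Coalgebra.counit (R := ℂ) (r i) • r' i := by
    conv_rhs => rw [h1]
    rw [Finset.sum_mul_sum, Finset.sum_comm]
    refine Finset.sum_congr rfl fun i _ => Finset.sum_congr rfl fun j _ => ?_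
    rw [smul_mul_smul_comm, mul_comm (Coalgebra.counit (R := ℂ) (r i))]
  have h3 : IsUnit (∑ i ∈ s, Coalgebra.counit (R := ℂ) (r i) • r' i) := by
    have h4 := hu.map ((Algebra.TensorProduct.lid ℂ L).toAlgHom.comp
      (Algebra.TensorProduct.map (Bialgebra.counitAlgHom ℂ K) (AlgHom.id ℂ L)))
    simpa [map_sum] using h4
  exact h3.mul_left_cancel (h2.trans (mul_one _).symm)

variable [Bialgebra ℂ L] (s : Finset (K × L))

theorem sum_counit_smul_snd (hu : IsUnit (∑ i ∈ s, i.1 ⊗ₜ[ℂ] i.2))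
    (f : K × L → K × L → K ⊗[ℂ] K)
    (hf : ∀ i j, LinearMap.mul' ℂ ℂ (TensorProduct.map Coalgebra.counit Coalgebra.counit (f i j)) =
      Coalgebra.counit (R := ℂ) i.1 * Coalgebra.counit (R := ℂ) j.1)
    (h : ∑ i ∈ s, Coalgebra.comul (R := ℂ) i.1 ⊗ₜ[ℂ] i.2 =
      ∑ i ∈ s, ∑ j ∈ s, f i j ⊗ₜ[ℂ] (j.2 * i.2)) :
    ∑ i ∈ s, Coalgebra.counit (R := ℂ) i.1 • i.2 = 1 :=
  sum_counit_smul s _ _ hu f hf h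

theorem sum_counit_smul_fst (hu : IsUnit (∑ i ∈ s, i.1 ⊗ₜ[ℂ] i.2))
    (h : ∑ i ∈ s, i.1 ⊗ₜ[ℂ] Coalgebra.comul (R := ℂ) i.2 =
      ∑ i ∈ s, ∑ j ∈ s, (j.1 * i.1) ⊗ₜ[ℂ] (i.2 ⊗ₜ[ℂ] j.2)) :
    ∑ i ∈ s, Coalgebra.counit (R := ℂ) i.2 • i.1 = 1 := by
  refine sum_counit_smul s (fun i => i.2) (fun i => i.1) ?_ (fun i j => i.2 ⊗ₜ j.2)
    (fun i j => by simp) ?_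
  · simpa [map_sum] using hu.map (Algebra.TensorProduct.comm ℂ K L)
  · simpa [map_sum] using congrArg (TensorProduct.comm ℂ K (L ⊗[ℂ] L)) h

variable [Module.Finite ℂ K] [Module.Finite ℂ L]

variable {s}

/-- The flip of `R` is a skew pairing of `(L^{cop})^*` and `K^*`. -/
theorem isSkewPairing_cop_left (hu : IsUnit (∑ i ∈ s, i.1 ⊗ₜ[ℂ] i.2))
    (h1 : ∑ i ∈ s, Coalgebra.comul (R := ℂ) i.1 ⊗ₜ[ℂ] i.2 =
      ∑ i ∈ s, ∑ j ∈ s, (i.1 ⊗ₜ[ℂ] j.1) ⊗ₜ[ℂ] (j.2 * i.2))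
    (h2 : ∑ i ∈ s, i.1 ⊗ₜ[ℂ] Coalgebra.comul (R := ℂ) i.2 =
      ∑ i ∈ s, ∑ j ∈ s, (j.1 * i.1) ⊗ₜ[ℂ] (i.2 ⊗ₜ[ℂ] j.2)) :
    IsSkewPairing (form (∑ i ∈ s, (Cop.algEquiv L).symm i.2 ⊗ₜ[ℂ] i.1)) := by
  refine isSkewPairing_form s _ _ ?_ ?_ ?_ ?_
  · have h := congrArg (fun z => TensorProduct.comm ℂ _ _ (LinearMap.lTensor K
      (TensorProduct.map (Cop.algEquiv L).symm.toLinearMap (Cop.algEquiv L).symm.toLinearMap ∘ₗ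
        (TensorProduct.comm ℂ L L).toLinearMap) z)) h2
    simp only [map_sum, LinearMap.lTensor_tmul, LinearMap.comp_apply, LinearEquiv.coe_coe,
      TensorProduct.comm_tmul, TensorProduct.map_tmul] at h
    rw [Finset.sum_comm] at h
    exact h
  · have h := congrArg (fun z => TensorProduct.comm ℂ _ _ (LinearMap.lTensor (K ⊗[ℂ] K)
      (Cop.algEquiv L).symm.toLinearMap z)) h1
    simp only [map_sum, LinearMap.lTensor_tmul, TensorProduct.comm_tmul] at h
    rw [Finset.sum_comm] at h
    refine h.trans (Finset.sum_congr rfl fun i _ => Finset.sum_congr rfl fun j _ => ?_)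
    rfl
  · exact sum_counit_smul_fst s hu h2
  · have h := congrArg (Cop.algEquiv L).symm
      (sum_counit_smul_snd s hu (fun i j => i.1 ⊗ₜ j.1) (fun i j => by simp) h1)
    simpa only [map_sum, map_smul, map_one] using h

/-- `R` is a skew pairing of `K^*` and `(L^{op})^*`. -/
theorem isSkewPairing_op_right (hu : IsUnit (∑ i ∈ s, i.1 ⊗ₜ[ℂ] i.2))
    (h1 : ∑ i ∈ s, Coalgebra.comul (R := ℂ) i.1 ⊗ₜ[ℂ] i.2 =
      ∑ i ∈ s, ∑ j ∈ s, (i.1 ⊗ₜ[ℂ] j.1) ⊗ₜ[ℂ] (j.2 * i.2))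
    (h2 : ∑ i ∈ s, i.1 ⊗ₜ[ℂ] Coalgebra.comul (R := ℂ) i.2 =
      ∑ i ∈ s, ∑ j ∈ s, (j.1 * i.1) ⊗ₜ[ℂ] (i.2 ⊗ₜ[ℂ] j.2)) :
    IsSkewPairing (form (∑ i ∈ s, i.1 ⊗ₜ[ℂ] MulOpposite.op i.2)) := by
  refine isSkewPairing_form s _ _ ?_ ?_ ?_ ?_
  · have h := congrArg (LinearMap.lTensor (K ⊗[ℂ] K)
      (MulOpposite.opLinearEquiv ℂ (M := L)).toLinearMap) h1
    simpa only [map_sum, LinearMap.lTensor_tmul, LinearEquiv.coe_coe,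
      MulOpposite.coe_opLinearEquiv, MulOpposite.op_mul] using h
  · have h := congrArg (LinearMap.lTensor K (TensorProduct.map
      (MulOpposite.opLinearEquiv ℂ (M := L)).toLinearMap
        (MulOpposite.opLinearEquiv ℂ (M := L)).toLinearMap)) h2
    simp only [map_sum, LinearMap.lTensor_tmul, TensorProduct.map_tmul, LinearEquiv.coe_coe,
      MulOpposite.coe_opLinearEquiv] at h
    rw [Finset.sum_comm] at h
    exact h
  · have h := congrArg MulOpposite.op
      (sum_counit_smul_snd s hu (fun i j => i.1 ⊗ₜ j.1) (fun i j => by simp) h1)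
    simpa using h
  · exact sum_counit_smul_fst s hu h2

/-- `R` is a skew pairing of `(K^{op})^*` and `(L^{cop})^*`, if the first two factors of
`(Δ ⊗ 1)(R)` occur in the order opposite to that in the other two cases. -/
theorem isSkewPairing_op_cop (hu : IsUnit (∑ i ∈ s, i.1 ⊗ₜ[ℂ] i.2))
    (h1 : ∑ i ∈ s, Coalgebra.comul (R := ℂ) i.1 ⊗ₜ[ℂ] i.2 =
      ∑ i ∈ s, ∑ j ∈ s, (j.1 ⊗ₜ[ℂ] i.1) ⊗ₜ[ℂ] (j.2 * i.2))
    (h2 : ∑ i ∈ s, i.1 ⊗ₜ[ℂ] Coalgebra.comul (R := ℂ) i.2 =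
      ∑ i ∈ s, ∑ j ∈ s, (j.1 * i.1) ⊗ₜ[ℂ] (i.2 ⊗ₜ[ℂ] j.2)) :
    IsSkewPairing (form (∑ i ∈ s, MulOpposite.op i.1 ⊗ₜ[ℂ] (Cop.algEquiv L).symm i.2)) := by
  refine isSkewPairing_form s _ _ ?_ ?_ ?_ ?_
  · have h := congrArg (TensorProduct.map (TensorProduct.map
      (MulOpposite.opLinearEquiv ℂ (M := K)).toLinearMap
        (MulOpposite.opLinearEquiv ℂ (M := K)).toLinearMap) (Cop.algEquiv L).symm.toLinearMap) h1
    simp only [map_sum, TensorProduct.map_tmul, LinearEquiv.coe_coe,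
      MulOpposite.coe_opLinearEquiv, AlgEquiv.toLinearMap_apply, map_mul] at h
    rw [Finset.sum_comm] at h
    exact h
  · have h := congrArg (TensorProduct.map (MulOpposite.opLinearEquiv ℂ (M := K)).toLinearMap
      (TensorProduct.map (Cop.algEquiv L).symm.toLinearMap (Cop.algEquiv L).symm.toLinearMap ∘ₗ
        (TensorProduct.comm ℂ L L).toLinearMap)) h2
    simp only [map_sum, TensorProduct.map_tmul, LinearMap.comp_apply, LinearEquiv.coe_coe,
      TensorProduct.comm_tmul, MulOpposite.coe_opLinearEquiv, MulOpposite.op_mul] at h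
    exact h
  · have h := congrArg (Cop.algEquiv L).symm
      (sum_counit_smul_snd s hu (fun i j => j.1 ⊗ₜ i.1) (fun i j => by simp [mul_comm]) h1)
    simp only [map_sum, map_smul, map_one] at h
    exact h
  · have h := congrArg (MulOpposite.opLinearEquiv ℂ) (sum_counit_smul_fst s hu h2)
    simp only [map_sum, map_smul] at h
    exact h

end SkewPairings

section Inverse

variable {K L : Type} [Ring K] [HopfAlgebra ℂ K] [Ring L] [Bialgebra ℂ L]
  [Module.Finite ℂ K] [Module.Finite ℂ L] {s s' : Finset (K × L)}

/-- The inverse of `R` is `(S ⊗ 1)(R)`; since `S² = id`, it is also the inverse of `R` in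
`K^{op} ⊗ L`. -/
theorem convInv_form_op_cop
    (hS : ∀ x : K, HopfAlgebra.antipode ℂ (HopfAlgebra.antipode ℂ x) = x)
    (hr : (∑ i ∈ s, i.1 ⊗ₜ[ℂ] i.2) * (∑ i ∈ s', i.1 ⊗ₜ[ℂ] i.2) = 1)
    (hl : (∑ i ∈ s', i.1 ⊗ₜ[ℂ] i.2) * (∑ i ∈ s, i.1 ⊗ₜ[ℂ] i.2) = 1)
    (h1 : ∑ i ∈ s, Coalgebra.comul (R := ℂ) i.1 ⊗ₜ[ℂ] i.2 =
      ∑ i ∈ s, ∑ j ∈ s, (j.1 ⊗ₜ[ℂ] i.1) ⊗ₜ[ℂ] (j.2 * i.2)) :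
    convInv (form (∑ i ∈ s, MulOpposite.op i.1 ⊗ₜ[ℂ] (Cop.algEquiv L).symm i.2)) =
      form (∑ i ∈ s', MulOpposite.op i.1 ⊗ₜ[ℂ] (Cop.algEquiv L).symm i.2) := by
  have h0 : ∑ i ∈ s, Coalgebra.counit (R := ℂ) i.1 • i.2 = 1 :=
    sum_counit_smul_snd s ⟨⟨_, _, hr, hl⟩, rfl⟩
      (fun i j => j.1 ⊗ₜ i.1) (fun i j => by simp [mul_comm]) h1
  have hε : ∑ i ∈ s, algebraMap ℂ K (Coalgebra.counit (R := ℂ) i.1) ⊗ₜ[ℂ] i.2 = 1 := by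
    simp only [Algebra.algebraMap_eq_smul_one, TensorProduct.smul_tmul, ← TensorProduct.tmul_sum]
    rw [h0]
    rfl
  -- the inverse of `R` is `(S ⊗ 1)(R)`
  have hS1 : (∑ i ∈ s, HopfAlgebra.antipode ℂ i.1 ⊗ₜ[ℂ] i.2) * (∑ i ∈ s, i.1 ⊗ₜ[ℂ] i.2) = 1 := by
    have h := congrArg (LinearMap.rTensor L (LinearMap.mul' ℂ K ∘ₗ
      (HopfAlgebra.antipode ℂ (A := K)).rTensor K)) h1
    simp only [map_sum, LinearMap.rTensor_tmul, LinearMap.comp_apply, LinearMap.mul'_apply,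
      HopfAlgebra.mul_antipode_rTensor_comul_apply] at h
    simp only [Finset.sum_mul_sum, Algebra.TensorProduct.tmul_mul_tmul]
    rw [Finset.sum_comm]
    exact h.symm.trans hε
  have hs' : ∑ i ∈ s', i.1 ⊗ₜ[ℂ] i.2 = ∑ i ∈ s, HopfAlgebra.antipode ℂ i.1 ⊗ₜ[ℂ] i.2 :=
    (left_inv_eq_right_inv hS1 hr).symm
  have hs'' : ∑ i ∈ s', MulOpposite.op i.1 ⊗ₜ[ℂ] (Cop.algEquiv L).symm i.2 =
      ∑ i ∈ s, MulOpposite.op (HopfAlgebra.antipode ℂ i.1) ⊗ₜ[ℂ] (Cop.algEquiv L).symm i.2 := by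
    have h := congrArg (TensorProduct.map (MulOpposite.opLinearEquiv ℂ (M := K)).toLinearMap
      (Cop.algEquiv L).symm.toLinearMap) hs'
    simp only [map_sum, TensorProduct.map_tmul] at h
    exact h
  have hε' : ∑ i ∈ s, MulOpposite.op (algebraMap ℂ K (Coalgebra.counit (R := ℂ) i.1)) ⊗ₜ[ℂ]
      (Cop.algEquiv L).symm i.2 = 1 := by
    have h := congrArg (TensorProduct.map (MulOpposite.opLinearEquiv ℂ (M := K)).toLinearMap
      (Cop.algEquiv L).symm.toLinearMap) hε
    simp only [map_sum, TensorProduct.map_tmul, Algebra.TensorProduct.one_def] at h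
    exact h
  rw [hs'']
  refine convInv_form ?_ ?_
  · have h := congrArg (TensorProduct.map ((MulOpposite.opLinearEquiv ℂ (M := K)).toLinearMap ∘ₗ
      LinearMap.mul' ℂ K ∘ₗ (HopfAlgebra.antipode ℂ (A := K)).rTensor K ∘ₗ
        (TensorProduct.comm ℂ K K).toLinearMap) (Cop.algEquiv L).symm.toLinearMap) h1
    have e : ∀ x : K, LinearMap.mul' ℂ K ((HopfAlgebra.antipode ℂ (A := K)).rTensor K
        (TensorProduct.comm ℂ K K (Coalgebra.comul (R := ℂ) x))) =
          algebraMap ℂ K (Coalgebra.counit (R := ℂ) x) := fun x => by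
      let r := Coalgebra.Repr.arbitrary ℂ x
      rw [← antipode_mul_reversed hS x r, ← r.eq]
      simp [map_sum]
    simp only [map_sum, TensorProduct.map_tmul, LinearMap.comp_apply, LinearEquiv.coe_coe, e,
      TensorProduct.comm_tmul, LinearMap.rTensor_tmul, LinearMap.mul'_apply] at h
    simp only [Finset.sum_mul_sum, Algebra.TensorProduct.tmul_mul_tmul]
    rw [Finset.sum_comm]
    exact h.symm.trans hε'
  · have h := congrArg (TensorProduct.map ((MulOpposite.opLinearEquiv ℂ (M := K)).toLinearMap ∘ₗ
      LinearMap.mul' ℂ K ∘ₗ (HopfAlgebra.antipode ℂ (A := K)).lTensor K ∘ₗ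
        (TensorProduct.comm ℂ K K).toLinearMap) (Cop.algEquiv L).symm.toLinearMap) h1
    have e : ∀ x : K, LinearMap.mul' ℂ K ((HopfAlgebra.antipode ℂ (A := K)).lTensor K
        (TensorProduct.comm ℂ K K (Coalgebra.comul (R := ℂ) x))) =
          algebraMap ℂ K (Coalgebra.counit (R := ℂ) x) := fun x => by
      let r := Coalgebra.Repr.arbitrary ℂ x
      rw [← mul_antipode_reversed hS x r, ← r.eq]
      simp [map_sum]
    simp only [map_sum, TensorProduct.map_tmul, LinearMap.comp_apply, LinearEquiv.coe_coe, e,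
      TensorProduct.comm_tmul, LinearMap.lTensor_tmul, LinearMap.mul'_apply] at h
    simp only [Finset.sum_mul_sum, Algebra.TensorProduct.tmul_mul_tmul]
    rw [Finset.sum_comm]
    exact h.symm.trans hε'

end Inverse

/-! ### The Hopf triplet of three crossings -/

section TripletData

/-- Three bialgebras with elements `∑ t ⊗ t' ∈ H_B ⊗ H_A`, `∑ q ⊗ q' ∈ H_B ⊗ H_C` and
`∑ p ⊗ p' ∈ H_C ⊗ H_A` that satisfy the identities of the representing elements of the crossings of
a right action of `ℬ`, a left action of `𝒞` and a functor from `𝒜`, and an element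
`∑ p'' ⊗ p''' ∈ H_A ⊗ H_C` that represents the inverse of the third one. -/
structure CrossingElements (HA HB HC : Type) [Ring HA] [Bialgebra ℂ HA] [Ring HB] [Bialgebra ℂ HB]
    [Ring HC] [Bialgebra ℂ HC] where
  t : Finset (HB × HA)
  q : Finset (HB × HC)
  p : Finset (HC × HA)
  pinv : Finset (HA × HC)
  t_isUnit : IsUnit (∑ i ∈ t, i.1 ⊗ₜ[ℂ] i.2)
  q_isUnit : IsUnit (∑ i ∈ q, i.1 ⊗ₜ[ℂ] i.2)
  p_mul_pinv : (∑ i ∈ p, i.1 ⊗ₜ[ℂ] i.2) * (∑ i ∈ pinv, i.2 ⊗ₜ[ℂ] i.1) = 1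
  pinv_mul_p : (∑ i ∈ pinv, i.2 ⊗ₜ[ℂ] i.1) * (∑ i ∈ p, i.1 ⊗ₜ[ℂ] i.2) = 1
  t_fst : ∑ i ∈ t, Coalgebra.comul (R := ℂ) i.1 ⊗ₜ[ℂ] i.2 =
    ∑ i ∈ t, ∑ j ∈ t, (i.1 ⊗ₜ[ℂ] j.1) ⊗ₜ[ℂ] (j.2 * i.2)
  t_snd : ∑ i ∈ t, i.1 ⊗ₜ[ℂ] Coalgebra.comul (R := ℂ) i.2 =
    ∑ i ∈ t, ∑ j ∈ t, (j.1 * i.1) ⊗ₜ[ℂ] (i.2 ⊗ₜ[ℂ] j.2)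
  q_fst : ∑ i ∈ q, Coalgebra.comul (R := ℂ) i.1 ⊗ₜ[ℂ] i.2 =
    ∑ i ∈ q, ∑ j ∈ q, (i.1 ⊗ₜ[ℂ] j.1) ⊗ₜ[ℂ] (j.2 * i.2)
  q_snd : ∑ i ∈ q, i.1 ⊗ₜ[ℂ] Coalgebra.comul (R := ℂ) i.2 =
    ∑ i ∈ q, ∑ j ∈ q, (j.1 * i.1) ⊗ₜ[ℂ] (i.2 ⊗ₜ[ℂ] j.2)
  p_fst : ∑ i ∈ p, Coalgebra.comul (R := ℂ) i.1 ⊗ₜ[ℂ] i.2 =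
    ∑ i ∈ p, ∑ j ∈ p, (j.1 ⊗ₜ[ℂ] i.1) ⊗ₜ[ℂ] (j.2 * i.2)
  p_snd : ∑ i ∈ p, i.1 ⊗ₜ[ℂ] Coalgebra.comul (R := ℂ) i.2 =
    ∑ i ∈ p, ∑ j ∈ p, (j.1 * i.1) ⊗ₜ[ℂ] (i.2 ⊗ₜ[ℂ] j.2)
  hexagon : ∑ i ∈ t, ∑ j ∈ p, ∑ k ∈ q,
      (i.2 * j.2) ⊗ₜ[ℂ] ((k.1 * i.1) ⊗ₜ[ℂ] (k.2 * j.1)) =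
    ∑ i ∈ t, ∑ j ∈ p, ∑ k ∈ q, (j.2 * i.2) ⊗ₜ[ℂ] ((i.1 * k.1) ⊗ₜ[ℂ] (j.1 * k.2))

namespace CrossingElements

variable {HA HB HC : Type} [Ring HA] [HopfAlgebra ℂ HA] [Module.Finite ℂ HA]
  [Ring HB] [HopfAlgebra ℂ HB] [Module.Finite ℂ HB] [Ring HC] [HopfAlgebra ℂ HC]
  [Module.Finite ℂ HC] (E : CrossingElements HA HB HC)

/-- The form on `(H_A^{cop})^* × H_B^*`. -/
def τAB : HDual (Cop HA) →ₗ[ℂ] HDual HB →ₗ[ℂ] ℂ :=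
  form (∑ i ∈ E.t, (Cop.algEquiv HA).symm i.2 ⊗ₜ[ℂ] i.1)

/-- The form on `H_B^* × (H_C^{op})^*`. -/
def τBC : HDual HB →ₗ[ℂ] HDual HCᵐᵒᵖ →ₗ[ℂ] ℂ :=
  form (∑ i ∈ E.q, i.1 ⊗ₜ[ℂ] MulOpposite.op i.2)

/-- The form on `(H_C^{op})^* × (H_A^{cop})^*`. -/
def τCA : HDual HCᵐᵒᵖ →ₗ[ℂ] HDual (Cop HA) →ₗ[ℂ] ℂ :=
  form (∑ i ∈ E.p, MulOpposite.op i.1 ⊗ₜ[ℂ] (Cop.algEquiv HA).symm i.2)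

theorem isSkewPairing_τAB : IsSkewPairing E.τAB :=
  isSkewPairing_cop_left E.t_isUnit E.t_fst E.t_snd

theorem isSkewPairing_τBC : IsSkewPairing E.τBC :=
  isSkewPairing_op_right E.q_isUnit E.q_fst E.q_snd

theorem isSkewPairing_τCA : IsSkewPairing E.τCA :=
  isSkewPairing_op_cop ⟨⟨_, _, E.p_mul_pinv, E.pinv_mul_p⟩, rfl⟩ E.p_fst E.p_snd

theorem convInv_τCA
    (hS : ∀ x : HC, HopfAlgebra.antipode ℂ (HopfAlgebra.antipode ℂ x) = x) :
    convInv E.τCA = form (∑ i ∈ E.pinv, MulOpposite.op i.2 ⊗ₜ[ℂ] (Cop.algEquiv HA).symm i.1) := by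
  have e : ∀ {M : Type} [AddCommMonoid M] (f : HC × HA → M),
      ∑ i ∈ E.pinv.map (Equiv.prodComm HA HC).toEmbedding, f i = ∑ i ∈ E.pinv, f i.swap :=
    fun f => Finset.sum_map _ _ _
  have h := convInv_form_op_cop (s := E.p)
    (s' := E.pinv.map (Equiv.prodComm HA HC).toEmbedding) hS
    (by rw [e]; exact E.p_mul_pinv) (by rw [e]; exact E.pinv_mul_p) E.p_fst
  rw [e] at h
  exact h

theorem yangBaxter : YangBaxter E.τAB E.τBC E.τCA := by
  refine yangBaxter_form E.t _ _ E.q _ _ E.p _ _ ?_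
  have h := congrArg (TensorProduct.map (Cop.algEquiv HA).symm.toLinearMap
    ((MulOpposite.opLinearEquiv ℂ (M := HC)).toLinearMap.lTensor HB)) E.hexagon
  simp only [map_sum, TensorProduct.map_tmul, LinearMap.lTensor_tmul, LinearEquiv.coe_coe,
    MulOpposite.coe_opLinearEquiv, MulOpposite.op_mul, AlgEquiv.toLinearMap_apply, map_mul] at h
  exact h

/-- The Hopf triplet given by the representing elements of the crossings. -/
@[reducible] def triplet
    (hA : ∀ x : HA, HopfAlgebra.antipode ℂ (HopfAlgebra.antipode ℂ x) = x)
    (hB : ∀ x : HB, HopfAlgebra.antipode ℂ (HopfAlgebra.antipode ℂ x) = x)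
    (hC : ∀ x : HC, HopfAlgebra.antipode ℂ (HopfAlgebra.antipode ℂ x) = x) : HopfTriplet :=
  letI := Cop.hopfAlgebra hA
  letI := opHopfAlgebra hC
  { A := HDual (Cop HA)
    B := HDual HB
    C := HDual HCᵐᵒᵖ
    ssA := HDual.isSemisimpleRing hA
    ssB := HDual.isSemisimpleRing hB
    ssC := HDual.isSemisimpleRing (MulOpposite.rec' fun x => congrArg MulOpposite.op (hC x))
    τAB := E.τAB
    τBC := E.τBC
    τCA := E.τCA
    skewAB := E.isSkewPairing_τAB
    skewBC := E.isSkewPairing_τBC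
    skewCA := E.isSkewPairing_τCA
    homABC := E.yangBaxter.isDoubleHom E.isSkewPairing_τAB E.isSkewPairing_τBC E.isSkewPairing_τCA
    homBCA := E.yangBaxter.rotate.isDoubleHom E.isSkewPairing_τBC E.isSkewPairing_τCA
      E.isSkewPairing_τAB
    homCAB := E.yangBaxter.rotate.rotate.isDoubleHom E.isSkewPairing_τCA E.isSkewPairing_τAB
      E.isSkewPairing_τBC }

end CrossingElements

end TripletData

section DoubleDuals

variable (H : Type) [Ring H] [Bialgebra ℂ H]

/-- An isomorphism of algebras is compatible with the comultiplications if its inverse is. -/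
theorem comul_symm_of_comul {K : Type} [Ring K] [Bialgebra ℂ K] (e : K ≃ₐ[ℂ] H)
    (h : ∀ x, TensorProduct.map e.symm.toLinearMap e.symm.toLinearMap (Coalgebra.comul (R := ℂ) x) =
      Coalgebra.comul (R := ℂ) (e.symm x)) (k : K) :
    TensorProduct.map e.toLinearMap e.toLinearMap (Coalgebra.comul (R := ℂ) k) =
      Coalgebra.comul (R := ℂ) (e k) := by
  have h1 := congrArg (TensorProduct.map e.toLinearMap e.toLinearMap) (h (e k))
  have h2 : ∀ t : H ⊗[ℂ] H, TensorProduct.map e.toLinearMap e.toLinearMap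
      (TensorProduct.map e.symm.toLinearMap e.symm.toLinearMap t) = t := fun t => by
    induction t with
    | zero => simp
    | add s t hs ht => simp only [map_add, hs, ht]
    | tmul a b => simp
  rw [h2, e.symm_apply_apply] at h1
  exact h1.symm

variable [Module.Finite ℂ H]

/-- The isomorphism `H^{**} ≅ H`. -/
def dualDual : HDual (HDual H) ≃ₐ[ℂ] H := (HDual.eval H).symm

theorem comul_dualDual (k : HDual (HDual H)) :
    TensorProduct.map (dualDual H).toLinearMap (dualDual H).toLinearMap
      (Coalgebra.comul (R := ℂ) k) =
      Coalgebra.comul (R := ℂ) (dualDual H k) :=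
  comul_symm_of_comul H (dualDual H) (fun x => by
    let r := Coalgebra.Repr.arbitrary ℂ x
    rw [← r.eq]
    refine Eq.trans ?_ (HDual.comul_eval x r).symm
    simp only [map_sum]
    rfl) k

theorem counit_dualDual (k : HDual (HDual H)) :
    Coalgebra.counit (R := ℂ) k = Coalgebra.counit (R := ℂ) (dualDual H k) := by
  obtain ⟨x, rfl⟩ := (dualDual H).symm.surjective k
  rw [AlgEquiv.apply_symm_apply]
  rfl

/-- The isomorphism `((H^{cop})^{**})^{cop} ≅ H`. -/
def copDualDual : Cop (HDual (HDual (Cop H))) ≃ₐ[ℂ] H :=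
  (Cop.algEquiv _).trans ((HDual.eval (Cop H)).symm.trans (Cop.algEquiv H))

theorem comul_copDualDual (k : Cop (HDual (HDual (Cop H)))) :
    TensorProduct.map (copDualDual H).toLinearMap (copDualDual H).toLinearMap
      (Coalgebra.comul (R := ℂ) k) = Coalgebra.comul (R := ℂ) (copDualDual H k) :=
  comul_symm_of_comul H (copDualDual H) (fun x => by
    let r := Coalgebra.Repr.arbitrary ℂ x
    rw [← r.eq]
    let r' : Coalgebra.Repr ℂ (HDual.eval (Cop H) ((Cop.algEquiv H).symm x)) _ :=
      ⟨r.index, fun i => HDual.eval (Cop H) ((Cop.algEquiv H).symm (r.right i)),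
        fun i => HDual.eval (Cop H) ((Cop.algEquiv H).symm (r.left i)),
        (HDual.comul_eval _ (Cop.repr r)).symm⟩
    refine Eq.trans ?_ (Cop.comul_eq_sum _ r').symm
    simp only [map_sum]
    rfl) k

theorem counit_copDualDual (k : Cop (HDual (HDual (Cop H)))) :
    Coalgebra.counit (R := ℂ) k = Coalgebra.counit (R := ℂ) (copDualDual H k) := by
  obtain ⟨x, rfl⟩ := (copDualDual H).symm.surjective k
  rw [AlgEquiv.apply_symm_apply]
  rfl

/-- The isomorphism `((H^{op})^{**})^{op} ≅ H`. -/
def opDualDual : (HDual (HDual Hᵐᵒᵖ))ᵐᵒᵖ ≃ₐ[ℂ] H :=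
  ((AlgEquiv.opOp ℂ H).trans (AlgEquiv.op (HDual.eval Hᵐᵒᵖ))).symm

theorem comul_opDualDual (k : (HDual (HDual Hᵐᵒᵖ))ᵐᵒᵖ) :
    TensorProduct.map (opDualDual H).toLinearMap (opDualDual H).toLinearMap
      (Coalgebra.comul (R := ℂ) k) = Coalgebra.comul (R := ℂ) (opDualDual H k) :=
  comul_symm_of_comul H (opDualDual H) (fun x => by
    let r := Coalgebra.Repr.arbitrary ℂ x
    rw [← r.eq]
    let r' : Coalgebra.Repr ℂ (HDual.eval Hᵐᵒᵖ (MulOpposite.op x)) _ :=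
      ⟨r.index, fun i => HDual.eval Hᵐᵒᵖ (MulOpposite.op (r.left i)),
        fun i => HDual.eval Hᵐᵒᵖ (MulOpposite.op (r.right i)),
        (HDual.comul_eval _ (opRepr r)).symm⟩
    refine Eq.trans ?_ (opRepr r').eq
    simp only [map_sum]
    rfl) k

theorem counit_opDualDual (k : (HDual (HDual Hᵐᵒᵖ))ᵐᵒᵖ) :
    Coalgebra.counit (R := ℂ) k = Coalgebra.counit (R := ℂ) (opDualDual H k) := by
  obtain ⟨x, rfl⟩ := (opDualDual H).symm.surjective k
  rw [AlgEquiv.apply_symm_apply]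
  rfl

end DoubleDuals

/-! ### The hexagon of three crossings -/

section Hexagon

universe v v' v'' u u' u''

variable {𝒟 : Type u} [Category.{v} 𝒟] {𝒟' : Type u'} [Category.{v'} 𝒟']
  {𝒟'' : Type u''} [Category.{v''} 𝒟'']
  {G : 𝒟 ⥤ Vect ⥤ Vect} {G' : 𝒟' ⥤ Vect ⥤ Vect} {G'' : 𝒟'' ⥤ Vect ⥤ Vect}
  [∀ X, (G.obj X).Additive] [∀ X, (G.obj X).Linear ℂ]
  [∀ X, (G'.obj X).Additive] [∀ X, (G'.obj X).Linear ℂ]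
  [∀ X, (G''.obj X).Additive] [∀ X, (G''.obj X).Linear ℂ]
  [Preadditive 𝒟] [Linear ℂ 𝒟] [Preadditive 𝒟'] [Linear ℂ 𝒟'] [Preadditive 𝒟''] [Linear ℂ 𝒟'']
  {B : SimpleBasis 𝒟} {B' : SimpleBasis 𝒟'} {B'' : SimpleBasis 𝒟''}
  [(fibre G).Additive] [(fibre G).Linear ℂ]
  [(fibre G').Additive] [(fibre G').Linear ℂ]
  [(fibre G'').Additive] [(fibre G'').Linear ℂ]

namespace Crossing

/-- Three crossings that satisfy the hexagon identity have representing elements that satisfy the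
Yang–Baxter equation. -/
theorem IsRepr.hexagon {T : Crossing G' G} {P : Crossing G'' G} {Q : Crossing G' G''}
    {t : Finset (Tan B' (fibre G') × Tan B (fibre G))}
    {p : Finset (Tan B'' (fibre G'') × Tan B (fibre G))}
    {q : Finset (Tan B' (fibre G') × Tan B'' (fibre G''))}
    (ht : T.IsRepr t) (hp : P.IsRepr p) (hq : Q.IsRepr q)
    (hσ : ∀ (X : 𝒟) (Y : 𝒟') (Z : 𝒟'') (V : Vect),
      (G'.obj Y).map (P.σ Z X V).hom ≫ (T.σ Y X ((G''.obj Z).obj V)).hom ≫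
          (G.obj X).map (Q.σ Y Z V).hom =
        (Q.σ Y Z ((G.obj X).obj V)).hom ≫ (G''.obj Z).map (T.σ Y X V).hom ≫
          (P.σ Z X ((G'.obj Y).obj V)).hom) :
    ∑ i ∈ t, ∑ j ∈ p, ∑ k ∈ q, (i.2 * j.2) ⊗ₜ[ℂ] ((k.1 * i.1) ⊗ₜ[ℂ] (k.2 * j.1)) =
      ∑ i ∈ t, ∑ j ∈ p, ∑ k ∈ q, (j.2 * i.2) ⊗ₜ[ℂ] ((i.1 * k.1) ⊗ₜ[ℂ] (j.1 * k.2)) := by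
  refine Tan.tensor_ext₃ fun X Y Z m n l => ?_
  have inj : Function.Injective
      ((dotEquiv (G.obj X) ((G''.obj Z).obj ((G'.obj Y).obj (𝟙_ Vect)))).toLinearMap ∘ₗ
        (swapDot G' G'' Y Z (V := 𝟙_ Vect) (1 : ℂ)).lTensor ((fibre G).obj X)) :=
    (dotEquiv (G.obj X) ((G''.obj Z).obj ((G'.obj Y).obj (𝟙_ Vect)))).injective.comp
      (Module.Flat.lTensor_preserves_injective_linearMap _ (swapDot_one_injective Y Z))
  apply inj
  have h := hom_congr_apply (hσ X Y Z (𝟙_ Vect))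
    (dot (G'.obj Y) n (dot (G''.obj Z) l (dot (G.obj X) (V := 𝟙_ Vect) m (1 : ℂ))))
  have hL : ((G'.obj Y).map (P.σ Z X (𝟙_ Vect)).hom ≫ (T.σ Y X ((G''.obj Z).obj (𝟙_ Vect))).hom ≫
      (G.obj X).map (Q.σ Y Z (𝟙_ Vect)).hom).hom.hom
        (dot (G'.obj Y) n (dot (G''.obj Z) l (dot (G.obj X) (V := 𝟙_ Vect) m (1 : ℂ)))) =
      ((G.obj X).map (Q.σ Y Z (𝟙_ Vect)).hom).hom.hom
        ((T.σ Y X ((G''.obj Z).obj (𝟙_ Vect))).hom.hom.hom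
          (((G'.obj Y).map (P.σ Z X (𝟙_ Vect)).hom).hom.hom
        (dot (G'.obj Y) n (dot (G''.obj Z) l (dot (G.obj X) (V := 𝟙_ Vect) m (1 : ℂ)))))) := rfl
  have hR : ((Q.σ Y Z ((G.obj X).obj (𝟙_ Vect))).hom ≫ (G''.obj Z).map (T.σ Y X (𝟙_ Vect)).hom ≫
      (P.σ Z X ((G'.obj Y).obj (𝟙_ Vect))).hom).hom.hom
        (dot (G'.obj Y) n (dot (G''.obj Z) l (dot (G.obj X) (V := 𝟙_ Vect) m (1 : ℂ)))) =
      (P.σ Z X ((G'.obj Y).obj (𝟙_ Vect))).hom.hom.hom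
        (((G''.obj Z).map (T.σ Y X (𝟙_ Vect)).hom).hom.hom
          ((Q.σ Y Z ((G.obj X).obj (𝟙_ Vect))).hom.hom.hom
        (dot (G'.obj Y) n (dot (G''.obj Z) l (dot (G.obj X) (V := 𝟙_ Vect) m (1 : ℂ)))))) := rfl
  rw [hL, hR, map_dot, hp, hq, dot_sum] at h
  simp only [map_sum] at h
  simp only [map_sum, TensorProduct.map_tmul, LinearMap.comp_apply, LinearEquiv.coe_coe,
    LinearMap.lTensor_tmul, Tan.ev_apply, swapDot_tmul, map_mul,
    Module.End.mul_apply]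
  refine Eq.trans ?_ (h.trans ?_)
  · rw [Finset.sum_comm]
    refine Finset.sum_congr rfl fun j _ => ?_
    rw [ht, map_sum]
    refine Finset.sum_congr rfl fun i _ => ?_
    rw [map_dot, hq, dot_sum]
    rfl
  · have e : ∀ k ∈ q, (P.σ Z X ((G'.obj Y).obj (𝟙_ Vect))).hom.hom.hom
        (((G''.obj Z).map (T.σ Y X (𝟙_ Vect)).hom).hom.hom (dot (G''.obj Z) (Tan.act Z k.2 l)
          (dot (G'.obj Y) (Tan.act Y k.1 n) (dot (G.obj X) (V := 𝟙_ Vect) m (1 : ℂ))))) =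
        ∑ i ∈ t, ∑ j ∈ p, dot (G.obj X) (Tan.act X j.2 (Tan.act X i.2 m))
          (dot (G''.obj Z) (Tan.act Z j.1 (Tan.act Z k.2 l))
            (dot (G'.obj Y) (Tan.act Y i.1 (Tan.act Y k.1 n)) (1 : ℂ))) := fun k _ => by
      rw [map_dot, ht, dot_sum, map_sum]
      exact Finset.sum_congr rfl fun i _ => hp _ _ _
    refine (Finset.sum_congr rfl e).trans ?_
    rw [Finset.sum_comm]
    exact Finset.sum_congr rfl fun i _ => Finset.sum_comm

end Crossing

end Hexagon

/-! ### The fibre functors of the datum and their crossings -/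

section FibreFunctors

variable {𝒜 : Type u₁} [Category.{v₁} 𝒜] [Preadditive 𝒜] [Linear ℂ 𝒜] [MonoidalCategory 𝒜]
  {ℬ : Type u₂} [Category.{v₂} ℬ] [Preadditive ℬ] [Linear ℂ ℬ] [MonoidalCategory ℬ]
  {𝒞 : Type u₃} [Category.{v₃} 𝒞] [Preadditive 𝒞] [Linear ℂ 𝒞] [MonoidalCategory 𝒞]
  [MonoidalLeftAction 𝒞 Vect] [LinearLeftAction 𝒞 Vect]
  [MonoidalRightAction ℬ Vect] [LinearRightAction ℬ Vect]
  [BimoduleCategory 𝒞 ℬ Vect]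

variable (𝒞) in
/-- The fibre functor `x ↦ x ▷ ℂ` of the left action. -/
abbrev leftFibre : 𝒞 ⥤ Vect := fibre (MonoidalLeftAction.curriedAction 𝒞 Vect)

variable (ℬ) in
/-- The fibre functor `u ↦ ℂ ◁ u` of the right action. -/
abbrev rightFibre : ℬ ⥤ Vect := fibre (MonoidalRightAction.curriedAction ℬ Vect)

/-- The fibre functor `a ↦ Φ(a)(ℂ)`. -/
abbrev functorFibre (Φ : 𝒜 ⥤ BimodEnd 𝒞 ℬ Vect) : 𝒜 ⥤ Vect := fibre (Φ ⋙ BimodEnd.forget 𝒞 ℬ Vect)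

instance : (leftFibre 𝒞).Monoidal := (leftCoherence 𝒞).monoidal
instance : (rightFibre ℬ).Monoidal := (rightCoherence ℬ).monoidal

variable (Φ : 𝒜 ⥤ BimodEnd 𝒞 ℬ Vect) [Φ.Monoidal]

instance : (functorFibre Φ).Monoidal := (functorCoherence Φ).monoidal

variable [(Φ ⋙ BimodEnd.forget 𝒞 ℬ Vect).Additive] [(Φ ⋙ BimodEnd.forget 𝒞 ℬ Vect).Linear ℂ]
  (DA : SimpleBasis 𝒜) (DB : SimpleBasis ℬ) (DC : SimpleBasis 𝒞)

/-- The elements that represent the crossings of a bimodule category structure on the category of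
vector spaces and a monoidal functor to its bimodule endofunctors. -/
theorem exists_crossingElements :
    ∃ E : CrossingElements (Tan DA (functorFibre Φ)) (Tan DB (rightFibre ℬ)) (Tan DC (leftFibre 𝒞)),
      (tCrossing Φ).IsRepr E.t ∧ (midCrossing 𝒞 ℬ).IsRepr E.q ∧ (sCrossing Φ).symm.IsRepr E.p ∧
        (sCrossing Φ).IsRepr E.pinv := by
  obtain ⟨t, ht⟩ := (tCrossing Φ).exists_isRepr DB DA
  obtain ⟨t', ht'⟩ := (tCrossing Φ).symm.exists_isRepr DA DB
  obtain ⟨q, hq⟩ := (midCrossing 𝒞 ℬ).exists_isRepr DB DC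
  obtain ⟨q', hq'⟩ := (midCrossing 𝒞 ℬ).symm.exists_isRepr DC DB
  obtain ⟨p, hp⟩ := (sCrossing Φ).symm.exists_isRepr DC DA
  obtain ⟨p', hp'⟩ := (sCrossing Φ).exists_isRepr DA DC
  have hpp : (sCrossing Φ).symm.symm.IsRepr p' := hp'
  refine ⟨{ t := t, q := q, p := p, pinv := p'
            t_isUnit := ⟨⟨_, _, (ht.mul_symm ht').1, (ht.mul_symm ht').2⟩, rfl⟩
            q_isUnit := ⟨⟨_, _, (hq.mul_symm hq').1, (hq.mul_symm hq').2⟩, rfl⟩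
            p_mul_pinv := (hp.mul_symm hpp).1
            pinv_mul_p := (hp.mul_symm hpp).2
            t_fst := ht.comul_fst_of_right (rightCoherence ℬ) (fun _ _ => rfl)
              fun u v a V => ((Φ.obj a).t_tensor V u v).symm
            t_snd := ht.comul_snd (functorCoherence Φ) (fun _ _ => rfl) (tCrossing_left Φ)
            q_fst := hq.comul_fst_of_right (rightCoherence ℬ) (fun _ _ => rfl) midCrossing_right
            q_snd := hq.comul_snd (leftCoherence 𝒞) (fun _ _ => rfl) midCrossing_left
            p_fst := hp.comul_fst_of_left (leftCoherence 𝒞) (fun _ _ => rfl)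
              fun x y a V => sCrossing_left (Φ.obj a) x y V
            p_snd := hp.comul_snd (functorCoherence Φ) (fun _ _ => rfl) (sCrossing_functor Φ)
            hexagon := ht.hexagon hp hq fun a u x V => crossing_hexagon (Φ.obj a) x u V },
    ht, hq, hp, hp'⟩

end FibreFunctors

/-! ### Crossings in terms of the pairings of the triplet -/

section Elements

variable {U V W X : Vect}

theorem comp_apply (f : U ⟶ V) (g : V ⟶ W) (u : U) :
    (f ≫ g).hom.hom u = g.hom.hom (f.hom.hom u) := rfl

theorem whiskerLeft_tmul (f : V ⟶ W) (u : U) (v : V) :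
    (U ◁ f).hom.hom (u ⊗ₜ[ℂ] v) = u ⊗ₜ[ℂ] f.hom.hom v := rfl

end Elements

section DotIso

variable (G : Vect ⥤ Vect) [G.Additive] [G.Linear ℂ]

/-- The isomorphism `G(V) ≅ G(ℂ) ⊗ V` for a linear functor `G`. -/
def dotIso (V : Vect) : G.obj V ≅ tensorObj (G.obj (𝟙_ Vect)) V :=
  LinearEquiv.toFGModuleCatIso (dotEquiv G V).symm

theorem dotIso_dot {V : Vect} (p : G.obj (𝟙_ Vect)) (v : V) :
    (dotIso G V).hom.hom.hom (dot G p v) = p ⊗ₜ[ℂ] v :=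
  (dotEquiv G V).symm_apply_apply (p ⊗ₜ v)

variable {G}

theorem hom_ext_dot {V W : Vect} {f g : G.obj V ⟶ W}
    (h : ∀ p v, f.hom.hom (dot G p v) = g.hom.hom (dot G p v)) : f = g :=
  FGModuleCat.hom_ext (ext_dot G h)

theorem hom_ext_dot_dot {G' : Vect ⥤ Vect} [G'.Additive] [G'.Linear ℂ] {V W : Vect}
    {f g : G.obj (G'.obj V) ⟶ W}
    (h : ∀ p q v, f.hom.hom (dot G p (dot G' q v)) = g.hom.hom (dot G p (dot G' q v))) : f = g :=
  hom_ext_dot fun p z => LinearMap.congr_fun (f := f.hom.hom ∘ₗ dotₗ G _ p)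
    (g := g.hom.hom ∘ₗ dotₗ G _ p) (ext_dot G' fun q v => h p q v) z

end DotIso

section DotIsoLaws

universe v u v' u'

variable {𝒟 : Type u} [Category.{v} 𝒟] {G : 𝒟 ⥤ Vect ⥤ Vect}
  [∀ X, (G.obj X).Additive] [∀ X, (G.obj X).Linear ℂ]

theorem dotIso_natural {X Y : 𝒟} {V W : Vect} (f : X ⟶ Y) (α : V ⟶ W) :
    ((G.map f).app V ≫ (G.obj Y).map α) ≫ (dotIso (G.obj Y) W).hom =
      (dotIso (G.obj X) V).hom ≫ ((fibre G).map f ⊗ₘ α) :=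
  hom_ext_dot fun p v => by
    rw [comp_apply, comp_apply, comp_apply, app_dot, map_dot, dotIso_dot, dotIso_dot]
    rfl

section Monoidal

variable [MonoidalCategory 𝒟]

/-- Under `G(V) ≅ G(ℂ) ⊗ V`, the coherence isomorphism of an action from the left is the tensor
structure of its fibre functor. -/
theorem LeftCoherence.dotIso_tensor (L : LeftCoherence G) (X Y : 𝒟) (V : Vect)
    (m : tensorObj ((fibre G).obj X) ((fibre G).obj Y) ⟶ (fibre G).obj (X ⊗ Y))
    (hm : ∀ p q, m.hom.hom (p ⊗ₜ[ℂ] q) = (L.c X Y (𝟙_ Vect)).hom.hom.hom (dot (G.obj X) p q)) :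
    (L.c X Y V).hom ≫ (dotIso (G.obj (X ⊗ Y)) V).hom =
      (dotIso (G.obj X) ((G.obj Y).obj V)).hom ≫
        ((fibre G).obj X ◁ (dotIso (G.obj Y) V).hom) ≫ (α_ _ _ _).inv ≫ (m ▷ V) :=
  hom_ext_dot_dot fun p q v => by
    rw [comp_apply, L.c_dot_dot, dotIso_dot, ← hm, comp_apply, dotIso_dot, comp_apply]
    erw [whiskerLeft_tmul, dotIso_dot]
    rfl

theorem LeftCoherence.dotIso_unit (L : LeftCoherence G) (V : Vect)
    (e : 𝟙_ Vect ⟶ (fibre G).obj (𝟙_ 𝒟)) (he : e = (L.u (𝟙_ Vect)).hom) :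
    (L.u V).hom ≫ (dotIso (G.obj (𝟙_ 𝒟)) V).hom = (λ_ V).inv ≫ (e ▷ V) :=
  hom_ext_apply fun v => by
    rw [he, comp_apply, L.u_dot, dotIso_dot]
    rfl

/-- Under `G(V) ≅ G(ℂ) ⊗ V`, the coherence isomorphism of an action from the right is the flip
followed by the tensor structure of its fibre functor. -/
theorem RightCoherence.dotIso_tensor (L : RightCoherence G) (X Y : 𝒟) (V : Vect)
    (m : tensorObj ((fibre G).obj X) ((fibre G).obj Y) ⟶ (fibre G).obj (X ⊗ Y))
    (hm : ∀ p q, m.hom.hom (p ⊗ₜ[ℂ] q) = (L.c X Y (𝟙_ Vect)).hom.hom.hom (dot (G.obj Y) q p)) :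
    (L.c X Y V).hom ≫ (dotIso (G.obj (X ⊗ Y)) V).hom =
      (dotIso (G.obj Y) ((G.obj X).obj V)).hom ≫
        ((fibre G).obj Y ◁ (dotIso (G.obj X) V).hom) ≫ (α_ _ _ _).inv ≫
          ((β_ ((fibre G).obj Y) ((fibre G).obj X)).hom ▷ V) ≫ (m ▷ V) :=
  hom_ext_dot_dot fun q p v => by
    rw [comp_apply, L.c_dot_dot, dotIso_dot, ← hm, comp_apply, dotIso_dot, comp_apply]
    erw [whiskerLeft_tmul, dotIso_dot]
    rfl

theorem RightCoherence.dotIso_unit (L : RightCoherence G) (V : Vect)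
    (e : 𝟙_ Vect ⟶ (fibre G).obj (𝟙_ 𝒟)) (he : e = (L.u (𝟙_ Vect)).hom) :
    (L.u V).hom ≫ (dotIso (G.obj (𝟙_ 𝒟)) V).hom = (λ_ V).inv ≫ (e ▷ V) :=
  hom_ext_apply fun v => by
    rw [he, comp_apply, L.u_dot, dotIso_dot]
    rfl

end Monoidal

variable {𝒟' : Type u'} [Category.{v'} 𝒟'] {G' : 𝒟' ⥤ Vect ⥤ Vect}
  [∀ X, (G'.obj X).Additive] [∀ X, (G'.obj X).Linear ℂ]
  [Preadditive 𝒟] [Linear ℂ 𝒟] [Preadditive 𝒟'] [Linear ℂ 𝒟']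
  {B : SimpleBasis 𝒟} {B' : SimpleBasis 𝒟'} [(fibre G).Additive] [(fibre G).Linear ℂ]
  [(fibre G').Additive] [(fibre G').Linear ℂ] {S : Crossing G G'}
  {s : Finset (Tan B (fibre G) × Tan B' (fibre G'))}

/-- A crossing in terms of its representing elements. -/
theorem Crossing.IsRepr.dotIso_crossing (hs : S.IsRepr s) (X : 𝒟) (Y : 𝒟') (V : Vect)
    (r : tensorObj ((fibre G).obj X) ((fibre G').obj Y) ⟶
      tensorObj ((fibre G').obj Y) ((fibre G).obj X))
    (hr : ∀ p q, r.hom.hom (p ⊗ₜ[ℂ] q) = ∑ i ∈ s, Tan.act Y i.2 q ⊗ₜ[ℂ] Tan.act X i.1 p) :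
    (S.σ X Y V).hom ≫ (dotIso (G'.obj Y) ((G.obj X).obj V)).hom ≫
        ((fibre G').obj Y ◁ (dotIso (G.obj X) V).hom) =
      (dotIso (G.obj X) ((G'.obj Y).obj V)).hom ≫
        ((fibre G).obj X ◁ (dotIso (G'.obj Y) V).hom) ≫ (α_ _ _ _).inv ≫ (r ▷ V) ≫
          (α_ _ _ _).hom :=
  hom_ext_dot_dot fun p q v => by
    have hL : ((S.σ X Y V).hom ≫ (dotIso (G'.obj Y) ((G.obj X).obj V)).hom ≫
        ((fibre G').obj Y ◁ (dotIso (G.obj X) V).hom)).hom.hom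
          (dot (G.obj X) p (dot (G'.obj Y) q v)) =
        ∑ i ∈ s, Tan.act Y i.2 q ⊗ₜ[ℂ] (Tan.act X i.1 p ⊗ₜ[ℂ] v) := by
      rw [comp_apply, hs, map_sum]
      refine Finset.sum_congr rfl fun i _ => ?_
      rw [comp_apply, dotIso_dot]
      exact congrArg (fun z => Tan.act Y i.2 q ⊗ₜ[ℂ] z) (dotIso_dot (G.obj X) _ v)
    have hR : ((dotIso (G.obj X) ((G'.obj Y).obj V)).hom ≫
        ((fibre G).obj X ◁ (dotIso (G'.obj Y) V).hom) ≫ (α_ _ _ _).inv ≫ (r ▷ V) ≫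
          (α_ _ _ _).hom).hom.hom (dot (G.obj X) p (dot (G'.obj Y) q v)) =
        (α_ ((fibre G').obj Y) ((fibre G).obj X) V).hom.hom.hom
          (r.hom.hom (p ⊗ₜ[ℂ] q) ⊗ₜ[ℂ] v) := by
      rw [comp_apply, dotIso_dot, comp_apply]
      have h : ((fibre G).obj X ◁ (dotIso (G'.obj Y) V).hom).hom.hom
          (p ⊗ₜ[ℂ] dot (G'.obj Y) q v) = p ⊗ₜ[ℂ] (q ⊗ₜ[ℂ] v) :=
        congrArg (fun z => p ⊗ₜ[ℂ] z) (dotIso_dot (G'.obj Y) q v)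
      rw [h]
      rfl
    rw [hL, hR, hr, TensorProduct.sum_tmul, map_sum]
    rfl

variable {R R' : Type} [AddCommGroup R] [Module ℂ R] [AddCommGroup R'] [Module ℂ R']

theorem tensorAct_sum_tmul {U W : Vect} (ρ : R →ₗ[ℂ] Module.End ℂ U) (ρ' : R' →ₗ[ℂ] Module.End ℂ W)
    {ι : Type*} (t : Finset ι) (x : ι → R) (y : ι → R') (u : U) (w : W) :
    (tensorAct ρ ρ' (∑ i ∈ t, x i ⊗ₜ y i)).hom.hom (u ⊗ₜ[ℂ] w) =
      ∑ i ∈ t, ρ (x i) u ⊗ₜ[ℂ] ρ' (y i) w := by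
  change TensorProduct.homTensorHomMap (RingHom.id ℂ) U W U W
    (TensorProduct.map ρ ρ' (∑ i ∈ t, x i ⊗ₜ y i)) (u ⊗ₜ[ℂ] w) = _
  rw [map_sum, map_sum, LinearMap.sum_apply]
  rfl

end DotIsoLaws

/-! ### Realization of the datum by the triplet -/

section DoubleDualEquiv

universe v u

variable {𝒟 : Type u} [Category.{v} 𝒟] [Preadditive 𝒟] [Linear ℂ 𝒟] [MonoidalCategory 𝒟]
  [RightRigidCategory 𝒟] [HasFiniteBiproducts 𝒟] {ω : PivotalStructure 𝒟} {B : SimpleBasis 𝒟}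
  {F : 𝒟 ⥤ Vect} [F.Additive] [F.Linear ℂ] [F.Monoidal] (hF : ∀ i, Nontrivial (F.obj (B.S i)))
  (hω : ∀ (X : 𝒟) (f : F.obj (Xᘁ)) (v : F.obj X),
    evPair F (Xᘁ) (fmap F (ω.iso X).inv v) f = evPair F X f v)

namespace Tan

/-- Tannaka reconstruction with modules over `H^{**}`. -/
def dualEquiv : PivotalTensorEquiv ω (HDual (HDual (Tan B F))) :=
  pivotalEquiv (dualDual (Tan B F)) (comul_dualDual (Tan B F)) (counit_dualDual (Tan B F)) hF hω

/-- Tannaka reconstruction with modules over `((H^{cop})^{**})^{cop}`. -/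
def copDualEquiv : PivotalTensorEquiv ω (Cop (HDual (HDual (Cop (Tan B F))))) :=
  pivotalEquiv (copDualDual (Tan B F)) (comul_copDualDual (Tan B F)) (counit_copDualDual (Tan B F))
    hF hω

/-- Tannaka reconstruction with modules over `((H^{op})^{**})^{op}`. -/
def opDualEquiv : PivotalTensorEquiv ω (HDual (HDual (Tan B F)ᵐᵒᵖ))ᵐᵒᵖ :=
  pivotalEquiv (opDualDual (Tan B F)) (comul_opDualDual (Tan B F)) (counit_opDualDual (Tan B F))
    hF hω

theorem μ_dualEquiv (X Y : 𝒟) :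
    Functor.LaxMonoidal.μ (dualEquiv hF hω).fib X Y = Functor.LaxMonoidal.μ F X Y :=
  Category.id_comp _

theorem ε_dualEquiv : Functor.LaxMonoidal.ε (dualEquiv hF hω).fib = Functor.LaxMonoidal.ε F :=
  Category.id_comp _

theorem act_dualEquiv (X : 𝒟) (h : Tan B F) :
    (dualEquiv hF hω).act X (HDual.eval (Tan B F) h) = act X h :=
  congrArg (act X) ((dualDual (Tan B F)).apply_symm_apply h)

theorem μ_copDualEquiv (X Y : 𝒟) :
    Functor.LaxMonoidal.μ (copDualEquiv hF hω).fib X Y = Functor.LaxMonoidal.μ F X Y :=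
  Category.id_comp _

theorem ε_copDualEquiv :
    Functor.LaxMonoidal.ε (copDualEquiv hF hω).fib = Functor.LaxMonoidal.ε F :=
  Category.id_comp _

theorem act_copDualEquiv (X : 𝒟) (h : Tan B F) :
    (copDualEquiv hF hω).act X ((Cop.algEquiv (HDual (HDual (Cop (Tan B F))))).symm
      (HDual.eval (Cop (Tan B F)) ((Cop.algEquiv (Tan B F)).symm h))) = act X h :=
  congrArg (act X) ((copDualDual (Tan B F)).apply_symm_apply h)

theorem μ_opDualEquiv (X Y : 𝒟) :
    Functor.LaxMonoidal.μ (opDualEquiv hF hω).fib X Y = Functor.LaxMonoidal.μ F X Y :=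
  Category.id_comp _

theorem ε_opDualEquiv : Functor.LaxMonoidal.ε (opDualEquiv hF hω).fib = Functor.LaxMonoidal.ε F :=
  Category.id_comp _

theorem act_opDualEquiv (X : 𝒟) (h : Tan B F) :
    (opDualEquiv hF hω).act X (MulOpposite.op (HDual.eval (Tan B F)ᵐᵒᵖ (MulOpposite.op h))) =
      act X h :=
  congrArg (act X) ((opDualDual (Tan B F)).apply_symm_apply h)

end Tan

end DoubleDualEquiv

section PairingAction

namespace CrossingElements

variable {HA HB HC : Type} [Ring HA] [HopfAlgebra ℂ HA] [Module.Finite ℂ HA]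
  [Ring HB] [HopfAlgebra ℂ HB] [Module.Finite ℂ HB] [Ring HC] [HopfAlgebra ℂ HC]
  [Module.Finite ℂ HC] (E : CrossingElements HA HB HC) {U W : Vect} (u : U) (w : W)

/-- The action of `τ_{AB}` on a tensor product, in terms of representing elements. -/
theorem tensorAct_τAB (ρ : HDual (HDual (Cop HA)) →ₗ[ℂ] Module.End ℂ U)
    (ρ' : HDual (HDual HB) →ₗ[ℂ] Module.End ℂ W) :
    (tensorAct ρ ρ' (pairingElt E.τAB)).hom.hom (u ⊗ₜ[ℂ] w) =
      ∑ i ∈ E.t, ρ (HDual.eval (Cop HA) ((Cop.algEquiv HA).symm i.2)) u ⊗ₜ[ℂ]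
        ρ' (HDual.eval HB i.1) w := by
  rw [τAB, pairingElt_form, map_sum]
  exact tensorAct_sum_tmul ρ ρ' E.t _ _ u w

/-- The action of `τ_{BC}` on a tensor product, in terms of representing elements. -/
theorem tensorAct_τBC (ρ : HDual (HDual HB) →ₗ[ℂ] Module.End ℂ U)
    (ρ' : HDual (HDual HCᵐᵒᵖ) →ₗ[ℂ] Module.End ℂ W) :
    (tensorAct ρ ρ' (pairingElt E.τBC)).hom.hom (u ⊗ₜ[ℂ] w) =
      ∑ i ∈ E.q, ρ (HDual.eval HB i.1) u ⊗ₜ[ℂ] ρ' (HDual.eval HCᵐᵒᵖ (MulOpposite.op i.2)) w := by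
  rw [τBC, pairingElt_form, map_sum]
  exact tensorAct_sum_tmul ρ ρ' E.q _ _ u w

/-- The action of `τ_{CA}^{-1}` on a tensor product, in terms of the elements that represent the
inverse crossing. -/
theorem tensorAct_convInv_τCA
    (hS : ∀ x : HC, HopfAlgebra.antipode ℂ (HopfAlgebra.antipode ℂ x) = x)
    (ρ : HDual (HDual HCᵐᵒᵖ) →ₗ[ℂ] Module.End ℂ U)
    (ρ' : HDual (HDual (Cop HA)) →ₗ[ℂ] Module.End ℂ W) :
    (tensorAct ρ ρ' (pairingElt (convInv E.τCA))).hom.hom (u ⊗ₜ[ℂ] w) =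
      ∑ i ∈ E.pinv, ρ (HDual.eval HCᵐᵒᵖ (MulOpposite.op i.2)) u ⊗ₜ[ℂ]
        ρ' (HDual.eval (Cop HA) ((Cop.algEquiv HA).symm i.1)) w := by
  rw [E.convInv_τCA hS, pairingElt_form, map_sum]
  exact tensorAct_sum_tmul ρ ρ' E.pinv _ _ u w

end CrossingElements

end PairingAction

section Realization

variable {𝒜 : Type u₁} [Category.{v₁} 𝒜] [Preadditive 𝒜] [Linear ℂ 𝒜] [MonoidalCategory 𝒜]
  [RightRigidCategory 𝒜] [HasFiniteBiproducts 𝒜]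
  {ℬ : Type u₂} [Category.{v₂} ℬ] [Preadditive ℬ] [Linear ℂ ℬ] [MonoidalCategory ℬ]
  [RightRigidCategory ℬ] [HasFiniteBiproducts ℬ]
  {𝒞 : Type u₃} [Category.{v₃} 𝒞] [Preadditive 𝒞] [Linear ℂ 𝒞] [MonoidalCategory 𝒞]
  [RightRigidCategory 𝒞] [HasFiniteBiproducts 𝒞]
  [MonoidalLeftAction 𝒞 Vect] [LinearLeftAction 𝒞 Vect]
  [MonoidalRightAction ℬ Vect] [LinearRightAction ℬ Vect]
  [BimoduleCategory 𝒞 ℬ Vect] {ωA : PivotalStructure 𝒜} {ωB : PivotalStructure ℬ}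
  {ωC : PivotalStructure 𝒞}
  (Φ : 𝒜 ⥤ BimodEnd 𝒞 ℬ Vect) [Φ.Monoidal]
  [(Φ ⋙ BimodEnd.forget 𝒞 ℬ Vect).Additive] [(Φ ⋙ BimodEnd.forget 𝒞 ℬ Vect).Linear ℂ]
  {DA : SimpleBasis 𝒜} {DB : SimpleBasis ℬ} {DC : SimpleBasis 𝒞}
  (E : CrossingElements (Tan DA (functorFibre Φ)) (Tan DB (rightFibre ℬ)) (Tan DC (leftFibre 𝒞)))
  (hA : ∀ x : Tan DA (functorFibre Φ), HopfAlgebra.antipode ℂ (HopfAlgebra.antipode ℂ x) = x)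
  (hB : ∀ x : Tan DB (rightFibre ℬ), HopfAlgebra.antipode ℂ (HopfAlgebra.antipode ℂ x) = x)
  (hC : ∀ x : Tan DC (leftFibre 𝒞), HopfAlgebra.antipode ℂ (HopfAlgebra.antipode ℂ x) = x)

variable
    (hωA : ∀ (X : 𝒜) (f : (functorFibre Φ).obj (Xᘁ)) (v : (functorFibre Φ).obj X),
      evPair (functorFibre Φ) (Xᘁ) (fmap (functorFibre Φ) (ωA.iso X).inv v) f =
        evPair (functorFibre Φ) X f v)
    (hωB : ∀ (X : ℬ) (f : (rightFibre ℬ).obj (Xᘁ)) (v : (rightFibre ℬ).obj X),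
      evPair (rightFibre ℬ) (Xᘁ) (fmap (rightFibre ℬ) (ωB.iso X).inv v) f =
        evPair (rightFibre ℬ) X f v)
    (hωC : ∀ (X : 𝒞) (f : (leftFibre 𝒞).obj (Xᘁ)) (v : (leftFibre 𝒞).obj X),
      evPair (leftFibre 𝒞) (Xᘁ) (fmap (leftFibre 𝒞) (ωC.iso X).inv v) f =
        evPair (leftFibre 𝒞) X f v)
    (hFA : ∀ i, Nontrivial ((functorFibre Φ).obj (DA.S i)))
    (hFB : ∀ i, Nontrivial ((rightFibre ℬ).obj (DB.S i)))
    (hFC : ∀ i, Nontrivial ((leftFibre 𝒞).obj (DC.S i)))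

/-- The realization of the datum by the Hopf triplet of the representing elements. -/
def realization
    (ht : (tCrossing Φ).IsRepr E.t) (hq : (midCrossing 𝒞 ℬ).IsRepr E.q)
    (hp : (sCrossing Φ).IsRepr E.pinv) :
    (E.triplet hA hB hC).Realization ωA ωB ωC Φ where
  EA := Tan.copDualEquiv hFA hωA
  EB := Tan.dualEquiv hFB hωB
  EC := Tan.opDualEquiv hFC hωC
  κ x V := dotIso ((MonoidalLeftAction.curriedAction 𝒞 Vect).obj x) V
  κ_naturality {x y V W} f α :=
    (congrArg (fun k => k ≫ (dotIso ((MonoidalLeftAction.curriedAction 𝒞 Vect).obj y) W).hom)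
      (MonoidalLeftAction.actionHom_def f α)).trans
        (dotIso_natural (G := MonoidalLeftAction.curriedAction 𝒞 Vect) f α)
  κ_tensor x y V :=
    ((Iso.inv_comp_eq (αₗ x y V)).mp ((leftCoherence 𝒞).dotIso_tensor x y V
      (Functor.LaxMonoidal.μ (Tan.opDualEquiv hFC hωC).fib x y)
      fun p q => hom_congr_apply (Tan.μ_opDualEquiv hFC hωC x y) (p ⊗ₜ q))).symm
  κ_unit V :=
    (Iso.inv_comp_eq (λₗ[𝒞] V)).mp ((leftCoherence 𝒞).dotIso_unit V
      (Functor.LaxMonoidal.ε (Tan.opDualEquiv hFC hωC).fib) (Tan.ε_opDualEquiv hFC hωC))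
  κr V u := dotIso ((MonoidalRightAction.curriedAction ℬ Vect).obj u) V
  κr_naturality {u v V W} α f :=
    (congrArg (fun k => k ≫ (dotIso ((MonoidalRightAction.curriedAction ℬ Vect).obj v) W).hom)
      (MonoidalRightAction.actionHom_def' α f)).trans
        (dotIso_natural (G := MonoidalRightAction.curriedAction ℬ Vect) f α)
  κr_tensor V u v :=
    ((Iso.inv_comp_eq (αᵣ V u v)).mp ((rightCoherence ℬ).dotIso_tensor u v V
      (Functor.LaxMonoidal.μ (Tan.dualEquiv hFB hωB).fib u v)
      fun p q => hom_congr_apply (Tan.μ_dualEquiv hFB hωB u v) (p ⊗ₜ q))).symm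
  κr_unit V :=
    (Iso.inv_comp_eq (ρᵣ[ℬ] V)).mp ((rightCoherence ℬ).dotIso_unit V
      (Functor.LaxMonoidal.ε (Tan.dualEquiv hFB hωB).fib) (Tan.ε_dualEquiv hFB hωB))
  θ a V := dotIso ((Φ ⋙ BimodEnd.forget 𝒞 ℬ Vect).obj a) V
  θ_naturality_left {a b} f V :=
    hom_ext_dot (G := (Φ ⋙ BimodEnd.forget 𝒞 ℬ Vect).obj a) fun p v => by
      refine (congrArg (dotIso ((Φ ⋙ BimodEnd.forget 𝒞 ℬ Vect).obj b) V).hom.hom.hom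
        (app_dot ((Φ ⋙ BimodEnd.forget 𝒞 ℬ Vect).map f) p v)).trans
          ((dotIso_dot ((Φ ⋙ BimodEnd.forget 𝒞 ℬ Vect).obj b) _ v).trans ?_)
      exact (congrArg ((functorFibre Φ).map f ▷ V).hom.hom
        (dotIso_dot ((Φ ⋙ BimodEnd.forget 𝒞 ℬ Vect).obj a) p v)).symm
  θ_naturality_right a V W α :=
    hom_ext_dot (G := (Φ ⋙ BimodEnd.forget 𝒞 ℬ Vect).obj a) fun p v => by
      refine (congrArg (dotIso ((Φ ⋙ BimodEnd.forget 𝒞 ℬ Vect).obj a) W).hom.hom.hom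
        (map_dot ((Φ ⋙ BimodEnd.forget 𝒞 ℬ Vect).obj a) α p v)).trans
          ((dotIso_dot ((Φ ⋙ BimodEnd.forget 𝒞 ℬ Vect).obj a) p _).trans ?_)
      exact (congrArg ((functorFibre Φ).obj a ◁ α).hom.hom
        (dotIso_dot ((Φ ⋙ BimodEnd.forget 𝒞 ℬ Vect).obj a) p v)).symm
  θ_tensor a b V :=
    (functorCoherence Φ).dotIso_tensor a b V
      (Functor.LaxMonoidal.μ (Tan.copDualEquiv hFA hωA).fib a b)
      fun p q => hom_congr_apply (Tan.μ_copDualEquiv hFA hωA a b) (p ⊗ₜ q)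
  θ_unit V :=
    (functorCoherence Φ).dotIso_unit V
      (Functor.LaxMonoidal.ε (Tan.copDualEquiv hFA hωA).fib) (Tan.ε_copDualEquiv hFA hωA)
  q_eq x V u := hq.dotIso_crossing u x V _ fun n p => by
    refine (congrArg (β_ ((rightFibre ℬ).obj u) ((leftFibre 𝒞).obj x)).hom.hom.hom
      (E.tensorAct_τBC n p _ _)).trans ((map_sum _ _ _).trans (Finset.sum_congr rfl fun i _ => ?_))
    exact congrArg₂ (fun a b => b p ⊗ₜ[ℂ] a n) (Tan.act_dualEquiv hFB hωB u i.1)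
      (Tan.act_opDualEquiv hFC hωC x i.2)
  s_eq a x V := hp.dotIso_crossing a x V _ fun m p =>
    (E.tensorAct_convInv_τCA p m hC _ _).trans (Finset.sum_congr rfl fun i _ =>
      congrArg₂ (fun a b => a p ⊗ₜ[ℂ] b m) (Tan.act_opDualEquiv hFC hωC x i.2)
        (Tan.act_copDualEquiv hFA hωA a i.1))
  t_eq a V u := ht.dotIso_crossing u a V _ fun n m =>
    (E.tensorAct_τAB m n _ _).trans (Finset.sum_congr rfl fun i _ =>
      congrArg₂ (fun a b => a m ⊗ₜ[ℂ] b n) (Tan.act_copDualEquiv hFA hωA a i.2)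
        (Tan.act_dualEquiv hFB hωB u i.1))

end Realization

/-! ### Endomorphisms of the unit object -/

section EndUnit

universe v u

/-- The endomorphisms of the unit object of a fusion category are scalars. -/
theorem FusionCategory.end_unit_scalar {𝒟 : Type u} [Category.{v} 𝒟] [Abelian 𝒟] [Linear ℂ 𝒟]
    [MonoidalCategory 𝒟] [MonoidalPreadditive 𝒟] [MonoidalLinear ℂ 𝒟] [RigidCategory 𝒟]
    [FusionCategory 𝒟] (f : 𝟙_ 𝒟 ⟶ 𝟙_ 𝒟) : ∃ c : ℂ, f = c • 𝟙 _ := by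
  have h1 := FusionCategory.finrank_end_unit (C := 𝒟)
  have h0 : 𝟙 (𝟙_ 𝒟) ≠ 0 := fun h => by
    have : Subsingleton (𝟙_ 𝒟 ⟶ 𝟙_ 𝒟) :=
      ⟨fun g g' => by rw [← Category.id_comp g, ← Category.id_comp g', h, zero_comp, zero_comp]⟩
    rw [Module.finrank_zero_of_subsingleton] at h1
    exact zero_ne_one h1
  obtain ⟨c, hc⟩ := (finrank_eq_one_iff_of_nonzero' _ h0).mp h1 f
  exact ⟨c, hc.symm⟩

end EndUnit

end HopfTrip

end

theorem proposition4p5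
    {𝒜 : Type u₁} [Category.{v₁} 𝒜] [Abelian 𝒜] [Linear ℂ 𝒜] [MonoidalCategory 𝒜]
    [MonoidalPreadditive 𝒜] [MonoidalLinear ℂ 𝒜] [RigidCategory 𝒜]
    [HopfTrip.FusionCategory 𝒜]
    {ℬ : Type u₂} [Category.{v₂} ℬ] [Abelian ℬ] [Linear ℂ ℬ] [MonoidalCategory ℬ]
    [MonoidalPreadditive ℬ] [MonoidalLinear ℂ ℬ] [RigidCategory ℬ]
    [HopfTrip.FusionCategory ℬ]
    {𝒞 : Type u₃} [Category.{v₃} 𝒞] [Abelian 𝒞] [Linear ℂ 𝒞] [MonoidalCategory 𝒞]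
    [MonoidalPreadditive 𝒞] [MonoidalLinear ℂ 𝒞] [RigidCategory 𝒞]
    [HopfTrip.FusionCategory 𝒞]
    (ωA : HopfTrip.PivotalStructure 𝒜) (hA : ωA.IsSpherical)
    (ωB : HopfTrip.PivotalStructure ℬ) (hB : ωB.IsSpherical)
    (ωC : HopfTrip.PivotalStructure 𝒞) (hC : ωC.IsSpherical)
    [MonoidalLeftAction 𝒞 HopfTrip.Vect] [HopfTrip.LinearLeftAction 𝒞 HopfTrip.Vect]
    [MonoidalRightAction ℬ HopfTrip.Vect] [HopfTrip.LinearRightAction ℬ HopfTrip.Vect]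
    [HopfTrip.BimoduleCategory 𝒞 ℬ HopfTrip.Vect]
    (tr : HopfTrip.BimoduleTrace HopfTrip.Vect ωC ωB)
    (Φ : 𝒜 ⥤ HopfTrip.BimodEnd 𝒞 ℬ HopfTrip.Vect) [Φ.Monoidal]
    [(Φ ⋙ HopfTrip.BimodEnd.forget 𝒞 ℬ HopfTrip.Vect).Additive]
    [(Φ ⋙ HopfTrip.BimodEnd.forget 𝒞 ℬ HopfTrip.Vect).Linear ℂ]
    [PreservesFiniteLimits Φ] [PreservesFiniteColimits Φ]
    (hΦ : HopfTrip.IsPivotalFunctor ωA tr Φ) :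
    ∃ T : HopfTrip.HopfTriplet, Nonempty (T.Realization ωA ωB ωC Φ) := by
  haveI : HasFiniteBiproducts 𝒜 := Abelian.hasFiniteBiproducts
  haveI : HasFiniteBiproducts ℬ := Abelian.hasFiniteBiproducts
  haveI : HasFiniteBiproducts 𝒞 := Abelian.hasFiniteBiproducts
  obtain ⟨DA⟩ := HopfTrip.FusionCategory.nonempty_simpleBasis 𝒜
  obtain ⟨DB⟩ := HopfTrip.FusionCategory.nonempty_simpleBasis ℬ
  obtain ⟨DC⟩ := HopfTrip.FusionCategory.nonempty_simpleBasis 𝒞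
  have hωA := HopfTrip.evPair_functor_pivotal tr hΦ
  have hωB := HopfTrip.evPair_right_pivotal tr
  have hωC := HopfTrip.evPair_left_pivotal tr
  obtain ⟨E, ht, hq, _, hp⟩ := HopfTrip.exists_crossingElements Φ DA DB DC
  exact ⟨E.triplet (HopfTrip.Tan.antipode_antipode hωA) (HopfTrip.Tan.antipode_antipode hωB)
      (HopfTrip.Tan.antipode_antipode hωC),
    ⟨HopfTrip.realization Φ E _ _ _ hωA hωB hωC
      (HopfTrip.nontrivial_obj_simple DA _ HopfTrip.FusionCategory.end_unit_scalar)
      (HopfTrip.nontrivial_obj_simple DB _ HopfTrip.FusionCategory.end_unit_scalar)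
      (HopfTrip.nontrivial_obj_simple DC _ HopfTrip.FusionCategory.end_unit_scalar) ht hq hp⟩⟩
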